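/- Let $r\in\{2,3,\dots,\infty\}$ and $1\le s\le n$. Let $M$ be a (Hausdorff) manifold of class $C^r$ and dimension $2n$ with a symplectic form $\Omega$ of class $C^{r-1}$, let $\varepsilon_0>0$, $E=(-\varepsilon_0,\varepsilon_0)$, and let $F_1^\varepsilon,\dots,F_s^\varepsilon:M\to\mathbf R$ be functions of class $C^r$ jointly in $(x,\varepsilon)\in M\times E$, with Hamiltonian vector fields $X_i^\varepsilon$ defined by $\Omega(X_i^\varepsilon,\cdot)=dF_i^\varepsilon$. Assume: (i) $\Lambda\subset M$ is a compact connected $C^r$ submanifold of dimension $s$, invariant under the flows of all $X_i^0$; (ii) there is an open neighbourhood $W$ of $\Lambda$ such that, on $W$ and for all $\varepsilon\in E$, the differentials $dF_1^\varepsilon,\dots,dF_s^\varepsilon$ are linearly independent and $\{F_i^\varepsilon,F_j^\varepsilon\}=\Omega(X_i^\varepsilon,X_j^\varepsilon)=0$ for all $i,j$; (iii) there is $c\in\mathbf R^s$ such that all orbits on $\Lambda$ of $X_\alpha=\sum_i c_iX_i^0$ are closed with period one, and such that the Floquet multiplier $1$ of these orbits (eigenvalue $1$ of the differential, at a point of $\Lambda$,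 of the time-one map of $X_\alpha$) has algebraic multiplicity exactly $2s$. Then $F^0=(F_1^0,\dots,F_s^0)$ has a constant value $\beta_0\in\mathbf R^s$ on $\Lambda$, and the following holds. (a) There are $\varepsilon_*\in(0,\varepsilon_0]$, a connected open set $B\ni\beta_0$ in $\mathbf R^s$, and for $|\varepsilon|<\varepsilon_*$ a $2s$-dimensional symplectic submanifold $N_\varepsilon\subset W$ of class $C^{r-1}$ with action-angle coordinates $(I,\varphi)$, $I\in D_\varepsilon\subset\mathbf R^s$, $\varphi\in(\mathbf R/2\pi\mathbf Z)^s$, such that: $\Omega(\partial_{\varphi_j},\partial_{\varphi_k})=0$ and $\Omega(\partial_{\varphi_j},\partial_{I_k})=\delta_{jk}$; on $N_\varepsilon$ the functions $F_i^\varepsilon=F_i^\varepsilon(I)$ depend on $I$ only, and $I\mapsto F^\varepsilon(I)$ is a bijection of $D_\varepsilon$ onto $B$; for $\beta\in B$ the set $\Lambda_\beta^\varepsilon=N_\varepsilon\cap (F^{\varepsilon})^{-1}(\beta)$ is an $s$-dimensional torus of class $C^r$, invariant under the flows of all $X_i^\varepsilon$; $\Lambda_{\beta_0}^0=\Lambda$;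 the set of $(\varepsilon,I)$ with $|\varepsilon|<\varepsilon_*$, $I\in D_\varepsilon$ is open, and the point with coordinates $(I,\varphi)$, the value $F^\varepsilon(I)$ and the derivative $\partial F^\varepsilon/\partial I$ are of class $C^{r-1}$ jointly in $\varepsilon$ and the coordinates. (b) Let $\kappa\in\{1,\dots,s\}$, let any family as in (a) be given (with $C^1$ in place of $C^{r-1}$ being enough), and suppose that at some $m\in\Lambda$ $$\det\left(\frac{\partial^2F_\kappa^0}{\partial I_j\partial I_k}\right)(m)\neq0 .$$ Then there is $\varepsilon_1\in(0,\varepsilon_*]$ such that for every fixed $\varepsilon$ with $|\varepsilon|<\varepsilon_1$ there is a neighbourhood $B_0\subset B$ of $\beta_0$ such that for Lebesgue-almost every $\beta\in B_0$ the flow of $X_\kappa^\varepsilon$ on $\Lambda_\beta^\varepsilon$ is quasiperiodic with $s$ rationally independent frequencies: there are $\omega\in\mathbf R^s$ with components linearly independent over $\mathbf Q$ and a $C^r$ embedding of $(\mathbf R/2\pi\mathbf Z)^s$ with image $\Lambda_\beta^\varepsilon$ that carries the linear flow $\varphi\mapsto\varphi+t\omega$ to the flow of $X_\kappa^\varepsilon$.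 -/

import Mathlib

open Set MeasureTheory Topology
open scoped Manifold

noncomputable section

namespace Nekhoroshev

/-- Model space of a `2n`-dimensional manifold. -/
abbrev Model (n : ℕ) : Type := EuclideanSpace ℝ (Fin (2 * n))

section Manifold

variable {n : ℕ} {M : Type*} [TopologicalSpace M] [ChartedSpace (Model n) M]

/-- The bilinear form field `Ω` read in the preferred chart around `x₀`. -/
def formInChart (Ω : (x : M) → TangentSpace (𝓡 (2 * n)) x →L[ℝ] TangentSpace (𝓡 (2 * n)) x →L[ℝ] ℝ)
    (x₀ : M) (y : Model n) : Model n →L[ℝ] Model n →L[ℝ] ℝ :=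
  let A : Model n →L[ℝ] Model n :=
    mfderiv 𝓘(ℝ, Model n) (𝓡 (2 * n)) (extChartAt (𝓡 (2 * n)) x₀).symm y
  let B : Model n →L[ℝ] Model n →L[ℝ] ℝ := Ω ((extChartAt (𝓡 (2 * n)) x₀).symm y)
  B.bilinearComp A A

/-- `Ω` is a symplectic form of class `C^k`: a nondegenerate closed 2-form. Regularity and
closedness are expressed in charts; the last field is `dΩ = 0` evaluated on three constant
vector fields. -/
structure IsSymplecticForm (k : ℕ∞)
    (Ω : (x : M) → TangentSpace (𝓡 (2 * n)) x →L[ℝ] TangentSpace (𝓡 (2 * n)) x →L[ℝ] ℝ) :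
    Prop where
  contDiffOn : ∀ x₀ : M,
    ContDiffOn ℝ k (formInChart Ω x₀) (extChartAt (𝓡 (2 * n)) x₀).target
  alternating : ∀ (x : M) (v : TangentSpace (𝓡 (2 * n)) x), Ω x v v = 0
  nondegenerate : ∀ (x : M) (v : TangentSpace (𝓡 (2 * n)) x), (∀ w, Ω x v w = 0) → v = 0
  closed : ∀ x₀ : M, ∀ y ∈ (extChartAt (𝓡 (2 * n)) x₀).target, ∀ u v w : Model n,
    fderiv ℝ (formInChart Ω x₀) y u v w + fderiv ℝ (formInChart Ω x₀) y v w u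
      + fderiv ℝ (formInChart Ω x₀) y w u v = 0

/-- The differential `df` at `x` of a real function `f`. -/
def differential (f : M → ℝ) (x : M) : TangentSpace (𝓡 (2 * n)) x →L[ℝ] ℝ :=
  mfderiv (𝓡 (2 * n)) 𝓘(ℝ, ℝ) f x

/-- The Hamiltonian vector field `X` of `f`, i.e. the solution of `Ω(X, ·) = df`. -/
def hamVF (Ω : (x : M) → TangentSpace (𝓡 (2 * n)) x →L[ℝ] TangentSpace (𝓡 (2 * n)) x →L[ℝ] ℝ)
    (f : M → ℝ) (x : M) : TangentSpace (𝓡 (2 * n)) x :=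
  (Ω x).inverse (differential f x)

/-- `S` is invariant under the (local) flow of `X`: an integral curve of `X`, defined on any
interval, that meets `S` stays in `S`. -/
def FlowInvariant (X : (x : M) → TangentSpace (𝓡 (2 * n)) x) (S : Set M) : Prop :=
  ∀ (γ : ℝ → M) (T : Set ℝ), T.OrdConnected → IsMIntegralCurveOn γ X T →
    ∀ t₀ ∈ T, γ t₀ ∈ S → ∀ t ∈ T, γ t ∈ S

/-- The integral curve of `X` issued from `p` reaches `q` at time `t`. -/
def FlowsTo (X : (x : M) → TangentSpace (𝓡 (2 * n)) x) (t : ℝ) (p q : M) : Prop :=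
  ∃ γ : ℝ → M, IsMIntegralCurveOn γ X (uIcc 0 t) ∧ γ 0 = p ∧ γ t = q

open Classical in
/-- The time-`t` map of the flow of `X` (equal to `p` by convention at the points `p` whose
integral curve does not live up to time `t`). -/
def timeMap (X : (x : M) → TangentSpace (𝓡 (2 * n)) x) (t : ℝ) (p : M) : M :=
  if h : ∃ q, FlowsTo X t p q then h.choose else p

/-- The Jacobian at `m` of the time-`t` map of `X`. When `m` is `t`-periodic this is the monodromy
endomorphism of the tangent space at `m`, whose eigenvalues are the Floquet multipliers. -/
def monodromy (X : (x : M) → TangentSpace (𝓡 (2 * n)) x) (t : ℝ) (m : M) :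
    Model n →L[ℝ] Model n :=
  mfderiv (𝓡 (2 * n)) (𝓡 (2 * n)) (timeMap X t) m

/-- The algebraic multiplicity of the Floquet multiplier `1` of the `t`-periodic point `m`. -/
def floquetOneMultiplicity (X : (x : M) → TangentSpace (𝓡 (2 * n)) x) (t : ℝ) (m : M) : ℕ :=
  (monodromy X t m).toLinearMap.charpoly.rootMultiplicity 1

/-- The flow of `X` on `S` is quasiperiodic with `s` rationally independent frequencies: `S` is
parametrized as an embedded torus `(ℝ / 2πℤ)^s` of class `C^r` on which the flow of `X` is the
linear flow `φ ↦ φ + t ω`, where `ω₁, …, ω_s` are linearly independent over `ℚ`. -/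
def IsQuasiperiodicOn (r : ℕ∞) (s : ℕ) (X : (x : M) → TangentSpace (𝓡 (2 * n)) x) (S : Set M) :
    Prop :=
  ∃ (ω : Fin s → ℝ) (θ : (Fin s → ℝ) → M),
    LinearIndependent ℚ ω ∧
    ContMDiff 𝓘(ℝ, Fin s → ℝ) (𝓡 (2 * n)) r θ ∧
    (∀ φ, Function.Injective (mfderiv 𝓘(ℝ, Fin s → ℝ) (𝓡 (2 * n)) θ φ)) ∧
    (∀ φ φ', θ φ = θ φ' ↔ ∃ z : Fin s → ℤ, ∀ j, φ' j = φ j + 2 * Real.pi * z j) ∧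
    range θ = S ∧
    ∀ φ, IsMIntegralCurve (fun t : ℝ => θ (φ + t • ω)) X

/-- The standing hypotheses. `F i ε` is the function `F_i^ε`, and `ι` is the inclusion of the
compact connected `s`-dimensional manifold `Λ` (as `L` is compact, an injective immersion is an
embedding). -/
structure Hypotheses {s : ℕ} {L : Type*} [TopologicalSpace L]
    [ChartedSpace (EuclideanSpace ℝ (Fin s)) L] (r : ℕ∞)
    (Ω : (x : M) → TangentSpace (𝓡 (2 * n)) x →L[ℝ] TangentSpace (𝓡 (2 * n)) x →L[ℝ] ℝ)
    (ε₀ : ℝ) (F : Fin s → ℝ → M → ℝ) (ι : L → M) (W : Set M) : Prop where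
  ε₀_pos : 0 < ε₀
  symplectic : IsSymplecticForm (r - 1) Ω
  contMDiffOn_F : ∀ i, ContMDiffOn ((𝓡 (2 * n)).prod 𝓘(ℝ, ℝ)) 𝓘(ℝ, ℝ) r
    (fun p : M × ℝ => F i p.2 p.1) (univ ×ˢ Ioo (-ε₀) ε₀)
  contMDiff_ι : ContMDiff (𝓡 s) (𝓡 (2 * n)) r ι
  injective_ι : Function.Injective ι
  immersion_ι : ∀ x, Function.Injective (mfderiv (𝓡 s) (𝓡 (2 * n)) ι x)
  /-- `Λ` is invariant under the unperturbed vector fields. -/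
  invariant : ∀ i, FlowInvariant (hamVF Ω (F i 0)) (range ι)
  isOpen_W : IsOpen W
  subset_W : range ι ⊆ W
  independent : ∀ ε ∈ Ioo (-ε₀) ε₀, ∀ x ∈ W,
    LinearIndependent ℝ (fun i => differential (n := n) (F i ε) x)
  involution : ∀ ε ∈ Ioo (-ε₀) ε₀, ∀ x ∈ W, ∀ i j,
    Ω x (hamVF Ω (F i ε) x) (hamVF Ω (F j ε) x) = 0
  /-- Some field `X_α = ∑ cᵢ Xᵢ` has flow of period one on `Λ` (`α` is the homotopy class of its
  closed orbits in `Λ`), and the Floquet multiplier `1` of these orbits has multiplicity `2s`.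
  The multipliers do not depend on the orbit, so it is enough to ask this at one point. -/
  floquet : ∃ c : Fin s → ℝ,
    (∀ x, FlowsTo (fun p : M => ∑ i, c i • hamVF Ω (F i 0) p) 1 (ι x) (ι x)) ∧
    ∃ x, floquetOneMultiplicity (fun p : M => ∑ i, c i • hamVF Ω (F i 0) p) 1 (ι x) = 2 * s

end Manifold

/-- The data of a family, depending on `ε`, of `2s`-dimensional manifolds `N_ε` with action-angle
coordinates: `chart ε J φ` is the point of `N_ε` with actions `J ∈ dom ε` and angles `φ` (mod `2π`),
`energy ε J` is the value of `(F_1^ε, …, F_s^ε)` at that point, `ε` ranges over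
`(-radius, radius)`, and the values of `(F_1^ε, …, F_s^ε)` range over `base`. -/
structure TorusFamily (s : ℕ) (M : Type*) where
  radius : ℝ
  base : Set (Fin s → ℝ)
  dom : ℝ → Set (Fin s → ℝ)
  energy : ℝ → (Fin s → ℝ) → Fin s → ℝ
  chart : ℝ → (Fin s → ℝ) → (Fin s → ℝ) → M

namespace TorusFamily

variable {s : ℕ} {M : Type*}

/-- The manifold `N_ε`. -/
def total (T : TorusFamily s M) (ε : ℝ) : Set M :=
  {p | ∃ J ∈ T.dom ε, ∃ φ, T.chart ε J φ = p}

/-- The torus `Λ_β^ε = N_ε ∩ F_ε⁻¹(β)`. -/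
def torus (T : TorusFamily s M) (F : Fin s → ℝ → M → ℝ) (ε : ℝ) (β : Fin s → ℝ) : Set M :=
  T.total ε ∩ {p | ∀ i, F i ε p = β i}

/-- The Hessian matrix of `F_κ^0` with respect to the actions, at the actions `J`. -/
def hessian (T : TorusFamily s M) (κ : Fin s) (J : Fin s → ℝ) : Matrix (Fin s) (Fin s) ℝ :=
  Matrix.of fun j k =>
    fderiv ℝ (fun J' => fderiv ℝ (fun J'' => T.energy 0 J'' κ) J' (Pi.single k 1)) J
      (Pi.single j 1)

end TorusFamily

/-- `T` is a family of invariant tori around `Λ` with action-angle coordinates, of class `C^k`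
jointly in `ε` and the coordinates, with tori of class `C^r`.

The canonical relations `Ω(∂_φⱼ, ∂_φₖ) = 0` and `Ω(∂_φⱼ, ∂_Jₖ) = δⱼₖ` imply that `chart ε` is an
immersion of a `2s`-dimensional manifold on which `Ω` is nondegenerate, and they determine the
actions up to an integral unimodular change of basis and additive constants. The normalization
`Ω(∂_Jⱼ, ∂_Jₖ) = 0` of the origin of the angles is not demanded, as it has no effect on the tori,
the actions or the functions `F_i^ε` of them. -/
structure IsTorusFamily {n : ℕ} {M : Type*} [TopologicalSpace M] [ChartedSpace (Model n) M]
    {s : ℕ} (k r : ℕ∞)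
    (Ω : (x : M) → TangentSpace (𝓡 (2 * n)) x →L[ℝ] TangentSpace (𝓡 (2 * n)) x →L[ℝ] ℝ)
    (ε₀ : ℝ) (F : Fin s → ℝ → M → ℝ) (Λ W : Set M) (β₀ : Fin s → ℝ) (T : TorusFamily s M) :
    Prop where
  radius_pos : 0 < T.radius
  radius_le : T.radius ≤ ε₀
  isOpen_base : IsOpen T.base
  isConnected_base : IsConnected T.base
  mem_base : β₀ ∈ T.base
  isOpen_dom : IsOpen {q : ℝ × (Fin s → ℝ) | q.1 ∈ Ioo (-T.radius) T.radius ∧ q.2 ∈ T.dom q.1}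
  bijOn_energy : ∀ ε ∈ Ioo (-T.radius) T.radius, BijOn (T.energy ε) (T.dom ε) T.base
  contDiffOn_energy : ContDiffOn ℝ k (fun q : ℝ × (Fin s → ℝ) => T.energy q.1 q.2)
    {q | q.1 ∈ Ioo (-T.radius) T.radius ∧ q.2 ∈ T.dom q.1}
  contDiffOn_fderiv_energy : ContDiffOn ℝ k
    (fun q : ℝ × (Fin s → ℝ) => fderiv ℝ (T.energy q.1) q.2)
    {q | q.1 ∈ Ioo (-T.radius) T.radius ∧ q.2 ∈ T.dom q.1}
  contMDiffOn_chart : ContMDiffOn 𝓘(ℝ, ℝ × (Fin s → ℝ) × (Fin s → ℝ)) (𝓡 (2 * n)) k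
    (fun q : ℝ × (Fin s → ℝ) × (Fin s → ℝ) => T.chart q.1 q.2.1 q.2.2)
    {q | q.1 ∈ Ioo (-T.radius) T.radius ∧ q.2.1 ∈ T.dom q.1}
  contMDiff_angles : ∀ ε ∈ Ioo (-T.radius) T.radius, ∀ J ∈ T.dom ε,
    ContMDiff 𝓘(ℝ, Fin s → ℝ) (𝓡 (2 * n)) r (T.chart ε J)
  /-- `(J, φ)` are coordinates on `N_ε`, with `φ` defined modulo `2π`. -/
  chart_eq_iff : ∀ ε ∈ Ioo (-T.radius) T.radius, ∀ J ∈ T.dom ε, ∀ J' ∈ T.dom ε, ∀ φ φ',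
    T.chart ε J φ = T.chart ε J' φ' ↔
      J = J' ∧ ∃ z : Fin s → ℤ, ∀ j, φ' j = φ j + 2 * Real.pi * z j
  chart_mem : ∀ ε ∈ Ioo (-T.radius) T.radius, ∀ J ∈ T.dom ε, ∀ φ, T.chart ε J φ ∈ W
  /-- On `N_ε` the functions `F_i^ε` depend on the actions only. -/
  F_chart : ∀ ε ∈ Ioo (-T.radius) T.radius, ∀ J ∈ T.dom ε, ∀ φ i,
    F i ε (T.chart ε J φ) = T.energy ε J i
  invariant : ∀ ε ∈ Ioo (-T.radius) T.radius, ∀ β ∈ T.base, ∀ i,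
    FlowInvariant (hamVF Ω (F i ε)) (T.torus F ε β)
  form_angle_angle : ∀ ε ∈ Ioo (-T.radius) T.radius, ∀ J ∈ T.dom ε, ∀ φ, ∀ j k : Fin s,
    Ω (T.chart ε J φ)
      (mfderiv 𝓘(ℝ, Fin s → ℝ) (𝓡 (2 * n)) (T.chart ε J) φ (Pi.single j (1 : ℝ) : Fin s → ℝ))
      (mfderiv 𝓘(ℝ, Fin s → ℝ) (𝓡 (2 * n)) (T.chart ε J) φ (Pi.single k (1 : ℝ) : Fin s → ℝ)) = 0
  form_angle_action : ∀ ε ∈ Ioo (-T.radius) T.radius, ∀ J ∈ T.dom ε, ∀ φ, ∀ j k : Fin s,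
    Ω (T.chart ε J φ)
      (mfderiv 𝓘(ℝ, Fin s → ℝ) (𝓡 (2 * n)) (T.chart ε J) φ (Pi.single j (1 : ℝ) : Fin s → ℝ))
      (mfderiv 𝓘(ℝ, Fin s → ℝ) (𝓡 (2 * n)) (fun J' => T.chart ε J' φ) J
        (Pi.single k (1 : ℝ) : Fin s → ℝ)) = if j = k then 1 else 0
  /-- The original torus is the one over `ε = 0`, `β = β₀`. -/
  torus_zero : T.torus F 0 β₀ = Λ

end Nekhoroshev

end

/-! The fields `Xᵢ^ε` are in involution, so their flows commute and `v ↦` (time-one map of `∑ vᵢ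
Xᵢ^ε`) is a local action of `ℝˢ` on `W`, called `flow`. It is of class `C^{r-1}` jointly in `(ε, v,
x)`, it preserves `Ω` and the `Fᵢ^ε`, and its orbits are isotropic. On `Λ` the action is complete
(compactness), locally free (independence of the `dFᵢ`) and transitive (connectedness). Hence `F^0`
is constant on `Λ`, and the periods of a point `m` form a lattice with a basis `b₁, …, b_s`
(`exists_period_basis`); the vector `c` is one of these periods.

Persistence rests on the single period `c`. Its monodromy fixes the `s` vectors `Xᵢ(m)` and leaves
the `s` functionals `dFᵢ` invariant, which already forces the multiplicity of the eigenvalue `1` to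
be at least `2s`. Equality means that a vector `u` in the common kernel of the `dFᵢ`, with `D u - u`
in the span of the `Xᵢ`, belongs to that span (`mem_range_of_rootMultiplicity`). This is the
nondegeneracy needed to solve by the implicit function theorem, for every `(ε, β)` near `(0, β₀)`,
the system: `y` on a transversal section, `F^ε(y) = β`, `flow (ε, T) y = y` (`exists_fixed_family`).

The other periods come for free. Start from the solution `Y`, flow for a time close to `b_j` and
return to the section. As the flows commute, the point reached solves the same system, so by
uniqueness it is `Y`, and the return time `τ_j` is a period (`exists_periodic_family`). An orbit
with `s` independent periods is complete (`completeAt_of_periods`), and compactness excludes further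
periods (`exists_torusData`): the orbit is a torus.

Differentiating `flow (ε, τ_j) Y = Y` in `β` and using that the flow preserves `Ω` shows that `∑ᵢ
τ_{ji} dβᵢ` is closed (`symmetric_τ`). Its primitives divided by `2π` are the actions, and the
angles are the coordinates of the time vector in the basis `τ_j`, up to `2π` (`exists_action_chart`,
`TorusData.isTorusFamily`).

For the last part, let any such family be given. The fields are tangent to its tori, and pairing
`X_κ` with the action directions identifies its angular velocity with `∂F_κ/∂I`, which is constant
on each torus (`vD_freq`). The Hessian is the derivative of this frequency map, so the frequency map
is a local diffeomorphism in the actions for all small `ε`, as is the map from actions to `β`.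
Rationally dependent frequencies form a null set, and differentiable maps between spaces of equal
dimension send null sets to null sets (`ae_quasiperiodic`). -/

set_option linter.unusedSectionVars false
set_option autoImplicit false

noncomputable section

namespace Nekhoroshev

/-! ### Smoothness of composition operators on spaces of continuous curves. -/

section Superposition

variable {K : Type*} [TopologicalSpace K] [CompactSpace K]

/-- Pointwise application of a family of continuous linear maps to a family of vectors. -/
def applyCLM (K : Type*) [TopologicalSpace K] [CompactSpace K]
    (E F : Type*) [NormedAddCommGroup E] [NormedSpace ℝ E]
    [NormedAddCommGroup F] [NormedSpace ℝ F] : C(K, E →L[ℝ] F) →L[ℝ] C(K, E) →L[ℝ] C(K, F) :=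
  LinearMap.mkContinuous₂
    (LinearMap.mk₂ ℝ (fun (A : C(K, E →L[ℝ] F)) (h : C(K, E)) =>
      (⟨fun t => A t (h t), A.continuous.clm_apply h.continuous⟩ : C(K, F)))
      (fun _ _ _ => by ext; simp) (fun _ _ _ => by ext; simp)
      (fun _ _ _ => by ext; simp) (fun _ _ _ => by ext; simp)) 1 (fun A h => by
        rw [ContinuousMap.norm_le _ (by positivity)]
        intro t
        simp only [LinearMap.mk₂_apply, ContinuousMap.coe_mk, one_mul]
        exact (ContinuousLinearMap.le_opNorm _ _).trans (mul_le_mul (A.norm_coe_le_norm t)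
          (h.norm_coe_le_norm t) (norm_nonneg _) (by positivity)))

variable {E F : Type*} [NormedAddCommGroup E] [NormedSpace ℝ E]
    [NormedAddCommGroup F] [NormedSpace ℝ F]

@[simp] lemma applyCLM_apply (A : C(K, E →L[ℝ] F)) (h : C(K, E)) (t : K) :
    applyCLM K E F A h t = A t (h t) := rfl

open Classical in
/-- The superposition operator `u ↦ f ∘ u` (zero where `f ∘ u` is not continuous). -/
def superpose (f : E → F) (u : C(K, E)) : C(K, F) :=
  if h : Continuous (f ∘ u) then ⟨f ∘ u, h⟩ else 0

/-- The continuous maps with values in `O`. -/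
def mapsInto (K : Type*) [TopologicalSpace K] (O : Set E) : Set C(K, E) :=
  {u | ∀ t, u t ∈ O}

lemma isOpen_mapsInto {O : Set E} (hO : IsOpen O) : IsOpen (mapsInto K O) := by
  have := ContinuousMap.isOpen_setOfPred_mapsTo (X := K) (Y := E) isCompact_univ hO
  convert this using 1
  ext u
  simp [mapsInto, MapsTo]

lemma superpose_apply {f : E → F} {O : Set E} (hf : ContinuousOn f O) {u : C(K, E)}
    (hu : u ∈ mapsInto K O) (t : K) : superpose f u t = f (u t) := by
  have : Continuous (f ∘ u) := hf.comp_continuous u.continuous hu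
  simp [superpose, this]

/-- Compactness of the range of `u` makes the radius independent of `t`, so that pointwise estimates
become estimates in the sup norm. -/
lemma exists_forall_near_range {f : E → F} {O : Set E} (hO : IsOpen O) (hf : ContinuousOn f O)
    {u : C(K, E)} (hu : u ∈ mapsInto K O) {c : ℝ} (hc : 0 < c) :
    ∃ η > 0, ∀ t, ∀ z ∈ Metric.ball (u t) η, z ∈ O ∧ ‖f z - f (u t)‖ < c := by
  have hcomp : IsCompact (range u) := isCompact_range u.continuous
  obtain ⟨η₁, h1, hs⟩ := hcomp.exists_thickening_subset_open hO (by rintro _ ⟨t, rfl⟩; exact hu t)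
  have := hcomp.uniformContinuousAt_of_continuousAt f (r := {p | dist p.1 p.2 < c}) (by
    rintro _ ⟨t, rfl⟩; exact hf.continuousAt (hO.mem_nhds (hu t))) (Metric.dist_mem_uniformity hc)
  obtain ⟨η₂, h2, hs2⟩ := Metric.mem_uniformity_dist.1 this
  refine ⟨min η₁ η₂, lt_min h1 h2, fun t z hz => ⟨hs ?_, ?_⟩⟩
  · rw [Metric.mem_thickening_iff]
    exact ⟨u t, mem_range_self t, lt_of_lt_of_le hz (min_le_left _ _)⟩
  · have h3 : dist (u t) z < η₂ := by
      rw [dist_comm]; exact lt_of_lt_of_le hz (min_le_right _ _)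
    have := hs2 h3 (mem_range_self t)
    rw [← dist_eq_norm, dist_comm]
    exact this

lemma continuousOn_superpose {f : E → F} {O : Set E} (hO : IsOpen O) (hf : ContinuousOn f O) :
    ContinuousOn (superpose (K := K) f) (mapsInto K O) := by
  intro u hu
  refine ContinuousAt.continuousWithinAt ?_
  rw [Metric.continuousAt_iff]
  intro c hc
  obtain ⟨η, hη, h⟩ := exists_forall_near_range hO hf hu (half_pos hc)
  refine ⟨η, hη, fun {w} hw => ?_⟩
  have hw' : ∀ t, w t ∈ Metric.ball (u t) η := fun t =>
    lt_of_le_of_lt (ContinuousMap.dist_apply_le_dist t) hw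
  have hwO : w ∈ mapsInto K O := fun t => (h t _ (hw' t)).1
  refine lt_of_le_of_lt ((ContinuousMap.dist_le (half_pos hc).le).2 fun t => ?_) (half_lt_self hc)
  rw [superpose_apply hf hwO, superpose_apply hf hu, dist_eq_norm]
  exact (h t _ (hw' t)).2.le

/-- The mean value inequality on the ball around `u t` bounds the remainder by `c ‖w‖` at each `t`,
with a radius that does not depend on `t`. -/
lemma hasFDerivAt_superpose {f : E → F} {O : Set E} (hO : IsOpen O) (hf : ContDiffOn ℝ 1 f O)
    {u : C(K, E)} (hu : u ∈ mapsInto K O) :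
    HasFDerivAt (superpose (K := K) f) (applyCLM K E F (superpose (fderiv ℝ f) u)) u := by
  have hf' : ContinuousOn (fderiv ℝ f) O := hf.continuousOn_fderiv_of_isOpen hO le_rfl
  rw [hasFDerivAt_iff_isLittleO_nhds_zero, Asymptotics.isLittleO_iff]
  intro c hc
  obtain ⟨η, hη, h⟩ := exists_forall_near_range hO hf' hu hc
  filter_upwards [Metric.ball_mem_nhds (0 : C(K, E)) hη] with w hw
  have hw0 : ∀ t, ‖w t‖ < η := fun t =>
    lt_of_le_of_lt (w.norm_coe_le_norm t) (by simpa using hw)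
  have hw' : ∀ t, (u + w) t ∈ Metric.ball (u t) η := fun t => by
    simpa [Metric.mem_ball, dist_eq_norm] using hw0 t
  have hwO : u + w ∈ mapsInto K O := fun t => (h t _ (hw' t)).1
  rw [ContinuousMap.norm_le _ (by positivity)]
  intro t
  simp only [ContinuousMap.sub_apply, applyCLM_apply]
  rw [superpose_apply hf.continuousOn hwO, superpose_apply hf.continuousOn hu,
    superpose_apply hf' hu]
  have := Convex.norm_image_sub_le_of_norm_fderiv_le' (𝕜 := ℝ) (f := f) (C := c)
    (φ := fderiv ℝ f (u t)) (s := Metric.ball (u t) η)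
    (fun z hz => (hf.contDiffAt (hO.mem_nhds (h t z hz).1)).differentiableAt one_ne_zero)
    (fun z hz => (h t z hz).2.le) (convex_ball _ _) (Metric.mem_ball_self hη) (hw' t)
  have e : (u + w) t - u t = w t := by simp
  rw [e] at this
  exact this.trans (mul_le_mul_of_nonneg_left (w.norm_coe_le_norm t) hc.le)

end Superposition

universe u

/-- Induction on `k`: the derivative is superposition with `fderiv ℝ f` followed by the bounded
bilinear map `applyCLM`. The target becomes `E →L[ℝ] F` at each stage, hence the quantification over
`F` and the common universe. -/
lemma contDiffOn_superpose_nat {K : Type*} [TopologicalSpace K] [CompactSpace K]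
    {E : Type u} [NormedAddCommGroup E] [NormedSpace ℝ E] (k : ℕ) :
    ∀ {F : Type u} [NormedAddCommGroup F] [NormedSpace ℝ F] {f : E → F} {O : Set E},
    IsOpen O → ContDiffOn ℝ k f O → ContDiffOn ℝ k (superpose (K := K) f) (mapsInto K O) := by
  induction k with
  | zero =>
    intro F _ _ f O hO hf
    simp only [Nat.cast_zero, contDiffOn_zero] at hf ⊢
    exact continuousOn_superpose hO hf
  | succ k ih =>
    intro F _ _ f O hO hf
    have h1 : ContDiffOn ℝ 1 f O := hf.of_le (by exact_mod_cast Nat.le_add_left 1 k)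
    push_cast at hf ⊢
    have h2 := ((contDiffOn_succ_iff_fderiv_of_isOpen hO).1 hf).2.2
    rw [contDiffOn_succ_iff_fderiv_of_isOpen (isOpen_mapsInto hO)]
    refine ⟨fun u hu => (hasFDerivAt_superpose hO h1 hu).differentiableAt.differentiableWithinAt,
      fun h => by simp at h, ?_⟩
    refine ((applyCLM K E F).contDiff.comp_contDiffOn (ih hO h2)).congr fun u hu => ?_
    exact (hasFDerivAt_superpose hO h1 hu).fderiv

lemma contDiffOn_superpose {K : Type*} [TopologicalSpace K] [CompactSpace K]
    {E : Type u} [NormedAddCommGroup E] [NormedSpace ℝ E] {F : Type u} [NormedAddCommGroup F]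
    [NormedSpace ℝ F] {f : E → F} {O : Set E} (hO : IsOpen O) {k : ℕ∞} (hf : ContDiffOn ℝ k f O) :
    ContDiffOn ℝ k (superpose (K := K) f) (mapsInto K O) := by
  induction k with
  | top =>
    rw [contDiffOn_infty] at hf ⊢
    exact fun m => contDiffOn_superpose_nat m hO (hf m)
  | coe k => exact contDiffOn_superpose_nat k hO hf

/-- Inverse function theorem on an open set, with regularity of the inverse. -/
theorem exists_inverse_on_nhds {E F : Type*} [NormedAddCommGroup E] [NormedSpace ℝ E]
    [CompleteSpace E] [NormedAddCommGroup F] [NormedSpace ℝ F] {k : ℕ∞} (hk : 1 ≤ k) {f : E → F}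
    {O : Set E} (hO : IsOpen O) (hf : ContDiffOn ℝ k f O) {a : E} (ha : a ∈ O) {f' : E ≃L[ℝ] F}
    (hf' : HasFDerivAt f (f' : E →L[ℝ] F) a) :
    ∃ e : OpenPartialHomeomorph E F, (∀ x, e x = f x) ∧ a ∈ e.source ∧ e.source ⊆ O ∧
      ContDiffOn ℝ k e.symm e.target ∧
      ∀ x ∈ e.source, ∃ L : E ≃L[ℝ] F, HasFDerivAt f (L : E →L[ℝ] F) x := by
  have hk0 : (k : WithTop ℕ∞) ≠ 0 := by
    intro h; have : k = 0 := by exact_mod_cast h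
    simp [this] at hk
  have hk1 : (1 : WithTop ℕ∞) ≤ k := by exact_mod_cast hk
  have hfa : ContDiffAt ℝ k f a := hf.contDiffAt (hO.mem_nhds ha)
  set e₀ := hfa.toOpenPartialHomeomorph f hf' hk0
  have hcont : ContinuousOn (fderiv ℝ f) O := hf.continuousOn_fderiv_of_isOpen hO hk1
  -- Invertible operators form an open set. Restricting the source to the points with invertible
  -- derivative makes the inverse smooth on the whole target, and not only near `f a`.
  have hU : IsOpen (O ∩ fderiv ℝ f ⁻¹' range ((↑) : (E ≃L[ℝ] F) → E →L[ℝ] F)) :=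
    hcont.isOpen_inter_preimage hO (ContinuousLinearEquiv.isOpen)
  set U := O ∩ fderiv ℝ f ⁻¹' range ((↑) : (E ≃L[ℝ] F) → E →L[ℝ] F)
  have haU : a ∈ U := ⟨ha, f', hf'.fderiv.symm⟩
  have hL : ∀ x ∈ U, ∃ L : E ≃L[ℝ] F, HasFDerivAt f (L : E →L[ℝ] F) x := by
    rintro x ⟨hx, L, hL⟩
    refine ⟨L, ?_⟩
    rw [hL]
    exact ((hf.contDiffAt (hO.mem_nhds hx)).differentiableAt hk0).hasFDerivAt
  refine ⟨e₀.restrOpen U hU, fun x => rfl, ⟨hfa.mem_toOpenPartialHomeomorph_source hf' hk0, haU⟩,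
    fun x hx => hx.2.1, ?_, fun x hx => hL x hx.2⟩
  intro y hy
  have hmem := (e₀.restrOpen U hU).map_target hy
  obtain ⟨L, hL⟩ := hL _ hmem.2
  exact ((e₀.restrOpen U hU).contDiffAt_symm hy hL
    (hf.contDiffAt (hO.mem_nhds hmem.2.1))).contDiffWithinAt


/-! ### Smooth dependence of ODE solutions, by the implicit function theorem in a space of curves.
-/

section LocalFlow

variable {E : Type*} [NormedAddCommGroup E] [NormedSpace ℝ E]

/-- The compact time interval on which curves are considered. -/
abbrev TimeSpan : Type := Icc (-1 : ℝ) 1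

/-- Extension of a curve on `[-1, 1]` by constants. -/
def extendCurve (u : C(TimeSpan, E)) : ℝ → E := IccExtend (by norm_num : (-1 : ℝ) ≤ 1) u

lemma continuous_extendCurve (u : C(TimeSpan, E)) : Continuous (extendCurve u) :=
  u.continuous.Icc_extend'

lemma extendCurve_of_mem (u : C(TimeSpan, E)) {s : ℝ} (hs : s ∈ Icc (-1 : ℝ) 1) :
    extendCurve u s = u ⟨s, hs⟩ :=
  IccExtend_of_mem _ _ hs

lemma norm_extendCurve_le (u : C(TimeSpan, E)) (s : ℝ) : ‖extendCurve u s‖ ≤ ‖u‖ :=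
  u.norm_coe_le_norm _

/-- The integration operator `u ↦ (s ↦ ∫₀ˢ u)`. -/
def primitiveCLM (E : Type*) [NormedAddCommGroup E] [NormedSpace ℝ E] :
    C(TimeSpan, E) →L[ℝ] C(TimeSpan, E) :=
  LinearMap.mkContinuous
    { toFun := fun u => ⟨fun s => ∫ τ in (0 : ℝ)..s, extendCurve u τ,
        (intervalIntegral.continuous_primitive
          (fun a b => (continuous_extendCurve u).intervalIntegrable a b) 0).comp
          continuous_subtype_val⟩
      map_add' := fun u v => by
        ext s
        simp only [ContinuousMap.coe_mk, ContinuousMap.add_apply]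
        rw [← intervalIntegral.integral_add ((continuous_extendCurve u).intervalIntegrable _ _)
          ((continuous_extendCurve v).intervalIntegrable _ _)]
        rfl
      map_smul' := fun c u => by
        ext s
        simp only [ContinuousMap.coe_mk, ContinuousMap.smul_apply, RingHom.id_apply]
        rw [← intervalIntegral.integral_smul]
        rfl } 1 (fun u => by
      rw [ContinuousMap.norm_le _ (by positivity)]
      intro s
      have := intervalIntegral.norm_integral_le_of_norm_le_const (a := (0 : ℝ)) (b := s)
        (f := extendCurve u) (C := ‖u‖) (fun x _ => norm_extendCurve_le u x)
      refine this.trans ?_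
      rw [mul_comm]
      refine mul_le_mul_of_nonneg_right ?_ (norm_nonneg _)
      rw [sub_zero, abs_le]
      exact s.2)

lemma primitiveCLM_apply (u : C(TimeSpan, E)) (s : TimeSpan) :
    primitiveCLM E u s = ∫ τ in (0 : ℝ)..s, extendCurve u τ := rfl

/-- Constant curves. -/
def constCurve (E : Type*) [NormedAddCommGroup E] [NormedSpace ℝ E] : E →L[ℝ] C(TimeSpan, E) :=
  LinearMap.mkContinuous
    { toFun := fun x => ContinuousMap.const _ x
      map_add' := fun _ _ => rfl
      map_smul' := fun _ _ => rfl } 1 (fun x => by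
        rw [ContinuousMap.norm_le _ (by positivity)]
        intro s
        rw [one_mul]
        exact le_rfl)

@[simp] lemma constCurve_apply (x : E) (s : TimeSpan) : constCurve E x s = x := rfl

/-- A solution of `h' = δ g` on `[-1, 1]` is slowed down to `(-δ, δ)`; the factor `δ` of the
integral equation cancels the derivative of `t / δ`. -/
lemma hasDerivAt_of_eq_primitive [CompleteSpace E] {h g : C(TimeSpan, E)} {w : E} {δ : ℝ}
    (hδ : 0 < δ) (H : h = constCurve E w + δ • primitiveCLM E g) {t : ℝ} (ht : t ∈ Ioo (-δ) δ) :
    HasDerivAt (fun t => extendCurve h (t / δ)) (extendCurve g (t / δ)) t := by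
  have hG : ∀ s ∈ Icc (-1 : ℝ) 1, extendCurve h s = w + δ • ∫ τ in (0 : ℝ)..s, extendCurve g τ := by
    intro s hs
    rw [extendCurve_of_mem _ hs, H]
    rfl
  have hmem : ∀ t ∈ Ioo (-δ) δ, t / δ ∈ Icc (-1 : ℝ) 1 := by
    intro t ht
    constructor
    · rw [le_div_iff₀ hδ]; linarith [ht.1]
    · rw [div_le_iff₀ hδ]; linarith [ht.2]
  have h1 : HasDerivAt (fun s => ∫ τ in (0 : ℝ)..s, extendCurve g τ) (extendCurve g (t / δ)) (t / δ) :=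
    intervalIntegral.integral_hasDerivAt_right ((continuous_extendCurve g).intervalIntegrable _ _)
      ((continuous_extendCurve g).stronglyMeasurableAtFilter _ _)
      (continuous_extendCurve g).continuousAt
  have h2 : HasDerivAt (fun t : ℝ => t / δ) (1 / δ) t := (hasDerivAt_id t).div_const δ
  have h3 := ((h1.scomp t h2).const_smul δ).const_add w
  rw [smul_smul, mul_one_div_cancel hδ.ne', one_smul] at h3
  refine h3.congr_of_eventuallyEq ?_
  filter_upwards [Ioo_mem_nhds ht.1 ht.2] with a ha
  simpa using hG _ (hmem a ha)

/-- The map whose zeros in the last component are the solutions of `u' = a f(u)`, `u(0) = x`. -/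
def curveEquation (f : E → E) (q : ℝ × E × C(TimeSpan, E)) : ℝ × E × C(TimeSpan, E) :=
  (q.1, q.2.1, q.2.2 - constCurve E q.2.1 - q.1 • primitiveCLM E (superpose f q.2.2))

/-- The derivative of `curveEquation` at a constant curve for zero time, as an equivalence. -/
def curveEquationDeriv (g : C(TimeSpan, E)) :
    (ℝ × E × C(TimeSpan, E)) ≃L[ℝ] (ℝ × E × C(TimeSpan, E)) :=
  let p₁ := ContinuousLinearMap.fst ℝ ℝ (E × C(TimeSpan, E))
  let p₂ := (ContinuousLinearMap.fst ℝ E C(TimeSpan, E)).comp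
    (ContinuousLinearMap.snd ℝ ℝ (E × C(TimeSpan, E)))
  let p₃ := (ContinuousLinearMap.snd ℝ E C(TimeSpan, E)).comp
    (ContinuousLinearMap.snd ℝ ℝ (E × C(TimeSpan, E)))
  ContinuousLinearEquiv.equivOfInverse
    (p₁.prod (p₂.prod (p₃ - (constCurve E).comp p₂ - p₁.smulRight g)))
    (p₁.prod (p₂.prod (p₃ + (constCurve E).comp p₂ + p₁.smulRight g)))
    (fun q => by ext <;> (simp [p₁, p₂, p₃]; try abel)) (fun q => by ext <;> (simp [p₁, p₂, p₃]; try abel))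

/-- The nonlinear term carries the factor `q.1`, which vanishes at the base point. The derivative of
`superpose f` therefore drops out and the linearization is triangular. -/
lemma hasFDerivAt_curveEquation {f : E → E} {O : Set E} (hO : IsOpen O) (hf : ContDiffOn ℝ 1 f O)
    {x₀ : E} (hx₀ : x₀ ∈ O) :
    HasFDerivAt (curveEquation f) (curveEquationDeriv (primitiveCLM E (superpose f (constCurve E x₀))) :
      (ℝ × E × C(TimeSpan, E)) →L[ℝ] (ℝ × E × C(TimeSpan, E))) (0, x₀, constCurve E x₀) := by
  have hs := hasFDerivAt_superpose (K := TimeSpan) hO hf (u := constCurve E x₀) (fun t => hx₀)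
  have h1 : HasFDerivAt (fun q : ℝ × E × C(TimeSpan, E) => q.1)
    (ContinuousLinearMap.fst ℝ ℝ (E × C(TimeSpan, E))) (0, x₀, constCurve E x₀) := hasFDerivAt_fst
  have h23 : HasFDerivAt (fun q : ℝ × E × C(TimeSpan, E) => q.2)
    (ContinuousLinearMap.snd ℝ ℝ (E × C(TimeSpan, E))) (0, x₀, constCurve E x₀) := hasFDerivAt_snd
  have h2 := h23.fst
  have h3 := h23.snd
  have hp := (primitiveCLM E).hasFDerivAt.comp (0, x₀, constCurve E x₀)
    (hs.comp (0, x₀, constCurve E x₀) h3)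
  have := h1.prodMk (h2.prodMk ((h3.sub ((constCurve E).hasFDerivAt.comp _ h2)).sub (h1.smul hp)))
  refine this.congr_fderiv ?_
  ext q <;> simp [curveEquationDeriv]

lemma contDiffOn_curveEquation {E : Type*} [NormedAddCommGroup E] [NormedSpace ℝ E]
    {f : E → E} {O : Set E} (hO : IsOpen O) {k : ℕ∞} (hf : ContDiffOn ℝ k f O) :
    ContDiffOn ℝ k (curveEquation f) (univ ×ˢ univ ×ˢ mapsInto TimeSpan O) := by
  have hs : ContDiffOn ℝ k (fun q : ℝ × E × C(TimeSpan, E) => superpose (K := TimeSpan) f q.2.2)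
      (univ ×ˢ univ ×ˢ mapsInto TimeSpan O) :=
    (contDiffOn_superpose hO hf).comp contDiff_snd.snd.contDiffOn (fun q hq => hq.2.2)
  unfold curveEquation
  refine contDiff_fst.contDiffOn.prodMk (contDiff_snd.fst.contDiffOn.prodMk ?_)
  refine ContDiffOn.sub (ContDiffOn.sub contDiff_snd.snd.contDiffOn ?_) ?_
  · exact ((constCurve E).contDiff.comp contDiff_snd.fst).contDiffOn
  · exact contDiff_fst.contDiffOn.smul ((primitiveCLM E).contDiff.comp_contDiffOn hs)

/-- The implicit function theorem for `curveEquation` at time scale zero. In the last clause the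
endpoint of the curve with scale `s a` is the value at `s` of the curve with scale `a`; this
converts smoothness in the scale into smoothness in time. -/
lemma exists_contDiffOn_curve {E : Type*} [NormedAddCommGroup E] [NormedSpace ℝ E]
    [CompleteSpace E] {f : E → E} {O : Set E} (hO : IsOpen O) {k : ℕ∞} (hk : 1 ≤ k)
    (hf : ContDiffOn ℝ k f O) {x₀ : E} (hx₀ : x₀ ∈ O) :
    ∃ δ > 0, ∃ ρ > 0, ∃ u : ℝ → E → C(TimeSpan, E),
      ContDiffOn ℝ k (fun q : ℝ × E => u q.1 q.2) (Ioo (-δ) δ ×ˢ Metric.ball x₀ ρ) ∧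
      (∀ a ∈ Ioo (-δ) δ, ∀ x ∈ Metric.ball x₀ ρ, u a x ∈ mapsInto TimeSpan O ∧
        u a x = constCurve E x + a • primitiveCLM E (superpose f (u a x))) ∧
      ∀ a ∈ Ioo (-δ) δ, ∀ x ∈ Metric.ball x₀ ρ, ∀ s : TimeSpan, u (s * a) x ⟨1, by simp⟩ = u a x s := by
  have hf1 : ContDiffOn ℝ 1 f O := hf.of_le (by exact_mod_cast hk)
  obtain ⟨e, he, hes, heO, hesymm, -⟩ := exists_inverse_on_nhds hk
    (isOpen_univ.prod (isOpen_univ.prod (isOpen_mapsInto hO))) (contDiffOn_curveEquation hO hf)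
    (a := (0, x₀, constCurve E x₀)) ⟨trivial, trivial, fun t => hx₀⟩
    (hasFDerivAt_curveEquation hO hf1 hx₀)
  have he0 : e (0, x₀, constCurve E x₀) = (0, x₀, 0) := by
    rw [he]; simp [curveEquation]
  obtain ⟨ρ', hρ', hball⟩ := Metric.isOpen_iff.1 e.open_source _ hes
  set u : ℝ → E → C(TimeSpan, E) := fun a x => (e.symm (a, x, 0)).2.2 with hu
  have hcont : ContinuousAt (fun q : ℝ × E => e.symm (q.1, q.2, 0)) (0, x₀) := by
    have h1 : ContinuousAt e.symm (0, x₀, 0) := by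
      rw [← he0]; exact e.symm.continuousAt (e.map_source hes)
    have h2 : Continuous (fun q : ℝ × E => ((q.1, q.2, 0) : ℝ × E × C(TimeSpan, E))) := by
      fun_prop
    exact ContinuousAt.comp (x := ((0 : ℝ), x₀)) (f := fun q : ℝ × E => ((q.1, q.2, 0) : ℝ × E × C(TimeSpan, E)))
      (g := e.symm) h1 h2.continuousAt
  have hs0 : e.symm (0, x₀, 0) = (0, x₀, constCurve E x₀) := by
    rw [← he0, e.left_inv hes]
  have hA : ∀ᶠ q : ℝ × E in 𝓝 (0, x₀), (q.1, q.2, (0 : C(TimeSpan, E))) ∈ e.target ∧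
      e.symm (q.1, q.2, 0) ∈ Metric.ball ((0 : ℝ), x₀, constCurve E x₀) ρ' := by
    have h2 : Continuous (fun q : ℝ × E => ((q.1, q.2, 0) : ℝ × E × C(TimeSpan, E))) := by
      fun_prop
    refine (h2.continuousAt.eventually (e.open_target.mem_nhds ?_)).and (hcont.eventually
      (p := fun z => z ∈ Metric.ball ((0 : ℝ), x₀, constCurve E x₀) ρ') ?_)
    · simp only; rw [← he0]; exact e.map_source hes
    · simp only; rw [hs0]; exact Metric.ball_mem_nhds _ hρ'
  rw [nhds_prod_eq] at hA
  obtain ⟨pa, hpa, pb, hpb, hpab⟩ := Filter.eventually_prod_iff.1 hA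
  obtain ⟨δ, hδ, hδa⟩ := Metric.eventually_nhds_iff_ball.1 hpa
  obtain ⟨ρ, hρ, hρb⟩ := Metric.eventually_nhds_iff_ball.1 hpb
  have hAll : ∀ a ∈ Ioo (-δ) δ, ∀ x ∈ Metric.ball x₀ ρ,
      (a, x, (0 : C(TimeSpan, E))) ∈ e.target ∧
      e.symm (a, x, 0) ∈ Metric.ball ((0 : ℝ), x₀, constCurve E x₀) ρ' := by
    intro a ha x hx
    exact hpab (hδa a (by simpa [Real.dist_eq, abs_lt] using ha)) (hρb x hx)
  have hsol : ∀ a ∈ Ioo (-δ) δ, ∀ x ∈ Metric.ball x₀ ρ, e.symm (a, x, 0) = (a, x, u a x) ∧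
      u a x ∈ mapsInto TimeSpan O ∧
        u a x = constCurve E x + a • primitiveCLM E (superpose f (u a x)) := by
    intro a ha x hx
    have h1 := e.right_inv (hAll a ha x hx).1
    rw [he] at h1
    simp only [curveEquation, Prod.mk.injEq] at h1
    obtain ⟨h11, h12, h13⟩ := h1
    refine ⟨Prod.ext h11 (Prod.ext h12 rfl), (heO (e.map_target (hAll a ha x hx).1)).2.2, ?_⟩
    rw [h11, h12, sub_sub, sub_eq_zero] at h13
    exact h13
  refine ⟨δ, hδ, ρ, hρ, u, ?_, fun a ha x hx => (hsol a ha x hx).2, ?_⟩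
  · have h2 : ContDiff ℝ k (fun q : ℝ × E => ((q.1, q.2, 0) : ℝ × E × C(TimeSpan, E))) := by
      fun_prop
    exact (hesymm.comp h2.contDiffOn (fun q hq => (hAll q.1 hq.1 q.2 hq.2).1)).snd.snd
  · intro a ha x hx s
    have hsa : (s : ℝ) * a ∈ Ioo (-δ) δ := by
      rw [mem_Ioo, ← abs_lt, abs_mul]
      have h1 : |(s : ℝ)| ≤ 1 := abs_le.2 s.2
      have h2 : |a| < δ := abs_lt.2 ha
      nlinarith [abs_nonneg a, abs_nonneg (s : ℝ)]
    have hmul : ∀ σ : TimeSpan, (s : ℝ) * σ ∈ Icc (-1 : ℝ) 1 := by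
      intro σ
      rw [mem_Icc, ← abs_le, abs_mul]
      exact mul_le_one₀ (abs_le.2 s.2) (abs_nonneg _) (abs_le.2 σ.2)
    -- The slowed curve `σ ↦ u a x (s σ)` solves the equation with scale `s a`, and it is no farther
    -- from the constant curve than `u a x` is. It thus lies in the region where the local inverse
    -- is unique, and equals `u (s a) x`.
    set w : C(TimeSpan, E) := ⟨fun σ => u a x ⟨s * σ, hmul σ⟩, by fun_prop⟩ with hw
    obtain ⟨h1, h2, h3⟩ := hsol a ha x hx
    have hwO : w ∈ mapsInto TimeSpan O := fun σ => h2 _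
    have hweq : w = constCurve E x + ((s : ℝ) * a) • primitiveCLM E (superpose f w) := by
      ext σ
      have e1 : w σ = u a x ⟨s * σ, hmul σ⟩ := rfl
      rw [e1, h3]
      simp only [ContinuousMap.add_apply, ContinuousMap.smul_apply, constCurve_apply,
        primitiveCLM_apply]
      congr 1
      have e2 : ∫ τ in (0 : ℝ)..σ, extendCurve (superpose f w) τ =
          ∫ τ in (0 : ℝ)..σ, extendCurve (superpose f (u a x)) (s * τ) := by
        refine intervalIntegral.integral_congr fun τ hτ => ?_
        have hτ' : τ ∈ Icc (-1 : ℝ) 1 := by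
          rw [mem_Icc, ← abs_le]
          have h0 : |τ| ≤ |(σ : ℝ)| := by
            rcases le_total 0 (σ : ℝ) with h | h
            · rw [uIcc_of_le h] at hτ
              rw [abs_of_nonneg hτ.1, abs_of_nonneg h]; exact hτ.2
            · rw [uIcc_of_ge h] at hτ
              rw [abs_of_nonpos hτ.2, abs_of_nonpos h]; linarith [hτ.1]
          exact h0.trans (abs_le.2 σ.2)
        rw [extendCurve_of_mem _ hτ', extendCurve_of_mem _ (hmul ⟨τ, hτ'⟩),
          superpose_apply hf.continuousOn hwO, superpose_apply hf.continuousOn h2]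
        rfl
      rw [e2, mul_comm (s : ℝ) a, ← smul_smul, intervalIntegral.smul_integral_comp_mul_left, mul_zero]
    have hmem : ((s : ℝ) * a, x, w) ∈ e.source := by
      apply hball
      have hm := (hAll a ha x hx).2
      rw [h1] at hm
      simp only [Metric.mem_ball, Prod.dist_eq, max_lt_iff] at hm ⊢
      have hm' := (hAll _ hsa x hx).2
      rw [(hsol _ hsa x hx).1] at hm'
      simp only [Metric.mem_ball, Prod.dist_eq, max_lt_iff] at hm'
      refine ⟨hm'.1, hm.2.1, lt_of_le_of_lt ?_ hm.2.2⟩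
      refine (ContinuousMap.dist_le dist_nonneg).2 fun σ => ?_
      exact ContinuousMap.dist_apply_le_dist (f := u a x) (g := constCurve E x₀) ⟨s * σ, hmul σ⟩
    have hew : e ((s : ℝ) * a, x, w) = ((s : ℝ) * a, x, 0) := by
      rw [he]
      simp only [curveEquation, Prod.mk.injEq, true_and]
      rw [sub_sub, sub_eq_zero]
      exact hweq
    have : u (s * a) x = w := by
      simp only [hu]
      rw [← hew, e.left_inv hmem]
    rw [this, hw]
    simp

/-- A vector field of class `C^k` has a local flow which is jointly of class `C^k`, and the
derivative of the flow with respect to the initial condition solves the variational equation. -/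
theorem exists_localFlow {E : Type*} [NormedAddCommGroup E] [NormedSpace ℝ E]
    [CompleteSpace E] {f : E → E} {O : Set E} (hO : IsOpen O) {k : ℕ∞} (hk : 1 ≤ k)
    (hf : ContDiffOn ℝ k f O) {x₀ : E} (hx₀ : x₀ ∈ O) :
    ∃ δ > 0, ∃ ρ > 0, ∃ ψ : ℝ → E → E,
      ContDiffOn ℝ k (fun q : ℝ × E => ψ q.1 q.2) (Ioo (-δ) δ ×ˢ Metric.ball x₀ ρ) ∧
      (∀ x ∈ Metric.ball x₀ ρ, ψ 0 x = x) ∧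
      (∀ t ∈ Ioo (-δ) δ, ∀ x ∈ Metric.ball x₀ ρ, ψ t x ∈ O ∧
        HasDerivAt (fun t => ψ t x) (f (ψ t x)) t) ∧
      ∀ t ∈ Ioo (-δ) δ, ∀ x ∈ Metric.ball x₀ ρ, ∀ w,
        HasDerivAt (fun t => fderiv ℝ (ψ t) x w) (fderiv ℝ f (ψ t x) (fderiv ℝ (ψ t) x w)) t := by
  obtain ⟨δ₀, hδ₀, ρ, hρ, u, hu, hsol, hscale⟩ := exists_contDiffOn_curve hO hk hf hx₀
  have hk1 : (1 : WithTop ℕ∞) ≤ k := by exact_mod_cast hk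
  have hk0 : (k : WithTop ℕ∞) ≠ 0 := (lt_of_lt_of_le zero_lt_one hk1).ne'
  have hf1 : ContDiffOn ℝ 1 f O := hf.of_le hk1
  -- The single curve `u δ x` contains the orbit of `x` for all `|t| < δ`; halving makes `δ` itself
  -- an admissible scale.
  set δ := δ₀ / 2 with hδdef
  have hδ : 0 < δ := half_pos hδ₀
  have hδm : δ ∈ Ioo (-δ₀) δ₀ := ⟨by linarith, by linarith⟩
  set ψ : ℝ → E → E := fun t x => u t x ⟨1, by simp⟩ with hψ
  have hmem : ∀ t ∈ Ioo (-δ) δ, t / δ ∈ Icc (-1 : ℝ) 1 := by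
    intro t ht
    constructor
    · rw [le_div_iff₀ hδ]; linarith [ht.1]
    · rw [div_le_iff₀ hδ]; linarith [ht.2]
  have hψe : ∀ t ∈ Ioo (-δ) δ, ∀ x ∈ Metric.ball x₀ ρ, ψ t x = extendCurve (u δ x) (t / δ) := by
    intro t ht x hx
    rw [extendCurve_of_mem _ (hmem t ht), ← hscale δ hδm x hx ⟨t / δ, hmem t ht⟩]
    simp only [hψ]
    rw [div_mul_cancel₀ _ hδ.ne']
  have hudiff : ∀ x ∈ Metric.ball x₀ ρ, ContDiffAt ℝ k (u δ) x := by
    intro x hx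
    have h1 : ContDiffAt ℝ k (fun q : ℝ × E => u q.1 q.2) (δ, x) :=
      hu.contDiffAt ((isOpen_Ioo.prod Metric.isOpen_ball).mem_nhds ⟨hδm, hx⟩)
    exact h1.comp x (contDiff_prodMk_right δ).contDiffAt
  have hfd : ∀ t ∈ Ioo (-δ) δ, ∀ x ∈ Metric.ball x₀ ρ, ∀ w,
      fderiv ℝ (ψ t) x w = extendCurve (fderiv ℝ (u δ) x w) (t / δ) := by
    intro t ht x hx w
    have h1 : HasFDerivAt (u δ) (fderiv ℝ (u δ) x) x :=
      ((hudiff x hx).differentiableAt hk0).hasFDerivAt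
    have h2 := ((ContinuousMap.evalCLM ℝ (⟨t / δ, hmem t ht⟩ : TimeSpan) :
      C(TimeSpan, E) →L[ℝ] E).hasFDerivAt).comp x h1
    have h3 : ψ t =ᶠ[𝓝 x] (ContinuousMap.evalCLM ℝ (⟨t / δ, hmem t ht⟩ : TimeSpan) ∘ u δ) := by
      filter_upwards [Metric.isOpen_ball.mem_nhds hx] with y hy
      rw [hψe t ht y hy, extendCurve_of_mem _ (hmem t ht)]
      rfl
    rw [(h2.congr_of_eventuallyEq h3).fderiv, extendCurve_of_mem _ (hmem t ht)]
    rfl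
  refine ⟨δ, hδ, ρ, hρ, ψ, ?_, ?_, ?_, ?_⟩
  · refine ((ContinuousMap.evalCLM ℝ (⟨1, by simp⟩ : TimeSpan)).contDiff.comp_contDiffOn
      (hu.mono ?_)).congr fun q hq => rfl
    exact prod_mono (Ioo_subset_Ioo (by linarith) (by linarith)) subset_rfl
  · intro x hx
    have h0 : (0 : ℝ) ∈ Ioo (-δ₀) δ₀ := ⟨by linarith, hδ₀⟩
    simp only [hψ]
    rw [(hsol 0 h0 x hx).2]
    simp
  · intro t ht x hx
    obtain ⟨h1, h2⟩ := hsol δ hδm x hx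
    have hE : extendCurve (superpose f (u δ x)) (t / δ) = f (ψ t x) := by
      rw [hψe t ht x hx, extendCurve_of_mem _ (hmem t ht), extendCurve_of_mem _ (hmem t ht),
        superpose_apply hf.continuousOn h1]
    refine ⟨?_, ?_⟩
    · rw [hψe t ht x hx, extendCurve_of_mem _ (hmem t ht)]; exact h1 _
    · have := hasDerivAt_of_eq_primitive hδ h2 ht
      rw [hE] at this
      refine this.congr_of_eventuallyEq ?_
      filter_upwards [Ioo_mem_nhds ht.1 ht.2] with t' ht'
      exact hψe t' ht' x hx
  · intro t ht x hx w
    obtain ⟨h1, h2⟩ := hsol δ hδm x hx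
    have hd : HasFDerivAt (u δ) (fderiv ℝ (u δ) x) x :=
      ((hudiff x hx).differentiableAt hk0).hasFDerivAt
    -- Differentiating the integral equation in `x` yields the variational equation in integrated
    -- form.
    have hd2 := (constCurve E).hasFDerivAt (x := x) |>.add
      (((primitiveCLM E).hasFDerivAt.comp x
        ((hasFDerivAt_superpose hO hf1 h1).comp x hd)).const_smul δ)
    have hev : u δ =ᶠ[𝓝 x] fun y => constCurve E y + δ • primitiveCLM E (superpose f (u δ y)) := by
      filter_upwards [Metric.isOpen_ball.mem_nhds hx] with y hy
      exact (hsol δ hδm y hy).2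
    have heq := hd.unique (hd2.congr_of_eventuallyEq hev)
    have heqw := congrArg (fun A : E →L[ℝ] C(TimeSpan, E) => A w) heq
    simp only [_root_.add_apply, _root_.smul_apply,
      ContinuousLinearMap.comp_apply] at heqw
    have := hasDerivAt_of_eq_primitive hδ heqw ht
    have hf'c : ContinuousOn (fderiv ℝ f) O := hf1.continuousOn_fderiv_of_isOpen hO le_rfl
    have hE : extendCurve (applyCLM TimeSpan E E (superpose (fderiv ℝ f) (u δ x))
        (fderiv ℝ (u δ) x w)) (t / δ) = fderiv ℝ f (ψ t x) (fderiv ℝ (ψ t) x w) := by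
      rw [hfd t ht x hx, hψe t ht x hx, extendCurve_of_mem _ (hmem t ht),
        extendCurve_of_mem _ (hmem t ht), extendCurve_of_mem _ (hmem t ht), applyCLM_apply,
        superpose_apply hf'c h1]
    rw [hE] at this
    refine this.congr_of_eventuallyEq ?_
    filter_upwards [Ioo_mem_nhds ht.1 ht.2] with t' ht'
    exact hfd t' ht' x hx w

end LocalFlow


/-! ### Derivatives of charts, and vector fields and integral curves read in charts. -/

section Charts

variable {E : Type*} [NormedAddCommGroup E] [NormedSpace ℝ E]
  {M : Type*} [TopologicalSpace M] [ChartedSpace E M]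

/-- The preferred extended chart at `x₀`. -/
abbrev cht (E : Type*) [NormedAddCommGroup E] [NormedSpace ℝ E]
    {M : Type*} [TopologicalSpace M] [ChartedSpace E M] (x₀ : M) : PartialEquiv M E :=
  extChartAt 𝓘(ℝ, E) x₀

/-- The derivative at `x` of the chart at `x₀`. -/
def chartD (E : Type*) [NormedAddCommGroup E] [NormedSpace ℝ E]
    {M : Type*} [TopologicalSpace M] [ChartedSpace E M] (x₀ x : M) : E →L[ℝ] E :=
  mfderiv 𝓘(ℝ, E) 𝓘(ℝ, E) (extChartAt 𝓘(ℝ, E) x₀) x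

/-- The derivative at `y` of the inverse of the chart at `x₀`. -/
def chartSymmD (E : Type*) [NormedAddCommGroup E] [NormedSpace ℝ E]
    {M : Type*} [TopologicalSpace M] [ChartedSpace E M] (x₀ : M) (y : E) : E →L[ℝ] E :=
  mfderiv 𝓘(ℝ, E) 𝓘(ℝ, E) (extChartAt 𝓘(ℝ, E) x₀).symm y

/-- A vector field read in the chart at `x₀`. -/
def fieldInChart (X : M → E) (x₀ : M) (y : E) : E :=
  chartD E x₀ ((cht E x₀).symm y) (X ((cht E x₀).symm y))

lemma cht_source_mem_nhds {x₀ x : M} (hx : x ∈ (cht E x₀).source) : (cht E x₀).source ∈ 𝓝 x :=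
  (isOpen_extChartAt_source x₀).mem_nhds hx

lemma cht_target_mem_nhds {x₀ : M} {y : E} (hy : y ∈ (cht E x₀).target) :
    (cht E x₀).target ∈ 𝓝 y :=
  (isOpen_extChartAt_target x₀).mem_nhds hy

/-- `γ` is an integral curve of `X` on `s`; the vector field is given as a function with values
in the model space. -/
abbrev IntegralCurveOn (γ : ℝ → M) (X : M → E) (s : Set ℝ) : Prop :=
  IsMIntegralCurveOn (I := 𝓘(ℝ, E)) γ X s

/-- The sign of `c` is free, so that translation, rescaling and reversal of time are all covered. -/
lemma IntegralCurveOn.comp_affine {γ : ℝ → M} {X : M → E} {s : Set ℝ}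
    (h : IntegralCurveOn γ X s) (c d : ℝ) {s' : Set ℝ} (hs' : ∀ t ∈ s', c * t + d ∈ s) :
    IntegralCurveOn (fun t => γ (c * t + d)) (fun x => c • X x) s' := by
  intro t ht
  have h1 : HasMFDerivWithinAt 𝓘(ℝ, ℝ) 𝓘(ℝ, ℝ) (fun t : ℝ => c * t + d) s' t
      (c • (1 : ℝ →L[ℝ] ℝ)) := by
    apply HasFDerivWithinAt.hasMFDerivWithinAt
    have := ((hasDerivAt_id t).const_mul c).add_const d
    have := this.hasFDerivAt.hasFDerivWithinAt (s := s')
    refine this.congr_fderiv ?_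
    ext; simp
  have h2 := HasMFDerivWithinAt.comp t (h _ (hs' t ht)) h1 hs'
  have hL : ((1 : ℝ →L[ℝ] ℝ).smulRight (X (γ (c * t + d)))).comp (c • (1 : ℝ →L[ℝ] ℝ)) =
      (1 : ℝ →L[ℝ] ℝ).smulRight (c • X (γ (c * t + d))) := by
    ext; simp
  exact h2.congr_mfderiv hL

variable [IsManifold 𝓘(ℝ, E) 1 M]

lemma hasMFDerivAt_cht {x₀ x : M} (hx : x ∈ (cht E x₀).source) :
    HasMFDerivAt 𝓘(ℝ, E) 𝓘(ℝ, E) (cht E x₀) x (chartD E x₀ x) := by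
  rw [extChartAt_source] at hx
  exact (mdifferentiableAt_extChartAt hx).hasMFDerivAt

lemma hasMFDerivAt_cht_symm {x₀ : M} {y : E} (hy : y ∈ (cht E x₀).target) :
    HasMFDerivAt 𝓘(ℝ, E) 𝓘(ℝ, E) (cht E x₀).symm y (chartSymmD E x₀ y) := by
  have := mdifferentiableWithinAt_extChartAt_symm (I := 𝓘(ℝ, E)) (x := x₀) hy
  rw [modelWithCornersSelf_coe, range_id, mdifferentiableWithinAt_univ] at this
  exact this.hasMFDerivAt

lemma chartD_comp_chartSymmD {x₀ : M} {y : E} (hy : y ∈ (cht E x₀).target) :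
    (chartD E x₀ ((cht E x₀).symm y)).comp (chartSymmD E x₀ y) = ContinuousLinearMap.id ℝ E := by
  have := mfderiv_extChartAt_comp_mfderivWithin_extChartAt_symm (I := 𝓘(ℝ, E)) (x := x₀) hy
  rw [modelWithCornersSelf_coe, range_id, mfderivWithin_univ] at this
  exact this

lemma chartSymmD_comp_chartD {x₀ : M} {y : E} (hy : y ∈ (cht E x₀).target) :
    (chartSymmD E x₀ y).comp (chartD E x₀ ((cht E x₀).symm y)) = ContinuousLinearMap.id ℝ E := by
  have := mfderivWithin_extChartAt_symm_comp_mfderiv_extChartAt (I := 𝓘(ℝ, E)) (x := x₀) hy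
  rw [modelWithCornersSelf_coe, range_id, mfderivWithin_univ] at this
  exact this

lemma chartD_chartSymmD {x₀ : M} {y : E} (hy : y ∈ (cht E x₀).target) (u : E) :
    chartD E x₀ ((cht E x₀).symm y) (chartSymmD E x₀ y u) = u :=
  congrArg (fun A : E →L[ℝ] E => A u) (chartD_comp_chartSymmD hy)

lemma chartSymmD_chartD {x₀ : M} {y : E} (hy : y ∈ (cht E x₀).target) (u : E) :
    chartSymmD E x₀ y (chartD E x₀ ((cht E x₀).symm y) u) = u :=
  congrArg (fun A : E →L[ℝ] E => A u) (chartSymmD_comp_chartD hy)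

lemma chartSymmD_chartD' {x₀ x : M} (hx : x ∈ (cht E x₀).source) (u : E) :
    chartSymmD E x₀ (cht E x₀ x) (chartD E x₀ x u) = u := by
  have := chartSymmD_chartD ((cht E x₀).map_source hx) u
  rwa [(cht E x₀).left_inv hx] at this

lemma chartD_chartSymmD' {x₀ x : M} (hx : x ∈ (cht E x₀).source) (u : E) :
    chartD E x₀ x (chartSymmD E x₀ (cht E x₀ x) u) = u := by
  have := chartD_chartSymmD ((cht E x₀).map_source hx) u
  rwa [(cht E x₀).left_inv hx] at this

lemma chartSymmD_fieldInChart (X : M → E) {x₀ : M} {y : E} (hy : y ∈ (cht E x₀).target) :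
    chartSymmD E x₀ y (fieldInChart X x₀ y) = X ((cht E x₀).symm y) :=
  chartSymmD_chartD hy _

lemma fieldInChart_cht (X : M → E) {x₀ x : M} (hx : x ∈ (cht E x₀).source) :
    fieldInChart X x₀ (cht E x₀ x) = chartD E x₀ x (X x) := by
  rw [fieldInChart, (cht E x₀).left_inv hx]

variable {G : Type*} [NormedAddCommGroup G] [NormedSpace ℝ G]

lemma HasMFDerivWithinAt.hasFDerivWithinAt_cht {f : G → M} {s : Set G} {a : G} {L : G →L[ℝ] E}
    (h : HasMFDerivWithinAt 𝓘(ℝ, G) 𝓘(ℝ, E) f s a L) {x₀ : M} (hx : f a ∈ (cht E x₀).source) :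
    HasFDerivWithinAt (cht E x₀ ∘ f) ((chartD E x₀ (f a)).comp L) s a :=
  hasMFDerivWithinAt_iff_hasFDerivWithinAt.1 ((hasMFDerivAt_cht hx).comp_hasMFDerivWithinAt a h)

lemma hasMFDerivWithinAt_of_cht {f : G → M} {s : Set G} {a : G} {L : G →L[ℝ] E} {x₀ : M}
    (hc : ContinuousWithinAt f s a) (hx : f a ∈ (cht E x₀).source)
    (h : HasFDerivWithinAt (cht E x₀ ∘ f) L s a) :
    HasMFDerivWithinAt 𝓘(ℝ, G) 𝓘(ℝ, E) f s a ((chartSymmD E x₀ (cht E x₀ (f a))).comp L) := by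
  have h1 := (hasMFDerivAt_cht_symm ((cht E x₀).map_source hx)).comp_hasMFDerivWithinAt a
    (hasMFDerivWithinAt_iff_hasFDerivWithinAt.2 h)
  refine h1.congr_of_eventuallyEq ?_ ?_
  · filter_upwards [hc (cht_source_mem_nhds hx)] with z hz
    exact ((cht E x₀).left_inv hz).symm
  · exact ((cht E x₀).left_inv hx).symm

/-- Transfers the integral curve condition to an ODE in the model space. Derivatives are taken
within `s`, so that endpoints of intervals are included. -/
lemma integralCurveOn_iff_cht {γ : ℝ → M} {X : M → E} {s : Set ℝ} {t : ℝ} {x₀ : M}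
    (hc : ContinuousWithinAt γ s t) (hx : γ t ∈ (cht E x₀).source) :
    HasMFDerivWithinAt 𝓘(ℝ, ℝ) 𝓘(ℝ, E) γ s t ((1 : ℝ →L[ℝ] ℝ).smulRight (X (γ t))) ↔
      HasDerivWithinAt (cht E x₀ ∘ γ) (fieldInChart X x₀ (cht E x₀ (γ t))) s t := by
  constructor
  · intro h
    have := HasMFDerivWithinAt.hasFDerivWithinAt_cht
      (L := (1 : ℝ →L[ℝ] ℝ).smulRight (X (γ t))) h hx
    rw [hasDerivWithinAt_iff_hasFDerivWithinAt, fieldInChart_cht X hx]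
    refine this.congr_fderiv ?_
    ext
    simp
  · intro h
    rw [hasDerivWithinAt_iff_hasFDerivWithinAt] at h
    have := hasMFDerivWithinAt_of_cht hc hx h
    have hX : chartSymmD E x₀ (cht E x₀ (γ t)) (fieldInChart X x₀ (cht E x₀ (γ t))) = X (γ t) := by
      rw [fieldInChart_cht X hx, chartSymmD_chartD' hx]
    have hL : (chartSymmD E x₀ (cht E x₀ (γ t))).comp (ContinuousLinearMap.toSpanSingleton ℝ
        (fieldInChart X x₀ (cht E x₀ (γ t)))) = (1 : ℝ →L[ℝ] ℝ).smulRight (X (γ t)) := by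
      ext
      simpa using hX
    exact this.congr_mfderiv hL

end Charts

/-! ### Uniqueness of integral curves on a Hausdorff manifold. -/

section Uniqueness

variable {E : Type*} [NormedAddCommGroup E] [NormedSpace ℝ E]
  {M : Type*} [TopologicalSpace M] [ChartedSpace E M] [IsManifold 𝓘(ℝ, E) 1 M]

lemma IntegralCurveOn.hasDerivWithinAt_cht {γ : ℝ → M} {X : M → E} {s : Set ℝ}
    (h : IntegralCurveOn γ X s) {t : ℝ} (ht : t ∈ s) {x₀ : M} (hx : γ t ∈ (cht E x₀).source) :
    HasDerivWithinAt (cht E x₀ ∘ γ) (fieldInChart X x₀ (cht E x₀ (γ t))) s t :=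
  (integralCurveOn_iff_cht (h.continuousWithinAt ht) hx).1 (h t ht)

/-- The vector field `X` is of class `C^1`. -/
def FieldC1 (X : M → E) : Prop :=
  ∀ x₀ : M, ContDiffOn ℝ 1 (fieldInChart X x₀) (cht E x₀).target

variable [T2Space M]

/-- Continuation: the coincidence set is closed because `M` is Hausdorff, and it extends to the
right of each of its points by uniqueness for ODEs in a chart, where a `C^1` field is locally
Lipschitz. -/
lemma IntegralCurveOn.eqOn_Icc {γ γ' : ℝ → M} {X : M → E} (hX : FieldC1 X) {a b : ℝ}
    (h : IntegralCurveOn γ X (Icc a b)) (h' : IntegralCurveOn γ' X (Icc a b)) (hab : γ a = γ' a) :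
    EqOn γ γ' (Icc a b) := by
  rcases lt_or_ge b a with hlt | hle
  · simp [Icc_eq_empty_of_lt hlt]
  have hclosed : IsClosed ({t | γ t = γ' t} ∩ Icc a b) := by
    have h2 : ContinuousOn (fun t => (γ t, γ' t)) (Icc a b) := h.continuousOn.prodMk h'.continuousOn
    have := h2.preimage_isClosed_of_isClosed isClosed_Icc isClosed_diagonal
    rw [inter_comm] at this
    exact this
  refine hclosed.Icc_subset_of_forall_exists_gt hab ?_
  rintro t ⟨hteq, hta, htb⟩ y hy
  have htI : t ∈ Icc a b := ⟨hta, htb.le⟩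
  have hteq' : γ t = γ' t := hteq
  set x₀ := γ t with hx₀
  have hsrc : x₀ ∈ (cht E x₀).source := mem_extChartAt_source x₀
  obtain ⟨K, U, hU, hLip⟩ := ((hX x₀).contDiffAt (cht_target_mem_nhds
    (mem_extChartAt_target x₀))).exists_lipschitzOnWith
  have hnear : ∀ (η : ℝ → M), IntegralCurveOn η X (Icc a b) → η t = x₀ →
      ∀ᶠ τ in 𝓝[Icc a b] t, η τ ∈ (cht E x₀).source ∧ cht E x₀ (η τ) ∈ U := by
    intro η hη hηt
    have hc := hη.continuousWithinAt htI
    have h1 : ∀ᶠ z in 𝓝 (η t), z ∈ (cht E x₀).source := by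
      rw [hηt]; exact cht_source_mem_nhds hsrc
    have h2 : ∀ᶠ z in 𝓝 (η t), cht E x₀ z ∈ U := by
      rw [hηt]; exact (continuousAt_extChartAt x₀).eventually hU
    exact (hc.eventually h1).and (hc.eventually h2)
  have hev := (hnear γ h rfl).and (hnear γ' h' hteq'.symm)
  have hsub : 𝓝[≥] t ≤ 𝓝[Icc a b] t := by
    rw [nhdsWithin_le_iff]
    exact Filter.mem_of_superset (Icc_mem_nhdsGE htb) (Icc_subset_Icc_left hta)
  obtain ⟨d, hd, hdsub⟩ := mem_nhdsGE_iff_exists_Icc_subset.1 (hsub hev)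
  have htd : t < d := hd
  set c := min (min d b) y with hc
  have htc : t < c := lt_min (lt_min htd htb) hy
  have hcd : c ≤ d := (min_le_left _ _).trans (min_le_left _ _)
  have hcb : c ≤ b := (min_le_left _ _).trans (min_le_right _ _)
  have hcy : c ≤ y := min_le_right _ _
  have hIcc : Icc t c ⊆ Icc a b := Icc_subset_Icc hta hcb
  have key : ∀ (η : ℝ → M), IntegralCurveOn η X (Icc a b) →
      (∀ τ ∈ Icc t c, η τ ∈ (cht E x₀).source ∧ cht E x₀ (η τ) ∈ U) →
      ContinuousOn (cht E x₀ ∘ η) (Icc t c) ∧ ∀ τ ∈ Ico t c,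
        HasDerivWithinAt (cht E x₀ ∘ η) (fieldInChart X x₀ ((cht E x₀ ∘ η) τ)) (Ici τ) τ := by
    intro η hη hηs
    refine ⟨fun τ hτ => ?_, fun τ hτ => ?_⟩
    · exact (IntegralCurveOn.hasDerivWithinAt_cht (hη.mono hIcc) hτ (hηs τ hτ).1).continuousWithinAt
    · refine (IntegralCurveOn.hasDerivWithinAt_cht (hη.mono hIcc) (Ico_subset_Icc_self hτ)
        (hηs τ (Ico_subset_Icc_self hτ)).1).mono_of_mem_nhdsWithin ?_
      exact Filter.mem_of_superset (Icc_mem_nhdsGE hτ.2) (Icc_subset_Icc_left hτ.1)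
  have m1 : ∀ τ ∈ Icc t c, γ τ ∈ (cht E x₀).source ∧ cht E x₀ (γ τ) ∈ U :=
    fun τ hτ => (hdsub ⟨hτ.1, hτ.2.trans hcd⟩).1
  have m2 : ∀ τ ∈ Icc t c, γ' τ ∈ (cht E x₀).source ∧ cht E x₀ (γ' τ) ∈ U :=
    fun τ hτ => (hdsub ⟨hτ.1, hτ.2.trans hcd⟩).2
  obtain ⟨k1, k2⟩ := key γ h m1
  obtain ⟨k3, k4⟩ := key γ' h' m2
  have := ODE_solution_unique_of_mem_Icc_right (v := fun _ => fieldInChart X x₀)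
    (s := fun _ => U) (fun _ _ => hLip) k1 k2 (fun τ hτ => (m1 τ (Ico_subset_Icc_self hτ)).2)
    k3 k4 (fun τ hτ => (m2 τ (Ico_subset_Icc_self hτ)).2)
    (by simp only [Function.comp]; rw [← hteq'])
  have hce := this (right_mem_Icc.2 htc.le)
  refine ⟨c, ?_, htc, hcy⟩
  exact (cht E x₀).injOn (m1 c (right_mem_Icc.2 htc.le)).1 (m2 c (right_mem_Icc.2 htc.le)).1 hce

end Uniqueness


section Uniqueness

variable {E : Type*} [NormedAddCommGroup E] [NormedSpace ℝ E]
  {M : Type*} [TopologicalSpace M] [ChartedSpace E M] [IsManifold 𝓘(ℝ, E) 1 M]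

lemma FieldC1.const_smul {X : M → E} (hX : FieldC1 X) (c : ℝ) : FieldC1 (fun x => c • X x) := by
  intro x₀
  refine ((hX x₀).const_smul c).congr fun y _ => ?_
  simp [fieldInChart]

lemma IntegralCurveOn.eqOn_of_ordConnected [T2Space M] {γ γ' : ℝ → M} {X : M → E} (hX : FieldC1 X)
    {s : Set ℝ} (hs : s.OrdConnected)
    (h : IntegralCurveOn γ X s) (h' : IntegralCurveOn γ' X s) {t₀ : ℝ} (ht₀ : t₀ ∈ s)
    (heq : γ t₀ = γ' t₀) : EqOn γ γ' s := by
  intro t ht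
  rcases le_total t₀ t with hle | hle
  · exact IntegralCurveOn.eqOn_Icc hX (h.mono (hs.out ht₀ ht)) (h'.mono (hs.out ht₀ ht)) heq
      (right_mem_Icc.2 hle)
  -- Backward in time: reflect the interval and reverse the field.
  · have hmap : ∀ τ ∈ Icc t t₀, (-1 : ℝ) * τ + (t + t₀) ∈ s := by
      intro τ hτ
      refine hs.out ht ht₀ ⟨?_, ?_⟩ <;> linarith [hτ.1, hτ.2]
    have := IntegralCurveOn.eqOn_Icc (hX.const_smul (-1)) (IntegralCurveOn.comp_affine h (-1) (t + t₀) hmap)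
      (IntegralCurveOn.comp_affine h' (-1) (t + t₀) hmap) (by simpa using heq) (right_mem_Icc.2 hle)
    simpa using this

end Uniqueness

/-! ### Orbit segments confined to a set: concatenation, uniqueness, rescaling. -/

section Arcs

variable {E : Type*} [NormedAddCommGroup E] [NormedSpace ℝ E]
  {M : Type*} [TopologicalSpace M] [ChartedSpace E M]

/-- The integral curve of `X` issued from `x` stays in `W` up to time `T`, when it reaches `y`. -/
def Arc (W : Set M) (X : M → E) (T : ℝ) (x y : M) : Prop :=
  ∃ γ : ℝ → M, IntegralCurveOn γ X (Icc 0 T) ∧ (∀ t ∈ Icc 0 T, γ t ∈ W) ∧ γ 0 = x ∧ γ T = y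

lemma Arc.trans {W : Set M} {X : M → E} {T T' : ℝ} (hT : 0 ≤ T) (hT' : 0 ≤ T') {x y z : M}
    (h : Arc W X T x y) (h' : Arc W X T' y z) : Arc W X (T + T') x z := by
  obtain ⟨γ, h1, h2, h3, h4⟩ := h
  obtain ⟨γ', h1', h2', h3', h4'⟩ := h'
  set η : ℝ → M := fun t => if t ≤ T then γ t else γ' (t - T) with hη
  have hηl : ∀ t ≤ T, η t = γ t := fun t ht => by simp [hη, ht]
  have hηr : ∀ t ≥ T, η t = γ' (t - T) := by
    intro t ht
    rcases ht.eq_or_lt with rfl | hlt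
    · simp [hη, h3', h4]
    · simp [hη, not_le.2 hlt]
  have hc1 : IntegralCurveOn η X (Icc 0 T) := by
    intro t ht
    rw [hηl t ht.2]
    exact HasMFDerivWithinAt.congr_of_eventuallyEq (h1 t ht)
      (Filter.eventuallyEq_of_mem self_mem_nhdsWithin fun t ht => hηl t ht.2) (hηl t ht.2)
  have hc2 : IntegralCurveOn η X (Icc T (T + T')) := by
    have hm : ∀ t ∈ Icc T (T + T'), (1 : ℝ) * t + (-T) ∈ Icc 0 T' := by
      intro t ht; constructor <;> linarith [ht.1, ht.2]
    have := IntegralCurveOn.comp_affine h1' 1 (-T) hm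
    have e : ∀ t ≥ T, η t = γ' (1 * t + -T) := by
      intro t ht; rw [hηr t ht, one_mul, sub_eq_add_neg]
    intro t ht
    rw [e t ht.1]
    have h5 := HasMFDerivWithinAt.congr_of_eventuallyEq (this t ht)
      (Filter.eventuallyEq_of_mem self_mem_nhdsWithin fun t ht => e t ht.1) (e t ht.1)
    simpa only [one_smul] using h5
  refine ⟨η, ?_, ?_, ?_, ?_⟩
  · intro t ht
    rcases lt_trichotomy t T with hlt | heq | hgt
    · refine (hc1 t ⟨ht.1, hlt.le⟩).mono_of_mem_nhdsWithin ?_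
      refine mem_nhdsWithin.2 ⟨Iio T, isOpen_Iio, hlt, fun τ hτ => ⟨hτ.2.1, le_of_lt hτ.1⟩⟩
    · subst heq
      have := (hc1 t ⟨ht.1, le_rfl⟩).union (hc2 t ⟨le_rfl, ht.2⟩)
      rwa [Icc_union_Icc_eq_Icc hT (by linarith)] at this
    · refine (hc2 t ⟨hgt.le, ht.2⟩).mono_of_mem_nhdsWithin ?_
      refine mem_nhdsWithin.2 ⟨Ioi T, isOpen_Ioi, hgt, fun τ hτ => ⟨le_of_lt hτ.1, hτ.2.2⟩⟩
  · intro t ht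
    rcases le_total t T with hle | hle
    · rw [hηl t hle]; exact h2 t ⟨ht.1, hle⟩
    · rw [hηr t hle]; exact h2' _ ⟨by linarith, by linarith [ht.2]⟩
  · rw [hηl 0 hT, h3]
  · rw [hηr _ (by linarith)]; simpa using h4'

lemma Arc.mem_left {W : Set M} {X : M → E} {T : ℝ} (hT : 0 ≤ T) {x y : M} (h : Arc W X T x y) :
    x ∈ W := by
  obtain ⟨γ, -, h2, h3, -⟩ := h
  exact h3 ▸ h2 0 (left_mem_Icc.2 hT)

lemma Arc.mem_right {W : Set M} {X : M → E} {T : ℝ} (hT : 0 ≤ T) {x y : M} (h : Arc W X T x y) :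
    y ∈ W := by
  obtain ⟨γ, -, h2, -, h4⟩ := h
  exact h4 ▸ h2 T (right_mem_Icc.2 hT)

lemma Arc.unique [IsManifold 𝓘(ℝ, E) 1 M] [T2Space M] {W : Set M} {X : M → E} (hX : FieldC1 X)
    {T : ℝ} (hT : 0 ≤ T) {x y y' : M} (h : Arc W X T x y) (h' : Arc W X T x y') : y = y' := by
  obtain ⟨γ, h1, h2, h3, rfl⟩ := h
  obtain ⟨γ', h1', h2', h3', rfl⟩ := h'
  exact IntegralCurveOn.eqOn_Icc hX h1 h1' (h3.trans h3'.symm) (right_mem_Icc.2 hT)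

lemma Arc.scale {W : Set M} {X : M → E} {T : ℝ} {x y : M} (h : Arc W X T x y) {c T' : ℝ}
    (hc : 0 ≤ c) (hcT : c * T' = T) : Arc W (fun z => c • X z) T' x y := by
  obtain ⟨γ, h1, h2, h3, rfl⟩ := h
  have hm : ∀ t ∈ Icc 0 T', c * t + 0 ∈ Icc 0 T := by
    intro t ht
    rw [add_zero, ← hcT]
    exact ⟨mul_nonneg hc ht.1, mul_le_mul_of_nonneg_left ht.2 hc⟩
  refine ⟨_, IntegralCurveOn.comp_affine h1 c 0 hm, fun t ht => h2 _ (hm t ht), by simpa using h3, ?_⟩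
  simp [hcT]

lemma Arc.initial {W : Set M} {X : M → E} {T : ℝ} {γ : ℝ → M} (h1 : IntegralCurveOn γ X (Icc 0 T))
    (h2 : ∀ t ∈ Icc 0 T, γ t ∈ W) {t : ℝ} (ht : t ≤ T) : Arc W X t (γ 0) (γ t) :=
  ⟨γ, h1.mono (Icc_subset_Icc_right ht), fun τ hτ => h2 τ ⟨hτ.1, hτ.2.trans ht⟩, rfl, rfl⟩

end Arcs

/-! ### Flows depending on parameters, locally and along long orbits. -/

section ParamFlow

variable {E : Type*} [NormedAddCommGroup E] [NormedSpace ℝ E]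
  {M : Type*} [TopologicalSpace M] [ChartedSpace E M]
  {P : Type*} [NormedAddCommGroup P] [NormedSpace ℝ P]

/-- The derivative of a map `M → M`, as an endomorphism of the model space. -/
def mD (E : Type*) [NormedAddCommGroup E] [NormedSpace ℝ E]
    {M : Type*} [TopologicalSpace M] [ChartedSpace E M] (f : M → M) (x : M) : E →L[ℝ] E :=
  mfderiv 𝓘(ℝ, E) 𝓘(ℝ, E) f x

/-- The derivative of `f` at `x` preserves the bilinear form `Ω`. -/
def PreservesForm (Ω : M → E →L[ℝ] E →L[ℝ] ℝ) (f : M → M) (x : M) : Prop :=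
  ∀ u w : E, Ω (f x) (mD E f x u) (mD E f x w) = Ω x u w

/-- A vector field `X` depending on a parameter `p ∈ O` is jointly of class `C^k`. -/
def ParamField (k : ℕ∞) (O : Set P) (X : P → M → E) : Prop :=
  ∀ x₀ : M, ContDiffOn ℝ k (fun q : P × E => fieldInChart (X q.1) x₀ q.2) (O ×ˢ (cht E x₀).target)

lemma ParamField.fieldC1 {k : ℕ∞} (hk : 1 ≤ k) {O : Set P} {X : P → M → E}
    (hX : ParamField k O X) {p : P} (hp : p ∈ O) : FieldC1 (X p) := by
  intro x₀
  have h1 : ContDiffOn ℝ 1 (fun q : P × E => fieldInChart (X q.1) x₀ q.2)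
    (O ×ˢ (cht E x₀).target) := (hX x₀).of_le (by exact_mod_cast hk)
  exact h1.comp (contDiff_prodMk_right p).contDiffOn (fun y hy => ⟨hp, hy⟩)

/-- The parameter is treated as an additional coordinate with zero velocity, so joint smoothness in
`(p, y)` is that of one local flow on `P × E`. -/
lemma exists_chartFlow [CompleteSpace E] [CompleteSpace P] {k : ℕ∞} (hk : 1 ≤ k) {O : Set P}
    (hO : IsOpen O) {X : P → M → E}
    (hX : ParamField k O X) {p₀ : P} (hp₀ : p₀ ∈ O) (x₀ : M) {W : Set M} (hW : IsOpen W)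
    (hx₀ : x₀ ∈ W) :
    ∃ δ > 0, ∃ U : Set (P × E), IsOpen U ∧ (p₀, cht E x₀ x₀) ∈ U ∧ U ⊆ O ×ˢ (cht E x₀).target ∧
      ∃ φ : ℝ → P → E → E, ∀ q ∈ U, φ 0 q.1 q.2 = q.2 ∧ ∀ t ∈ Ioo (-δ) δ,
        φ t q.1 q.2 ∈ (cht E x₀).target ∧ (cht E x₀).symm (φ t q.1 q.2) ∈ W ∧
        ContDiffAt ℝ k (fun q : P × E => φ t q.1 q.2) q ∧
        HasDerivAt (fun t => φ t q.1 q.2) (fieldInChart (X q.1) x₀ (φ t q.1 q.2)) t ∧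
        ∀ w, HasDerivAt (fun t => fderiv ℝ (φ t q.1) q.2 w)
          (fderiv ℝ (fieldInChart (X q.1) x₀) (φ t q.1 q.2) (fderiv ℝ (φ t q.1) q.2 w)) t := by
  have hk1 : (1 : WithTop ℕ∞) ≤ k := by exact_mod_cast hk
  have hk0 : (k : WithTop ℕ∞) ≠ 0 := (lt_of_lt_of_le zero_lt_one hk1).ne'
  set V : Set E := (cht E x₀).target ∩ (cht E x₀).symm ⁻¹' W with hV
  have hVo : IsOpen V := (continuousOn_extChartAt_symm x₀).isOpen_inter_preimage
    (isOpen_extChartAt_target x₀) hW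
  set Z : P × E → P × E := fun q => (0, fieldInChart (X q.1) x₀ q.2) with hZ
  have hZd : ContDiffOn ℝ k Z (O ×ˢ V) :=
    contDiffOn_const.prodMk ((hX x₀).mono (prod_mono subset_rfl inter_subset_left))
  have hz₀ : (p₀, cht E x₀ x₀) ∈ O ×ˢ V :=
    ⟨hp₀, mem_extChartAt_target x₀, by simpa [(cht E x₀).left_inv (mem_extChartAt_source x₀)] using hx₀⟩
  obtain ⟨δ, hδ, ρ, hρ, ψ, h1, h2, h3, h4⟩ := exists_localFlow (hO.prod hVo) hk hZd hz₀
  have hfst : ∀ q ∈ Metric.ball (p₀, cht E x₀ x₀) ρ, ∀ t ∈ Ioo (-δ) δ, (ψ t q).1 = q.1 := by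
    intro q hq t ht
    have h0 : (0 : ℝ) ∈ Ioo (-δ) δ := ⟨by linarith, hδ⟩
    have hd : ∀ τ ∈ Ioo (-δ) δ, HasDerivAt (fun τ => (ψ τ q).1) 0 τ := fun τ hτ =>
      (h3 τ hτ q hq).2.fst
    have := isOpen_Ioo.is_const_of_deriv_eq_zero isPreconnected_Ioo
      (fun τ hτ => (hd τ hτ).differentiableAt.differentiableWithinAt)
      (fun τ hτ => (hd τ hτ).deriv) ht h0
    rw [this, h2 q hq]
  refine ⟨δ, hδ, Metric.ball (p₀, cht E x₀ x₀) ρ ∩ O ×ˢ V, Metric.isOpen_ball.inter (hO.prod hVo),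
    ⟨Metric.mem_ball_self hρ, hz₀⟩, fun q hq => ⟨hq.2.1, hq.2.2.1⟩,
    fun t p y => (ψ t (p, y)).2, ?_⟩
  rintro ⟨p, y⟩ ⟨hq, hqO⟩
  refine ⟨by simp only; rw [h2 _ hq], fun t ht => ?_⟩
  obtain ⟨h5, h6⟩ := h3 t ht _ hq
  have hψ : ψ t (p, y) = (p, (ψ t (p, y)).2) := Prod.ext (hfst _ hq t ht) rfl
  have hCD : ∀ τ ∈ Ioo (-δ) δ, ContDiffAt ℝ k (fun q : P × E => ψ τ q) (p, y) := by
    intro τ hτ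
    have := h1.contDiffAt ((isOpen_Ioo.prod Metric.isOpen_ball).mem_nhds
      (⟨hτ, hq⟩ : (τ, (p, y)) ∈ Ioo (-δ) δ ×ˢ Metric.ball (p₀, cht E x₀ x₀) ρ))
    exact this.comp (p, y) (contDiff_prodMk_right τ).contDiffAt
  -- The parameter component of the flow is constant, hence the variational equation in the
  -- direction `(0, w)` reduces to the one for `y` alone.
  have hpartial : ∀ τ ∈ Ioo (-δ) δ, ∀ w, fderiv ℝ (ψ τ) (p, y) (0, w) =
      (0, fderiv ℝ (fun y => (ψ τ (p, y)).2) y w) := by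
    intro τ hτ w
    have hd := ((hCD τ hτ).differentiableAt hk0).hasFDerivAt
    have hc := hd.comp y (hasFDerivAt_prodMk_right p y)
    have hs : HasFDerivAt (fun y => (ψ τ (p, y)).2) _ y := hc.snd
    have hf : HasFDerivAt (fun y => (ψ τ (p, y)).1) _ y := hc.fst
    have hconst : (fun y => (ψ τ (p, y)).1) =ᶠ[𝓝 y] fun _ => p := by
      have : Continuous fun y : E => (p, y) := by fun_prop
      filter_upwards [this.continuousAt.eventually (Metric.isOpen_ball.mem_nhds hq)] with z hz
      exact hfst _ hz τ hτ
    have hf0 := hf.unique ((hasFDerivAt_const p y).congr_of_eventuallyEq hconst)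
    refine Prod.ext ?_ ?_
    · exact congrArg (fun A : E →L[ℝ] P => A w) hf0
    · rw [hs.fderiv]; rfl
  refine ⟨h5.2.1, h5.2.2, (hCD t ht).snd, ?_, ?_⟩
  · have := h6.snd
    simp only [hZ] at this
    rwa [hfst _ hq t ht] at this
  · intro w
    have h7 := h4 t ht _ hq (0, w)
    have h8 : HasDerivAt (fun t => (fderiv ℝ (ψ t) (p, y) (0, w)).2)
      (fderiv ℝ Z (ψ t (p, y)) (fderiv ℝ (ψ t) (p, y) (0, w))).2 t := h7.snd
    have hZ' : DifferentiableAt ℝ Z (ψ t (p, y)) :=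
      (hZd.contDiffAt ((hO.prod hVo).mem_nhds h5)).differentiableAt hk0
    have hval : (fderiv ℝ Z (ψ t (p, y)) (fderiv ℝ (ψ t) (p, y) (0, w))).2 =
        fderiv ℝ (fieldInChart (X p) x₀) (ψ t (p, y)).2 (fderiv ℝ (fun y => (ψ t (p, y)).2) y w) := by
      rw [hpartial t ht w]
      have hd := hZ'.hasFDerivAt
      rw [hψ] at hd
      have hs : HasFDerivAt (fieldInChart (X p) x₀) _ (ψ t (p, y)).2 :=
        (hd.comp (ψ t (p, y)).2 (hasFDerivAt_prodMk_right p (ψ t (p, y)).2)).snd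
      rw [hs.fderiv, ← hψ]
      rfl
    rw [hval] at h8
    refine h8.congr_of_eventuallyEq ?_
    filter_upwards [Ioo_mem_nhds ht.1 ht.2] with τ hτ
    rw [hpartial τ hτ w]

/-- Local flows inside `W`, jointly of class `C^k` in the parameter and the initial point, whose
time-`t` maps preserve the form `Ω`. -/
def HasLocalFlows (k : ℕ∞) (O : Set P) (W : Set M) (X : P → M → E)
    (Ω : M → E →L[ℝ] E →L[ℝ] ℝ) : Prop :=
  ∀ p₀ ∈ O, ∀ x₀ ∈ W, ∃ δ > 0, ∃ U ∈ 𝓝 (p₀, x₀), ∃ ψ : ℝ → P → M → M, ∀ q ∈ U,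
    ψ 0 q.1 q.2 = q.2 ∧ ∀ t ∈ Ioo (-δ) δ, ψ t q.1 q.2 ∈ W ∧
      ContMDiffAt (𝓘(ℝ, P).prod 𝓘(ℝ, E)) 𝓘(ℝ, E) k (fun q : P × M => ψ t q.1 q.2) q ∧
      HasMFDerivAt 𝓘(ℝ, ℝ) 𝓘(ℝ, E) (fun t => ψ t q.1 q.2) t
        ((1 : ℝ →L[ℝ] ℝ).smulRight (X q.1 (ψ t q.1 q.2))) ∧
      PreservesForm Ω (ψ t q.1) q.2

lemma PreservesForm.comp {Ω : M → E →L[ℝ] E →L[ℝ] ℝ} {f g : M → M} {x : M}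
    (hf : MDifferentiableAt 𝓘(ℝ, E) 𝓘(ℝ, E) f x) (hg : MDifferentiableAt 𝓘(ℝ, E) 𝓘(ℝ, E) g (f x))
    (h : PreservesForm Ω f x) (h' : PreservesForm Ω g (f x)) : PreservesForm Ω (g ∘ f) x := by
  intro u w
  have e : mD E (g ∘ f) x = (mD E g (f x)).comp (mD E f x) := mfderiv_comp x hg hf
  rw [e]
  exact (h' _ _).trans (h _ _)

lemma mdifferentiableAt_of_param {k : ℕ∞} (hk : 1 ≤ k) {Ψ : P → M → M} {p : P} {x : M}
    (h : ContMDiffAt (𝓘(ℝ, P).prod 𝓘(ℝ, E)) 𝓘(ℝ, E) k (fun q : P × M => Ψ q.1 q.2) (p, x)) :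
    MDifferentiableAt 𝓘(ℝ, E) 𝓘(ℝ, E) (Ψ p) x := by
  have hk1 : (1 : WithTop ℕ∞) ≤ k := by exact_mod_cast hk
  have hk0 : (k : WithTop ℕ∞) ≠ 0 := (lt_of_lt_of_le zero_lt_one hk1).ne'
  have h1 : ContMDiffAt 𝓘(ℝ, E) (𝓘(ℝ, P).prod 𝓘(ℝ, E)) k (fun x : M => (p, x)) x :=
    contMDiffAt_const.prodMk contMDiffAt_id
  exact (ContMDiffAt.comp x h h1).mdifferentiableAt hk0

/-- Long integral curves persist, and the flow along them is of class `C^k`. -/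
theorem exists_flow_near [IsManifold 𝓘(ℝ, E) 1 M] [T2Space M] {k : ℕ∞} (hk : 1 ≤ k) {O : Set P}
    {W : Set M} {X : P → M → E} {Ω : M → E →L[ℝ] E →L[ℝ] ℝ} (hloc : HasLocalFlows k O W X Ω)
    (hC1 : ∀ p ∈ O, FieldC1 (X p)) {p₀ : P} (hp₀ : p₀ ∈ O) {γ : ℝ → M}
    (hγ : IntegralCurveOn γ (X p₀) (Icc 0 1)) (hγW : ∀ t ∈ Icc (0 : ℝ) 1, γ t ∈ W) :
    ∃ Ψ : P → M → M, ContMDiffAt (𝓘(ℝ, P).prod 𝓘(ℝ, E)) 𝓘(ℝ, E) k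
        (fun q : P × M => Ψ q.1 q.2) (p₀, γ 0) ∧ Ψ p₀ (γ 0) = γ 1 ∧
      (∀ᶠ q in 𝓝 (p₀, γ 0), Arc W (X q.1) 1 q.2 (Ψ q.1 q.2)) ∧ PreservesForm Ω (Ψ p₀) (γ 0) := by
  have hex : ∀ t₀ : Icc (0 : ℝ) 1, ∃ δ > 0, ∃ U ∈ 𝓝 (p₀, γ t₀), ∃ ψ : ℝ → P → M → M, ∀ q ∈ U,
    ψ 0 q.1 q.2 = q.2 ∧ ∀ t ∈ Ioo (-δ) δ, ψ t q.1 q.2 ∈ W ∧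
      ContMDiffAt (𝓘(ℝ, P).prod 𝓘(ℝ, E)) 𝓘(ℝ, E) k (fun q : P × M => ψ t q.1 q.2) q ∧
      HasMFDerivAt 𝓘(ℝ, ℝ) 𝓘(ℝ, E) (fun t => ψ t q.1 q.2) t
        ((1 : ℝ →L[ℝ] ℝ).smulRight (X q.1 (ψ t q.1 q.2))) ∧
      PreservesForm Ω (ψ t q.1) q.2 := fun t₀ => hloc p₀ hp₀ _ (hγW t₀ t₀.2)
  choose δ hδ U hU ψ hψ using hex
  have hγc : Continuous (fun t : Icc (0 : ℝ) 1 => γ t) := hγ.continuousOn.domRestrict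
  -- The cover for a finite subdivision of `[0, 1]`. With radius `δ / 2`, two times in the same
  -- piece differ by less than `δ`, so the local flow at `t₀` crosses the whole piece.
  set c : Icc (0 : ℝ) 1 → Set (Icc (0 : ℝ) 1) := fun t₀ =>
    {t | (p₀, γ t) ∈ interior (U t₀) ∧ |(t : ℝ) - t₀| < δ t₀ / 2} with hc
  have hc1 : ∀ i, IsOpen (c i) := by
    intro i
    refine IsOpen.inter ?_ ?_
    · exact isOpen_interior.preimage (continuous_const.prodMk hγc)
    · exact isOpen_lt ((continuous_subtype_val.sub continuous_const).abs) continuous_const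
  have hc2 : univ ⊆ ⋃ i, c i := by
    intro t _
    refine mem_iUnion.2 ⟨t, mem_interior_iff_mem_nhds.2 (hU t), ?_⟩
    simpa using hδ t
  obtain ⟨τ, hτ0, hτm, ⟨m, hm⟩, hτc⟩ := exists_monotone_Icc_subset_open_cover_Icc zero_le_one hc1 hc2
  have main : ∀ j : ℕ, ∃ Ψ : P → M → M, ContMDiffAt (𝓘(ℝ, P).prod 𝓘(ℝ, E)) 𝓘(ℝ, E) k
        (fun q : P × M => Ψ q.1 q.2) (p₀, γ 0) ∧ Ψ p₀ (γ 0) = γ (τ j) ∧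
      (∀ᶠ q in 𝓝 (p₀, γ 0), Arc W (X q.1) (τ j) q.2 (Ψ q.1 q.2)) ∧
      PreservesForm Ω (Ψ p₀) (γ 0) := by
    intro j
    induction j with
    | zero =>
      refine ⟨fun _ x => x, contMDiffAt_snd, by simp [hτ0], ?_, ?_⟩
      · rw [hτ0]
        have hev : ∀ᶠ q in 𝓝 (p₀, γ 0), q ∈ U ⟨0, by simp⟩ := hU ⟨0, by simp⟩
        filter_upwards [hev] with q hq
        obtain ⟨h0, h1⟩ := hψ ⟨0, by simp⟩ q hq
        have hδ0 := hδ ⟨0, by simp⟩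
        have hz : (0 : ℝ) ∈ Ioo (-δ ⟨0, by simp⟩) (δ ⟨0, by simp⟩) := ⟨by linarith, hδ0⟩
        refine ⟨fun t => ψ ⟨0, by simp⟩ t q.1 q.2, ?_, ?_, h0, h0⟩
        · intro t ht
          have ht0 : t = 0 := le_antisymm ht.2 ht.1
          subst ht0
          exact (h1 0 hz).2.2.1.hasMFDerivWithinAt
        · intro t ht
          have ht0 : t = 0 := le_antisymm ht.2 ht.1
          subst ht0
          exact (h1 0 hz).1
      · intro u w
        have : mD E (fun x : M => x) (γ 0) = ContinuousLinearMap.id ℝ E := mfderiv_id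
        rw [this]
        rfl
    | succ j ih =>
      obtain ⟨Ψ, i1, i2, i3, i4⟩ := ih
      obtain ⟨i, hi⟩ := hτc j
      have hle : τ j ≤ τ (j + 1) := hτm (Nat.le_succ j)
      have hleR : (τ j : ℝ) ≤ τ (j + 1) := hle
      have mj := hi (left_mem_Icc.2 hle)
      have mj' := hi (right_mem_Icc.2 hle)
      set d : ℝ := τ (j + 1) - τ j with hd
      have hdlt : d < δ i := by
        have h1 := abs_lt.1 mj.2
        have h2 := abs_lt.1 mj'.2
        simp only [hd]; linarith [h1.1, h2.2]
      have hd0 : 0 ≤ d := sub_nonneg.2 hleR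
      have hdI : d ∈ Ioo (-δ i) (δ i) := ⟨by linarith [hδ i], hdlt⟩
      have hUj : (p₀, γ (τ j)) ∈ U i := interior_subset mj.1
      have hcont : ContinuousAt (fun q : P × M => (q.1, Ψ q.1 q.2)) (p₀, γ 0) :=
        continuousAt_fst.prodMk i1.continuousAt
      have hUev : ∀ᶠ q in 𝓝 (p₀, γ 0), (q.1, Ψ q.1 q.2) ∈ U i := by
        refine hcont.eventually (p := fun z => z ∈ U i) ?_
        simp only; rw [i2]
        exact mem_interior_iff_mem_nhds.1 mj.1
      have harc : ∀ q ∈ U i, Arc W (X q.1) d q.2 (ψ i d q.1 q.2) := by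
        intro q hq
        obtain ⟨h0, h1⟩ := hψ i q hq
        have hsub : ∀ t ∈ Icc 0 d, t ∈ Ioo (-δ i) (δ i) := fun t ht =>
          ⟨by linarith [ht.1, hδ i], by linarith [ht.2]⟩
        exact ⟨fun t => ψ i t q.1 q.2, fun t ht => (h1 t (hsub t ht)).2.2.1.hasMFDerivWithinAt,
          fun t ht => (h1 t (hsub t ht)).1, h0, rfl⟩
      -- By uniqueness the local flow follows `γ` exactly at the parameter `p₀`, so the next step
      -- again starts at a point of `γ`.
      have hend : ψ i d p₀ (γ (τ j)) = γ (τ (j + 1)) := by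
        refine (harc _ hUj).unique (hC1 p₀ hp₀) hd0 ?_
        have hmap : ∀ t ∈ Icc 0 d, 1 * t + (τ j : ℝ) ∈ Icc (0 : ℝ) 1 := by
          intro t ht
          refine ⟨by linarith [ht.1, (τ j).2.1], ?_⟩
          have := (τ (j + 1)).2.2
          linarith [ht.2]
        refine ⟨fun t => γ (1 * t + τ j), ?_, fun t ht => hγW _ (hmap t ht), by simp, ?_⟩
        · have := IntegralCurveOn.comp_affine hγ 1 (τ j) hmap
          simpa only [one_smul] using this
        · simp [hd]
      obtain ⟨-, hfl⟩ := hψ i _ hUj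
      obtain ⟨-, hsm, -, hpf⟩ := hfl d hdI
      refine ⟨fun p x => ψ i d p (Ψ p x), ?_, ?_, ?_, ?_⟩
      · have hpair : ContMDiffAt (𝓘(ℝ, P).prod 𝓘(ℝ, E)) (𝓘(ℝ, P).prod 𝓘(ℝ, E)) k
            (fun q : P × M => (q.1, Ψ q.1 q.2)) (p₀, γ 0) := contMDiffAt_fst.prodMk i1
        refine ContMDiffAt.comp (p₀, γ 0) (g := fun q : P × M => ψ i d q.1 q.2) ?_ hpair
        simp only; rw [i2]; exact hsm
      · simp only; rw [i2, hend]
      · filter_upwards [hUev, i3] with q hq hq3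
        have := hq3.trans (τ j).2.1 hd0 (harc _ hq)
        simpa [hd] using this
      · refine PreservesForm.comp (f := Ψ p₀) (g := ψ i d p₀) (mdifferentiableAt_of_param hk i1) ?_ i4 ?_
        · rw [i2]; exact mdifferentiableAt_of_param hk hsm
        · rw [i2]; exact hpf
  obtain ⟨Ψ, h1, h2, h3, h4⟩ := main m
  have hm1 : τ m = ⟨1, by simp⟩ := Subtype.ext (hm m le_rfl)
  rw [hm1] at h2 h3
  exact ⟨Ψ, h1, h2, h3, h4⟩

end ParamFlow


/-! ### Hamiltonian fields: regularity, and invariance of the symplectic form under their flows. -/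

section Hamiltonian

variable {n : ℕ} {M : Type*} [TopologicalSpace M] [ChartedSpace (Model n) M]

/-- `hamVF`, with values in the model space. -/
def ham (Ω : M → Model n →L[ℝ] Model n →L[ℝ] ℝ) (f : M → ℝ) (x : M) : Model n := hamVF Ω f x

/-- `differential`, as a functional on the model space. -/
def dfun (f : M → ℝ) (x : M) : Model n →L[ℝ] ℝ := differential f x

/-- `formInChart`, for forms on the model space. -/
def formC (Ω : M → Model n →L[ℝ] Model n →L[ℝ] ℝ) (x₀ : M) (y : Model n) :
    Model n →L[ℝ] Model n →L[ℝ] ℝ := formInChart Ω x₀ y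

/-- The linear combination `∑ vᵢ Xᵢ^ε` of the Hamiltonian vector fields, for the parameter
`(ε, v)`. -/
def combField {s : ℕ} (Ω : M → Model n →L[ℝ] Model n →L[ℝ] ℝ) (F : Fin s → ℝ → M → ℝ)
    (p : ℝ × (Fin s → ℝ)) (x : M) : Model n := ∑ i, p.2 i • ham Ω (F i p.1) x

/-- The part of the hypotheses that does not involve the torus. -/
structure Involutive {s : ℕ} (r : ℕ∞) (Ω : M → Model n →L[ℝ] Model n →L[ℝ] ℝ) (ε₀ : ℝ)
    (F : Fin s → ℝ → M → ℝ) (W : Set M) : Prop where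
  two_le : 2 ≤ r
  symplectic : IsSymplecticForm (r - 1) Ω
  contMDiffOn_F : ∀ i, ContMDiffOn ((𝓡 (2 * n)).prod 𝓘(ℝ, ℝ)) 𝓘(ℝ, ℝ) r
    (fun p : M × ℝ => F i p.2 p.1) (univ ×ˢ Ioo (-ε₀) ε₀)
  isOpen_W : IsOpen W
  independent : ∀ ε ∈ Ioo (-ε₀) ε₀, ∀ x ∈ W, LinearIndependent ℝ (fun i => dfun (n := n) (F i ε) x)
  involution : ∀ ε ∈ Ioo (-ε₀) ε₀, ∀ x ∈ W, ∀ i j,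
    Ω x (ham Ω (F i ε) x) (ham Ω (F j ε) x) = 0

lemma formC_apply (Ω : M → Model n →L[ℝ] Model n →L[ℝ] ℝ) (x₀ : M) (y u v : Model n) :
    formC Ω x₀ y u v = Ω ((cht (Model n) x₀).symm y) (chartSymmD (Model n) x₀ y u)
      (chartSymmD (Model n) x₀ y v) := rfl

/-- A nondegenerate bilinear form on a finite-dimensional space as an isomorphism with the
dual. -/
def dualEquiv {B : Model n →L[ℝ] Model n →L[ℝ] ℝ} (hB : ∀ v, (∀ w, B v w = 0) → v = 0) :
    Model n ≃L[ℝ] (Model n →L[ℝ] ℝ) := by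
  have hinj : Function.Injective (B : Model n →ₗ[ℝ] (Model n →L[ℝ] ℝ)) := by
    rw [← LinearMap.ker_eq_bot, LinearMap.ker_eq_bot']
    intro v hv
    exact hB v (fun w => congrArg (fun A : Model n →L[ℝ] ℝ => A w) hv)
  have hdim : Module.finrank ℝ (Model n) = Module.finrank ℝ (Model n →L[ℝ] ℝ) := by
    rw [← (LinearMap.toContinuousLinearMap (𝕜 := ℝ) (E := Model n) (F' := ℝ)).finrank_eq,
      Module.finrank_linearMap_self]
  exact (LinearEquiv.ofInjectiveOfFinrankEq (B : Model n →ₗ[ℝ] (Model n →L[ℝ] ℝ)) hinj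
    hdim).toContinuousLinearEquiv

lemma dualEquiv_coe {B : Model n →L[ℝ] Model n →L[ℝ] ℝ} (hB : ∀ v, (∀ w, B v w = 0) → v = 0) :
    (dualEquiv hB : Model n →L[ℝ] (Model n →L[ℝ] ℝ)) = B := by
  ext v w
  rfl

lemma apply_inverse {B : Model n →L[ℝ] Model n →L[ℝ] ℝ} (hB : ∀ v, (∀ w, B v w = 0) → v = 0)
    (l : Model n →L[ℝ] ℝ) : B (B.inverse l) = l := by
  have h : B.inverse = ((dualEquiv hB).symm : (Model n →L[ℝ] ℝ) →L[ℝ] Model n) := by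
    rw [← ContinuousLinearMap.inverse_equiv, dualEquiv_coe]
  rw [h]
  exact (dualEquiv hB).apply_symm_apply l

variable {k : ℕ∞} {Ω : M → Model n →L[ℝ] Model n →L[ℝ] ℝ}

lemma form_ham (hΩ : IsSymplecticForm k Ω) (f : M → ℝ) (x : M) :
    Ω x (ham Ω f x) = dfun f x :=
  apply_inverse (hΩ.nondegenerate x) _

lemma form_swap (hΩ : IsSymplecticForm k Ω) (x : M) (u v : Model n) : Ω x u v = - Ω x v u := by
  have h : Ω x (u + v) (u + v) = 0 := hΩ.alternating x (u + v)
  have h1 : Ω x u u = 0 := hΩ.alternating x u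
  have h2 : Ω x v v = 0 := hΩ.alternating x v
  simp only [map_add, _root_.add_apply, h1, h2] at h
  linarith

lemma formC_swap (hΩ : IsSymplecticForm k Ω) (x₀ : M) (y u v : Model n) :
    formC Ω x₀ y u v = - formC Ω x₀ y v u := by
  rw [formC_apply, formC_apply, form_swap hΩ]

section

variable [IsManifold 𝓘(ℝ, Model n) 1 M]

lemma formC_nondegenerate (hΩ : IsSymplecticForm k Ω) {x₀ : M} {y : Model n}
    (hy : y ∈ (cht (Model n) x₀).target) (v : Model n) (hv : ∀ w, formC Ω x₀ y v w = 0) : v = 0 := by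
  have h : chartSymmD (Model n) x₀ y v = 0 := by
    refine hΩ.nondegenerate ((cht (Model n) x₀).symm y) _ (fun (w : Model n) => ?_)
    have := hv (chartD (Model n) x₀ ((cht (Model n) x₀).symm y) w)
    rw [formC_apply, chartSymmD_chartD hy] at this
    exact this
  rw [← chartD_chartSymmD hy v, h, map_zero]

lemma fderiv_comp_cht_symm {f : M → ℝ} {x₀ : M} {y : Model n} (hy : y ∈ (cht (Model n) x₀).target)
    (hf : MDifferentiableAt 𝓘(ℝ, Model n) 𝓘(ℝ, ℝ) f ((cht (Model n) x₀).symm y)) :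
    HasFDerivAt (f ∘ (cht (Model n) x₀).symm)
      ((dfun f ((cht (Model n) x₀).symm y)).comp (chartSymmD (Model n) x₀ y)) y :=
  hasMFDerivAt_iff_hasFDerivAt.1 (HasMFDerivAt.comp y hf.hasMFDerivAt (hasMFDerivAt_cht_symm hy))

lemma formC_fieldInChart (hΩ : IsSymplecticForm k Ω) {f : M → ℝ} {x₀ : M} {y : Model n}
    (hy : y ∈ (cht (Model n) x₀).target)
    (hf : MDifferentiableAt 𝓘(ℝ, Model n) 𝓘(ℝ, ℝ) f ((cht (Model n) x₀).symm y)) :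
    formC Ω x₀ y (fieldInChart (ham Ω f) x₀ y) = fderiv ℝ (f ∘ (cht (Model n) x₀).symm) y := by
  rw [(fderiv_comp_cht_symm hy hf).fderiv]
  ext w
  rw [formC_apply, chartSymmD_fieldInChart _ hy, form_ham hΩ]
  rfl

/-- Regularity is read off from this expression: inversion of operators is smooth, so the field
inherits the class `C^{r-1}` common to the form and to the differential of a `C^r` function. -/
lemma fieldInChart_ham (hΩ : IsSymplecticForm k Ω) {f : M → ℝ} {x₀ : M} {y : Model n}
    (hy : y ∈ (cht (Model n) x₀).target)
    (hf : MDifferentiableAt 𝓘(ℝ, Model n) 𝓘(ℝ, ℝ) f ((cht (Model n) x₀).symm y)) :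
    fieldInChart (ham Ω f) x₀ y =
      (formC Ω x₀ y).inverse (fderiv ℝ (f ∘ (cht (Model n) x₀).symm) y) := by
  have h1 := formC_fieldInChart hΩ hy hf
  have h2 := apply_inverse (formC_nondegenerate hΩ hy) (fderiv ℝ (f ∘ (cht (Model n) x₀).symm) y)
  rw [← h1] at h2
  have h3 := formC_nondegenerate hΩ hy ((formC Ω x₀ y).inverse (formC Ω x₀ y
    (fieldInChart (ham Ω f) x₀ y)) - fieldInChart (ham Ω f) x₀ y) (fun w => by
      rw [map_sub, h2, sub_self]; rfl)
  rw [← h1]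
  exact (sub_eq_zero.1 h3).symm

end

section

variable {r : ℕ∞} {s : ℕ} {ε₀ : ℝ} {F : Fin s → ℝ → M → ℝ} {W : Set M}

lemma one_le_sub_one_of_two_le {r : ℕ∞} (h : 2 ≤ r) : 1 ≤ r - 1 := by
  induction r with
  | top => simp
  | coe m =>
    have h' : 2 ≤ m := by exact_mod_cast h
    have : 1 ≤ m - 1 := by omega
    exact_mod_cast this

lemma Involutive.one_le (H : Involutive r Ω ε₀ F W) : 1 ≤ r := le_trans (by norm_num) H.two_le

lemma Involutive.pred_add_one (H : Involutive r Ω ε₀ F W) : (r - 1) + 1 = r :=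
  tsub_add_cancel_of_le H.one_le

lemma Involutive.one_le_pred (H : Involutive r Ω ε₀ F W) : 1 ≤ r - 1 :=
  one_le_sub_one_of_two_le H.two_le

lemma Involutive.cast_pred (H : Involutive r Ω ε₀ F W) :
    ((r - 1 : ℕ∞) : WithTop ℕ∞) + 1 = (r : WithTop ℕ∞) := by
  exact_mod_cast congrArg (fun a : ℕ∞ => (a : WithTop ℕ∞)) H.pred_add_one

lemma Involutive.ne_zero (H : Involutive r Ω ε₀ F W) : (r : WithTop ℕ∞) ≠ 0 := by
  rw [← H.cast_pred]
  simp

lemma Involutive.pred_ne_zero (H : Involutive r Ω ε₀ F W) : ((r - 1 : ℕ∞) : WithTop ℕ∞) ≠ 0 := by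
  have := H.one_le_pred
  intro h
  have h' : r - 1 = 0 := by exact_mod_cast h
  rw [h'] at this
  simp at this

variable [IsManifold (𝓡 (2 * n)) r M]

lemma Involutive.isManifold_one (H : Involutive r Ω ε₀ F W) : IsManifold 𝓘(ℝ, Model n) 1 M :=
  IsManifold.of_le (n := r) (by exact_mod_cast H.one_le)

lemma Involutive.mdifferentiableAt (H : Involutive r Ω ε₀ F W) (i : Fin s) {ε : ℝ}
    (hε : ε ∈ Ioo (-ε₀) ε₀) (x : M) : MDifferentiableAt 𝓘(ℝ, Model n) 𝓘(ℝ, ℝ) (F i ε) x := by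
  have h1 : ContMDiffAt ((𝓡 (2 * n)).prod 𝓘(ℝ, ℝ)) 𝓘(ℝ, ℝ) r
    (fun p : M × ℝ => F i p.2 p.1) (x, ε) :=
    (H.contMDiffOn_F i).contMDiffAt ((isOpen_univ.prod isOpen_Ioo).mem_nhds ⟨trivial, hε⟩)
  have h2 : ContMDiffAt 𝓘(ℝ, Model n) ((𝓡 (2 * n)).prod 𝓘(ℝ, ℝ)) r (fun x : M => (x, ε)) x :=
    contMDiffAt_id.prodMk contMDiffAt_const
  exact (ContMDiffAt.comp x h1 h2).mdifferentiableAt H.ne_zero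

lemma Involutive.contDiffOn_chart (H : Involutive r Ω ε₀ F W) (i : Fin s) (x₀ : M) :
    ContDiffOn ℝ r (fun q : ℝ × Model n => F i q.1 ((cht (Model n) x₀).symm q.2))
      (Ioo (-ε₀) ε₀ ×ˢ (cht (Model n) x₀).target) := by
  rw [← contMDiffOn_iff_contDiffOn]
  have h1 : ContMDiffOn 𝓘(ℝ, ℝ × Model n) ((𝓡 (2 * n)).prod 𝓘(ℝ, ℝ)) r
      (fun q : ℝ × Model n => ((cht (Model n) x₀).symm q.2, q.1))
      (Ioo (-ε₀) ε₀ ×ˢ (cht (Model n) x₀).target) := by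
    refine ContMDiffOn.prodMk ?_ ?_
    · exact (contMDiffOn_extChartAt_symm x₀).comp contDiff_snd.contMDiff.contMDiffOn
        (fun q hq => hq.2)
    · exact contDiff_fst.contMDiff.contMDiffOn
  exact (H.contMDiffOn_F i).comp h1 (fun q hq => ⟨trivial, hq.1⟩)

lemma Involutive.contDiffOn_fderiv_chart (H : Involutive r Ω ε₀ F W) (i : Fin s) (x₀ : M) :
    ContDiffOn ℝ (r - 1 : ℕ∞)
      (fun q : ℝ × Model n => fderiv ℝ (F i q.1 ∘ (cht (Model n) x₀).symm) q.2)
      (Ioo (-ε₀) ε₀ ×ˢ (cht (Model n) x₀).target) := by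
  have hopen : IsOpen (Ioo (-ε₀) ε₀ ×ˢ (cht (Model n) x₀).target) :=
    isOpen_Ioo.prod (isOpen_extChartAt_target x₀)
  have h := (H.contDiffOn_chart i x₀).fderiv_of_isOpen hopen H.cast_pred.le
  have h2 : ContDiffOn ℝ (r - 1 : ℕ∞) (fun q => (fderiv ℝ
      (fun q : ℝ × Model n => F i q.1 ((cht (Model n) x₀).symm q.2)) q).comp
      (ContinuousLinearMap.inr ℝ ℝ (Model n))) (Ioo (-ε₀) ε₀ ×ˢ (cht (Model n) x₀).target) :=
    h.clm_comp contDiffOn_const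
  refine h2.congr fun q hq => ?_
  have h3 := (((H.contDiffOn_chart i x₀).contDiffAt (hopen.mem_nhds hq)).differentiableAt
    H.ne_zero).hasFDerivAt
  exact (HasFDerivAt.comp (f := fun y : Model n => (q.1, y)) q.2 h3
    (hasFDerivAt_prodMk_right (𝕜 := ℝ) q.1 q.2)).fderiv

lemma contDiffOn_formC (hΩ : IsSymplecticForm k Ω) (x₀ : M) :
    ContDiffOn ℝ k (formC Ω x₀) (cht (Model n) x₀).target := hΩ.contDiffOn x₀

lemma Involutive.contDiffOn_ham (H : Involutive r Ω ε₀ F W) (i : Fin s) (x₀ : M) :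
    ContDiffOn ℝ (r - 1 : ℕ∞) (fun q : ℝ × Model n => fieldInChart (ham Ω (F i q.1)) x₀ q.2)
      (Ioo (-ε₀) ε₀ ×ˢ (cht (Model n) x₀).target) := by
  have := H.isManifold_one
  have h1 : ContDiffOn ℝ (r - 1 : ℕ∞) (fun q : ℝ × Model n => (formC Ω x₀ q.2).inverse)
      (Ioo (-ε₀) ε₀ ×ˢ (cht (Model n) x₀).target) := by
    intro q hq
    have hB := formC_nondegenerate H.symplectic hq.2
    have h2 : ContDiffAt ℝ (r - 1 : ℕ∞) ContinuousLinearMap.inverse (formC Ω x₀ q.2) := by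
      have := contDiffAt_map_inverse (𝕜 := ℝ) (n := ((r - 1 : ℕ∞) : WithTop ℕ∞)) (dualEquiv hB)
      rwa [dualEquiv_coe] at this
    have h3 : ContDiffWithinAt ℝ (r - 1 : ℕ∞) (fun q : ℝ × Model n => formC Ω x₀ q.2)
        (Ioo (-ε₀) ε₀ ×ˢ (cht (Model n) x₀).target) q :=
      (contDiffOn_formC H.symplectic x₀).comp contDiff_snd.contDiffOn (fun q hq => hq.2) q hq
    exact h2.comp_contDiffWithinAt q h3
  refine (h1.clm_apply (H.contDiffOn_fderiv_chart i x₀)).congr fun q hq => ?_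
  exact fieldInChart_ham H.symplectic hq.2 (H.mdifferentiableAt i hq.1 _)

lemma fieldInChart_combField (Ω : M → Model n →L[ℝ] Model n →L[ℝ] ℝ) (F : Fin s → ℝ → M → ℝ)
    (p : ℝ × (Fin s → ℝ)) (x₀ : M) (y : Model n) :
    fieldInChart (combField Ω F p) x₀ y = ∑ i, p.2 i • fieldInChart (ham Ω (F i p.1)) x₀ y := by
  simp [fieldInChart, combField]

/-- The parameters `(ε, v)` with `|ε| < ε₀`. -/
abbrev params (s : ℕ) (ε₀ : ℝ) : Set (ℝ × (Fin s → ℝ)) := Ioo (-ε₀) ε₀ ×ˢ univ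

lemma isOpen_params (s : ℕ) (ε₀ : ℝ) : IsOpen (params s ε₀) := isOpen_Ioo.prod isOpen_univ

lemma Involutive.paramField (H : Involutive r Ω ε₀ F W) :
    ParamField (r - 1) (params s ε₀) (combField Ω F) := by
  intro x₀
  have h : ContDiffOn ℝ (r - 1 : ℕ∞) (fun q : (ℝ × (Fin s → ℝ)) × Model n =>
      ∑ i, q.1.2 i • fieldInChart (ham Ω (F i q.1.1)) x₀ q.2)
      (params s ε₀ ×ˢ (cht (Model n) x₀).target) := by
    refine ContDiffOn.sum fun i _ => ContDiffOn.fun_smul ?_ ?_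
    · exact (contDiff_apply ℝ ℝ i |>.comp contDiff_fst.snd).contDiffOn
    · have hm : ContDiff ℝ (r - 1 : ℕ∞) (fun q : (ℝ × (Fin s → ℝ)) × Model n => (q.1.1, q.2)) :=
        contDiff_fst.fst.prodMk contDiff_snd
      exact (H.contDiffOn_ham i x₀).comp hm.contDiffOn (fun q hq => ⟨hq.1.1, hq.2⟩)
  exact h.congr fun q hq => fieldInChart_combField Ω F q.1 x₀ q.2

lemma Involutive.fieldC1 (H : Involutive r Ω ε₀ F W) {ε : ℝ} (hε : ε ∈ Ioo (-ε₀) ε₀)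
    (v : Fin s → ℝ) : FieldC1 (combField Ω F (ε, v)) :=
  H.paramField.fieldC1 H.one_le_pred ⟨hε, trivial⟩

/-- The linear combination `∑ vᵢ Fᵢ^ε` read in the chart at `x₀`. -/
def combFun (F : Fin s → ℝ → M → ℝ) (p : ℝ × (Fin s → ℝ)) (x₀ : M) (y : Model n) : ℝ :=
  ∑ i, p.2 i * F i p.1 ((cht (Model n) x₀).symm y)

lemma Involutive.contDiffOn_combFun (H : Involutive r Ω ε₀ F W) {p : ℝ × (Fin s → ℝ)}
    (hp : p ∈ params s ε₀) (x₀ : M) :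
    ContDiffOn ℝ r (combFun F p x₀) (cht (Model n) x₀).target := by
  refine ContDiffOn.sum fun i _ => contDiffOn_const.mul ?_
  exact (H.contDiffOn_chart i x₀).comp (contDiff_prodMk_right p.1).contDiffOn
    (fun y hy => ⟨hp.1, hy⟩)

lemma Involutive.formC_combField (H : Involutive r Ω ε₀ F W) {p : ℝ × (Fin s → ℝ)}
    (hp : p ∈ params s ε₀) {x₀ : M} {y : Model n} (hy : y ∈ (cht (Model n) x₀).target) :
    formC Ω x₀ y (fieldInChart (combField Ω F p) x₀ y) = fderiv ℝ (combFun F p x₀) y := by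
  have := H.isManifold_one
  rw [fieldInChart_combField, map_sum]
  have hd : ∀ i ∈ Finset.univ, HasFDerivAt (fun y => p.2 i * F i p.1 ((cht (Model n) x₀).symm y))
      (p.2 i • fderiv ℝ (F i p.1 ∘ (cht (Model n) x₀).symm) y) y := fun i _ =>
    ((fderiv_comp_cht_symm hy (H.mdifferentiableAt i hp.1 _)).differentiableAt.hasFDerivAt).const_mul
      (p.2 i)
  have hs : HasFDerivAt (combFun F p x₀) _ y := HasFDerivAt.fun_sum hd
  rw [hs.fderiv]
  refine Finset.sum_congr rfl fun i _ => ?_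
  rw [map_smul, formC_fieldInChart H.symplectic hy (H.mdifferentiableAt i hp.1 _)]

/-- Cartan's formula: `i_X Ω` is the exact form `d(∑ vᵢ Fᵢ)` and `Ω` is closed, so the Lie
derivative vanishes. Exactness enters as the symmetry of the second derivative, which is where `2 ≤
r` is needed. -/
lemma Involutive.lie_derivative_zero (H : Involutive r Ω ε₀ F W) {p : ℝ × (Fin s → ℝ)}
    (hp : p ∈ params s ε₀) {x₀ : M} {y : Model n} (hy : y ∈ (cht (Model n) x₀).target)
    (u w : Model n) :
    fderiv ℝ (formC Ω x₀) y (fieldInChart (combField Ω F p) x₀ y) u w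
      + formC Ω x₀ y (fderiv ℝ (fieldInChart (combField Ω F p) x₀) y u) w
      + formC Ω x₀ y u (fderiv ℝ (fieldInChart (combField Ω F p) x₀) y w) = 0 := by
  have := H.isManifold_one
  have hnhds := cht_target_mem_nhds hy
  set X := fieldInChart (combField Ω F p) x₀ with hX
  have hΩd : DifferentiableAt ℝ (formC Ω x₀) y :=
    ((contDiffOn_formC H.symplectic x₀).contDiffAt hnhds).differentiableAt H.pred_ne_zero
  have hXd : DifferentiableAt ℝ X y :=
    ((H.fieldC1 hp.1 p.2 x₀).contDiffAt hnhds).differentiableAt one_ne_zero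
  have hfd : ContDiffAt ℝ r (combFun F p x₀) y := (H.contDiffOn_combFun hp x₀).contDiffAt hnhds
  have hsymm : IsSymmSndFDerivAt ℝ (combFun F p x₀) y := hfd.isSymmSndFDerivAt (by
    rw [minSmoothness_of_isRCLikeNormedField]; exact WithTop.coe_le_coe.2 H.two_le)
  have hev : (fun z => formC Ω x₀ z (X z)) =ᶠ[𝓝 y] fderiv ℝ (combFun F p x₀) := by
    filter_upwards [hnhds] with z hz
    exact H.formC_combField hp hz
  have hprod := hΩd.hasFDerivAt.clm_apply hXd.hasFDerivAt
  have h2 : ∀ a b, fderiv ℝ (formC Ω x₀) y a (X y) b + formC Ω x₀ y (fderiv ℝ X y a) b =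
      fderiv ℝ (fderiv ℝ (combFun F p x₀)) y a b := by
    intro a b
    rw [← hev.fderiv_eq, hprod.fderiv]
    simp [ContinuousLinearMap.flip_apply]
    ring
  have hanti : ∀ a b c, fderiv ℝ (formC Ω x₀) y a b c = - fderiv ℝ (formC Ω x₀) y a c b := by
    intro a b c
    have e1 : HasFDerivAt (fun z => formC Ω x₀ z b c) _ y :=
      (hΩd.hasFDerivAt.clm_apply (hasFDerivAt_const b y)).clm_apply (hasFDerivAt_const c y)
    have e2 : HasFDerivAt (fun z => formC Ω x₀ z c b) _ y :=
      (hΩd.hasFDerivAt.clm_apply (hasFDerivAt_const c y)).clm_apply (hasFDerivAt_const b y)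
    have e3 : (fun z => formC Ω x₀ z b c) = fun z => - formC Ω x₀ z c b :=
      funext fun z => formC_swap H.symplectic x₀ z b c
    rw [e3] at e1
    have e4 := congrArg (fun A : Model n →L[ℝ] ℝ => A a) (e1.unique e2.neg)
    simpa [ContinuousLinearMap.flip_apply] using e4
  have hcl : fderiv ℝ (formC Ω x₀) y (X y) u w + fderiv ℝ (formC Ω x₀) y u w (X y)
      + fderiv ℝ (formC Ω x₀) y w (X y) u = 0 := H.symplectic.closed x₀ y hy (X y) u w
  have e1 := h2 u w
  have e2 := h2 w u
  have e3 := hsymm.eq u w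
  have e4 := hanti u w (X y)
  have e5 := formC_swap H.symplectic x₀ y (fderiv ℝ X y w) u
  linarith

/-- By the variational equation, the time derivative of the form pulled back by the flow is the Lie
derivative evaluated on transported vectors. It vanishes, so the pulled-back form keeps its value at
time zero. -/
lemma Involutive.hasLocalFlows (H : Involutive r Ω ε₀ F W) :
    HasLocalFlows (r - 1) (params s ε₀) W (combField Ω F) Ω := by
  intro p₀ hp₀ x₀ hx₀
  have hM := H.isManifold_one
  have hMk : IsManifold 𝓘(ℝ, Model n) (r - 1 : ℕ∞) M :=
    IsManifold.of_le (n := r) (by exact_mod_cast tsub_le_self)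
  obtain ⟨δ, hδ, U, hU, hU₀, hUsub, φ, hφ⟩ := exists_chartFlow H.one_le_pred (isOpen_params s ε₀)
    H.paramField hp₀ x₀ H.isOpen_W hx₀
  have hs0 : x₀ ∈ (cht (Model n) x₀).source := mem_extChartAt_source x₀
  refine ⟨δ, hδ, {q | q.2 ∈ (cht (Model n) x₀).source ∧ (q.1, cht (Model n) x₀ q.2) ∈ U}, ?_,
    fun t p x => (cht (Model n) x₀).symm (φ t p (cht (Model n) x₀ x)), ?_⟩
  · refine Filter.inter_mem (continuousAt_snd.eventually (cht_source_mem_nhds hs0)) ?_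
    have : ContinuousAt (fun q : (ℝ × (Fin s → ℝ)) × M => (q.1, cht (Model n) x₀ q.2)) (p₀, x₀) :=
      continuousAt_fst.prodMk (ContinuousAt.comp (continuousAt_extChartAt x₀) continuousAt_snd)
    exact this.eventually (hU.mem_nhds hU₀)
  rintro ⟨p, x⟩ ⟨hx, hq⟩
  simp only at hx hq
  obtain ⟨h0, h1⟩ := hφ _ hq
  simp only at h0 h1
  refine ⟨by simp only; rw [h0, (cht (Model n) x₀).left_inv hx], fun t ht => ?_⟩
  obtain ⟨a1, a2, a3, a4, a5⟩ := h1 t ht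
  have hpO : p ∈ params s ε₀ := (hUsub hq).1
  refine ⟨a2, ?_, ?_, ?_⟩
  · have b1 : ContMDiffAt 𝓘(ℝ, Model n) 𝓘(ℝ, Model n) (r - 1 : ℕ∞) (cht (Model n) x₀).symm
        (φ t p (cht (Model n) x₀ x)) :=
      (contMDiffOn_extChartAt_symm x₀).contMDiffAt (cht_target_mem_nhds a1)
    have b2 : ContMDiffAt 𝓘(ℝ, Model n) 𝓘(ℝ, Model n) (r - 1 : ℕ∞) (cht (Model n) x₀) x :=
      contMDiffAt_extChartAt' (by rwa [extChartAt_source] at hx)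
    have b3 : ContMDiffAt (𝓘(ℝ, ℝ × (Fin s → ℝ)).prod 𝓘(ℝ, Model n))
        𝓘(ℝ, (ℝ × (Fin s → ℝ)) × Model n) (r - 1 : ℕ∞)
        (fun q : (ℝ × (Fin s → ℝ)) × M => (q.1, cht (Model n) x₀ q.2)) (p, x) := by
      refine ContMDiffAt.prodMk_space contMDiffAt_fst ?_
      exact ContMDiffAt.comp (p, x) (g := cht (Model n) x₀) b2 contMDiffAt_snd
    have b4 := ContMDiffAt.comp (p, x) (g := fun q : (ℝ × (Fin s → ℝ)) × Model n => φ t q.1 q.2)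
      a3.contMDiffAt b3
    exact ContMDiffAt.comp (p, x) b1 b4
  · have := (hasMFDerivAt_cht_symm a1).comp t (hasMFDerivAt_iff_hasFDerivAt.2 a4.hasFDerivAt)
    refine this.congr_mfderiv ?_
    have hL : (chartSymmD (Model n) x₀ (φ t p (cht (Model n) x₀ x))).comp
        (ContinuousLinearMap.toSpanSingleton ℝ (fieldInChart (combField Ω F p) x₀
          (φ t p (cht (Model n) x₀ x)))) = (1 : ℝ →L[ℝ] ℝ).smulRight (combField Ω F p
          ((cht (Model n) x₀).symm (φ t p (cht (Model n) x₀ x)))) := by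
      ext1
      change chartSymmD (Model n) x₀ (φ t p (cht (Model n) x₀ x)) ((1 : ℝ) • _) = (1 : ℝ) • _
      rw [one_smul, one_smul]
      exact chartSymmD_fieldInChart _ a1
    exact hL
  · set y := cht (Model n) x₀ x with hy
    have hyt : y ∈ (cht (Model n) x₀).target := (cht (Model n) x₀).map_source hx
    have hdiff : ∀ τ ∈ Ioo (-δ) δ, DifferentiableAt ℝ (φ τ p) y := by
      intro τ hτ
      obtain ⟨-, -, c3, -, -⟩ := h1 τ hτ
      exact (c3.comp y (contDiff_prodMk_right p).contDiffAt).differentiableAt H.pred_ne_zero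
    have hconst : ∀ u w, formC Ω x₀ (φ t p y) (fderiv ℝ (φ t p) y u) (fderiv ℝ (φ t p) y w) =
        formC Ω x₀ y u w := by
      intro u w
      have h00 : (0 : ℝ) ∈ Ioo (-δ) δ := ⟨by linarith, hδ⟩
      have hd : ∀ τ ∈ Ioo (-δ) δ, HasDerivAt (fun τ => formC Ω x₀ (φ τ p y)
          (fderiv ℝ (φ τ p) y u) (fderiv ℝ (φ τ p) y w)) 0 τ := by
        intro τ hτ
        obtain ⟨c1, c2, c3, c4, c5⟩ := h1 τ hτ
        have hΩd : DifferentiableAt ℝ (formC Ω x₀) (φ τ p y) :=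
          ((contDiffOn_formC H.symplectic x₀).contDiffAt
            (cht_target_mem_nhds c1)).differentiableAt H.pred_ne_zero
        have d1 := HasFDerivAt.comp_hasDerivAt (f := fun τ => φ τ p y) (l := formC Ω x₀) τ
          hΩd.hasFDerivAt c4
        have d2 := (d1.clm_apply (c5 u)).clm_apply (c5 w)
        exact d2.congr_deriv
          (H.lie_derivative_zero hpO c1 (fderiv ℝ (φ τ p) y u) (fderiv ℝ (φ τ p) y w))
      have := isOpen_Ioo.is_const_of_deriv_eq_zero isPreconnected_Ioo
        (fun τ hτ => (hd τ hτ).differentiableAt.differentiableWithinAt)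
        (fun τ hτ => (hd τ hτ).deriv) ht h00
      rw [this, h0]
      have hid : fderiv ℝ (φ 0 p) y = ContinuousLinearMap.id ℝ (Model n) := by
        have he : φ 0 p =ᶠ[𝓝 y] id := by
          have hc : Continuous (fun z : Model n => (p, z)) := by fun_prop
          filter_upwards [hc.continuousAt.eventually (hU.mem_nhds hq)] with z hz
          exact (hφ _ hz).1
        rw [he.fderiv_eq, fderiv_id]
      rw [hid]
      rfl
    have hmd : mD (Model n) (fun x => (cht (Model n) x₀).symm (φ t p (cht (Model n) x₀ x))) x =
        (chartSymmD (Model n) x₀ (φ t p y)).comp ((fderiv ℝ (φ t p) y).comp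
          (chartD (Model n) x₀ x)) := by
      have e1 := (hasMFDerivAt_iff_hasFDerivAt.2 (hdiff t ht).hasFDerivAt).comp x
        (hasMFDerivAt_cht hx)
      have e2 := (hasMFDerivAt_cht_symm a1).comp x e1
      exact e2.mfderiv
    intro u w
    rw [hmd]
    have h3 := hconst (chartD (Model n) x₀ x u) (chartD (Model n) x₀ x w)
    rw [formC_apply, formC_apply, chartSymmD_chartD' hx, chartSymmD_chartD' hx,
      (cht (Model n) x₀).left_inv hx] at h3
    exact h3

end

end Hamiltonian


/-! ### Velocities of curves in a manifold. -/

section CurveDerivative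

variable {E : Type*} [NormedAddCommGroup E] [NormedSpace ℝ E]
  {M : Type*} [TopologicalSpace M] [ChartedSpace E M]
  {G : Type*} [NormedAddCommGroup G] [NormedSpace ℝ G]

/-- The derivative at `a` of a map from a normed space to a manifold, with values in the model
space. -/
def vD (E : Type*) [NormedAddCommGroup E] [NormedSpace ℝ E]
    {M : Type*} [TopologicalSpace M] [ChartedSpace E M] {G : Type*} [NormedAddCommGroup G]
    [NormedSpace ℝ G] (f : G → M) (a : G) : G →L[ℝ] E :=
  mfderiv 𝓘(ℝ, G) 𝓘(ℝ, E) f a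

lemma hasMFDerivWithinAt_comp_curve {f : G → M} {c : ℝ → G} {c' : G} {s : Set ℝ} {t : ℝ}
    (hf : MDifferentiableAt 𝓘(ℝ, G) 𝓘(ℝ, E) f (c t)) (hc : HasDerivWithinAt c c' s t) :
    HasMFDerivWithinAt 𝓘(ℝ, ℝ) 𝓘(ℝ, E) (fun τ => f (c τ)) s t
      ((1 : ℝ →L[ℝ] ℝ).smulRight (vD E f (c t) c')) := by
  have h1 : HasMFDerivWithinAt 𝓘(ℝ, ℝ) 𝓘(ℝ, G) c s t ((1 : ℝ →L[ℝ] ℝ).smulRight c') := by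
    apply HasFDerivWithinAt.hasMFDerivWithinAt
    exact hc.hasFDerivWithinAt.congr_fderiv (by ext1; rfl)
  have h2 := HasMFDerivAt.comp_hasMFDerivWithinAt t hf.hasMFDerivAt h1
  have hL : (vD E f (c t)).comp ((1 : ℝ →L[ℝ] ℝ).smulRight c') =
      (1 : ℝ →L[ℝ] ℝ).smulRight (vD E f (c t) c') := by
    ext; simp
  exact hL ▸ h2

lemma hasMFDerivWithinAt_comp_map {f : M → M} {c : ℝ → M} {c' : E} {s : Set ℝ} {t : ℝ}
    (hf : MDifferentiableAt 𝓘(ℝ, E) 𝓘(ℝ, E) f (c t))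
    (hc : HasMFDerivWithinAt 𝓘(ℝ, ℝ) 𝓘(ℝ, E) c s t ((1 : ℝ →L[ℝ] ℝ).smulRight c')) :
    HasMFDerivWithinAt 𝓘(ℝ, ℝ) 𝓘(ℝ, E) (fun τ => f (c τ)) s t
      ((1 : ℝ →L[ℝ] ℝ).smulRight (mD E f (c t) c')) := by
  have h2 := HasMFDerivAt.comp_hasMFDerivWithinAt t hf.hasMFDerivAt hc
  have hL : (mD E f (c t)).comp ((1 : ℝ →L[ℝ] ℝ).smulRight c') =
      (1 : ℝ →L[ℝ] ℝ).smulRight (mD E f (c t) c') := by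
    ext; simp
  exact hL ▸ h2

lemma IntegralCurveOn.congr_eqOn {γ γ' : ℝ → M} {X : M → E} {s : Set ℝ}
    (h : IntegralCurveOn γ X s) (heq : EqOn γ' γ s) : IntegralCurveOn γ' X s := by
  intro t ht
  rw [heq ht]
  exact HasMFDerivWithinAt.congr_of_eventuallyEq (h t ht)
    (Filter.eventuallyEq_of_mem self_mem_nhdsWithin heq) (heq ht)

/-- Derivatives within a nondegenerate closed interval are unique, even at its endpoints. Two
computations of the velocity of the same curve can therefore be compared. -/
lemma velocity_unique {c : ℝ → M} {w w' : E} {a b t : ℝ} (hab : a < b) (ht : t ∈ Icc a b)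
    (h : HasMFDerivWithinAt 𝓘(ℝ, ℝ) 𝓘(ℝ, E) c (Icc a b) t ((1 : ℝ →L[ℝ] ℝ).smulRight w))
    (h' : HasMFDerivWithinAt 𝓘(ℝ, ℝ) 𝓘(ℝ, E) c (Icc a b) t ((1 : ℝ →L[ℝ] ℝ).smulRight w')) :
    w = w' := by
  have hu : UniqueMDiffWithinAt 𝓘(ℝ, ℝ) (Icc a b) t :=
    (uniqueDiffOn_Icc hab t ht).uniqueMDiffWithinAt
  have h1 : ((1 : ℝ →L[ℝ] ℝ).smulRight w : ℝ →L[ℝ] E) = (1 : ℝ →L[ℝ] ℝ).smulRight w' :=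
    UniqueMDiffWithinAt.eq hu h h'
  simpa using congrArg (fun A : ℝ →L[ℝ] E => A 1) h1

end CurveDerivative

/-! ### The local action of `ℝˢ` by commuting Hamiltonian flows. -/

section Flow

variable {n : ℕ} {M : Type*} [TopologicalSpace M] [ChartedSpace (Model n) M]
  {s : ℕ} {r : ℕ∞} {Ω : M → Model n →L[ℝ] Model n →L[ℝ] ℝ} {ε₀ : ℝ} {F : Fin s → ℝ → M → ℝ}
  {W : Set M}

/-- The pairs `((ε, v), x)` such that the orbit of `x` under `∑ vᵢ Xᵢ^ε` stays in `W` up to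
time one. -/
def flowDom (Ω : M → Model n →L[ℝ] Model n →L[ℝ] ℝ) (F : Fin s → ℝ → M → ℝ) (W : Set M) :
    Set ((ℝ × (Fin s → ℝ)) × M) := {q | ∃ y, Arc W (combField Ω F q.1) 1 q.2 y}

open Classical in
/-- The time-one map of `∑ vᵢ Xᵢ^ε` inside `W`, as a function of `p = (ε, v)` and of the
point. -/
def flow (Ω : M → Model n →L[ℝ] Model n →L[ℝ] ℝ) (F : Fin s → ℝ → M → ℝ) (W : Set M)
    (p : ℝ × (Fin s → ℝ)) (x : M) : M :=
  -- The default `x` makes a vector outside the domain look like a period of `x`; for this reason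
  -- the group of periods is formed only at complete points.
  if h : ∃ y, Arc W (combField Ω F p) 1 x y then h.choose else x

lemma arc_flow {p : ℝ × (Fin s → ℝ)} {x : M} (h : (p, x) ∈ flowDom Ω F W) :
    Arc W (combField Ω F p) 1 x (flow Ω F W p x) := by
  have h' : ∃ y, Arc W (combField Ω F p) 1 x y := h
  rw [flow, dif_pos h']
  exact h'.choose_spec

lemma flow_mem {p : ℝ × (Fin s → ℝ)} {x : M} (h : (p, x) ∈ flowDom Ω F W) :
    flow Ω F W p x ∈ W := (arc_flow h).mem_right zero_le_one

lemma combField_smul (ε t : ℝ) (v : Fin s → ℝ) (x : M) :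
    combField Ω F (ε, t • v) x = t • combField Ω F (ε, v) x := by
  simp [combField, Finset.smul_sum, mul_smul]

lemma combField_add (ε : ℝ) (v w : Fin s → ℝ) (x : M) :
    combField Ω F (ε, v + w) x = combField Ω F (ε, v) x + combField Ω F (ε, w) x := by
  simp [combField, add_smul, Finset.sum_add_distrib]

lemma combField_single (ε : ℝ) (i : Fin s) (x : M) :
    combField Ω F (ε, Pi.single i 1) x = ham Ω (F i ε) x := by
  simp [combField, Pi.single_apply]

/-- The linear map `v ↦ ∑ vᵢ Xᵢ^ε(x)`. -/
def combL (Ω : M → Model n →L[ℝ] Model n →L[ℝ] ℝ) (F : Fin s → ℝ → M → ℝ) (ε : ℝ) (x : M) :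
    (Fin s → ℝ) →L[ℝ] Model n :=
  ∑ i, (ContinuousLinearMap.proj i : (Fin s → ℝ) →L[ℝ] ℝ).smulRight (ham Ω (F i ε) x)

lemma combL_apply (ε : ℝ) (x : M) (v : Fin s → ℝ) :
    combL Ω F ε x v = combField Ω F (ε, v) x := by
  simp [combL, combField]

variable [T2Space M] [IsManifold (𝓡 (2 * n)) r M]

lemma Involutive.flow_eq (H : Involutive r Ω ε₀ F W) {p : ℝ × (Fin s → ℝ)} (hp : p.1 ∈ Ioo (-ε₀) ε₀)
    {x y : M} (h : Arc W (combField Ω F p) 1 x y) : flow Ω F W p x = y := by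
  have := H.isManifold_one
  exact Arc.unique (H.fieldC1 hp p.2) zero_le_one (arc_flow ⟨y, h⟩) h

/-- Along an integral curve inside `W`, the flow is the curve. -/
lemma Involutive.flow_smul_eq (H : Involutive r Ω ε₀ F W) {ε : ℝ} (hε : ε ∈ Ioo (-ε₀) ε₀)
    {v : Fin s → ℝ} {T : ℝ} {γ : ℝ → M} (h1 : IntegralCurveOn γ (combField Ω F (ε, v)) (Icc 0 T))
    (h2 : ∀ t ∈ Icc 0 T, γ t ∈ W) {t : ℝ} (ht : t ∈ Icc 0 T) :
    ((ε, t • v), γ 0) ∈ flowDom Ω F W ∧ flow Ω F W (ε, t • v) (γ 0) = γ t := by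
  have h3 := (Arc.initial h1 h2 ht.2).scale (c := t) (T' := 1) ht.1 (mul_one t)
  have h4 : Arc W (combField Ω F (ε, t • v)) 1 (γ 0) (γ t) := by
    have e : combField Ω F (ε, t • v) = fun z => t • combField Ω F (ε, v) z :=
      funext fun z => combField_smul ε t v z
    rw [e]; exact h3
  exact ⟨⟨_, h4⟩, H.flow_eq hε h4⟩

lemma Involutive.flow_orbit (H : Involutive r Ω ε₀ F W) {ε : ℝ} (hε : ε ∈ Ioo (-ε₀) ε₀)
    {v : Fin s → ℝ} {x : M} (h : ((ε, v), x) ∈ flowDom Ω F W) :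
    (∀ t ∈ Icc (0 : ℝ) 1, ((ε, t • v), x) ∈ flowDom Ω F W) ∧
      IntegralCurveOn (fun t => flow Ω F W (ε, t • v) x) (combField Ω F (ε, v)) (Icc 0 1) := by
  obtain ⟨y, γ, h1, h2, rfl, h4⟩ := h
  refine ⟨fun t ht => (H.flow_smul_eq hε h1 h2 ht).1, fun t ht => ?_⟩
  have e : ∀ t ∈ Icc (0 : ℝ) 1, flow Ω F W (ε, t • v) (γ 0) = γ t := fun t ht =>
    (H.flow_smul_eq hε h1 h2 ht).2
  exact IntegralCurveOn.congr_eqOn h1 e t ht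

lemma zero_mem_flowDom {ε : ℝ} {x : M} (hx : x ∈ W) : ((ε, (0 : Fin s → ℝ)), x) ∈ flowDom Ω F W := by
  refine ⟨x, fun _ => x, fun t _ => ?_, fun _ _ => hx, rfl, rfl⟩
  have h0 : combField Ω F (ε, (0 : Fin s → ℝ)) x = 0 := by simp [combField]
  have h1 : HasMFDerivWithinAt 𝓘(ℝ, ℝ) 𝓘(ℝ, Model n) (fun _ : ℝ => x) (Icc 0 1) t
    (0 : ℝ →L[ℝ] Model n) := hasMFDerivWithinAt_const ..
  have hL : (0 : ℝ →L[ℝ] Model n) =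
      (1 : ℝ →L[ℝ] ℝ).smulRight (combField Ω F (ε, (0 : Fin s → ℝ)) x) := by
    rw [h0]; ext; simp
  exact hL ▸ h1

lemma Involutive.flow_zero (H : Involutive r Ω ε₀ F W) {ε : ℝ} (hε : ε ∈ Ioo (-ε₀) ε₀)
    {x : M} (hx : x ∈ W) : flow Ω F W (ε, 0) x = x := by
  have h : ((ε, (0 : Fin s → ℝ)), x) ∈ flowDom Ω F W := zero_mem_flowDom hx
  obtain ⟨y, γ, h1, h2, h3, h4⟩ := h
  have := (H.flow_smul_eq hε h1 h2 (t := 0) (by simp)).2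
  simp only [h3, smul_zero] at this
  exact this

lemma Involutive.exists_flow_near (H : Involutive r Ω ε₀ F W) {q : (ℝ × (Fin s → ℝ)) × M}
    (hε : q.1.1 ∈ Ioo (-ε₀) ε₀) (hq : q ∈ flowDom Ω F W) :
    (∀ᶠ q' in 𝓝 q, q' ∈ flowDom Ω F W) ∧
    ContMDiffAt (𝓘(ℝ, ℝ × (Fin s → ℝ)).prod 𝓘(ℝ, Model n)) 𝓘(ℝ, Model n) (r - 1 : ℕ∞)
      (fun q : (ℝ × (Fin s → ℝ)) × M => flow Ω F W q.1 q.2) q ∧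
    PreservesForm Ω (flow Ω F W q.1) q.2 := by
  have := H.isManifold_one
  obtain ⟨p, x⟩ := q
  obtain ⟨y, γ, h1, h2, h3, h4⟩ := hq
  simp only at h1 h3 hε
  subst h3
  obtain ⟨Ψ, e1, e2, e3, e4⟩ := Nekhoroshev.exists_flow_near H.one_le_pred H.hasLocalFlows
    (fun p hp => H.fieldC1 hp.1 p.2) (p₀ := p) ⟨hε, trivial⟩ h1 h2
  have hopen : ∀ᶠ q' in 𝓝 (p, γ 0), q'.1.1 ∈ Ioo (-ε₀) ε₀ :=
    (continuousAt_fst.fst : ContinuousAt (fun q' : (ℝ × (Fin s → ℝ)) × M => q'.1.1)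
      (p, γ 0)).eventually (isOpen_Ioo.mem_nhds hε)
  have heq : (fun q : (ℝ × (Fin s → ℝ)) × M => flow Ω F W q.1 q.2) =ᶠ[𝓝 (p, γ 0)]
      fun q => Ψ q.1 q.2 := by
    filter_upwards [hopen, e3] with q' h5 h6
    exact H.flow_eq h5 h6
  refine ⟨e3.mono fun q' h => ⟨_, h⟩, e1.congr_of_eventuallyEq heq, ?_⟩
  have heq2 : flow Ω F W p =ᶠ[𝓝 (γ 0)] Ψ p := by
    have hc : ContinuousAt (fun x : M => (p, x)) (γ 0) := by fun_prop
    exact hc.eventually heq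
  intro u w
  have hd : mD (Model n) (flow Ω F W p) (γ 0) = mD (Model n) (Ψ p) (γ 0) := heq2.mfderiv_eq
  simp only
  rw [hd, heq2.eq_of_nhds]
  exact e4 u w

lemma Involutive.mdifferentiableAt_flow (H : Involutive r Ω ε₀ F W) {p : ℝ × (Fin s → ℝ)} {x : M}
    (hε : p.1 ∈ Ioo (-ε₀) ε₀) (hq : (p, x) ∈ flowDom Ω F W) :
    MDifferentiableAt 𝓘(ℝ, Model n) 𝓘(ℝ, Model n) (flow Ω F W p) x :=
  mdifferentiableAt_of_param H.one_le_pred (H.exists_flow_near hε hq).2.1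

lemma Involutive.contMDiffAt_flow_param (H : Involutive r Ω ε₀ F W) {p : ℝ × (Fin s → ℝ)} {x : M}
    (hε : p.1 ∈ Ioo (-ε₀) ε₀) (hq : (p, x) ∈ flowDom Ω F W) :
    ContMDiffAt 𝓘(ℝ, ℝ × (Fin s → ℝ)) 𝓘(ℝ, Model n) (r - 1 : ℕ∞) (fun p => flow Ω F W p x) p := by
  have h1 : ContMDiffAt 𝓘(ℝ, ℝ × (Fin s → ℝ)) (𝓘(ℝ, ℝ × (Fin s → ℝ)).prod 𝓘(ℝ, Model n))
      (r - 1 : ℕ∞) (fun p => (p, x)) p := contMDiffAt_id.prodMk contMDiffAt_const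
  exact ContMDiffAt.comp p (H.exists_flow_near hε hq).2.1 h1

lemma Involutive.contMDiffAt_flow_vec (H : Involutive r Ω ε₀ F W) {ε : ℝ} {v : Fin s → ℝ} {x : M}
    (hε : ε ∈ Ioo (-ε₀) ε₀) (hq : ((ε, v), x) ∈ flowDom Ω F W) :
    ContMDiffAt 𝓘(ℝ, Fin s → ℝ) 𝓘(ℝ, Model n) (r - 1 : ℕ∞) (fun v => flow Ω F W (ε, v) x) v :=
  ContMDiffAt.comp (g := fun p => flow Ω F W p x) v (H.contMDiffAt_flow_param hε hq)
    (contDiff_prodMk_right ε).contMDiff.contMDiffAt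

/-- The functions `Fᵢ` are first integrals. -/
lemma Involutive.F_curve (H : Involutive r Ω ε₀ F W) {ε : ℝ} (hε : ε ∈ Ioo (-ε₀) ε₀)
    {v : Fin s → ℝ} {a b : ℝ} {γ : ℝ → M}
    (h1 : IntegralCurveOn γ (combField Ω F (ε, v)) (Icc a b))
    (h2 : ∀ t ∈ Icc a b, γ t ∈ W) (i : Fin s) {t : ℝ} (ht : t ∈ Icc a b) :
    F i ε (γ t) = F i ε (γ a) := by
  have hzero : ∀ x ∈ W, dfun (F i ε) x (combField Ω F (ε, v) x) = 0 := by
    intro x hx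
    rw [combField, map_sum]
    refine Finset.sum_eq_zero fun j _ => ?_
    rw [map_smul, ← form_ham H.symplectic, H.involution ε hε x hx, smul_zero]
  have hd : ∀ t ∈ Icc a b, HasDerivWithinAt (F i ε ∘ γ) 0 (Icc a b) t := by
    intro t ht
    have h3 := HasMFDerivAt.comp_hasMFDerivWithinAt t (H.mdifferentiableAt i hε (γ t)).hasMFDerivAt
      (h1 t ht)
    have h4 : HasFDerivWithinAt (F i ε ∘ γ) ((dfun (F i ε) (γ t)).comp
      ((1 : ℝ →L[ℝ] ℝ).smulRight (combField Ω F (ε, v) (γ t)))) (Icc a b) t :=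
      hasMFDerivWithinAt_iff_hasFDerivWithinAt.1 h3
    refine h4.hasDerivWithinAt.congr_deriv ?_
    simpa using hzero _ (h2 t ht)
  rcases eq_or_lt_of_le (ht.1.trans ht.2) with hab | hab
  · have : t = a := le_antisymm (hab ▸ ht.2) ht.1
    rw [this]
  · exact constant_of_derivWithin_zero (fun t ht => (hd t ht).differentiableWithinAt)
      (fun t ht => (hd t ⟨ht.1, ht.2.le⟩).derivWithin (uniqueDiffOn_Icc hab t ⟨ht.1, ht.2.le⟩)) t ht

lemma Involutive.F_flow (H : Involutive r Ω ε₀ F W) {ε : ℝ} (hε : ε ∈ Ioo (-ε₀) ε₀)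
    {v : Fin s → ℝ} {x : M} (h : ((ε, v), x) ∈ flowDom Ω F W) (i : Fin s) :
    F i ε (flow Ω F W (ε, v) x) = F i ε x := by
  obtain ⟨γ, h1, h2, h3, h4⟩ := arc_flow h
  have := H.F_curve hε h1 h2 i (right_mem_Icc.2 zero_le_one)
  rwa [h3, h4] at this

/-- The flows commute with the fields. -/
lemma Involutive.mD_flow_combField (H : Involutive r Ω ε₀ F W) {ε : ℝ} (hε : ε ∈ Ioo (-ε₀) ε₀)
    {v : Fin s → ℝ} {x : M} (h : ((ε, v), x) ∈ flowDom Ω F W) :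
    (∀ i u, dfun (F i ε) (flow Ω F W (ε, v) x) (mD (Model n) (flow Ω F W (ε, v)) x u) =
      dfun (F i ε) x u) ∧
    ∀ w, mD (Model n) (flow Ω F W (ε, v)) x (combField Ω F (ε, w) x) =
      combField Ω F (ε, w) (flow Ω F W (ε, v) x) := by
  set D := mD (Model n) (flow Ω F W (ε, v)) x with hD
  obtain ⟨hn, -, hp⟩ := H.exists_flow_near hε h
  have hdF : ∀ i u, dfun (F i ε) (flow Ω F W (ε, v) x) (D u) = dfun (F i ε) x u := by
    intro i u
    have heq : F i ε ∘ flow Ω F W (ε, v) =ᶠ[𝓝 x] F i ε := by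
      have hc : ContinuousAt (fun x : M => ((ε, v), x)) x := by fun_prop
      filter_upwards [hc.eventually hn] with z hz
      exact H.F_flow hε hz i
    have h1 : dfun (F i ε) x = (dfun (F i ε) (flow Ω F W (ε, v) x)).comp D :=
      heq.mfderiv_eq.symm.trans (mfderiv_comp x (H.mdifferentiableAt i hε _)
        (H.mdifferentiableAt_flow hε h))
    rw [h1]; rfl
  have hinj : Function.Injective (D : Model n →ₗ[ℝ] Model n) := by
    rw [← LinearMap.ker_eq_bot, LinearMap.ker_eq_bot']
    intro u hu
    refine H.symplectic.nondegenerate x u fun (w : Model n) => ?_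
    have h1 : Ω (flow Ω F W (ε, v) x) (D u) (D w) = Ω x u w := hp u w
    have h2 : D u = 0 := hu
    rw [h2, map_zero] at h1
    exact h1.symm
  have hsurj := LinearMap.surjective_of_injective hinj
  refine ⟨hdF, ?_⟩
  -- The field `Xᵢ` is determined by `Ω` and `dFᵢ`, and the flow preserves both. Since `D` is onto,
  -- testing against vectors `D u` suffices, and the commutation is obtained without Lie brackets.
  have hi : ∀ i, D (ham Ω (F i ε) x) = ham Ω (F i ε) (flow Ω F W (ε, v) x) := by
    intro i
    refine sub_eq_zero.1 (H.symplectic.nondegenerate (flow Ω F W (ε, v) x) _ fun (w : Model n) => ?_)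
    obtain ⟨u, rfl⟩ := hsurj w
    have h1 : Ω (flow Ω F W (ε, v) x) (D (ham Ω (F i ε) x)) (D u) = Ω x (ham Ω (F i ε) x) u :=
      hp _ u
    have h2 : Ω (flow Ω F W (ε, v) x) (D (ham Ω (F i ε) x) - ham Ω (F i ε) (flow Ω F W (ε, v) x))
        (D u) = 0 := by
      rw [map_sub, _root_.sub_apply, h1, form_ham H.symplectic, form_ham H.symplectic, hdF, sub_self]
    exact h2
  intro w
  simp only [combField, map_sum, map_smul, hi]

lemma Involutive.flow_curve (H : Involutive r Ω ε₀ F W) {ε : ℝ} (hε : ε ∈ Ioo (-ε₀) ε₀)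
    {v : Fin s → ℝ} {x : M} {T : ℝ} (hT : 0 < T) (h : ((ε, T • v), x) ∈ flowDom Ω F W) :
    (∀ t ∈ Icc (0 : ℝ) T, ((ε, t • v), x) ∈ flowDom Ω F W) ∧
      IntegralCurveOn (fun t => flow Ω F W (ε, t • v) x) (combField Ω F (ε, v)) (Icc 0 T) := by
  obtain ⟨y, γ, h1, h2, h3, h4⟩ := h
  have hm : ∀ t ∈ Icc 0 T, T⁻¹ * t + 0 ∈ Icc (0 : ℝ) 1 := by
    intro t ht
    rw [add_zero, inv_mul_eq_div]
    exact ⟨div_nonneg ht.1 hT.le, (div_le_one hT).2 ht.2⟩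
  have h5 : IntegralCurveOn (fun t => γ (T⁻¹ * t + 0)) (combField Ω F (ε, v)) (Icc 0 T) := by
    have e : (fun x : M => T⁻¹ • combField Ω F (ε, T • v) x) = combField Ω F (ε, v) := by
      funext z
      rw [combField_smul, smul_smul, inv_mul_cancel₀ hT.ne', one_smul]
    have := IntegralCurveOn.comp_affine h1 T⁻¹ 0 hm
    simp only at this
    rwa [e] at this
  have h6 : ∀ t ∈ Icc 0 T, γ (T⁻¹ * t + 0) ∈ W := fun t ht => h2 _ (hm t ht)
  have h0 : γ (T⁻¹ * 0 + 0) = x := by simpa using h3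
  have h7 := fun t (ht : t ∈ Icc 0 T) => H.flow_smul_eq hε h5 h6 ht
  simp only [h0] at h7
  exact ⟨fun t ht => (h7 t ht).1, IntegralCurveOn.congr_eqOn h5 fun t ht => (h7 t ht).2⟩

/-- Openness of the domain prolongs the orbit past `t`. The velocity at `t` can then be taken within
an interval of positive length, even when `t = 0`. -/
lemma Involutive.exists_orbit_extension (H : Involutive r Ω ε₀ F W) {ε : ℝ}
    (hε : ε ∈ Ioo (-ε₀) ε₀) {v : Fin s → ℝ} {x : M} {t : ℝ} (ht : 0 ≤ t)
    (h : ((ε, t • v), x) ∈ flowDom Ω F W) :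
    ∃ T > t, IntegralCurveOn (fun t => flow Ω F W (ε, t • v) x) (combField Ω F (ε, v)) (Icc 0 T) ∧
      ∀ τ ∈ Icc (0 : ℝ) T, ((ε, τ • v), x) ∈ flowDom Ω F W := by
  have hc : ContinuousAt (fun τ : ℝ => ((ε, τ • v), x)) t := by fun_prop
  have h1 : ∀ᶠ τ in 𝓝 t, ((ε, τ • v), x) ∈ flowDom Ω F W :=
    hc.eventually (H.exists_flow_near hε h).1
  have h2 : ∀ᶠ τ in 𝓝[>] t, ((ε, τ • v), x) ∈ flowDom Ω F W := h1.filter_mono nhdsWithin_le_nhds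
  obtain ⟨T, hT, hT'⟩ := (h2.and self_mem_nhdsWithin).exists
  obtain ⟨h3, h4⟩ := H.flow_curve hε (ht.trans_lt hT') hT
  exact ⟨T, hT', h4, h3⟩

/-- Two flows compose to the flow of the sum, when the intermediate orbits exist. -/
lemma Involutive.flow_comp_aux (H : Involutive r Ω ε₀ F W) {ε : ℝ} (hε : ε ∈ Ioo (-ε₀) ε₀)
    {v w : Fin s → ℝ} {x : M} (hw : ((ε, w), x) ∈ flowDom Ω F W)
    (hv : ∀ t ∈ Icc (0 : ℝ) 1, ((ε, t • v), flow Ω F W (ε, t • w) x) ∈ flowDom Ω F W) :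
    Arc W (combField Ω F (ε, v + w)) 1 x (flow Ω F W (ε, v) (flow Ω F W (ε, w) x)) := by
  obtain ⟨h1, h2⟩ := H.flow_orbit hε hw
  refine ⟨fun t => flow Ω F W (ε, t • v) (flow Ω F W (ε, t • w) x), fun t ht => ?_,
    fun t ht => flow_mem (hv t ht), ?_, by simp⟩
  · set z := flow Ω F W (ε, t • w) x with hz
    have hzt := hv t ht
    -- The candidate curve is `g` on the diagonal, so its velocity is the sum of the two partial
    -- velocities. The second is the field of `w` transported by the flow of `v`, hence again the
    -- field of `w`.
    set g : ℝ × ℝ → M := fun q => flow Ω F W (ε, q.1 • v) (flow Ω F W (ε, q.2 • w) x) with hg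
    have hgd : MDifferentiableAt 𝓘(ℝ, ℝ × ℝ) 𝓘(ℝ, Model n) g (t, t) := by
      have a1 : ContMDiffAt 𝓘(ℝ, ℝ × ℝ) 𝓘(ℝ, Model n) (r - 1 : ℕ∞)
          (fun q : ℝ × ℝ => flow Ω F W (ε, q.2 • w) x) (t, t) :=
        ContMDiffAt.comp (t, t) (g := fun v => flow Ω F W (ε, v) x)
          (f := fun q : ℝ × ℝ => q.2 • w) (H.contMDiffAt_flow_vec hε (h1 t ht))
          (contDiff_snd.smul contDiff_const).contMDiff.contMDiffAt
      have a2 : ContMDiffAt 𝓘(ℝ, ℝ × ℝ) 𝓘(ℝ, ℝ × (Fin s → ℝ)) (r - 1 : ℕ∞)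
          (fun q : ℝ × ℝ => (ε, q.1 • v)) (t, t) :=
        (contDiff_const.prodMk (contDiff_fst.smul contDiff_const)).contMDiff.contMDiffAt
      exact (ContMDiffAt.comp (t, t) (g := fun q : (ℝ × (Fin s → ℝ)) × M => flow Ω F W q.1 q.2)
        (f := fun q : ℝ × ℝ => ((ε, q.1 • v), flow Ω F W (ε, q.2 • w) x))
        (H.exists_flow_near hε hzt).2.1 (a2.prodMk a1)).mdifferentiableAt H.pred_ne_zero
    obtain ⟨T, htT, horb, -⟩ := H.exists_orbit_extension hε ht.1 hzt
    have hc1 : HasDerivWithinAt (fun τ : ℝ => (τ, t)) ((1 : ℝ), (0 : ℝ)) (Icc (0 : ℝ) T) t :=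
      (hasDerivWithinAt_id t _).prodMk (hasDerivWithinAt_const ..)
    have hc2 : HasDerivWithinAt (fun τ : ℝ => (t, τ)) ((0 : ℝ), (1 : ℝ)) (Icc (0 : ℝ) 1) t :=
      (hasDerivWithinAt_const ..).prodMk (hasDerivWithinAt_id t _)
    have hc : HasDerivWithinAt (fun τ : ℝ => (τ, τ)) ((1 : ℝ), (1 : ℝ)) (Icc (0 : ℝ) 1) t :=
      (hasDerivWithinAt_id t _).prodMk (hasDerivWithinAt_id t _)
    have hd1 : vD (Model n) g (t, t) ((1 : ℝ), (0 : ℝ)) =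
        combField Ω F (ε, v) (flow Ω F W (ε, t • v) z) :=
      velocity_unique (ht.1.trans_lt htT) ⟨ht.1, htT.le⟩
        (hasMFDerivWithinAt_comp_curve (c := fun τ : ℝ => (τ, t)) hgd hc1)
        (horb t ⟨ht.1, htT.le⟩)
    have hd2 : vD (Model n) g (t, t) ((0 : ℝ), (1 : ℝ)) =
        combField Ω F (ε, w) (flow Ω F W (ε, t • v) z) := by
      rw [← (H.mD_flow_combField hε hzt).2 w]
      exact velocity_unique zero_lt_one ht
        (hasMFDerivWithinAt_comp_curve (c := fun τ : ℝ => (t, τ)) hgd hc2)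
        (hasMFDerivWithinAt_comp_map (c := fun τ => flow Ω F W (ε, τ • w) x)
          (H.mdifferentiableAt_flow hε hzt) (h2 t ht))
    have hd : vD (Model n) g (t, t) ((1 : ℝ), (1 : ℝ)) = combField Ω F (ε, v + w)
        ((fun t => flow Ω F W (ε, t • v) (flow Ω F W (ε, t • w) x)) t) := by
      simp only
      rw [combField_add, ← hd1, ← hd2, ← map_add]
      simp
    rw [← hd]
    exact hasMFDerivWithinAt_comp_curve (c := fun τ : ℝ => (τ, τ)) hgd hc
  · have : x ∈ W := (arc_flow hw).mem_left zero_le_one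
    simp [H.flow_zero hε this]

/-- Compactness of the orbit segment `t ↦ flow (ε, t • v) x` provides one bound on `u` for which all
the intermediate orbits of `flow_comp_aux` exist. -/
lemma Involutive.flow_add_small (H : Involutive r Ω ε₀ F W) {ε : ℝ} (hε : ε ∈ Ioo (-ε₀) ε₀)
    {v : Fin s → ℝ} {x : M} (hv : ((ε, v), x) ∈ flowDom Ω F W) :
    ∀ᶠ u in 𝓝 (0 : Fin s → ℝ), flow Ω F W (ε, v + u) x = flow Ω F W (ε, u) (flow Ω F W (ε, v) x) ∧
      ((ε, u), flow Ω F W (ε, v) x) ∈ flowDom Ω F W := by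
  obtain ⟨h1, h2⟩ := H.flow_orbit hε hv
  have key : ∀ᶠ u in 𝓝 (0 : Fin s → ℝ), ∀ t ∈ Icc (0 : ℝ) 1, ∀ t' ∈ Icc (0 : ℝ) 1,
      ((ε, t' • u), flow Ω F W (ε, t • v) x) ∈ flowDom Ω F W := by
    have k1 : ∀ᶠ u in 𝓝 (0 : Fin s → ℝ), ∀ t ∈ Icc (0 : ℝ) 1,
      ((ε, u), flow Ω F W (ε, t • v) x) ∈ flowDom Ω F W := by
      have hloc : ∀ t ∈ Icc (0 : ℝ) 1, ∀ᶠ q : ℝ × (Fin s → ℝ) in 𝓝 (t, 0),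
          ((ε, q.2), flow Ω F W (ε, q.1 • v) x) ∈ flowDom Ω F W := by
        intro t ht
        have c1 : ContinuousAt (fun q : ℝ × (Fin s → ℝ) => flow Ω F W (ε, q.1 • v) x) (t, 0) :=
          ContinuousAt.comp (g := fun v => flow Ω F W (ε, v) x)
            (f := fun q : ℝ × (Fin s → ℝ) => q.1 • v)
            (H.contMDiffAt_flow_vec hε (h1 t ht)).continuousAt (by fun_prop)
        have c2 : ContinuousAt (fun q : ℝ × (Fin s → ℝ) =>
            ((ε, q.2), flow Ω F W (ε, q.1 • v) x)) (t, 0) :=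
          (continuousAt_const.prodMk continuousAt_snd).prodMk c1
        exact c2.eventually (H.exists_flow_near hε (q := ((ε, 0), flow Ω F W (ε, t • v) x))
          (zero_mem_flowDom (flow_mem (h1 t ht)))).1
      have := isCompact_Icc.eventually_forall_of_forall_eventually (x₀ := (0 : Fin s → ℝ))
        (P := fun u t => ((ε, u), flow Ω F W (ε, t • v) x) ∈ flowDom Ω F W)
        (K := Icc (0 : ℝ) 1) fun t ht => by
          have hsw : ContinuousAt (fun z : (Fin s → ℝ) × ℝ => (z.2, z.1)) (0, t) := by fun_prop
          exact hsw.eventually (hloc t ht)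
      exact this
    filter_upwards [k1] with u hu t ht t' ht'
    exact (H.flow_orbit hε (hu t ht)).1 t' ht'
  filter_upwards [key] with u hu
  have h3 := H.flow_comp_aux hε hv fun t ht => hu t ht t ht
  rw [add_comm v u]
  refine ⟨H.flow_eq hε h3, ?_⟩
  simpa using hu 1 (by simp) 1 (by simp)

/-- The derivative of the flow in the time vector. -/
lemma Involutive.vD_flow (H : Involutive r Ω ε₀ F W) {ε : ℝ} (hε : ε ∈ Ioo (-ε₀) ε₀)
    {v : Fin s → ℝ} {x : M} (hv : ((ε, v), x) ∈ flowDom Ω F W) :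
    vD (Model n) (fun v => flow Ω F W (ε, v) x) v = combL Ω F ε (flow Ω F W (ε, v) x) := by
  ext1 w
  rw [combL_apply]
  have hd : MDifferentiableAt 𝓘(ℝ, Fin s → ℝ) 𝓘(ℝ, Model n) (fun v => flow Ω F W (ε, v) x) v :=
    (H.contMDiffAt_flow_vec hε hv).mdifferentiableAt H.pred_ne_zero
  set z := flow Ω F W (ε, v) x with hz
  have hc : ContinuousAt (fun t : ℝ => t • w) 0 := by fun_prop
  have h1 : ∀ᶠ t in 𝓝 (0 : ℝ), flow Ω F W (ε, v + t • w) x = flow Ω F W (ε, t • w) z ∧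
      ((ε, t • w), z) ∈ flowDom Ω F W := by
    have h0 := H.flow_add_small hε hv
    rw [← zero_smul ℝ w] at h0
    exact hc.eventually h0
  obtain ⟨δ, hδ, hball⟩ := Metric.eventually_nhds_iff.1 h1
  have hδ2 : 0 < δ / 2 := by positivity
  have hm : ∀ t ∈ Icc 0 (δ / 2), dist t 0 < δ := by
    intro t ht
    rw [Real.dist_eq, sub_zero, abs_of_nonneg ht.1]
    linarith [ht.2]
  have hcur := (H.flow_curve hε hδ2 (hball (hm _ (right_mem_Icc.2 hδ2.le))).2).2
  have hcur2 : IntegralCurveOn (fun t => flow Ω F W (ε, v + t • w) x) (combField Ω F (ε, w))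
      (Icc 0 (δ / 2)) := IntegralCurveOn.congr_eqOn hcur fun t ht => (hball (hm t ht)).1
  have h2 := hcur2 0 (left_mem_Icc.2 hδ2.le)
  have hder : HasDerivWithinAt (fun t : ℝ => v + t • w) w (Icc 0 (δ / 2)) 0 := by
    have := ((hasDerivAt_id (0 : ℝ)).smul_const w).const_add v
    simpa using this.hasDerivWithinAt
  have hv0 : v = (fun t : ℝ => v + t • w) 0 := by simp
  have hzz : z = (fun t : ℝ => flow Ω F W (ε, v + t • w) x) 0 := by simp [hz]
  rw [hzz]
  conv_lhs => rw [hv0]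
  refine velocity_unique hδ2 (left_mem_Icc.2 hδ2.le)
    (hasMFDerivWithinAt_comp_curve (f := fun v => flow Ω F W (ε, v) x)
      (c := fun t : ℝ => v + t • w) ?_ hder) h2
  change MDifferentiableAt 𝓘(ℝ, Fin s → ℝ) 𝓘(ℝ, Model n) _ ((fun t : ℝ => v + t • w) 0)
  rw [← hv0]; exact hd

/-- The group law of the flow, along a segment of times for which the flow exists. -/
lemma Involutive.flow_add (H : Involutive r Ω ε₀ F W) {ε : ℝ} (hε : ε ∈ Ioo (-ε₀) ε₀)
    {v w : Fin s → ℝ} {x : M}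
    (h : ∀ t ∈ Icc (0 : ℝ) 1, ((ε, w + t • v), x) ∈ flowDom Ω F W) :
    ((ε, v), flow Ω F W (ε, w) x) ∈ flowDom Ω F W ∧
      flow Ω F W (ε, v) (flow Ω F W (ε, w) x) = flow Ω F W (ε, w + v) x := by
  -- By `vD_flow` the orbit map of `x` sends the straight segment from `w` to `w + v` to an integral
  -- curve of the field of `v`.
  have harc : Arc W (combField Ω F (ε, v)) 1 (flow Ω F W (ε, w) x) (flow Ω F W (ε, w + v) x) := by
    refine ⟨fun t => flow Ω F W (ε, w + t • v) x, fun t ht => ?_, fun t ht => flow_mem (h t ht),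
      by simp, by simp⟩
    have hd : MDifferentiableAt 𝓘(ℝ, Fin s → ℝ) 𝓘(ℝ, Model n) (fun v => flow Ω F W (ε, v) x)
        (w + t • v) := (H.contMDiffAt_flow_vec hε (h t ht)).mdifferentiableAt H.pred_ne_zero
    have hder : HasDerivWithinAt (fun t : ℝ => w + t • v) v (Icc 0 1) t := by
      have := ((hasDerivAt_id t).smul_const v).const_add w
      simpa using this.hasDerivWithinAt
    have h1 := hasMFDerivWithinAt_comp_curve (c := fun t : ℝ => w + t • v) hd hder
    have h2 : combField Ω F (ε, v) ((fun t => flow Ω F W (ε, w + t • v) x) t) =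
        vD (Model n) (fun v => flow Ω F W (ε, v) x) (w + t • v) v := by
      rw [H.vD_flow hε (h t ht), combL_apply]
    rw [h2]
    exact h1
  exact ⟨⟨_, harc⟩, H.flow_eq hε harc⟩

end Flow


/-! ### Complete orbits and their periods. -/

section Complete

variable {n : ℕ} {M : Type*} [TopologicalSpace M] [ChartedSpace (Model n) M]
  {s : ℕ} {r : ℕ∞} {Ω : M → Model n →L[ℝ] Model n →L[ℝ] ℝ} {ε₀ : ℝ} {F : Fin s → ℝ → M → ℝ}
  {W : Set M}

/-- The orbit of `x` under all the fields `∑ vᵢ Xᵢ^ε` stays in `W` for all times. -/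
def CompleteAt (Ω : M → Model n →L[ℝ] Model n →L[ℝ] ℝ) (F : Fin s → ℝ → M → ℝ) (W : Set M)
    (ε : ℝ) (x : M) : Prop := ∀ v : Fin s → ℝ, ((ε, v), x) ∈ flowDom Ω F W

lemma CompleteAt.mem {ε : ℝ} {x : M} (h : CompleteAt Ω F W ε x) : x ∈ W :=
  (arc_flow (h 0)).mem_left zero_le_one

variable [T2Space M] [IsManifold (𝓡 (2 * n)) r M]

lemma Involutive.flow_flow (H : Involutive r Ω ε₀ F W) {ε : ℝ} (hε : ε ∈ Ioo (-ε₀) ε₀)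
    {x : M} (h : CompleteAt Ω F W ε x) (v w : Fin s → ℝ) :
    flow Ω F W (ε, v) (flow Ω F W (ε, w) x) = flow Ω F W (ε, w + v) x :=
  (H.flow_add hε fun _ _ => h _).2

/-- The group of periods of a complete point. -/
def Involutive.periods (H : Involutive r Ω ε₀ F W) {ε : ℝ} (hε : ε ∈ Ioo (-ε₀) ε₀)
    {x : M} (h : CompleteAt Ω F W ε x) : AddSubgroup (Fin s → ℝ) where
  carrier := {v | flow Ω F W (ε, v) x = x}
  zero_mem' := H.flow_zero hε h.mem
  add_mem' {v w} hv hw := by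
    simp only [mem_ofPred_eq] at hv hw ⊢
    rw [← H.flow_flow hε h, hv, hw]
  neg_mem' {v} hv := by
    simp only [mem_ofPred_eq] at hv ⊢
    conv_lhs => rw [← hv]
    rw [H.flow_flow hε h, add_neg_cancel, H.flow_zero hε h.mem]

lemma Involutive.mem_periods (H : Involutive r Ω ε₀ F W) {ε : ℝ} (hε : ε ∈ Ioo (-ε₀) ε₀)
    {x : M} (h : CompleteAt Ω F W ε x) {v : Fin s → ℝ} :
    v ∈ H.periods hε h ↔ flow Ω F W (ε, v) x = x := Iff.rfl

lemma Involutive.flow_eq_flow_iff (H : Involutive r Ω ε₀ F W) {ε : ℝ} (hε : ε ∈ Ioo (-ε₀) ε₀)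
    {x : M} (h : CompleteAt Ω F W ε x) {v w : Fin s → ℝ} :
    flow Ω F W (ε, v) x = flow Ω F W (ε, w) x ↔ w - v ∈ H.periods hε h := by
  rw [H.mem_periods]
  constructor
  · intro he
    have h1 := H.flow_flow hε h (-v) w
    rw [← he, H.flow_flow hε h, add_neg_cancel, H.flow_zero hε h.mem] at h1
    rw [sub_eq_add_neg, ← h1]
  · intro he
    have h1 := H.flow_flow hε h v (w - v)
    rwa [he, sub_add_cancel] at h1

/-- Orbits inside a set that is preserved by a uniform time step are complete. -/
lemma Involutive.completeAt_of_step (H : Involutive r Ω ε₀ F W) {ε : ℝ} (hε : ε ∈ Ioo (-ε₀) ε₀)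
    {S : Set M} {δ : ℝ} (hδ : 0 < δ)
    (hS : ∀ x ∈ S, ∀ v, ‖v‖ < δ → ((ε, v), x) ∈ flowDom Ω F W ∧ flow Ω F W (ε, v) x ∈ S)
    {x : M} (hx : x ∈ S) : CompleteAt Ω F W ε x ∧ ∀ v, flow Ω F W (ε, v) x ∈ S := by
  have key : ∀ v, ∃ y ∈ S, Arc W (combField Ω F (ε, v)) 1 x y := by
    intro v
    -- The vector `v` is cut into `N` equal steps shorter than `δ`, and the steps are concatenated
    -- inside `S`.
    obtain ⟨N, hN⟩ := exists_nat_gt (‖v‖ / δ)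
    have hN0 : (0 : ℝ) < N := lt_of_le_of_lt (by positivity) hN
    set w : Fin s → ℝ := (N : ℝ)⁻¹ • v with hw
    have hwδ : ‖w‖ < δ := by
      rw [hw, norm_smul, norm_inv, Real.norm_natCast, inv_mul_lt_iff₀ hN0]
      rwa [div_lt_iff₀ hδ] at hN
    have hk : ∀ k : ℕ, ∃ y ∈ S, Arc W (combField Ω F (ε, w)) k x y := by
      intro k
      induction k with
      | zero =>
        obtain ⟨γ, h1, h2, h3, h4⟩ := arc_flow (hS x hx w hwδ).1
        have := Arc.initial h1 h2 (t := 0) zero_le_one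
        rw [h3] at this
        exact ⟨x, hx, by simpa using this⟩
      | succ k ih =>
        obtain ⟨y, hy, h1⟩ := ih
        obtain ⟨h2, h3⟩ := hS y hy w hwδ
        refine ⟨_, h3, ?_⟩
        have := h1.trans (Nat.cast_nonneg k) zero_le_one (arc_flow h2)
        exact_mod_cast this
    obtain ⟨y, hy, h1⟩ := hk N
    refine ⟨y, hy, ?_⟩
    have h2 := h1.scale (c := (N : ℝ)) (T' := 1) hN0.le (mul_one _)
    have e : (fun z : M => (N : ℝ) • combField Ω F (ε, w) z) = combField Ω F (ε, v) := by
      funext z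
      rw [← combField_smul, hw, smul_smul, mul_inv_cancel₀ hN0.ne', one_smul]
    rwa [e] at h2
  refine ⟨fun v => ?_, fun v => ?_⟩
  · obtain ⟨y, -, h⟩ := key v
    exact ⟨y, h⟩
  · obtain ⟨y, hy, h⟩ := key v
    rwa [H.flow_eq hε h]

/-- A point with a full lattice of periods whose orbit exists for sufficiently long times is
complete. -/
lemma Involutive.completeAt_of_periods (H : Involutive r Ω ε₀ F W) {ε : ℝ}
    (hε : ε ∈ Ioo (-ε₀) ε₀) {p : M} (b : Module.Basis (Fin s) ℝ (Fin s → ℝ))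
    (hb : ∀ j, flow Ω F W (ε, b j) p = p) {R : ℝ} (hR : 3 * ∑ j, ‖b j‖ ≤ R)
    (hdom : ∀ v, ‖v‖ ≤ R → ((ε, v), p) ∈ flowDom Ω F W) : CompleteAt Ω F W ε p := by
  have hsum0 : 0 ≤ ∑ j, ‖b j‖ := Finset.sum_nonneg fun j _ => norm_nonneg _
  have hp : p ∈ W := (arc_flow (hdom 0 (by simpa using by linarith))).mem_left zero_le_one
  -- Coefficients in `[-1, 2]` are all that occur: those of a point of the cell `[0, 1)ˢ`, changed
  -- by less than one. They give norm at most `2 ∑ ‖b j‖`, which `R` exceeds.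
  have hnorm : ∀ t : Fin s → ℝ, (∀ j, t j ∈ Icc (-1 : ℝ) 2) → ‖∑ j, t j • b j‖ ≤ R := by
    intro t ht
    calc ‖∑ j, t j • b j‖ ≤ ∑ j, ‖t j • b j‖ := norm_sum_le _ _
      _ ≤ ∑ j, 2 * ‖b j‖ := by
        refine Finset.sum_le_sum fun j _ => ?_
        rw [norm_smul]
        refine mul_le_mul_of_nonneg_right ?_ (norm_nonneg _)
        rw [Real.norm_eq_abs, abs_le]
        constructor <;> linarith [(ht j).1, (ht j).2]
      _ ≤ R := by rw [← Finset.mul_sum]; linarith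
  have hconv : Convex ℝ {v : Fin s → ℝ | ‖v‖ ≤ R} := by
    simpa [Metric.closedBall, dist_zero_right] using convex_closedBall (0 : Fin s → ℝ) R
  have hseg : ∀ v w : Fin s → ℝ, ‖w‖ ≤ R → ‖w + v‖ ≤ R → ∀ t ∈ Icc (0 : ℝ) 1,
      ((ε, w + t • v), p) ∈ flowDom Ω F W := by
    intro v w h1 h2 t ht
    refine hdom _ ?_
    have := hconv.add_smul_sub_mem h1 h2 ht
    simpa using this
  have hbR : ∀ j, ‖b j‖ ≤ R := fun j => by
    have := Finset.single_le_sum (f := fun j => ‖b j‖) (fun j _ => norm_nonneg _)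
      (Finset.mem_univ j)
    linarith
  have hshift : ∀ j (a : Fin s → ℝ), ‖a + b j‖ ≤ R →
      flow Ω F W (ε, a + b j) p = flow Ω F W (ε, a) p := by
    intro j a h
    rw [add_comm] at h
    have := (H.flow_add hε (hseg a (b j) (hbR j) h)).2
    rw [add_comm, ← this, hb]
  -- Coordinates are reduced modulo the periods one at a time, since a shift by `b i` is legitimate
  -- only when both time vectors lie in the ball where orbits are known to exist. For a coefficient
  -- in `(-1, 2)` the integer part is `-1`, `0` or `1`.
  have hone : ∀ (t : Fin s → ℝ) (i : Fin s), (∀ j, t j ∈ Ioo (-1 : ℝ) 2) →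
      flow Ω F W (ε, ∑ j, Function.update t i (Int.fract (t i)) j • b j) p =
        flow Ω F W (ε, ∑ j, t j • b j) p := by
    intro t i ht
    have hdiff : ∑ j, t j • b j = ∑ j, Function.update t i (Int.fract (t i)) j • b j +
        (⌊t i⌋ : ℝ) • b i := by
      rw [← Finset.add_sum_erase _ _ (Finset.mem_univ i),
        ← Finset.add_sum_erase (Finset.univ) (fun j => Function.update t i (Int.fract (t i)) j • b j)
          (Finset.mem_univ i)]
      have : ∑ j ∈ Finset.univ.erase i, Function.update t i (Int.fract (t i)) j • b j =
          ∑ j ∈ Finset.univ.erase i, t j • b j := by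
        refine Finset.sum_congr rfl fun j hj => ?_
        rw [Function.update_of_ne (Finset.ne_of_mem_erase hj)]
      rw [this, Function.update_self]
      have h2 : t i • b i = Int.fract (t i) • b i + (⌊t i⌋ : ℝ) • b i := by
        rw [← add_smul, Int.fract_add_floor]
      rw [h2]; abel
    have hfl1 : -1 ≤ ⌊t i⌋ := Int.le_floor.2 (by exact_mod_cast (ht i).1.le)
    have hfl2 : ⌊t i⌋ < 2 := Int.floor_lt.2 (by exact_mod_cast (ht i).2)
    have hn1 : ‖∑ j, t j • b j‖ ≤ R := hnorm t fun j => ⟨(ht j).1.le, (ht j).2.le⟩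
    have hn2 : ‖∑ j, Function.update t i (Int.fract (t i)) j • b j‖ ≤ R := by
      refine hnorm _ fun j => ?_
      by_cases hj : j = i
      · subst hj
        rw [Function.update_self]
        exact ⟨by linarith [Int.fract_nonneg (t j)], by linarith [Int.fract_lt_one (t j)]⟩
      · rw [Function.update_of_ne hj]
        exact ⟨(ht j).1.le, (ht j).2.le⟩
    have h3 : ⌊t i⌋ = -1 ∨ ⌊t i⌋ = 0 ∨ ⌊t i⌋ = 1 := by omega
    rcases h3 with h3 | h3 | h3
    · have e : ∑ j, Function.update t i (Int.fract (t i)) j • b j = ∑ j, t j • b j + b i := by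
        rw [hdiff, h3]; simp
      rw [e] at hn2 ⊢
      exact hshift i _ hn2
    · rw [hdiff, h3]; simp
    · have e : ∑ j, t j • b j = ∑ j, Function.update t i (Int.fract (t i)) j • b j + b i := by
        rw [hdiff, h3]; simp
      rw [e] at hn1 ⊢
      exact (hshift i _ hn1).symm
  have hall : ∀ (t : Fin s → ℝ), (∀ j, t j ∈ Ioo (-1 : ℝ) 2) →
      flow Ω F W (ε, ∑ j, Int.fract (t j) • b j) p = flow Ω F W (ε, ∑ j, t j • b j) p := by
    intro t ht
    have hA : ∀ A : Finset (Fin s), flow Ω F W (ε, ∑ j, (if j ∈ A then Int.fract (t j) else t j) • b j) p =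
        flow Ω F W (ε, ∑ j, t j • b j) p := by
      intro A
      induction A using Finset.induction_on with
      | empty => simp
      | insert i A hi ih =>
        rw [← ih, ← hone (fun j => if j ∈ A then Int.fract (t j) else t j) i]
        · refine congrArg (fun a => flow Ω F W (ε, a) p) (Finset.sum_congr rfl fun j _ => ?_)
          by_cases hj : j = i
          · subst hj; simp [hi]
          · rw [Function.update_of_ne hj]; simp [hj]
        · intro j
          split_ifs
          · exact ⟨by linarith [Int.fract_nonneg (t j)], by linarith [Int.fract_lt_one (t j)]⟩
          · exact ht j
    simpa using hA Finset.univ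
  obtain ⟨δ, hδ, hδ'⟩ : ∃ δ > 0, ∀ v : Fin s → ℝ, ‖v‖ < δ → ∀ j, |b.equivFun v j| < 1 := by
    have hc : Continuous fun v => b.equivFun v :=
      LinearMap.continuous_of_finiteDimensional (b.equivFun : (Fin s → ℝ) →ₗ[ℝ] (Fin s → ℝ))
    obtain ⟨δ, hδ, h⟩ := Metric.continuousAt_iff.1 (hc.continuousAt (x := 0)) 1 one_pos
    refine ⟨δ, hδ, fun v hv j => ?_⟩
    have h1 := h (x := v) (by simpa using hv)
    rw [map_zero, dist_zero_right] at h1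
    exact (norm_le_pi_norm (b.equivFun v) j).trans_lt h1
  -- The image of the fundamental cell. A step shorter than `δ` moves the coefficients into `(-1,
  -- 2)`, from where the periods bring them back to the cell, so `S` admits a uniform time step.
  set S : Set M := {x | ∃ t : Fin s → ℝ, (∀ j, t j ∈ Ico (0 : ℝ) 1) ∧
    flow Ω F W (ε, ∑ j, t j • b j) p = x} with hS
  have hpS : p ∈ S := ⟨0, by simp, by simp [H.flow_zero hε hp]⟩
  refine (H.completeAt_of_step hε hδ (S := S) ?_ hpS).1
  rintro x ⟨t, ht, rfl⟩ v hv
  have hvs : v = ∑ j, b.equivFun v j • b j := (b.sum_equivFun v).symm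
  set a := b.equivFun v with ha
  have ha1 := fun j => abs_lt.1 (hδ' v hv j)
  have hsum : ∑ j, t j • b j + v = ∑ j, (t j + a j) • b j := by
    rw [hvs, ← Finset.sum_add_distrib]
    simp only [add_smul]
  have hta : ∀ j, t j + a j ∈ Ioo (-1 : ℝ) 2 := fun j =>
    ⟨by linarith [(ht j).1, (ha1 j).1], by linarith [(ht j).2, (ha1 j).2]⟩
  have h1 : ‖∑ j, t j • b j‖ ≤ R :=
    hnorm t fun j => ⟨by linarith [(ht j).1], by linarith [(ht j).2]⟩
  have h2 : ‖∑ j, t j • b j + v‖ ≤ R := by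
    rw [hsum]; exact hnorm _ fun j => ⟨(hta j).1.le, (hta j).2.le⟩
  obtain ⟨h3, h4⟩ := H.flow_add hε (hseg v _ h1 h2)
  refine ⟨h3, fun j => Int.fract (t j + a j), fun j => ⟨Int.fract_nonneg _, Int.fract_lt_one _⟩, ?_⟩
  rw [h4, hsum, hall _ hta]

end Complete


/-! ### Linear algebra of the multiplier one; lattices from discrete cobounded groups. -/

section LinearAlgebra

/-- If the eigenvalue one of `D` has the smallest algebraic multiplicity compatible with the fixed
vectors `A v` and the invariant functionals `G`, then it is nondegenerate transversally. -/
lemma mem_range_of_rootMultiplicity {E V : Type*} [AddCommGroup E] [Module ℝ E]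
    [FiniteDimensional ℝ E] [AddCommGroup V] [Module ℝ V] [FiniteDimensional ℝ V]
    {D : Module.End ℝ E} {A : V →ₗ[ℝ] E} {G : E →ₗ[ℝ] V} (hA : Function.Injective A)
    (hG : Function.Surjective G) (hDA : ∀ v, D (A v) = A v) (hGD : ∀ u, G (D u) = G u)
    (hGA : ∀ v, G (A v) = 0)
    (hm : D.charpoly.rootMultiplicity 1 = 2 * Module.finrank ℝ V) {u : E} (hu : G u = 0)
    {v : V} (huv : D u - u = A v) : u ∈ LinearMap.range A := by
  set N : Module.End ℝ E := D - (1 : ℝ) • 1 with hN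
  have hNa : ∀ x, N x = D x - x := fun x => by simp [hN]
  set K := D.maxGenEigenspace 1 with hK
  have hKdim : Module.finrank ℝ K = 2 * Module.finrank ℝ V := by
    rw [← hm, LinearMap.finrank_maxGenEigenspace_eq]
  have hNA : ∀ v, N (A v) = 0 := fun v => by rw [hNa, hDA, sub_self]
  have hGN : ∀ x, G (N x) = 0 := fun x => by rw [hNa, map_sub, hGD, sub_self]
  have hcompl : IsCompl (⨆ n : ℕ, LinearMap.ker (N ^ n)) (⨅ n : ℕ, LinearMap.range (N ^ n)) :=
    LinearMap.isCompl_iSup_ker_pow_iInf_range_pow N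
  have hKsup : (⨆ n : ℕ, LinearMap.ker (N ^ n)) = K := by
    rw [hK, ← Module.End.iSup_genEigenspace_eq]
    simp [Module.End.genEigenspace_nat, hN]
  rw [hKsup] at hcompl
  set g : K →ₗ[ℝ] V := G.comp K.subtype with hg
  -- `G` vanishes on the range of `N = D - 1`, so it is already onto when restricted to the
  -- generalized eigenspace `K`. With `dim K = 2 dim V`, its kernel in `K` has dimension `dim V`.
  have hgs : Function.Surjective g := by
    intro w
    obtain ⟨x, rfl⟩ := hG w
    have hx : x ∈ K ⊔ ⨅ n : ℕ, LinearMap.range (N ^ n) := by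
      rw [hcompl.sup_eq_top]; trivial
    obtain ⟨a, ha, b, hb, rfl⟩ := Submodule.mem_sup.1 hx
    refine ⟨⟨a, ha⟩, ?_⟩
    have hb1 : b ∈ LinearMap.range (N ^ 1) := (Submodule.mem_iInf _).1 hb 1
    obtain ⟨c, rfl⟩ := hb1
    simp [hg, hGN]
  have hker : Module.finrank ℝ (LinearMap.ker g) = Module.finrank ℝ V := by
    have h1 := LinearMap.finrank_range_add_finrank_ker g
    rw [LinearMap.range_eq_top.2 hgs, finrank_top, hKdim] at h1
    omega
  have hAK : ∀ v, A v ∈ K := fun v =>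
    (Module.End.mem_maxGenEigenspace D 1 _).2 ⟨1, by simpa [hN] using hNA v⟩
  -- The range of `A` lies in that kernel and has the same dimension, hence it is the whole kernel.
  -- It remains to see that `u`, a generalized eigenvector of order at most two, belongs to the
  -- kernel.
  set a : V →ₗ[ℝ] LinearMap.ker g :=
    (A.codRestrict K hAK).codRestrict (LinearMap.ker g) (fun v => by simp [hg, hGA]) with ha
  have hai : Function.Injective a := by
    intro v w hvw
    exact hA (congrArg (fun z : LinearMap.ker g => ((z : K) : E)) hvw)
  have has : Function.Surjective a :=
    (LinearMap.injective_iff_surjective_of_finrank_eq_finrank hker.symm).1 hai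
  have huK : u ∈ K := by
    refine (Module.End.mem_maxGenEigenspace D 1 _).2 ⟨2, ?_⟩
    have : N (N u) = 0 := by rw [hNa u, huv, hNA]
    rw [pow_two]
    exact this
  obtain ⟨w, hw⟩ := has ⟨⟨u, huK⟩, by simp [hg, hu]⟩
  exact ⟨w, congrArg (fun z : LinearMap.ker g => ((z : K) : E)) hw⟩

/-- A discrete subgroup at bounded distance from every point has a basis. -/
lemma exists_basis_of_discrete_of_cobounded {s : ℕ} (Γ : AddSubgroup (Fin s → ℝ)) {δ : ℝ}
    (hδ : 0 < δ) (hdisc : ∀ v ∈ Γ, ‖v‖ < δ → v = 0) {R : ℝ}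
    (hR : ∀ v : Fin s → ℝ, ∃ u ∈ Γ, ‖v - u‖ ≤ R) :
    ∃ b : Module.Basis (Fin s) ℝ (Fin s → ℝ), ∀ v, v ∈ Γ ↔ ∃ z : Fin s → ℤ, v = ∑ j, (z j : ℝ) • b j := by
  set L : Submodule ℤ (Fin s → ℝ) := AddSubgroup.toIntSubmodule Γ with hL
  have hmem : ∀ v, v ∈ L ↔ v ∈ Γ := fun v => Iff.rfl
  have hd : DiscreteTopology L := by
    refine DiscreteTopology.of_forall_le_dist hδ fun x y hxy => ?_
    by_contra hlt
    push Not at hlt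
    have h1 : ((x : Fin s → ℝ) - y) ∈ Γ := Γ.sub_mem x.2 y.2
    have h2 := hdisc _ h1 (by rw [← dist_eq_norm]; exact hlt)
    exact hxy (Subtype.ext (sub_eq_zero.1 h2))
  -- A nonzero functional vanishing on `Γ` would be bounded on the whole space, every vector being
  -- within `R` of `Γ`.
  have hspan : Submodule.span ℝ (L : Set (Fin s → ℝ)) = ⊤ := by
    by_contra hne
    obtain ⟨f, hf0, hf⟩ := Submodule.exists_le_ker_of_lt_top _ (lt_top_iff_ne_top.2 hne)
    obtain ⟨v, hv⟩ : ∃ v, f v ≠ 0 := by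
      by_contra h
      push Not at h
      exact hf0 (LinearMap.ext h)
    set f' := LinearMap.toContinuousLinearMap f with hf'
    obtain ⟨N, hN⟩ := exists_nat_gt (‖f'‖ * R / |f v|)
    obtain ⟨u, hu, hu'⟩ := hR ((N : ℝ) • v)
    have h1 : f u = 0 := hf (Submodule.subset_span hu)
    have h2 : f' ((N : ℝ) • v - u) = N * f v := by simp [hf', h1]
    have h3 := f'.le_opNorm ((N : ℝ) • v - u)
    rw [h2, Real.norm_eq_abs, abs_mul, Nat.abs_cast] at h3
    have h4 : ‖f'‖ * ‖(N : ℝ) • v - u‖ ≤ ‖f'‖ * R := mul_le_mul_of_nonneg_left hu' (norm_nonneg _)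
    rw [div_lt_iff₀ (abs_pos.2 hv)] at hN
    linarith
  have hz : IsZLattice ℝ L := ⟨hspan⟩
  have hfree : Module.Free ℤ L := ZLattice.module_free ℝ L
  have hfin : Module.Finite ℤ L := ZLattice.module_finite ℝ L
  have hrank : Module.finrank ℤ L = s := by rw [ZLattice.rank ℝ L]; simp
  let b := Module.finBasisOfFinrankEq ℤ L hrank
  refine ⟨b.ofZLatticeBasis ℝ L, fun v => ?_⟩
  rw [← hmem]
  constructor
  · intro hv
    refine ⟨fun j => b.repr ⟨v, hv⟩ j, ?_⟩
    have h1 := b.sum_repr ⟨v, hv⟩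
    have h2 := congrArg (fun z : L => (z : Fin s → ℝ)) h1
    simp only [Submodule.coe_sum, Submodule.coe_smul] at h2
    refine h2.symm.trans (Finset.sum_congr rfl fun j _ => ?_)
    rw [Module.Basis.ofZLatticeBasis_apply, Int.cast_smul_eq_zsmul]
  · rintro ⟨z, rfl⟩
    refine Submodule.sum_mem _ fun j _ => ?_
    rw [Module.Basis.ofZLatticeBasis_apply, Int.cast_smul_eq_zsmul]
    exact L.smul_mem _ (b j).2

end LinearAlgebra

/-! ### Tangency of curves contained in an immersed image. -/

section Tangent

variable {E G : Type*} [NormedAddCommGroup E] [NormedSpace ℝ E] [NormedAddCommGroup G]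
  [NormedSpace ℝ G] [FiniteDimensional ℝ G]

/-- The velocity of a curve inside the image of an immersion is tangent to the image. -/
lemma mem_range_of_curve_factors {θ : G → E} {A : G →L[ℝ] E} {a : G} (hθ : HasFDerivAt θ A a)
    (hA : Function.Injective A) {σ : ℝ → G} {S : Set ℝ} {t : ℝ} [(𝓝[S \ {t}] t).NeBot]
    (hσ : Filter.Tendsto σ (𝓝[S \ {t}] t) (𝓝 a)) {γ : ℝ → E} {w : E}
    (hγ : HasDerivWithinAt γ w S t) (hγt : γ t = θ a) (heq : ∀ᶠ τ in 𝓝[S \ {t}] t, γ τ = θ (σ τ)) :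
    w ∈ LinearMap.range (A : G →ₗ[ℝ] E) := by
  obtain ⟨K, hK0, hK⟩ := (A : G →ₗ[ℝ] E).exists_antilipschitzWith (LinearMap.ker_eq_bot.2 hA)
  have hK' : AntilipschitzWith K A := hK
  set l := 𝓝[S \ {t}] t with hl
  have h1 : (fun τ => θ (σ τ) - θ a - A (σ τ - a)) =o[l] fun τ => σ τ - a :=
    hθ.isLittleO.comp_tendsto hσ
  -- The lift `σ` is only known to converge. An injective linear map on a finite-dimensional space
  -- is bounded below, so the increments of `θ ∘ σ` control those of `σ`.
  have h2 : (fun τ => σ τ - a) =O[l] fun τ => θ (σ τ) - θ a := by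
    have h2a : (fun τ => σ τ - a) =O[l] fun τ => A (σ τ - a) := by
      refine Asymptotics.IsBigO.of_bound K (Filter.Eventually.of_forall fun τ => ?_)
      simpa using hK'.le_mul_dist (σ τ - a) 0
    have h2b : (fun τ => A (σ τ - a) - (θ (σ τ) - θ a)) =o[l] fun τ => A (σ τ - a) := by
      have := (h1.trans_isBigO h2a).neg_left
      refine this.congr_left fun τ => ?_
      abel
    refine h2a.trans (h2b.right_isBigO_sub.congr_right fun τ => ?_)
    abel
  have h3 : Filter.Tendsto (fun τ => (τ - t)⁻¹ • (γ τ - γ t)) l (𝓝 w) := by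
    have := hasDerivWithinAt_iff_tendsto_slope.1 hγ
    exact this
  have h4 : (fun τ => θ (σ τ) - θ a) =O[l] fun τ => τ - t := by
    have h5 : (fun τ => γ τ - γ t) =O[l] fun τ => τ - t :=
      (hγ.hasFDerivWithinAt.isBigO_sub).mono (nhdsWithin_mono t sdiff_subset)
    refine h5.congr' ?_ (Filter.EventuallyEq.refl _ _)
    filter_upwards [heq] with τ hτ
    rw [hτ, hγt]
  have h6 : Filter.Tendsto (fun τ => (τ - t)⁻¹ • (θ (σ τ) - θ a - A (σ τ - a))) l (𝓝 0) := by
    have h7 : (fun τ => θ (σ τ) - θ a - A (σ τ - a)) =o[l] fun τ => τ - t :=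
      h1.trans_isBigO (h2.trans h4)
    have h8 := (Asymptotics.isBigO_refl (fun τ => (τ - t)⁻¹) l).smul_isLittleO h7
    have h9 : (fun τ => (τ - t)⁻¹ • (τ - t)) =O[l] fun _ => (1 : ℝ) := by
      refine Asymptotics.IsBigO.of_bound 1 (Filter.Eventually.of_forall fun τ => ?_)
      rcases eq_or_ne (τ - t) 0 with h | h
      · simp [h]
      · simp [inv_mul_cancel₀ h]
    exact (Asymptotics.isLittleO_one_iff ℝ).1 (h8.trans_isBigO h9)
  have h10 : Filter.Tendsto (fun τ => A ((τ - t)⁻¹ • (σ τ - a))) l (𝓝 w) := by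
    have := h3.sub h6
    rw [sub_zero] at this
    refine this.congr' ?_
    filter_upwards [heq] with τ hτ
    rw [hτ, hγt, ← smul_sub, map_smul]
    congr 1
    abel
  have hcl : IsClosed (LinearMap.range (A : G →ₗ[ℝ] E) : Set E) :=
    Submodule.closed_of_finiteDimensional _
  exact hcl.mem_of_tendsto h10 (Filter.Eventually.of_forall fun τ => ⟨_, rfl⟩)

end Tangent

/-! ### Smoothness of integrals depending on parameters. -/

section ParametricIntegral

variable {H Y : Type} [NormedAddCommGroup H] [NormedSpace ℝ H] [NormedAddCommGroup Y]
  [NormedSpace ℝ Y]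

lemma eventually_bound_on_segment {g : H × ℝ → Y} {O : Set (H × ℝ)} (hO : IsOpen O)
    (hg : ContinuousOn g O) {x₀ : H} (hx₀ : ∀ t ∈ Icc (0 : ℝ) 1, (x₀, t) ∈ O) :
    ∃ C : ℝ, ∀ᶠ x in 𝓝 x₀, ∀ t ∈ Icc (0 : ℝ) 1, (x, t) ∈ O ∧ ‖g (x, t)‖ ≤ C := by
  have hc : ContinuousOn (fun t : ℝ => g (x₀, t)) (Icc 0 1) :=
    hg.comp (by fun_prop) hx₀
  obtain ⟨C, hC⟩ := isCompact_Icc.exists_bound_of_continuousOn hc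
  refine ⟨C + 1, isCompact_Icc.eventually_forall_of_forall_eventually
    (P := fun x t => (x, t) ∈ O ∧ ‖g (x, t)‖ ≤ C + 1) fun t ht => ?_⟩
  have h1 : ∀ᶠ q in 𝓝 (x₀, t), q ∈ O := hO.mem_nhds (hx₀ t ht)
  have h2 : ContinuousAt g (x₀, t) := hg.continuousAt h1
  have h3 : ∀ᶠ q in 𝓝 (x₀, t), ‖g q‖ < C + 1 :=
    h2.norm.eventually (gt_mem_nhds (by linarith [hC t ht]))
  filter_upwards [h1, h3] with q h4 h5 using ⟨h4, h5.le⟩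

lemma continuousOn_integral_segment {g : H × ℝ → Y} {O : Set (H × ℝ)} (hO : IsOpen O)
    (hg : ContinuousOn g O) {U : Set H} (hU : ∀ x ∈ U, ∀ t ∈ Icc (0 : ℝ) 1, (x, t) ∈ O) :
    ContinuousOn (fun x => ∫ t in (0 : ℝ)..1, g (x, t)) U := by
  intro x₀ hx₀
  obtain ⟨C, hC⟩ := eventually_bound_on_segment hO hg (hU x₀ hx₀)
  refine ContinuousAt.continuousWithinAt ?_
  have hI : uIoc (0 : ℝ) 1 ⊆ Icc 0 1 := by
    rw [uIoc_of_le zero_le_one]; exact Ioc_subset_Icc_self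
  refine intervalIntegral.continuousAt_of_dominated_interval (bound := fun _ => C) ?_ ?_
    intervalIntegrable_const ?_
  · filter_upwards [hC] with x hx
    have : ContinuousOn (fun t : ℝ => g (x, t)) (Icc 0 1) :=
      hg.comp (by fun_prop) fun t ht => (hx t ht).1
    exact (this.mono hI).aestronglyMeasurable measurableSet_uIoc
  · filter_upwards [hC] with x hx
    exact Filter.Eventually.of_forall fun t ht => (hx t (hI ht)).2
  · refine Filter.Eventually.of_forall fun t ht => ?_
    have h1 : ContinuousAt g (x₀, t) := hg.continuousAt (hO.mem_nhds (hU x₀ hx₀ t (hI ht)))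
    exact ContinuousAt.comp (f := fun x => (x, t)) h1 (by fun_prop)

lemma hasFDerivAt_integral_segment {g : H × ℝ → Y} {O : Set (H × ℝ)} (hO : IsOpen O)
    (hg : ContDiffOn ℝ 1 g O) {x₀ : H} (hx₀ : ∀ t ∈ Icc (0 : ℝ) 1, (x₀, t) ∈ O) :
    HasFDerivAt (fun x => ∫ t in (0 : ℝ)..1, g (x, t))
      (∫ t in (0 : ℝ)..1, (fderiv ℝ g (x₀, t)).comp (ContinuousLinearMap.inl ℝ H ℝ)) x₀ := by
  have hI : uIoc (0 : ℝ) 1 ⊆ Icc 0 1 := by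
    rw [uIoc_of_le zero_le_one]; exact Ioc_subset_Icc_self
  have hD : ContinuousOn (fun q => (fderiv ℝ g q).comp (ContinuousLinearMap.inl ℝ H ℝ)) O :=
    (hg.continuousOn_fderiv_of_isOpen hO le_rfl).clm_comp continuousOn_const
  obtain ⟨C, hC⟩ := eventually_bound_on_segment hO hD hx₀
  refine intervalIntegral.hasFDerivAt_integral_of_dominated_of_fderiv_le (bound := fun _ => C)
    (F' := fun x t => (fderiv ℝ g (x, t)).comp (ContinuousLinearMap.inl ℝ H ℝ)) hC ?_ ?_ ?_ ?_
    intervalIntegrable_const ?_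
  · filter_upwards [hC] with x hx
    have : ContinuousOn (fun t : ℝ => g (x, t)) (Icc 0 1) :=
      hg.continuousOn.comp (by fun_prop) fun t ht => (hx t ht).1
    exact (this.mono hI).aestronglyMeasurable measurableSet_uIoc
  · have : ContinuousOn (fun t : ℝ => g (x₀, t)) (uIcc 0 1) := by
      rw [uIcc_of_le zero_le_one]
      exact hg.continuousOn.comp (by fun_prop) hx₀
    exact this.intervalIntegrable
  · have : ContinuousOn (fun t : ℝ => (fderiv ℝ g (x₀, t)).comp (ContinuousLinearMap.inl ℝ H ℝ))
        (Icc 0 1) := hD.comp (f := fun t : ℝ => (x₀, t)) (by fun_prop) hx₀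
    exact (this.mono hI).aestronglyMeasurable measurableSet_uIoc
  · exact Filter.Eventually.of_forall fun t ht x hx => (hx t (hI ht)).2
  · refine Filter.Eventually.of_forall fun t ht x hx => ?_
    have h1 := ((hg.contDiffAt (hO.mem_nhds (hx t (hI ht)).1)).differentiableAt
      one_ne_zero).hasFDerivAt
    exact HasFDerivAt.comp (f := fun x : H => (x, t)) x h1 (hasFDerivAt_prodMk_left (𝕜 := ℝ) x t)

/-- Induction on the order by differentiation under the integral sign. The target is quantified in
`key` because the derivative takes values in a space of operators. -/
lemma contDiffOn_integral_segment {k : ℕ∞} {g : H × ℝ → Y} {O : Set (H × ℝ)} (hO : IsOpen O)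
    (hg : ContDiffOn ℝ k g O) {U : Set H} (hUo : IsOpen U)
    (hU : ∀ x ∈ U, ∀ t ∈ Icc (0 : ℝ) 1, (x, t) ∈ O) :
    ContDiffOn ℝ k (fun x => ∫ t in (0 : ℝ)..1, g (x, t)) U := by
  have key : ∀ m : ℕ, ∀ (Y : Type) [NormedAddCommGroup Y] [NormedSpace ℝ Y] (g : H × ℝ → Y),
      ContDiffOn ℝ m g O → ContDiffOn ℝ m (fun x => ∫ t in (0 : ℝ)..1, g (x, t)) U := by
    intro m
    induction m with
    | zero =>
      intro Y _ _ g hg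
      exact contDiffOn_zero.2 (continuousOn_integral_segment hO hg.continuousOn hU)
    | succ m ih =>
      intro Y _ _ g hg
      have hg' : ContDiffOn ℝ ((m : WithTop ℕ∞) + 1) g O := by exact_mod_cast hg
      have hg1 : ContDiffOn ℝ 1 g O := hg'.of_le le_add_self
      have hD : ContDiffOn ℝ m (fun q => (fderiv ℝ g q).comp (ContinuousLinearMap.inl ℝ H ℝ)) O :=
        (hg'.fderiv_of_isOpen hO le_rfl).clm_comp contDiffOn_const
      have hder := fun x hx => hasFDerivAt_integral_segment hO hg1 (hU x hx)
      have : ContDiffOn ℝ ((m : WithTop ℕ∞) + 1) (fun x => ∫ t in (0 : ℝ)..1, g (x, t)) U := by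
        rw [contDiffOn_succ_iff_fderiv_of_isOpen hUo]
        refine ⟨fun x hx => (hder x hx).differentiableAt.differentiableWithinAt, by simp, ?_⟩
        exact (ih _ _ hD).congr fun x hx => (hder x hx).fderiv
      exact_mod_cast this
  rw [contDiffOn_iff_forall_nat_le] at hg ⊢
  exact fun m hm => key m Y g (hg m hm)

end ParametricIntegral


/-! ### Independence of the fields and of the differentials. -/

section Fields

variable {n : ℕ} {M : Type*} [TopologicalSpace M] [ChartedSpace (Model n) M]
  {s : ℕ} {r : ℕ∞} {Ω : M → Model n →L[ℝ] Model n →L[ℝ] ℝ} {ε₀ : ℝ} {F : Fin s → ℝ → M → ℝ}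
  {W : Set M} [IsManifold (𝓡 (2 * n)) r M]

/-- The differential of `F^ε = (F_1^ε, …, F_s^ε)`. -/
def dF (F : Fin s → ℝ → M → ℝ) (ε : ℝ) (x : M) : Model n →L[ℝ] (Fin s → ℝ) :=
  ContinuousLinearMap.pi fun i => dfun (F i ε) x

lemma dF_apply (ε : ℝ) (x : M) (u : Model n) (i : Fin s) : dF F ε x u i = dfun (F i ε) x u := rfl

lemma Involutive.form_combL (H : Involutive r Ω ε₀ F W) (ε : ℝ) (x : M) (v : Fin s → ℝ)
    (u : Model n) : Ω x (combL Ω F ε x v) u = ∑ i, v i * dF F ε x u i := by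
  rw [combL_apply, combField, map_sum, _root_.sum_apply]
  refine Finset.sum_congr rfl fun i _ => ?_
  rw [map_smul, form_ham H.symplectic]
  rfl

lemma Involutive.dF_combL (H : Involutive r Ω ε₀ F W) {ε : ℝ} (hε : ε ∈ Ioo (-ε₀) ε₀) {x : M}
    (hx : x ∈ W) (v : Fin s → ℝ) : dF F ε x (combL Ω F ε x v) = 0 := by
  ext i
  rw [dF_apply, combL_apply, combField, map_sum]
  refine Finset.sum_eq_zero fun j _ => ?_
  rw [map_smul, ← form_ham H.symplectic, H.involution ε hε x hx, smul_zero]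

lemma Involutive.combL_injective (H : Involutive r Ω ε₀ F W) {ε : ℝ} (hε : ε ∈ Ioo (-ε₀) ε₀)
    {x : M} (hx : x ∈ W) : Function.Injective (combL Ω F ε x) := by
  rw [injective_iff_map_eq_zero]
  intro v hv
  have hli := Fintype.linearIndependent_iff.1 (H.independent ε hε x hx) v ?_
  · exact funext hli
  · ext u
    have h1 := H.form_combL ε x v u
    rw [hv, map_zero] at h1
    simp only [_root_.sum_apply, _root_.smul_apply, smul_eq_mul]
    exact h1.symm

/-- A functional vanishing on the range of `dF` is a linear relation between the `dFᵢ`. -/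
lemma Involutive.dF_surjective (H : Involutive r Ω ε₀ F W) {ε : ℝ} (hε : ε ∈ Ioo (-ε₀) ε₀)
    {x : M} (hx : x ∈ W) : Function.Surjective (dF (n := n) F ε x) := by
  by_contra hns
  have hne : LinearMap.range (dF (n := n) F ε x : Model n →ₗ[ℝ] (Fin s → ℝ)) ≠ ⊤ := fun h =>
    hns (LinearMap.range_eq_top.1 h)
  obtain ⟨f, hf0, hf⟩ := Submodule.exists_le_ker_of_lt_top _ (lt_top_iff_ne_top.2 hne)
  have hrep : ∀ a : Fin s → ℝ, f a = ∑ i, f (Pi.single i 1) * a i := by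
    intro a
    conv_lhs => rw [LinearMap.pi_apply_eq_sum_univ f a]
    refine Finset.sum_congr rfl fun i _ => ?_
    rw [smul_eq_mul, mul_comm]
    congr 2
    ext j
    simp [Pi.single_apply, eq_comm]
  have hli := Fintype.linearIndependent_iff.1 (H.independent ε hε x hx)
    (fun i => f (Pi.single i 1)) ?_
  · refine hf0 (LinearMap.ext fun a => ?_)
    rw [hrep a]
    simp [hli]
  · ext u
    simp only [_root_.sum_apply, _root_.smul_apply, smul_eq_mul]
    have h1 : f (dF F ε x u) = 0 := hf ⟨u, rfl⟩
    rw [hrep] at h1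
    exact h1

variable [T2Space M]

/-- The flow issued from `x`, read in a chart, has the derivative given by the fields. -/
lemma Involutive.hasStrictFDerivAt_flow_cht (H : Involutive r Ω ε₀ F W) {ε : ℝ}
    (hε : ε ∈ Ioo (-ε₀) ε₀) {v : Fin s → ℝ} {x x₀ : M} (hv : ((ε, v), x) ∈ flowDom Ω F W)
    (hx₀ : flow Ω F W (ε, v) x ∈ (cht (Model n) x₀).source) :
    ContDiffAt ℝ (r - 1 : ℕ∞) (fun v => cht (Model n) x₀ (flow Ω F W (ε, v) x)) v ∧
    HasStrictFDerivAt (fun v => cht (Model n) x₀ (flow Ω F W (ε, v) x))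
      ((chartD (Model n) x₀ (flow Ω F W (ε, v) x)).comp
        (combL Ω F ε (flow Ω F W (ε, v) x))) v := by
  have hMk : IsManifold 𝓘(ℝ, Model n) (r - 1 : ℕ∞) M :=
    IsManifold.of_le (n := r) (by exact_mod_cast tsub_le_self)
  have hM1 := H.isManifold_one
  have h1 := H.contMDiffAt_flow_vec hε hv
  have b2 : ContMDiffAt 𝓘(ℝ, Model n) 𝓘(ℝ, Model n) (r - 1 : ℕ∞) (cht (Model n) x₀)
      (flow Ω F W (ε, v) x) := contMDiffAt_extChartAt' (by rwa [extChartAt_source] at hx₀)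
  have h2 : ContDiffAt ℝ (r - 1 : ℕ∞) (fun v => cht (Model n) x₀ (flow Ω F W (ε, v) x)) v :=
    contMDiffAt_iff_contDiffAt.1 (ContMDiffAt.comp v b2 h1)
  refine ⟨h2, ?_⟩
  have h3 := (hasMFDerivAt_cht hx₀).comp v (h1.mdifferentiableAt H.pred_ne_zero).hasMFDerivAt
  have h4 : HasFDerivAt (fun v => cht (Model n) x₀ (flow Ω F W (ε, v) x))
      ((chartD (Model n) x₀ (flow Ω F W (ε, v) x)).comp
        (vD (Model n) (fun v => flow Ω F W (ε, v) x) v)) v := hasMFDerivAt_iff_hasFDerivAt.1 h3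
  rw [H.vD_flow hε hv] at h4
  exact h2.hasStrictFDerivAt' h4 H.pred_ne_zero

end Fields

/-! ### Invariance, completeness and tangent spaces of `Λ`. -/

section Torus

variable {n : ℕ} {M : Type*} [TopologicalSpace M] [ChartedSpace (Model n) M]
  {s : ℕ} {r : ℕ∞} {Ω : M → Model n →L[ℝ] Model n →L[ℝ] ℝ} {ε₀ : ℝ} {F : Fin s → ℝ → M → ℝ}
  {W : Set M} {L : Type*} [TopologicalSpace L] [ChartedSpace (EuclideanSpace ℝ (Fin s)) L]
  {ι : L → M}

lemma Hypotheses.involutive (H : Hypotheses r Ω ε₀ F ι W) (hr : 2 ≤ r) :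
    Involutive r Ω ε₀ F W where
  two_le := hr
  symplectic := H.symplectic
  contMDiffOn_F := H.contMDiffOn_F
  isOpen_W := H.isOpen_W
  independent := H.independent
  involution := H.involution

lemma Hypotheses.zero_mem (H : Hypotheses r Ω ε₀ F ι W) : (0 : ℝ) ∈ Ioo (-ε₀) ε₀ :=
  ⟨by linarith [H.ε₀_pos], H.ε₀_pos⟩

variable [T2Space M] [IsManifold (𝓡 (2 * n)) r M] [IsManifold (𝓡 s) r L] [CompactSpace L]

lemma Hypotheses.isClosedEmbedding (H : Hypotheses r Ω ε₀ F ι W) : IsClosedEmbedding ι :=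
  H.contMDiff_ι.continuous.isClosedEmbedding H.injective_ι

lemma Hypotheses.exists_uniform_step (H : Hypotheses r Ω ε₀ F ι W) (hr : 2 ≤ r) :
    ∃ δ > 0, ∀ x ∈ range ι, ∀ v : Fin s → ℝ, ‖v‖ < δ → ((0, v), x) ∈ flowDom Ω F W := by
  have hI := H.involutive hr
  have hK : IsCompact (range ι) := isCompact_range H.contMDiff_ι.continuous
  have h1 : ∀ᶠ v in 𝓝 (0 : Fin s → ℝ), ∀ x ∈ range ι, ((0, v), x) ∈ flowDom Ω F W := by
    refine hK.eventually_forall_of_forall_eventually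
      (P := fun v x => (((0 : ℝ), v), x) ∈ flowDom Ω F W) fun x hx => ?_
    have hc : ContinuousAt (fun z : (Fin s → ℝ) × M => (((0 : ℝ), z.1), z.2)) (0, x) := by fun_prop
    exact hc.eventually (hI.exists_flow_near (q := ((0, 0), x)) H.zero_mem
      (zero_mem_flowDom (H.subset_W hx))).1
  obtain ⟨δ, hδ, h⟩ := Metric.eventually_nhds_iff.1 h1
  exact ⟨δ, hδ, fun x hx v hv => h (by simpa using hv) x hx⟩

/-- Invariance is assumed only for the individual fields `Xᵢ`, so the orbit of `c Xᵢ` is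
reparametrized by `c⁻¹`, of either sign. -/
lemma Hypotheses.flow_single_mem (H : Hypotheses r Ω ε₀ F ι W) (hr : 2 ≤ r) {x : M} (hx : x ∈ range ι)
    {c : ℝ} {i : Fin s} (h : (((0 : ℝ), c • (Pi.single i 1 : Fin s → ℝ)), x) ∈ flowDom Ω F W) :
    flow Ω F W (0, c • (Pi.single i 1 : Fin s → ℝ)) x ∈ range ι := by
  rcases eq_or_ne c 0 with rfl | hc
  · rw [zero_smul, (H.involutive hr).flow_zero H.zero_mem (H.subset_W hx)]
    exact hx
  obtain ⟨γ, h1, h2, h3, h4⟩ := arc_flow h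
  rw [← h4]
  have hm : ∀ t ∈ {t : ℝ | c⁻¹ * t + 0 ∈ Icc (0 : ℝ) 1}, c⁻¹ * t + 0 ∈ Icc (0 : ℝ) 1 :=
    fun t ht => ht
  have h5 : IntegralCurveOn (fun t => γ (c⁻¹ * t + 0)) (ham Ω (F i 0))
      {t : ℝ | c⁻¹ * t + 0 ∈ Icc (0 : ℝ) 1} := by
    have e : (fun x : M => c⁻¹ • combField Ω F (0, c • (Pi.single i 1 : Fin s → ℝ)) x) =
        ham Ω (F i 0) := by
      funext z
      rw [combField_smul, smul_smul, inv_mul_cancel₀ hc, one_smul, combField_single]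
    have := IntegralCurveOn.comp_affine h1 c⁻¹ 0 hm
    rwa [e] at this
  have hord : OrdConnected {t : ℝ | c⁻¹ * t + 0 ∈ Icc (0 : ℝ) 1} := by
    have hcv : Convex ℝ ((LinearMap.mulLeft ℝ c⁻¹) ⁻¹' Icc (0 : ℝ) 1) :=
      (convex_Icc (0 : ℝ) 1).linear_preimage _
    have e : {t : ℝ | c⁻¹ * t + 0 ∈ Icc (0 : ℝ) 1} = (LinearMap.mulLeft ℝ c⁻¹) ⁻¹' Icc (0 : ℝ) 1 := by
      ext t; simp
    rw [e]
    exact hcv.ordConnected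
  have h6 := H.invariant i _ _ hord h5 0 (by simp) (by simpa [h3] using hx) c
    (by simp [inv_mul_cancel₀ hc])
  simpa [inv_mul_cancel₀ hc] using h6

/-- The step `v` is performed coordinate by coordinate. In the sup norm no intermediate time vector
is longer than `v`, so the uniform domain is never left. -/
lemma Hypotheses.flow_mem_of_small (H : Hypotheses r Ω ε₀ F ι W) (hr : 2 ≤ r) {δ : ℝ}
    (hδ : ∀ x ∈ range ι, ∀ v : Fin s → ℝ, ‖v‖ < δ → ((0, v), x) ∈ flowDom Ω F W)
    {x : M} (hx : x ∈ range ι) {v : Fin s → ℝ} (hv : ‖v‖ < δ) : flow Ω F W (0, v) x ∈ range ι := by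
  have hI := H.involutive hr
  have hδ0 : 0 < δ := (norm_nonneg v).trans_lt hv
  set part : Finset (Fin s) → Fin s → ℝ := fun A j => if j ∈ A then v j else 0 with hpart
  have hA : ∀ A : Finset (Fin s), flow Ω F W (0, part A) x ∈ range ι := by
    intro A
    induction A using Finset.induction_on with
    | empty =>
      have e : part ∅ = 0 := by ext j; simp [hpart]
      rw [e, hI.flow_zero H.zero_mem (H.subset_W hx)]
      exact hx
    | insert i A hi ih =>
      have e : part (insert i A) = part A + v i • (Pi.single i 1 : Fin s → ℝ) := by
        ext j
        by_cases hj : j = i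
        · subst hj; simp [hpart, hi]
        · simp [hpart, hj]
      have hseg : ∀ t ∈ Icc (0 : ℝ) 1,
          ((0, part A + t • (v i • (Pi.single i 1 : Fin s → ℝ))), x) ∈ flowDom Ω F W := by
        intro t ht
        refine hδ x hx _ (lt_of_le_of_lt ((pi_norm_le_iff_of_nonneg (norm_nonneg v)).2 fun j => ?_) hv)
        have hvj := norm_le_pi_norm v j
        by_cases hj : j = i
        · subst hj
          simp only [hpart, hi, Pi.add_apply, Pi.smul_apply, if_false, Pi.single_eq_same,
            smul_eq_mul, mul_one, zero_add, norm_mul]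
          refine le_trans (mul_le_of_le_one_left (norm_nonneg _) ?_) hvj
          rw [Real.norm_eq_abs, abs_of_nonneg ht.1]; exact ht.2
        · by_cases hjA : j ∈ A
          · simpa [hpart, hj, hjA] using hvj
          · simp [hpart, hj, hjA]
      obtain ⟨h1, h2⟩ := hI.flow_add H.zero_mem hseg
      rw [e, ← h2]
      exact H.flow_single_mem hr ih h1
  have e : part Finset.univ = v := by ext j; simp [hpart]
  rw [← e]; exact hA _

/-- The torus consists of complete orbits. -/
lemma Hypotheses.completeAt (H : Hypotheses r Ω ε₀ F ι W) (hr : 2 ≤ r) {x : M}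
    (hx : x ∈ range ι) : CompleteAt Ω F W 0 x ∧ ∀ v, flow Ω F W (0, v) x ∈ range ι := by
  obtain ⟨δ, hδ0, hδ⟩ := H.exists_uniform_step hr
  exact (H.involutive hr).completeAt_of_step H.zero_mem hδ0
    (fun x hx v hv => ⟨hδ x hx v hv, H.flow_mem_of_small hr hδ hx hv⟩) hx

/-- The inclusion of the torus read in charts. -/
def inclC (n : ℕ) {M : Type*} [TopologicalSpace M] [ChartedSpace (Model n) M] {s : ℕ}
    {L : Type*} [TopologicalSpace L] [ChartedSpace (EuclideanSpace ℝ (Fin s)) L] (ι : L → M)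
    (x : L) (y : EuclideanSpace ℝ (Fin s)) : Model n :=
  cht (Model n) (ι x) (ι ((cht (EuclideanSpace ℝ (Fin s)) x).symm y))

lemma Hypotheses.inclC_contDiffAt (H : Hypotheses r Ω ε₀ F ι W) (hr : 2 ≤ r) (x : L) :
    ContDiffAt ℝ r (inclC n ι x) (cht (EuclideanSpace ℝ (Fin s)) x x) ∧
    ∃ A : EuclideanSpace ℝ (Fin s) →L[ℝ] Model n, Function.Injective A ∧
      HasStrictFDerivAt (inclC n ι x) A (cht (EuclideanSpace ℝ (Fin s)) x x) := by
  have hI := H.involutive hr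
  have hM1 := hI.isManifold_one
  have hL1 : IsManifold 𝓘(ℝ, EuclideanSpace ℝ (Fin s)) 1 L :=
    IsManifold.of_le (n := r) (by exact_mod_cast hI.one_le)
  set a := cht (EuclideanSpace ℝ (Fin s)) x x with ha
  have hat : a ∈ (cht (EuclideanSpace ℝ (Fin s)) x).target := mem_extChartAt_target x
  have hax : (cht (EuclideanSpace ℝ (Fin s)) x).symm a = x :=
    (cht (EuclideanSpace ℝ (Fin s)) x).left_inv (mem_extChartAt_source x)
  have hsrc : ι x ∈ (cht (Model n) (ι x)).source := mem_extChartAt_source (ι x)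
  have c1 : ContMDiffAt 𝓘(ℝ, EuclideanSpace ℝ (Fin s)) 𝓘(ℝ, EuclideanSpace ℝ (Fin s)) r
      (cht (EuclideanSpace ℝ (Fin s)) x).symm a :=
    (contMDiffOn_extChartAt_symm x).contMDiffAt (cht_target_mem_nhds hat)
  have c2 : ContMDiffAt 𝓘(ℝ, EuclideanSpace ℝ (Fin s)) 𝓘(ℝ, Model n) r
      (fun y => ι ((cht (EuclideanSpace ℝ (Fin s)) x).symm y)) a :=
    ContMDiffAt.comp a (H.contMDiff_ι _) c1
  have c3 : ContMDiffAt 𝓘(ℝ, Model n) 𝓘(ℝ, Model n) r (cht (Model n) (ι x))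
      (ι ((cht (EuclideanSpace ℝ (Fin s)) x).symm a)) := by
    rw [hax]; exact contMDiffAt_extChartAt
  have c4 : ContDiffAt ℝ r (inclC n ι x) a := contMDiffAt_iff_contDiffAt.1 (ContMDiffAt.comp a c3 c2)
  refine ⟨c4, ?_⟩
  have d1 : MDifferentiableAt 𝓘(ℝ, EuclideanSpace ℝ (Fin s)) 𝓘(ℝ, Model n) ι
      ((cht (EuclideanSpace ℝ (Fin s)) x).symm a) := (H.contMDiff_ι _).mdifferentiableAt hI.ne_zero
  have d2 := HasMFDerivAt.comp a d1.hasMFDerivAt (hasMFDerivAt_cht_symm hat)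
  have hsrc' : ι ((cht (EuclideanSpace ℝ (Fin s)) x).symm a) ∈ (cht (Model n) (ι x)).source := by
    rw [hax]; exact hsrc
  have d3 := HasMFDerivAt.comp a (hasMFDerivAt_cht hsrc') d2
  have d4 := hasMFDerivAt_iff_hasFDerivAt.1 d3
  refine ⟨_, ?_, c4.hasStrictFDerivAt' d4 hI.ne_zero⟩
  refine Function.Injective.comp (g := chartD (Model n) (ι x)
    (ι ((cht (EuclideanSpace ℝ (Fin s)) x).symm a))) ?_ (Function.Injective.comp
      (H.immersion_ι _) (f := chartSymmD (EuclideanSpace ℝ (Fin s)) x a) ?_)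
  · exact Function.LeftInverse.injective (g := chartSymmD (Model n) (ι x) (cht (Model n) (ι x)
      (ι ((cht (EuclideanSpace ℝ (Fin s)) x).symm a)))) fun u => chartSymmD_chartD' hsrc' u
  · exact Function.LeftInverse.injective (g := chartD (EuclideanSpace ℝ (Fin s)) x
      ((cht (EuclideanSpace ℝ (Fin s)) x).symm a)) fun u => chartD_chartSymmD hat u

/-- The torus is tangent to the fields. -/
lemma Hypotheses.range_inclC (H : Hypotheses r Ω ε₀ F ι W) (hr : 2 ≤ r) (x : L)
    {A : EuclideanSpace ℝ (Fin s) →L[ℝ] Model n} (hA : Function.Injective A)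
    (hd : HasStrictFDerivAt (inclC n ι x) A (cht (EuclideanSpace ℝ (Fin s)) x x)) :
    LinearMap.range (A : EuclideanSpace ℝ (Fin s) →ₗ[ℝ] Model n) =
      LinearMap.range (((chartD (Model n) (ι x) (ι x)).comp (combL Ω F 0 (ι x)) :
        (Fin s → ℝ) →L[ℝ] Model n) : (Fin s → ℝ) →ₗ[ℝ] Model n) := by
  have hI := H.involutive hr
  have hM1 := hI.isManifold_one
  have hsrc : ι x ∈ (cht (Model n) (ι x)).source := mem_extChartAt_source (ι x)
  obtain ⟨hcomp, hmem⟩ := H.completeAt hr (mem_range_self x)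
  have hinj : Function.Injective ((chartD (Model n) (ι x) (ι x)).comp (combL Ω F 0 (ι x)) :
      (Fin s → ℝ) →L[ℝ] Model n) := by
    refine Function.Injective.comp (g := chartD (Model n) (ι x) (ι x)) ?_
      (hI.combL_injective H.zero_mem hcomp.mem)
    exact Function.LeftInverse.injective (g := chartSymmD (Model n) (ι x) (cht (Model n) (ι x)
      (ι x))) fun u => chartSymmD_chartD' hsrc u
  have hz := hI.flow_zero H.zero_mem hcomp.mem
  refine (Submodule.eq_of_le_of_finrank_eq ?_ ?_).symm
  · rintro _ ⟨v, rfl⟩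
    -- The orbit lifts to a curve in `L`, continuous at zero because `ι` is an embedding. By
    -- `mem_range_of_curve_factors` its velocity is tangent to `Λ`; the reverse inclusion holds
    -- since both spaces have dimension `s`.
    choose σ hσ using fun t : ℝ => hmem (t • v)
    have hstr := (hI.hasStrictFDerivAt_flow_cht H.zero_mem (x₀ := ι x) (hcomp 0)
      (by rw [hz]; exact hsrc)).2.hasFDerivAt
    rw [hz] at hstr
    have hline : HasDerivAt (fun t : ℝ => t • v) v 0 := by
      simpa using (hasDerivAt_id (0 : ℝ)).smul_const v
    have hcur : HasDerivAt (fun t : ℝ => cht (Model n) (ι x) (flow Ω F W (0, t • v) (ι x)))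
        (((chartD (Model n) (ι x) (ι x)).comp (combL Ω F 0 (ι x))) v) 0 := by
      refine HasFDerivAt.comp_hasDerivAt (f := fun t : ℝ => t • v)
        (l := fun v => cht (Model n) (ι x) (flow Ω F W (0, v) (ι x))) 0 ?_ hline
      rw [zero_smul]; exact hstr
    have hσ0 : σ 0 = x := H.injective_ι (by rw [hσ, zero_smul, hz])
    have hσc : ContinuousAt σ 0 := by
      rw [H.isClosedEmbedding.isInducing.continuousAt_iff]
      have e : ι ∘ σ = fun t : ℝ => flow Ω F W (0, t • v) (ι x) := funext hσ
      rw [e]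
      refine ContinuousAt.comp (f := fun t : ℝ => t • v) (g := fun v => flow Ω F W (0, v) (ι x)) ?_
        (by fun_prop)
      exact (hI.contMDiffAt_flow_vec H.zero_mem (hcomp _)).continuousAt
    have hσC : ContinuousAt (fun t => cht (EuclideanSpace ℝ (Fin s)) x (σ t)) 0 := by
      refine ContinuousAt.comp (g := cht (EuclideanSpace ℝ (Fin s)) x) ?_ hσc
      rw [hσ0]; exact continuousAt_extChartAt x
    have hev : ∀ᶠ t in 𝓝 (0 : ℝ), cht (Model n) (ι x) (flow Ω F W (0, t • v) (ι x)) =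
        inclC n ι x (cht (EuclideanSpace ℝ (Fin s)) x (σ t)) := by
      have hs : ∀ᶠ t in 𝓝 (0 : ℝ), σ t ∈ (cht (EuclideanSpace ℝ (Fin s)) x).source := by
        refine hσc.eventually (p := fun z => z ∈ (cht (EuclideanSpace ℝ (Fin s)) x).source) ?_
        rw [hσ0]
        exact (isOpen_extChartAt_source x).mem_nhds (mem_extChartAt_source x)
      filter_upwards [hs] with t ht
      rw [inclC, (cht (EuclideanSpace ℝ (Fin s)) x).left_inv ht, hσ]
    have hlim : Filter.Tendsto (fun t => cht (EuclideanSpace ℝ (Fin s)) x (σ t))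
        (𝓝[univ \ {0}] 0) (𝓝 (cht (EuclideanSpace ℝ (Fin s)) x x)) := by
      have := hσC.tendsto
      rw [hσ0] at this
      exact this.mono_left nhdsWithin_le_nhds
    have hne : (𝓝[univ \ {(0 : ℝ)}] 0).NeBot := by
      rw [← compl_eq_univ_sdiff]; infer_instance
    refine mem_range_of_curve_factors hd.hasFDerivAt hA hlim (hcur.hasDerivWithinAt (s := univ)) ?_
      (hev.filter_mono nhdsWithin_le_nhds)
    have := hev.self_of_nhds
    rwa [hσ0] at this
  · rw [LinearMap.finrank_range_of_inj hinj, LinearMap.finrank_range_of_inj hA]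
    simp

end Torus


/-! ### Local injectivity from injectivity of the derivative. -/

section LocalInverse

variable {G E : Type*} [NormedAddCommGroup G] [NormedSpace ℝ G] [FiniteDimensional ℝ G]
  [NormedAddCommGroup E] [NormedSpace ℝ E] [FiniteDimensional ℝ E]

lemma exists_leftInverse_clm {A : G →L[ℝ] E} (hA : Function.Injective A) :
    ∃ l : E →L[ℝ] G, ∀ v, l (A v) = v := by
  obtain ⟨l, hl⟩ := LinearMap.exists_leftInverse_of_injective (A : G →ₗ[ℝ] E)
    (LinearMap.ker_eq_bot.2 hA)
  exact ⟨LinearMap.toContinuousLinearMap l, fun v => LinearMap.congr_fun hl v⟩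

lemma exists_rightInverse_clm {A : E →L[ℝ] G} (hA : Function.Surjective A) :
    ∃ l : G →L[ℝ] E, ∀ v, A (l v) = v := by
  obtain ⟨l, hl⟩ := LinearMap.exists_rightInverse_of_surjective (A : E →ₗ[ℝ] G)
    (LinearMap.range_eq_top.2 hA)
  exact ⟨LinearMap.toContinuousLinearMap l, fun v => LinearMap.congr_fun hl v⟩

/-- Composed with a left inverse of `A`, the map has the identity as derivative, and the inverse
function theorem applies. -/
lemma exists_injOn_of_hasStrictFDerivAt {f : G → E} {A : G →L[ℝ] E} {a : G}
    (hf : HasStrictFDerivAt f A a) (hA : Function.Injective A) : ∃ U ∈ 𝓝 a, InjOn f U := by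
  have := FiniteDimensional.complete ℝ G
  obtain ⟨l, hl⟩ := exists_leftInverse_clm hA
  have h1 : HasStrictFDerivAt (fun x => l (f x)) (l.comp A) a := l.hasStrictFDerivAt.comp a hf
  have h2 : l.comp A = (ContinuousLinearEquiv.refl ℝ G : G →L[ℝ] G) := by ext v; exact hl v
  rw [h2] at h1
  refine ⟨_, (h1.toOpenPartialHomeomorph _).open_source.mem_nhds
    (h1.mem_toOpenPartialHomeomorph_source), fun x hx y hy hxy => ?_⟩
  refine (h1.toOpenPartialHomeomorph _).injOn hx hy ?_
  simp only [HasStrictFDerivAt.toOpenPartialHomeomorph_coe]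
  rw [hxy]

end LocalInverse

/-! ### `Λ` as a single orbit, its period lattice and its monodromy. -/

section Torus

variable {n : ℕ} {M : Type*} [TopologicalSpace M] [ChartedSpace (Model n) M]
  {s : ℕ} {r : ℕ∞} {Ω : M → Model n →L[ℝ] Model n →L[ℝ] ℝ} {ε₀ : ℝ} {F : Fin s → ℝ → M → ℝ}
  {W : Set M} {L : Type*} [TopologicalSpace L] [ChartedSpace (EuclideanSpace ℝ (Fin s)) L]
  {ι : L → M} [T2Space M] [IsManifold (𝓡 (2 * n)) r M]

lemma Involutive.chart_combL_injective (H : Involutive r Ω ε₀ F W) {ε : ℝ} (hε : ε ∈ Ioo (-ε₀) ε₀)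
    {x x₀ : M} (hx : x ∈ W) (hs : x ∈ (cht (Model n) x₀).source) :
    Function.Injective ((chartD (Model n) x₀ x).comp (combL Ω F ε x) :
      (Fin s → ℝ) →L[ℝ] Model n) := by
  have hM1 := H.isManifold_one
  refine Function.Injective.comp (g := chartD (Model n) x₀ x) ?_ (H.combL_injective hε hx)
  exact Function.LeftInverse.injective (g := chartSymmD (Model n) x₀ (cht (Model n) x₀ x))
    fun u => chartSymmD_chartD' hs u

/-- Small times are not periods. -/
lemma Involutive.eq_zero_of_small_period (H : Involutive r Ω ε₀ F W) {ε : ℝ}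
    (hε : ε ∈ Ioo (-ε₀) ε₀) {x : M} (hx : x ∈ W) :
    ∃ δ > 0, ∀ v : Fin s → ℝ, ‖v‖ < δ → flow Ω F W (ε, v) x = x → v = 0 := by
  have hz := H.flow_zero hε hx
  have hs : x ∈ (cht (Model n) x).source := mem_extChartAt_source x
  have h1 := (H.hasStrictFDerivAt_flow_cht hε (x₀ := x) (zero_mem_flowDom (F := F) (Ω := Ω) hx)
    (by rw [hz]; exact hs)).2
  rw [hz] at h1
  obtain ⟨U, hU, hinj⟩ := exists_injOn_of_hasStrictFDerivAt h1 (H.chart_combL_injective hε hx hs)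
  obtain ⟨δ, hδ, hball⟩ := Metric.mem_nhds_iff.1 hU
  refine ⟨δ, hδ, fun v hv he => hinj (hball (by simpa using hv)) (mem_of_mem_nhds hU) ?_⟩
  simp only
  rw [he, hz]

variable [IsManifold (𝓡 s) r L] [CompactSpace L]

/-- Nearby points of the torus are on the same orbit. -/
lemma Hypotheses.local_transitive (H : Hypotheses r Ω ε₀ F ι W) (hr : 2 ≤ r) (x : L) {ρ : ℝ}
    (hρ : 0 < ρ) :
    ∀ᶠ y in 𝓝 x, ∃ v : Fin s → ℝ, ‖v‖ < ρ ∧ ι y = flow Ω F W (0, v) (ι x) := by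
  have hI := H.involutive hr
  have hM1 := hI.isManifold_one
  obtain ⟨hcomp, hmem⟩ := H.completeAt hr (mem_range_self x)
  have hsrc : ι x ∈ (cht (Model n) (ι x)).source := mem_extChartAt_source (ι x)
  have hz := hI.flow_zero H.zero_mem hcomp.mem
  have hCinj := hI.chart_combL_injective H.zero_mem hcomp.mem hsrc
  set C : (Fin s → ℝ) →L[ℝ] Model n := (chartD (Model n) (ι x) (ι x)).comp (combL Ω F 0 (ι x))
    with hC
  -- The projection `l` is injective on the tangent space of `Λ`. Seen through it the inclusion is
  -- locally injective and the orbit map is locally onto; comparing the two puts nearby points of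
  -- `Λ` on the orbit.
  obtain ⟨l, hl⟩ := exists_leftInverse_clm hCinj
  obtain ⟨-, A, hA, hAd⟩ := H.inclC_contDiffAt hr x
  have hrange := H.range_inclC hr x hA hAd
  have hlA : Function.Injective (l.comp A) := by
    rw [injective_iff_map_eq_zero]
    intro u hu
    have h1 : A u ∈ LinearMap.range (A : EuclideanSpace ℝ (Fin s) →ₗ[ℝ] Model n) := ⟨u, rfl⟩
    rw [hrange] at h1
    obtain ⟨v, hv⟩ := h1
    have hv' : C v = A u := hv
    have h2 : l (A u) = 0 := hu
    rw [← hv', hl] at h2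
    rw [h2, map_zero] at hv'
    exact hA (by rw [← hv', map_zero])
  obtain ⟨U, hU, hUinj⟩ := exists_injOn_of_hasStrictFDerivAt
    (l.hasStrictFDerivAt.comp _ hAd) hlA
  have h1 := (hI.hasStrictFDerivAt_flow_cht H.zero_mem (x₀ := ι x) (hcomp 0)
    (by rw [hz]; exact hsrc)).2
  rw [hz] at h1
  have h2 : HasStrictFDerivAt (fun v => l (cht (Model n) (ι x) (flow Ω F W (0, v) (ι x))))
      (ContinuousLinearEquiv.refl ℝ (Fin s → ℝ) : (Fin s → ℝ) →L[ℝ] (Fin s → ℝ)) 0 := by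
    have h3 := l.hasStrictFDerivAt.comp (0 : Fin s → ℝ) h1
    refine h3.congr_fderiv ?_
    ext v
    exact congrFun (hl _) _
  have hopen := h2.map_nhds_eq_of_equiv
  choose σ hσ using hmem
  have hσ0 : σ 0 = x := H.injective_ι (by rw [hσ, hz])
  have hσc : ContinuousAt σ 0 := by
    rw [H.isClosedEmbedding.isInducing.continuousAt_iff]
    have e : ι ∘ σ = fun v => flow Ω F W (0, v) (ι x) := funext hσ
    rw [e]
    exact (hI.contMDiffAt_flow_vec H.zero_mem (hcomp _)).continuousAt
  set S : Set L := (cht (EuclideanSpace ℝ (Fin s)) x).source ∩ {y | cht (EuclideanSpace ℝ (Fin s)) x y ∈ U}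
    with hS
  have hSn : S ∈ 𝓝 x :=
    Filter.inter_mem ((isOpen_extChartAt_source x).mem_nhds (mem_extChartAt_source x))
      ((continuousAt_extChartAt x).eventually hU)
  have hgood : {v : Fin s → ℝ | ‖v‖ < ρ ∧ σ v ∈ S} ∈ 𝓝 (0 : Fin s → ℝ) := by
    refine Filter.inter_mem ?_ ?_
    · exact continuous_norm.continuousAt.eventually (gt_mem_nhds (by simpa using hρ))
    · refine hσc.eventually (p := fun z => z ∈ S) ?_
      rw [hσ0]; exact hSn
  have himg := Filter.image_mem_map (m := fun v => l (cht (Model n) (ι x) (flow Ω F W (0, v) (ι x))))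
    hgood
  rw [hopen, hz] at himg
  have hcont : ContinuousAt (fun y => l (cht (Model n) (ι x) (ι y))) x := by
    refine ContinuousAt.comp (g := l) l.continuous.continuousAt ?_
    exact ContinuousAt.comp (g := cht (Model n) (ι x)) (continuousAt_extChartAt (ι x))
      H.contMDiff_ι.continuous.continuousAt
  filter_upwards [hcont.eventually himg, hSn] with y hy hyS
  obtain ⟨v, ⟨hvρ, hvS⟩, hv⟩ := hy
  refine ⟨v, hvρ, ?_⟩
  rw [← hσ]
  congr 1
  refine (cht (EuclideanSpace ℝ (Fin s)) x).injOn hyS.1 hvS.1 (hUinj hyS.2 hvS.2 ?_)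
  simp only [inclC]
  rw [(cht (EuclideanSpace ℝ (Fin s)) x).left_inv hyS.1,
    (cht (EuclideanSpace ℝ (Fin s)) x).left_inv hvS.1, hσ]
  exact hv.symm

/-- The torus is a single orbit. -/
lemma Hypotheses.transitive [ConnectedSpace L] (H : Hypotheses r Ω ε₀ F ι W) (hr : 2 ≤ r)
    (x y : L) : ∃ v : Fin s → ℝ, ι y = flow Ω F W (0, v) (ι x) := by
  have hI := H.involutive hr
  have hcomp := fun x => (H.completeAt hr (mem_range_self (f := ι) x)).1
  set O : Set L := {y | ∃ v : Fin s → ℝ, ι y = flow Ω F W (0, v) (ι x)} with hO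
  have h1 : IsOpen O := by
    rw [isOpen_iff_mem_nhds]
    rintro y ⟨v, hv⟩
    filter_upwards [H.local_transitive hr y one_pos] with z hz
    obtain ⟨w, -, hw⟩ := hz
    exact ⟨v + w, by rw [hw, hv, hI.flow_flow H.zero_mem (hcomp x)]⟩
  have h2 : IsOpen Oᶜ := by
    rw [isOpen_iff_mem_nhds]
    intro y hy
    filter_upwards [H.local_transitive hr y one_pos] with z hz hzO
    obtain ⟨w, -, hw⟩ := hz
    obtain ⟨v, hv⟩ := hzO
    refine hy ⟨v + -w, ?_⟩
    rw [← hI.flow_flow H.zero_mem (hcomp x), ← hv, hw, hI.flow_flow H.zero_mem (hcomp y),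
      add_neg_cancel, hI.flow_zero H.zero_mem (hcomp y).mem]
  have h3 : IsClopen O := ⟨isOpen_compl_iff.1 h2, h1⟩
  have h4 : O = univ := h3.eq_univ ⟨x, 0, (hI.flow_zero H.zero_mem (hcomp x).mem).symm⟩
  have : y ∈ O := h4 ▸ mem_univ y
  exact this

/-- The period group is discrete because the action is locally free. It is cobounded because, by
transitivity and compactness, every point of `Λ` is reached by a time vector of bounded norm. -/
lemma Hypotheses.exists_period_basis [ConnectedSpace L] (H : Hypotheses r Ω ε₀ F ι W)
    (hr : 2 ≤ r) (x : L) :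
    ∃ b : Module.Basis (Fin s) ℝ (Fin s → ℝ), ∀ v, flow Ω F W (0, v) (ι x) = ι x ↔
      ∃ z : Fin s → ℤ, v = ∑ j, (z j : ℝ) • b j := by
  have hI := H.involutive hr
  obtain ⟨hcomp, hmem⟩ := H.completeAt hr (mem_range_self (f := ι) x)
  obtain ⟨δ, hδ, hdisc⟩ := hI.eq_zero_of_small_period H.zero_mem hcomp.mem
  obtain ⟨R, hR⟩ : ∃ R : ℝ, ∀ y ∈ (univ : Set L), ∃ v : Fin s → ℝ, ‖v‖ ≤ R ∧
      ι y = flow Ω F W (0, v) (ι x) := by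
    refine isCompact_univ.induction_on (p := fun S : Set L => ∃ R : ℝ, ∀ y ∈ S, ∃ v : Fin s → ℝ,
      ‖v‖ ≤ R ∧ ι y = flow Ω F W (0, v) (ι x)) ⟨0, by simp⟩ ?_ ?_ ?_
    · rintro S T hST ⟨R, hR⟩
      exact ⟨R, fun y hy => hR y (hST hy)⟩
    · rintro S T ⟨R, hR⟩ ⟨R', hR'⟩
      refine ⟨max R R', ?_⟩
      rintro y (hy | hy)
      · obtain ⟨v, h1, h2⟩ := hR y hy
        exact ⟨v, h1.trans (le_max_left _ _), h2⟩
      · obtain ⟨v, h1, h2⟩ := hR' y hy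
        exact ⟨v, h1.trans (le_max_right _ _), h2⟩
    · intro y _
      obtain ⟨v, hv⟩ := H.transitive hr x y
      refine ⟨_, nhdsWithin_le_nhds (H.local_transitive hr y one_pos), ‖v‖ + 1, ?_⟩
      rintro z ⟨w, hw, hz⟩
      refine ⟨v + w, (norm_add_le _ _).trans (by linarith), ?_⟩
      rw [hz, hv, hI.flow_flow H.zero_mem hcomp]
  refine exists_basis_of_discrete_of_cobounded (hI.periods H.zero_mem hcomp) hδ
    (fun v hv hv' => hdisc v hv' hv) (R := R) fun v => ?_
  obtain ⟨y, hy⟩ := hmem v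
  obtain ⟨u, hu, hu'⟩ := hR y trivial
  refine ⟨v - u, ?_, by simpa using hu⟩
  rw [← hI.flow_eq_flow_iff H.zero_mem hcomp, ← hu', hy]

lemma Hypotheses.F_const [ConnectedSpace L] (H : Hypotheses r Ω ε₀ F ι W) (hr : 2 ≤ r)
    (x y : L) (i : Fin s) : F i 0 (ι y) = F i 0 (ι x) := by
  obtain ⟨v, hv⟩ := H.transitive hr x y
  rw [hv]
  exact (H.involutive hr).F_flow H.zero_mem ((H.completeAt hr (mem_range_self x)).1 v) i

/-- The monodromy is the derivative of the flow. -/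
lemma Hypotheses.exists_floquet (H : Hypotheses r Ω ε₀ F ι W) (hr : 2 ≤ r) :
    ∃ (x : L) (c : Fin s → ℝ), flow Ω F W (0, c) (ι x) = ι x ∧
      (mD (Model n) (flow Ω F W (0, c)) (ι x) : Model n →ₗ[ℝ] Model n).charpoly.rootMultiplicity 1
        = 2 * s := by
  have hI := H.involutive hr
  have hM1 := hI.isManifold_one
  obtain ⟨c, hc, x, hx⟩ := H.floquet
  have hcomp := (H.completeAt hr (mem_range_self (f := ι) x)).1
  -- `timeMap` follows curves that are free to leave `W`. Uniqueness identifies such a curve with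
  -- the orbit inside `W` whenever the latter exists up to time one.
  have huniq : ∀ z q : M, ((0, c), z) ∈ flowDom Ω F W →
      FlowsTo (n := n) (combField Ω F (0, c)) 1 z q → q = flow Ω F W (0, c) z := by
    rintro z q hz ⟨γ, h1, h2, h3⟩
    rw [uIcc_of_le zero_le_one] at h1
    obtain ⟨γ', h1', -, h3', h4'⟩ := arc_flow hz
    rw [← h3, ← h4']
    exact IntegralCurveOn.eqOn_Icc (hI.fieldC1 H.zero_mem c) h1 h1' (h2.trans h3'.symm)
      (right_mem_Icc.2 zero_le_one)
  have hflows : ∀ z : M, ((0, c), z) ∈ flowDom Ω F W →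
      timeMap (n := n) (combField Ω F (0, c)) 1 z = flow Ω F W (0, c) z := by
    intro z hz
    have hex : ∃ q, FlowsTo (n := n) (combField Ω F (0, c)) 1 z q := by
      obtain ⟨γ', h1', -, h3', h4'⟩ := arc_flow hz
      refine ⟨_, γ', ?_, h3', rfl⟩
      rw [uIcc_of_le zero_le_one]; exact h1'
    have he : timeMap (n := n) (combField Ω F (0, c)) 1 z = hex.choose := dif_pos hex
    rw [he]
    exact huniq z _ hz hex.choose_spec
  refine ⟨x, c, (huniq _ _ (hcomp c) (hc x)).symm, ?_⟩
  have hev : timeMap (n := n) (combField Ω F (0, c)) 1 =ᶠ[𝓝 (ι x)] flow Ω F W (0, c) := by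
    have hcont : ContinuousAt (fun z : M => (((0 : ℝ), c), z)) (ι x) := by fun_prop
    filter_upwards [hcont.eventually (hI.exists_flow_near H.zero_mem (hcomp c)).1] with z hz
    exact hflows z hz
  have hmono : monodromy (n := n) (combField Ω F (0, c)) 1 (ι x) =
      mD (Model n) (flow Ω F W (0, c)) (ι x) := hev.mfderiv_eq
  have hx' : (monodromy (n := n) (combField Ω F (0, c)) 1
    (ι x)).toLinearMap.charpoly.rootMultiplicity 1 = 2 * s := hx
  rw [hmono] at hx'
  exact hx'

end Torus


lemma exists_equiv_of_injective {G : Type*} [NormedAddCommGroup G] [NormedSpace ℝ G]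
    [FiniteDimensional ℝ G] {A : G →L[ℝ] G} (hA : ∀ u, A u = 0 → u = 0) :
    ∃ e : G ≃L[ℝ] G, (e : G →L[ℝ] G) = A := by
  have hinj : Function.Injective (A : G →ₗ[ℝ] G) :=
    (injective_iff_map_eq_zero _).2 hA
  refine ⟨(LinearEquiv.ofInjectiveEndo (A : G →ₗ[ℝ] G) hinj).toContinuousLinearEquiv, ?_⟩
  ext u
  rfl

/-! ### The flow and the map `F^ε` read in one chart. -/

section ChartFlow

variable {n : ℕ} {M : Type*} [TopologicalSpace M] [ChartedSpace (Model n) M]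
  {s : ℕ} {r : ℕ∞} {Ω : M → Model n →L[ℝ] Model n →L[ℝ] ℝ} {ε₀ : ℝ} {F : Fin s → ℝ → M → ℝ}
  {W : Set M}

/-- The flow read in the chart at `x₀`, as a function of `((ε, v), y)`. -/
def flowC (Ω : M → Model n →L[ℝ] Model n →L[ℝ] ℝ) (F : Fin s → ℝ → M → ℝ) (W : Set M) (x₀ : M)
    (q : (ℝ × (Fin s → ℝ)) × Model n) : Model n :=
  cht (Model n) x₀ (flow Ω F W q.1 ((cht (Model n) x₀).symm q.2))

/-- The set where `flowC` is defined. -/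
def flowCDom (Ω : M → Model n →L[ℝ] Model n →L[ℝ] ℝ) (ε₀ : ℝ) (F : Fin s → ℝ → M → ℝ) (W : Set M)
    (x₀ : M) : Set ((ℝ × (Fin s → ℝ)) × Model n) :=
  {q | q.1.1 ∈ Ioo (-ε₀) ε₀ ∧ q.2 ∈ (cht (Model n) x₀).target ∧
    (q.1, (cht (Model n) x₀).symm q.2) ∈ flowDom Ω F W ∧
    flow Ω F W q.1 ((cht (Model n) x₀).symm q.2) ∈ (cht (Model n) x₀).source}

/-- The map `F^ε` read in the chart at `x₀`. -/
def mapC (F : Fin s → ℝ → M → ℝ) (x₀ : M) (q : ℝ × Model n) : Fin s → ℝ :=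
  fun i => F i q.1 ((cht (Model n) x₀).symm q.2)

variable [T2Space M] [IsManifold (𝓡 (2 * n)) r M]

lemma Involutive.contDiffOn_mapC (H : Involutive r Ω ε₀ F W) (x₀ : M) :
    ContDiffOn ℝ r (mapC F x₀) (Ioo (-ε₀) ε₀ ×ˢ (cht (Model n) x₀).target) :=
  contDiffOn_pi.2 fun i => H.contDiffOn_chart i x₀

lemma Involutive.fderiv_mapC (H : Involutive r Ω ε₀ F W) {x₀ : M} {q : ℝ × Model n}
    (hε : q.1 ∈ Ioo (-ε₀) ε₀) (hy : q.2 ∈ (cht (Model n) x₀).target) (u : Model n) :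
    fderiv ℝ (mapC F x₀) q (0, u) =
      dF F q.1 ((cht (Model n) x₀).symm q.2) (chartSymmD (Model n) x₀ q.2 u) := by
  have := H.isManifold_one
  have hopen : IsOpen (Ioo (-ε₀) ε₀ ×ˢ (cht (Model n) x₀).target) :=
    isOpen_Ioo.prod (isOpen_extChartAt_target x₀)
  have h1 := (((H.contDiffOn_mapC x₀).contDiffAt (hopen.mem_nhds ⟨hε, hy⟩)).differentiableAt
    H.ne_zero).hasFDerivAt
  have h2 := HasFDerivAt.comp (f := fun y : Model n => (q.1, y)) q.2 h1
    (hasFDerivAt_prodMk_right (𝕜 := ℝ) q.1 q.2)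
  have h3 : HasFDerivAt (fun y : Model n => mapC F x₀ (q.1, y))
      (ContinuousLinearMap.pi fun i => (dfun (F i q.1) ((cht (Model n) x₀).symm q.2)).comp
        (chartSymmD (Model n) x₀ q.2)) q.2 :=
    hasFDerivAt_pi.2 fun i => fderiv_comp_cht_symm hy (H.mdifferentiableAt i hε _)
  have h4 := h2.unique h3
  exact congrArg (fun A : Model n →L[ℝ] (Fin s → ℝ) => A u) h4

lemma Involutive.contMDiffAt_flow_cht_symm (H : Involutive r Ω ε₀ F W) {x₀ : M}
    {q : (ℝ × (Fin s → ℝ)) × Model n} (h1 : q.1.1 ∈ Ioo (-ε₀) ε₀)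
    (h2 : q.2 ∈ (cht (Model n) x₀).target)
    (h3 : (q.1, (cht (Model n) x₀).symm q.2) ∈ flowDom Ω F W) :
    (∀ᶠ z in 𝓝 q, (z.1, (cht (Model n) x₀).symm z.2) ∈ flowDom Ω F W) ∧
    ContMDiffAt 𝓘(ℝ, (ℝ × (Fin s → ℝ)) × Model n) 𝓘(ℝ, Model n) (r - 1 : ℕ∞)
      (fun q : (ℝ × (Fin s → ℝ)) × Model n => flow Ω F W q.1 ((cht (Model n) x₀).symm q.2)) q := by
  have hMk : IsManifold 𝓘(ℝ, Model n) (r - 1 : ℕ∞) M :=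
    IsManifold.of_le (n := r) (by exact_mod_cast tsub_le_self)
  obtain ⟨e1, e2, -⟩ := H.exists_flow_near h1 h3
  have c0 : ContMDiffAt 𝓘(ℝ, (ℝ × (Fin s → ℝ)) × Model n) 𝓘(ℝ, Model n) (r - 1 : ℕ∞)
      (fun q : (ℝ × (Fin s → ℝ)) × Model n => (cht (Model n) x₀).symm q.2) q :=
    ContMDiffAt.comp q (g := (cht (Model n) x₀).symm)
      ((contMDiffOn_extChartAt_symm x₀).contMDiffAt (cht_target_mem_nhds h2))
      contDiff_snd.contMDiff.contMDiffAt
  have c1 : ContMDiffAt 𝓘(ℝ, (ℝ × (Fin s → ℝ)) × Model n)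
      (𝓘(ℝ, ℝ × (Fin s → ℝ)).prod 𝓘(ℝ, Model n)) (r - 1 : ℕ∞)
      (fun q : (ℝ × (Fin s → ℝ)) × Model n => (q.1, (cht (Model n) x₀).symm q.2)) q :=
    ContMDiffAt.prodMk contDiff_fst.contMDiff.contMDiffAt c0
  have c2 : ContMDiffAt 𝓘(ℝ, (ℝ × (Fin s → ℝ)) × Model n) 𝓘(ℝ, Model n) (r - 1 : ℕ∞)
      (fun q : (ℝ × (Fin s → ℝ)) × Model n => flow Ω F W q.1 ((cht (Model n) x₀).symm q.2)) q :=
    ContMDiffAt.comp q (g := fun q : (ℝ × (Fin s → ℝ)) × M => flow Ω F W q.1 q.2)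
      (f := fun q : (ℝ × (Fin s → ℝ)) × Model n => (q.1, (cht (Model n) x₀).symm q.2)) e2 c1
  refine ⟨?_, c2⟩
  have hc : ContinuousAt (fun q : (ℝ × (Fin s → ℝ)) × Model n =>
    (q.1, (cht (Model n) x₀).symm q.2)) q := c1.continuousAt
  exact hc.eventually e1

lemma Involutive.flowCDom_mem_nhds (H : Involutive r Ω ε₀ F W) {x₀ : M}
    {q : (ℝ × (Fin s → ℝ)) × Model n} (hq : q ∈ flowCDom Ω ε₀ F W x₀) :
    flowCDom Ω ε₀ F W x₀ ∈ 𝓝 q := by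
  obtain ⟨h1, h2, h3, h4⟩ := hq
  obtain ⟨n3, c2⟩ := H.contMDiffAt_flow_cht_symm h1 h2 h3
  have n1 : ∀ᶠ z in 𝓝 q, z.1.1 ∈ Ioo (-ε₀) ε₀ :=
    (continuousAt_fst.fst : ContinuousAt (fun z : (ℝ × (Fin s → ℝ)) × Model n => z.1.1) q).eventually
      (isOpen_Ioo.mem_nhds h1)
  have n2 : ∀ᶠ z in 𝓝 q, z.2 ∈ (cht (Model n) x₀).target :=
    (continuousAt_snd : ContinuousAt (fun z : (ℝ × (Fin s → ℝ)) × Model n => z.2) q).eventually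
      (cht_target_mem_nhds h2)
  have hc : ContinuousAt (fun q : (ℝ × (Fin s → ℝ)) × Model n =>
    flow Ω F W q.1 ((cht (Model n) x₀).symm q.2)) q := c2.continuousAt
  have n4 := hc.eventually (cht_source_mem_nhds h4)
  exact n1.and (n2.and (n3.and n4))

lemma Involutive.contDiffAt_flowC (H : Involutive r Ω ε₀ F W) {x₀ : M}
    {q : (ℝ × (Fin s → ℝ)) × Model n} (hq : q ∈ flowCDom Ω ε₀ F W x₀) :
    ContDiffAt ℝ (r - 1 : ℕ∞) (flowC Ω F W x₀) q := by
  have hMk : IsManifold 𝓘(ℝ, Model n) (r - 1 : ℕ∞) M :=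
    IsManifold.of_le (n := r) (by exact_mod_cast tsub_le_self)
  obtain ⟨h1, h2, h3, h4⟩ := hq
  have c2 := (H.contMDiffAt_flow_cht_symm h1 h2 h3).2
  have c3 : ContMDiffAt 𝓘(ℝ, Model n) 𝓘(ℝ, Model n) (r - 1 : ℕ∞) (cht (Model n) x₀)
      (flow Ω F W q.1 ((cht (Model n) x₀).symm q.2)) :=
    contMDiffAt_extChartAt' (by rwa [extChartAt_source] at h4)
  exact contMDiffAt_iff_contDiffAt.1 (ContMDiffAt.comp q c3 c2)

lemma Involutive.isOpen_flowCDom (H : Involutive r Ω ε₀ F W) (x₀ : M) :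
    IsOpen (flowCDom Ω ε₀ F W x₀) :=
  isOpen_iff_mem_nhds.2 fun _ hq => H.flowCDom_mem_nhds hq

lemma Involutive.contDiffOn_flowC (H : Involutive r Ω ε₀ F W) (x₀ : M) :
    ContDiffOn ℝ (r - 1 : ℕ∞) (flowC Ω F W x₀) (flowCDom Ω ε₀ F W x₀) :=
  fun _ hq => (H.contDiffAt_flowC hq).contDiffWithinAt

/-- Variation of the time vector contributes the fields at the endpoint, and variation of the
initial point the differential of the flow. No variation of `ε` appears: in the implicit function
arguments `ε` is carried along unchanged. -/
lemma Involutive.fderiv_flowC (H : Involutive r Ω ε₀ F W) {x₀ : M} {ε : ℝ} {v : Fin s → ℝ}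
    {y : Model n} (hq : ((ε, v), y) ∈ flowCDom Ω ε₀ F W x₀) (w : Fin s → ℝ) (u : Model n) :
    fderiv ℝ (flowC Ω F W x₀) ((ε, v), y) ((0, w), u) =
      chartD (Model n) x₀ (flow Ω F W (ε, v) ((cht (Model n) x₀).symm y))
        (combL Ω F ε (flow Ω F W (ε, v) ((cht (Model n) x₀).symm y)) w +
        mD (Model n) (flow Ω F W (ε, v)) ((cht (Model n) x₀).symm y)
          (chartSymmD (Model n) x₀ y u)) := by
  have hM1 := H.isManifold_one
  obtain ⟨h1, h2, h3, h4⟩ := id hq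
  simp only at h1 h2 h3 h4
  have hd := ((H.contDiffAt_flowC hq).differentiableAt H.pred_ne_zero).hasFDerivAt
  have e : (((0 : ℝ), w), u) = ((0, w), 0) + ((0, (0 : Fin s → ℝ)), u) := by simp
  rw [e, map_add, map_add]
  congr 1
  · have hc : HasFDerivAt (fun v : Fin s → ℝ => ((ε, v), y))
        ((ContinuousLinearMap.inl ℝ (ℝ × (Fin s → ℝ)) (Model n)).comp
          (ContinuousLinearMap.inr ℝ ℝ (Fin s → ℝ))) v :=
      HasFDerivAt.comp (f := fun v : Fin s → ℝ => (ε, v)) v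
        (hasFDerivAt_prodMk_left (𝕜 := ℝ) (ε, v) y) (hasFDerivAt_prodMk_right (𝕜 := ℝ) ε v)
    have h5 := HasFDerivAt.comp (f := fun v : Fin s → ℝ => ((ε, v), y)) v hd hc
    have h6 := (H.hasStrictFDerivAt_flow_cht h1 h3 h4).2.hasFDerivAt
    exact congrArg (fun A : (Fin s → ℝ) →L[ℝ] Model n => A w) (h5.unique h6)
  · have h5 := HasFDerivAt.comp (f := fun y : Model n => ((ε, v), y)) y hd
      (hasFDerivAt_prodMk_right (𝕜 := ℝ) (ε, v) y)
    have g1 := (H.mdifferentiableAt_flow (p := (ε, v)) h1 h3).hasMFDerivAt.comp y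
      (hasMFDerivAt_cht_symm h2)
    have g2 := (hasMFDerivAt_cht h4).comp y g1
    have h6 := hasMFDerivAt_iff_hasFDerivAt.1 g2
    exact congrArg (fun A : Model n →L[ℝ] Model n => A u) (h5.unique h6)

end ChartFlow


/-! ### Persistence of the orbits with period near `c`. -/

section Family

variable {n : ℕ} {M : Type*} [TopologicalSpace M] [ChartedSpace (Model n) M]
  {s : ℕ} {r : ℕ∞} {Ω : M → Model n →L[ℝ] Model n →L[ℝ] ℝ} {ε₀ : ℝ} {F : Fin s → ℝ → M → ℝ}
  {W : Set M} [T2Space M] [IsManifold (𝓡 (2 * n)) r M]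

lemma mem_flowCDom_of_period (h0 : (0 : ℝ) ∈ Ioo (-ε₀) ε₀) {m : M} (hm : CompleteAt Ω F W 0 m)
    {v : Fin s → ℝ} (hv : flow Ω F W (0, v) m = m) :
    ((0, v), cht (Model n) m m) ∈ flowCDom Ω ε₀ F W m := by
  have hs : m ∈ (cht (Model n) m).source := mem_extChartAt_source m
  have hsymm : (cht (Model n) m).symm (cht (Model n) m m) = m := (cht (Model n) m).left_inv hs
  refine ⟨h0, mem_extChartAt_target m, ?_, ?_⟩
  · simp only; rw [hsymm]; exact hm v
  · simp only; rw [hsymm, hv]; exact hs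

lemma flowC_of_period {m : M} {v : Fin s → ℝ} (hv : flow Ω F W (0, v) m = m) :
    flowC Ω F W m ((0, v), cht (Model n) m m) = cht (Model n) m m := by
  have hs : m ∈ (cht (Model n) m).source := mem_extChartAt_source m
  simp only [flowC]
  rw [(cht (Model n) m).left_inv hs, hv]

/-- The return times to the section `l = const`, near a period. -/
lemma Involutive.exists_return_time (H : Involutive r Ω ε₀ F W) (h0 : (0 : ℝ) ∈ Ioo (-ε₀) ε₀)
    {m : M} (hm : CompleteAt Ω F W 0 m) {v₀ : Fin s → ℝ} (hv₀ : flow Ω F W (0, v₀) m = m)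
    {l : Model n →L[ℝ] (Fin s → ℝ)}
    (hl : ∀ v, l (chartD (Model n) m m (combL Ω F 0 m v)) = v) :
    ∃ (O : Set (ℝ × Model n)) (t : ℝ × Model n → Fin s → ℝ), IsOpen O ∧
      (0, cht (Model n) m m) ∈ O ∧ ContDiffOn ℝ (r - 1 : ℕ∞) t O ∧ t (0, cht (Model n) m m) = v₀ ∧
      ∀ q ∈ O, ((q.1, t q), q.2) ∈ flowCDom Ω ε₀ F W m ∧
        l (flowC Ω F W m ((q.1, t q), q.2) - cht (Model n) m m) = 0 := by
  set y₀ := cht (Model n) m m with hy₀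
  have hs : m ∈ (cht (Model n) m).source := mem_extChartAt_source m
  have hsymm : (cht (Model n) m).symm y₀ = m := (cht (Model n) m).left_inv hs
  set a : (ℝ × (Fin s → ℝ)) × Model n := ((0, v₀), y₀) with ha
  have haD : a ∈ flowCDom Ω ε₀ F W m := mem_flowCDom_of_period h0 hm hv₀
  -- `ε` and the initial point are carried along, and the time vector is adjusted to hit the
  -- section. By `hl` the derivative of this equation in the time vector is the identity.
  set Φ : (ℝ × (Fin s → ℝ)) × Model n → (ℝ × (Fin s → ℝ)) × Model n := fun q =>
    ((q.1.1, l (flowC Ω F W m q - y₀)), q.2) with hΦ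
  have hΦd : ContDiffOn ℝ (r - 1 : ℕ∞) Φ (flowCDom Ω ε₀ F W m) :=
    (contDiff_fst.fst.contDiffOn.prodMk (l.contDiff.comp_contDiffOn
      ((H.contDiffOn_flowC m).sub contDiffOn_const))).prodMk contDiff_snd.contDiffOn
  have hfd := ((H.contDiffAt_flowC haD).differentiableAt H.pred_ne_zero).hasFDerivAt
  set D := fderiv ℝ (flowC Ω F W m) a with hD
  have hΦf : HasFDerivAt Φ (((ContinuousLinearMap.fst ℝ ℝ (Fin s → ℝ)).comp
      (ContinuousLinearMap.fst ℝ (ℝ × (Fin s → ℝ)) (Model n))).prod (l.comp D) |>.prod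
      (ContinuousLinearMap.snd ℝ (ℝ × (Fin s → ℝ)) (Model n))) a :=
    (hasFDerivAt_fst.fst.prodMk (l.hasFDerivAt.comp a (hfd.sub_const y₀))).prodMk hasFDerivAt_snd
  obtain ⟨f', hf'⟩ := exists_equiv_of_injective (A := ((ContinuousLinearMap.fst ℝ ℝ (Fin s → ℝ)).comp
      (ContinuousLinearMap.fst ℝ (ℝ × (Fin s → ℝ)) (Model n))).prod (l.comp D) |>.prod
      (ContinuousLinearMap.snd ℝ (ℝ × (Fin s → ℝ)) (Model n))) (by
    rintro ⟨⟨e, w⟩, u⟩ hu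
    simp only [ContinuousLinearMap.prod_apply, Prod.mk_eq_zero, ContinuousLinearMap.comp_apply,
      ContinuousLinearMap.coe_fst', ContinuousLinearMap.coe_snd'] at hu
    obtain ⟨⟨rfl, h2⟩, rfl⟩ := hu
    rw [hD, ha, H.fderiv_flowC haD, hsymm, hv₀, map_zero, map_zero, add_zero, hl] at h2
    simp [h2])
  rw [← hf'] at hΦf
  obtain ⟨e, he, hae, hesub, hesymm, -⟩ := exists_inverse_on_nhds H.one_le_pred
    (H.isOpen_flowCDom m) hΦd haD hΦf
  have hea : e a = ((0, 0), y₀) := by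
    rw [he, hΦ]
    simp only [ha]
    rw [flowC_of_period hv₀]
    simp [hy₀]
  set j : ℝ × Model n → (ℝ × (Fin s → ℝ)) × Model n := fun q => ((q.1, 0), q.2) with hj
  have hjd : ContDiff ℝ (r - 1 : ℕ∞) j := (contDiff_fst.prodMk contDiff_const).prodMk contDiff_snd
  refine ⟨j ⁻¹' e.target, fun q => (e.symm (j q)).1.2, e.open_target.preimage hjd.continuous, ?_,
    ?_, ?_, ?_⟩
  · change j (0, y₀) ∈ e.target
    have : j (0, y₀) = e a := hea.symm
    rw [this]; exact e.map_source hae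
  · exact (hesymm.comp hjd.contDiffOn (fun q hq => hq)).fst.snd
  · have : j (0, y₀) = e a := hea.symm
    simp only
    rw [this, e.left_inv hae]
  · intro q hq
    have hsrc := e.map_target hq
    have h1 : Φ (e.symm (j q)) = j q := by rw [← he, e.right_inv hq]
    have h2 : (e.symm (j q)).1.1 = q.1 := congrArg (fun z => z.1.1) h1
    have h3 : (e.symm (j q)).2 = q.2 := congrArg (fun z => z.2) h1
    have h4 : e.symm (j q) = ((q.1, (e.symm (j q)).1.2), q.2) := by
      rw [← h2, ← h3]
    have h5 : l (flowC Ω F W m (e.symm (j q)) - y₀) = 0 := congrArg (fun z => z.1.2) h1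
    rw [← h4]
    exact ⟨hesub hsrc, h5⟩

/-- The periodic orbits with period close to `c` form a family parametrized by `ε` and the values
of `F^ε`. -/
lemma Involutive.exists_fixed_family (H : Involutive r Ω ε₀ F W) (h0 : (0 : ℝ) ∈ Ioo (-ε₀) ε₀)
    {m : M} (hm : CompleteAt Ω F W 0 m) {c : Fin s → ℝ} (hc : flow Ω F W (0, c) m = m)
    (hmult : (mD (Model n) (flow Ω F W (0, c)) m :
      Model n →ₗ[ℝ] Model n).charpoly.rootMultiplicity 1 = 2 * s)
    {l : Model n →L[ℝ] (Fin s → ℝ)}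
    (hl : ∀ v, l (chartD (Model n) m m (combL Ω F 0 m v)) = v) :
    ∃ (N : Set ((ℝ × (Fin s → ℝ)) × Model n)) (O : Set (ℝ × (Fin s → ℝ)))
      (Y : ℝ × (Fin s → ℝ) → Model n) (T : ℝ × (Fin s → ℝ) → Fin s → ℝ),
      N ∈ 𝓝 ((0, c), cht (Model n) m m) ∧ IsOpen O ∧ (0, fun i => F i 0 m) ∈ O ∧
      ContDiffOn ℝ (r - 1 : ℕ∞) Y O ∧ ContDiffOn ℝ (r - 1 : ℕ∞) T O ∧
      Y (0, fun i => F i 0 m) = cht (Model n) m m ∧ T (0, fun i => F i 0 m) = c ∧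
      ∀ q ∈ O, ((q.1, T q), Y q) ∈ flowCDom Ω ε₀ F W m ∧
        flowC Ω F W m ((q.1, T q), Y q) = Y q ∧ mapC F m (q.1, Y q) = q.2 ∧
        ∀ y, ((q.1, T q), y) ∈ N → l (y - cht (Model n) m m) = 0 → mapC F m (q.1, y) = q.2 →
          flowC Ω F W m ((q.1, T q), y) = y → y = Y q := by
  have hM1 := H.isManifold_one
  set y₀ := cht (Model n) m m with hy₀
  set β₀ : Fin s → ℝ := fun i => F i 0 m with hβ₀
  have hs : m ∈ (cht (Model n) m).source := mem_extChartAt_source m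
  have ht : y₀ ∈ (cht (Model n) m).target := mem_extChartAt_target m
  have hsymm : (cht (Model n) m).symm y₀ = m := (cht (Model n) m).left_inv hs
  set a : (ℝ × (Fin s → ℝ)) × Model n := ((0, c), y₀) with ha
  have haD : a ∈ flowCDom Ω ε₀ F W m := mem_flowCDom_of_period h0 hm hc
  have hmapC0 : mapC F m (0, y₀) = β₀ := by
    funext i; simp only [mapC]; rw [hsymm]
  have hopenT : IsOpen (Ioo (-ε₀) ε₀ ×ˢ (cht (Model n) m).target) :=
    isOpen_Ioo.prod (isOpen_extChartAt_target m)
  set G : Model n →L[ℝ] (Fin s → ℝ) := (dF F 0 m).comp (chartSymmD (Model n) m y₀) with hG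
  have hmapCd : ContDiffAt ℝ r (mapC F m) (0, y₀) :=
    (H.contDiffOn_mapC m).contDiffAt (hopenT.mem_nhds ⟨h0, ht⟩)
  have hmapCf := (hmapCd.differentiableAt H.ne_zero).hasFDerivAt
  have hmapG : ∀ u, fderiv ℝ (mapC F m) (0, y₀) (0, u) = G u := by
    intro u
    rw [H.fderiv_mapC (q := (0, y₀)) h0 ht u]
    simp only; rw [hsymm]; rfl
  have hGs : Function.Surjective G := by
    intro w
    obtain ⟨u, rfl⟩ := H.dF_surjective h0 hm.mem w
    refine ⟨chartD (Model n) m m u, ?_⟩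
    change dF F 0 m (chartSymmD (Model n) m y₀ (chartD (Model n) m m u)) = _
    rw [chartSymmD_chartD' hs]
  -- The model space splits into `ker G` and the range of `σ`. As the flow preserves `F^ε`, the full
  -- fixed point equation together with `F^ε = β` would be overdetermined; the former is imposed
  -- only in its `π` component, the latter fills the range of `σ`.
  obtain ⟨σ, hσ⟩ := exists_rightInverse_clm hGs
  set π : Model n →L[ℝ] Model n := ContinuousLinearMap.id ℝ _ - σ.comp G with hπ
  have hπa : ∀ u, π u = u - σ (G u) := fun u => rfl
  have hGπ : ∀ u, G (π u) = 0 := fun u => by rw [hπa, map_sub, hσ, sub_self]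
  set A : (Fin s → ℝ) →L[ℝ] Model n := (chartD (Model n) m m).comp (combL Ω F 0 m) with hA
  have hAinj : Function.Injective A := H.chart_combL_injective h0 hm.mem hs
  have hGA : ∀ v, G (A v) = 0 := by
    intro v
    change dF F 0 m (chartSymmD (Model n) m y₀ (chartD (Model n) m m (combL Ω F 0 m v))) = 0
    rw [chartSymmD_chartD' hs, H.dF_combL h0 hm.mem]
  set D₀ : Model n →L[ℝ] Model n := mD (Model n) (flow Ω F W (0, c)) m with hD₀
  have hcm := H.mD_flow_combField h0 (hm c)
  rw [hc] at hcm
  -- The use of the multiplicity `2s`, transported to the chart: within `ker G`, the only vectors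
  -- that the monodromy moves by an orbit direction are the orbit directions themselves.
  have hnd : ∀ u v, G u = 0 → chartD (Model n) m m (D₀ (chartSymmD (Model n) m y₀ u)) - u = A v →
      ∃ w, u = A w := by
    intro u v hu huv
    have key := mem_range_of_rootMultiplicity (D := (D₀ : Model n →ₗ[ℝ] Model n))
      (A := (combL Ω F 0 m : (Fin s → ℝ) →ₗ[ℝ] Model n))
      (G := (dF (n := n) F 0 m).toLinearMap) (H.combL_injective h0 hm.mem)
      (H.dF_surjective h0 hm.mem)
      (fun v => by
        have := hcm.2 v
        rw [← combL_apply] at this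
        exact this)
      (fun u => funext fun i => hcm.1 i u)
      (fun v => H.dF_combL h0 hm.mem v) (by simpa using hmult)
      (u := chartSymmD (Model n) m y₀ u) hu (v := v) (by
        have h1 := congrArg (chartSymmD (Model n) m y₀) huv
        change chartSymmD (Model n) m y₀ (_ - u) = chartSymmD (Model n) m y₀
          (chartD (Model n) m m (combL Ω F 0 m v)) at h1
        rw [map_sub, chartSymmD_chartD' hs, chartSymmD_chartD' hs] at h1
        exact h1)
    obtain ⟨w, hw⟩ := key
    refine ⟨w, ?_⟩
    have hw' : combL Ω F 0 m w = chartSymmD (Model n) m y₀ u := hw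
    change u = chartD (Model n) m m (combL Ω F 0 m w)
    rw [hw']
    exact (chartD_chartSymmD' hs u).symm
  -- local injectivity of `(ε, y) ↦ (ε, π y + σ F^ε(y))`
  obtain ⟨U, hU, hUinj⟩ : ∃ U ∈ 𝓝 ((0 : ℝ), y₀), InjOn (fun q : ℝ × Model n =>
      (q.1, π q.2 + σ (mapC F m q))) U := by
    refine exists_injOn_of_hasStrictFDerivAt (A := (ContinuousLinearMap.fst ℝ ℝ (Model n)).prod
      (π.comp (ContinuousLinearMap.snd ℝ ℝ (Model n)) + σ.comp (fderiv ℝ (mapC F m) (0, y₀)))) ?_ ?_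
    · exact hasStrictFDerivAt_fst.prodMk ((π.hasStrictFDerivAt.comp _ hasStrictFDerivAt_snd).add
        (σ.hasStrictFDerivAt.comp _ (hmapCd.hasStrictFDerivAt H.ne_zero)))
    · rw [injective_iff_map_eq_zero]
      rintro ⟨e, u⟩ hu
      simp only [ContinuousLinearMap.prod_apply, Prod.mk_eq_zero, ContinuousLinearMap.comp_apply,
        ContinuousLinearMap.coe_fst', ContinuousLinearMap.coe_snd', _root_.add_apply] at hu
      obtain ⟨rfl, h2⟩ := hu
      rw [hmapG, hπa, sub_add_cancel] at h2
      rw [h2]; rfl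
  -- the equation for the fixed points
  set Φ : (ℝ × (Fin s → ℝ)) × Model n → (ℝ × (Fin s → ℝ)) × Model n := fun q =>
    ((q.1.1, l (q.2 - y₀)), π (flowC Ω F W m q - q.2) + σ (mapC F m (q.1.1, q.2) - β₀)) with hΦ
  have hpr : ContDiff ℝ (r - 1 : ℕ∞) (fun q : (ℝ × (Fin s → ℝ)) × Model n => (q.1.1, q.2)) :=
    contDiff_fst.fst.prodMk contDiff_snd
  have hΦd : ContDiffOn ℝ (r - 1 : ℕ∞) Φ (flowCDom Ω ε₀ F W m) := by
    refine ContDiffOn.prodMk (contDiff_fst.fst.contDiffOn.prodMk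
      (l.contDiff.comp (contDiff_snd.sub contDiff_const)).contDiffOn) (ContDiffOn.add ?_ ?_)
    · exact π.contDiff.comp_contDiffOn ((H.contDiffOn_flowC m).sub contDiff_snd.contDiffOn)
    · refine σ.contDiff.comp_contDiffOn (ContDiffOn.sub ?_ contDiffOn_const)
      exact ((H.contDiffOn_mapC m).of_le (by exact_mod_cast tsub_le_self)).comp hpr.contDiffOn
        fun q hq => ⟨hq.1, hq.2.1⟩
  have hfd := ((H.contDiffAt_flowC haD).differentiableAt H.pred_ne_zero).hasFDerivAt
  set D := fderiv ℝ (flowC Ω F W m) a with hD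
  set p₁ : (ℝ × (Fin s → ℝ)) × Model n →L[ℝ] ℝ := (ContinuousLinearMap.fst ℝ ℝ (Fin s → ℝ)).comp
      (ContinuousLinearMap.fst ℝ (ℝ × (Fin s → ℝ)) (Model n)) with hp₁
  set p₂ := ContinuousLinearMap.snd ℝ (ℝ × (Fin s → ℝ)) (Model n) with hp₂
  set Φ' := (p₁.prod (l.comp p₂)).prod (π.comp (D - p₂) +
    σ.comp ((fderiv ℝ (mapC F m) (0, y₀)).comp (p₁.prod p₂))) with hΦ'
  have hΦf : HasFDerivAt Φ Φ' a := by
    refine HasFDerivAt.prodMk (hasFDerivAt_fst.fst.prodMk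
      (l.hasFDerivAt.comp a (hasFDerivAt_snd.sub_const y₀))) (HasFDerivAt.add ?_ ?_)
    · exact π.hasFDerivAt.comp a (hfd.sub hasFDerivAt_snd)
    · refine σ.hasFDerivAt.comp a (HasFDerivAt.sub_const β₀ ?_)
      exact HasFDerivAt.comp (f := fun q : (ℝ × (Fin s → ℝ)) × Model n => (q.1.1, q.2)) a hmapCf
        (hasFDerivAt_fst.fst.prodMk hasFDerivAt_snd)
  -- In the kernel of the linearization, `u` lies in `ker G` and is an orbit direction by `hnd`. The
  -- section condition then gives `u = 0`, and independence of the fields gives `w = 0`.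
  obtain ⟨f', hf'⟩ := exists_equiv_of_injective (A := Φ') (by
    rintro ⟨⟨e, w⟩, u⟩ hu
    simp only [hΦ', hp₁, hp₂, ContinuousLinearMap.prod_apply, Prod.mk_eq_zero,
      ContinuousLinearMap.comp_apply, ContinuousLinearMap.coe_fst', ContinuousLinearMap.coe_snd',
      _root_.add_apply, _root_.sub_apply] at hu
    obtain ⟨⟨rfl, h2⟩, h3⟩ := hu
    rw [hmapG] at h3
    have hGu : G u = 0 := by
      have := congrArg G h3
      rwa [map_add, hGπ, hσ, map_zero, zero_add] at this
    have hDw : D ((0, w), u) = A w + chartD (Model n) m m (D₀ (chartSymmD (Model n) m y₀ u)) := by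
      rw [hD, ha, H.fderiv_flowC haD, hsymm, hc, map_add]
      rfl
    have hGD : G (D ((0, w), u) - u) = 0 := by
      rw [map_sub, hGu, hDw, map_add, hGA, sub_zero, zero_add]
      change dF F 0 m (chartSymmD (Model n) m y₀ (chartD (Model n) m m _)) = 0
      rw [chartSymmD_chartD' hs]
      refine (funext fun i => hcm.1 i _ : dF F 0 m (D₀ (chartSymmD (Model n) m y₀ u)) =
        dF F 0 m (chartSymmD (Model n) m y₀ u)).trans hGu
    rw [hGu, map_zero, add_zero, hπa, hGD, map_zero, sub_zero, hDw] at h3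
    obtain ⟨z, rfl⟩ := hnd u (-w) hGu (by
      rw [map_neg, eq_neg_iff_add_eq_zero, ← h3]; abel)
    have hz : z = 0 := by
      have : l (A z) = 0 := h2
      rwa [show l (A z) = z from hl z] at this
    subst hz
    rw [map_zero, map_zero, map_zero, map_zero, add_zero, sub_zero] at h3
    have hw : w = 0 := hAinj (by rw [h3, map_zero])
    rw [hw, map_zero]; rfl)
  rw [← hf'] at hΦf
  obtain ⟨e, he, hae, hesub, hesymm, -⟩ := exists_inverse_on_nhds H.one_le_pred
    (H.isOpen_flowCDom m) hΦd haD hΦf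
  have hea : e a = ((0, 0), 0) := by
    rw [he, hΦ]
    simp only [ha]
    rw [flowC_of_period hc, hmapC0, ← hy₀]
    simp
  set j : ℝ × (Fin s → ℝ) → (ℝ × (Fin s → ℝ)) × Model n := fun q => ((q.1, 0), σ (q.2 - β₀))
    with hj
  have hjd : ContDiff ℝ (r - 1 : ℕ∞) j :=
    (contDiff_fst.prodMk contDiff_const).prodMk (σ.contDiff.comp (contDiff_snd.sub contDiff_const))
  have hj0 : j (0, β₀) = e a := by rw [hea]; simp [hj]
  set O₁ : Set (ℝ × (Fin s → ℝ)) := j ⁻¹' e.target with hO₁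
  have hO₁o : IsOpen O₁ := e.open_target.preimage hjd.continuous
  have h0O₁ : (0, β₀) ∈ O₁ := by
    change j (0, β₀) ∈ e.target
    rw [hj0]; exact e.map_source hae
  have hYd : ContDiffOn ℝ (r - 1 : ℕ∞) (fun q => e.symm (j q)) O₁ :=
    hesymm.comp hjd.contDiffOn (fun q hq => hq)
  have hval : e.symm (j (0, β₀)) = a := by rw [hj0, e.left_inv hae]
  -- the points where `flowC` fixes `Y`
  have hcont : ContinuousAt (fun q => e.symm (j q)) (0, β₀) :=
    (hYd.continuousOn).continuousAt (hO₁o.mem_nhds h0O₁)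
  have hev1 : ∀ᶠ q in 𝓝 ((0 : ℝ), β₀), (q.1, (e.symm (j q)).2) ∈ U := by
    have hc1 : ContinuousAt (fun q : ℝ × (Fin s → ℝ) => (q.1, (e.symm (j q)).2)) (0, β₀) :=
      continuousAt_fst.prodMk hcont.snd
    refine hc1.eventually (p := fun z => z ∈ U) ?_
    simp only; rw [hval]; exact hU
  have hev2 : ∀ᶠ q in 𝓝 ((0 : ℝ), β₀), (q.1, flowC Ω F W m (e.symm (j q))) ∈ U := by
    have hc2 : ContinuousAt (fun q : ℝ × (Fin s → ℝ) => flowC Ω F W m (e.symm (j q))) (0, β₀) := by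
      refine ContinuousAt.comp (g := flowC Ω F W m) (f := fun q => e.symm (j q)) ?_ hcont
      rw [hval]
      exact (H.contDiffAt_flowC haD).continuousAt
    have hc1 : ContinuousAt (fun q : ℝ × (Fin s → ℝ) => (q.1, flowC Ω F W m (e.symm (j q))))
        (0, β₀) := continuousAt_fst.prodMk hc2
    refine hc1.eventually (p := fun z => z ∈ U) ?_
    simp only; rw [hval, flowC_of_period hc]; exact hU
  obtain ⟨O₂, hO₂sub, hO₂o, h0O₂⟩ := mem_nhds_iff.1 (hev1.and hev2)
  refine ⟨e.source, O₁ ∩ O₂, fun q => (e.symm (j q)).2, fun q => (e.symm (j q)).1.2,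
    e.open_source.mem_nhds hae, hO₁o.inter hO₂o, ⟨h0O₁, h0O₂⟩,
    (hYd.mono inter_subset_left).snd, (hYd.mono inter_subset_left).fst.snd, ?_, ?_, ?_⟩
  · simp only; rw [hval]
  · simp only; rw [hval]
  rintro q ⟨hq1, hq2⟩
  obtain ⟨hqU, hqU'⟩ := hO₂sub hq2
  have hsrc := e.map_target hq1
  have hdom := hesub hsrc
  have h1 : Φ (e.symm (j q)) = j q := by rw [← he, e.right_inv hq1]
  have h2 : (e.symm (j q)).1.1 = q.1 := congrArg (fun z => z.1.1) h1
  have h4 : ((q.1, (e.symm (j q)).1.2), (e.symm (j q)).2) = e.symm (j q) := by rw [← h2]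
  have h5 : π (flowC Ω F W m (e.symm (j q)) - (e.symm (j q)).2) +
      σ (mapC F m ((e.symm (j q)).1.1, (e.symm (j q)).2) - β₀) = σ (q.2 - β₀) :=
    congrArg (fun z => z.2) h1
  rw [h2] at h5
  have h6 : mapC F m (q.1, (e.symm (j q)).2) = q.2 := by
    have := congrArg G h5
    rw [map_add, hGπ, hσ, hσ, zero_add] at this
    exact sub_left_injective this
  have h7 : π (flowC Ω F W m (e.symm (j q))) = π (e.symm (j q)).2 := by
    rw [h6, add_eq_right, map_sub, sub_eq_zero] at h5
    exact h5
  have h8 : mapC F m (q.1, flowC Ω F W m (e.symm (j q))) = q.2 := by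
    rw [← h6]
    funext i
    simp only [mapC, flowC]
    rw [(cht (Model n) m).left_inv hdom.2.2.2]
    have h9 := H.F_flow (v := (e.symm (j q)).1.2) (ε := q.1) (h2 ▸ hdom.1)
      (x := (cht (Model n) m).symm (e.symm (j q)).2) (by
        have := hdom.2.2.1
        rw [← h4] at this
        exact this) i
    rw [← h9]
    congr 2
    rw [← h2]
  -- Only the `π` component of the fixed point equation has been solved. The point and its image
  -- also share their value of `F^ε`, so the local injectivity of `(ε, π y + σ F^ε(y))` makes them
  -- equal.
  have h10 : flowC Ω F W m (e.symm (j q)) = (e.symm (j q)).2 := by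
    have := hUinj hqU' hqU (by simp only; rw [h7, h8, h6])
    exact congrArg Prod.snd this
  refine ⟨h4 ▸ hdom, by rw [h4]; exact h10, h6, fun y hy hy1 hy2 hy3 => ?_⟩
  have h11 : ((q.1, (e.symm (j q)).1.2), y) = e.symm (j q) := by
    refine e.injOn hy hsrc ?_
    rw [e.right_inv hq1, he, hΦ]
    simp only
    rw [hy1, hy3, hy2]
    simp [hj]
  exact congrArg Prod.snd h11

end Family


/-! ### Persistence of the whole period lattice. -/

section Family

variable {n : ℕ} {M : Type*} [TopologicalSpace M] [ChartedSpace (Model n) M]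
  {s : ℕ} {r : ℕ∞} {Ω : M → Model n →L[ℝ] Model n →L[ℝ] ℝ} {ε₀ : ℝ} {F : Fin s → ℝ → M → ℝ}
  {W : Set M}

/-- A family of invariant tori indexed by `q = (ε, β) ∈ O`: the torus is the orbit of the point
with coordinates `Y q` in the chart at `m`, and `τ₁ q, …, τ_s q` generate its periods. -/
structure TorusData (r : ℕ∞) (Ω : M → Model n →L[ℝ] Model n →L[ℝ] ℝ) (ε₀ : ℝ)
    (F : Fin s → ℝ → M → ℝ) (W : Set M) (m : M) (O : Set (ℝ × (Fin s → ℝ)))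
    (Y : ℝ × (Fin s → ℝ) → Model n) (τ : Fin s → ℝ × (Fin s → ℝ) → Fin s → ℝ) : Prop where
  isOpen : IsOpen O
  contDiffOn_Y : ContDiffOn ℝ (r - 1 : ℕ∞) Y O
  contDiffOn_τ : ∀ j, ContDiffOn ℝ (r - 1 : ℕ∞) (τ j) O
  mem_Ioo : ∀ q ∈ O, q.1 ∈ Ioo (-ε₀) ε₀
  mem_target : ∀ q ∈ O, Y q ∈ (cht (Model n) m).target
  complete : ∀ q ∈ O, CompleteAt Ω F W q.1 ((cht (Model n) m).symm (Y q))
  F_eq : ∀ q ∈ O, ∀ i, F i q.1 ((cht (Model n) m).symm (Y q)) = q.2 i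
  independent : ∀ q ∈ O, LinearIndependent ℝ (fun j => τ j q)
  flow_eq_iff : ∀ q ∈ O, ∀ v,
    flow Ω F W (q.1, v) ((cht (Model n) m).symm (Y q)) = (cht (Model n) m).symm (Y q) ↔
      ∃ z : Fin s → ℤ, v = ∑ j, (z j : ℝ) • τ j q

variable [T2Space M] [IsManifold (𝓡 (2 * n)) r M]

/-- Commutation is needed before completeness of the perturbed orbits is known, so existence is
assumed only for time vectors in a ball. -/
lemma Involutive.flow_comm_of_ball (H : Involutive r Ω ε₀ F W) {ε : ℝ} (hε : ε ∈ Ioo (-ε₀) ε₀)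
    {p : M} {R : ℝ} (hdom : ∀ v : Fin s → ℝ, ‖v‖ ≤ R → ((ε, v), p) ∈ flowDom Ω F W)
    {v w : Fin s → ℝ} (h : ‖v‖ + ‖w‖ ≤ R) :
    ((ε, w), flow Ω F W (ε, v) p) ∈ flowDom Ω F W ∧
    flow Ω F W (ε, w) (flow Ω F W (ε, v) p) = flow Ω F W (ε, v) (flow Ω F W (ε, w) p) := by
  have key : ∀ a b : Fin s → ℝ, ‖a‖ + ‖b‖ ≤ R → ∀ t ∈ Icc (0 : ℝ) 1,
      ((ε, a + t • b), p) ∈ flowDom Ω F W := by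
    intro a b hab t ht
    refine hdom _ (le_trans (norm_add_le _ _) (le_trans ?_ hab))
    rw [norm_smul, Real.norm_eq_abs, abs_of_nonneg ht.1]
    have := mul_le_of_le_one_left (norm_nonneg b) ht.2
    linarith
  obtain ⟨h1, h2⟩ := H.flow_add hε (key v w h)
  obtain ⟨-, h3⟩ := H.flow_add hε (key w v (by linarith))
  exact ⟨h1, by rw [h2, h3, add_comm]⟩

/-- From completeness at the unperturbed point, openness of the domain and compactness of the ball
give nearby orbits up to any prescribed length `R`. This is turned into completeness later, by the
periods. -/
lemma Involutive.eventually_closedBall_mem_flowDom (H : Involutive r Ω ε₀ F W) {Z : Type*}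
    [TopologicalSpace Z] {a : Z} {e : Z → ℝ} {p : Z → M} (he : ContinuousAt e a)
    (hp : ContinuousAt p a) (hε : e a ∈ Ioo (-ε₀) ε₀) (ha : CompleteAt Ω F W (e a) (p a)) (R : ℝ) :
    ∀ᶠ q in 𝓝 a, ∀ v ∈ Metric.closedBall (0 : Fin s → ℝ) R, ((e q, v), p q) ∈ flowDom Ω F W := by
  refine (isCompact_closedBall (0 : Fin s → ℝ) R).eventually_forall_of_forall_eventually
    (P := fun q v => ((e q, v), p q) ∈ flowDom Ω F W) fun v _ => ?_
  have he' : ContinuousAt (fun z : Z × (Fin s → ℝ) => e z.1) (a, v) :=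
    ContinuousAt.comp (f := fun z : Z × (Fin s → ℝ) => z.1) (g := e) he continuousAt_fst
  have hp' : ContinuousAt (fun z : Z × (Fin s → ℝ) => p z.1) (a, v) :=
    ContinuousAt.comp (f := fun z : Z × (Fin s → ℝ) => z.1) (g := p) hp continuousAt_fst
  exact ((he'.prodMk continuousAt_snd).prodMk hp').eventually
    (H.exists_flow_near (q := ((e a, v), p a)) hε (ha v)).1

/-- All periods of the unperturbed torus persist. -/
lemma Involutive.exists_periodic_family (H : Involutive r Ω ε₀ F W) (h0 : (0 : ℝ) ∈ Ioo (-ε₀) ε₀)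
    {m : M} (hm : CompleteAt Ω F W 0 m) {c : Fin s → ℝ} (hc : flow Ω F W (0, c) m = m)
    (hmult : (mD (Model n) (flow Ω F W (0, c)) m :
      Model n →ₗ[ℝ] Model n).charpoly.rootMultiplicity 1 = 2 * s)
    {b : Fin s → Fin s → ℝ} (hb : ∀ j, flow Ω F W (0, b j) m = m) (R : ℝ) :
    ∃ (O : Set (ℝ × (Fin s → ℝ))) (Y : ℝ × (Fin s → ℝ) → Model n)
      (τ : Fin s → ℝ × (Fin s → ℝ) → Fin s → ℝ),
      IsOpen O ∧ (0, fun i => F i 0 m) ∈ O ∧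
      ContDiffOn ℝ (r - 1 : ℕ∞) Y O ∧ (∀ j, ContDiffOn ℝ (r - 1 : ℕ∞) (τ j) O) ∧
      Y (0, fun i => F i 0 m) = cht (Model n) m m ∧ (∀ j, τ j (0, fun i => F i 0 m) = b j) ∧
      ∀ q ∈ O, q.1 ∈ Ioo (-ε₀) ε₀ ∧ Y q ∈ (cht (Model n) m).target ∧
        (∀ v : Fin s → ℝ, ‖v‖ ≤ R → ((q.1, v), (cht (Model n) m).symm (Y q)) ∈ flowDom Ω F W) ∧
        (∀ i, F i q.1 ((cht (Model n) m).symm (Y q)) = q.2 i) ∧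
        ∀ j, flow Ω F W (q.1, τ j q) ((cht (Model n) m).symm (Y q)) =
          (cht (Model n) m).symm (Y q) := by
  have hs : m ∈ (cht (Model n) m).source := mem_extChartAt_source m
  obtain ⟨l, hl⟩ := exists_leftInverse_clm (H.chart_combL_injective h0 hm.mem hs)
  obtain ⟨N, O₁, Y, T, hN, hO₁, h0O₁, hY, hT, hY0, hT0, hq⟩ :=
    H.exists_fixed_family h0 hm hc hmult (l := l) hl
  -- The spectral hypothesis is used for `c` alone. For `b j` there is at this point only a return
  -- time to the section, not yet a period.
  choose O' t hO' h0O' ht ht0 hqt using fun j => H.exists_return_time h0 hm (hb j) (l := l) hl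
  set y₀ := cht (Model n) m m with hy₀
  have hsymm : (cht (Model n) m).symm y₀ = m := (cht (Model n) m).left_inv hs
  set β₀ : Fin s → ℝ := fun i => F i 0 m with hβ₀
  set g : ℝ × (Fin s → ℝ) → ℝ × Model n := fun q => (q.1, Y q) with hg
  have hgd : ContDiffOn ℝ (r - 1 : ℕ∞) g O₁ := contDiff_fst.contDiffOn.prodMk hY
  have hg0 : g (0, β₀) = (0, y₀) := by simp [hg, hY0]
  set O₂ : Set (ℝ × (Fin s → ℝ)) := {q | q ∈ O₁ ∧ ∀ j, g q ∈ O' j} with hO₂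
  have hO₂o : IsOpen O₂ := by
    have : O₂ = O₁ ∩ g ⁻¹' (⋂ j, O' j) := by ext q; simp [hO₂]
    rw [this]
    exact hgd.continuousOn.isOpen_inter_preimage hO₁ (isOpen_iInter_of_finite hO')
  have h0O₂ : (0, β₀) ∈ O₂ := ⟨h0O₁, fun j => by rw [hg0]; exact h0O' j⟩
  have hτd : ∀ j, ContDiffOn ℝ (r - 1 : ℕ∞) (fun q => t j (g q)) O₂ := fun j =>
    (ht j).comp (hgd.mono fun q hq => hq.1) fun q hq => hq.2 j
  have hτ0 : ∀ j, t j (g (0, β₀)) = b j := fun j => by rw [hg0, ht0]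
  have hnhds : O₂ ∈ 𝓝 (0, β₀) := hO₂o.mem_nhds h0O₂
  have hYc : ContinuousAt Y (0, β₀) := hY.continuousOn.continuousAt (hO₁.mem_nhds h0O₁)
  have hTc : ContinuousAt T (0, β₀) := hT.continuousOn.continuousAt (hO₁.mem_nhds h0O₁)
  have hτc : ∀ j, ContinuousAt (fun q => t j (g q)) (0, β₀) := fun j =>
    (hτd j).continuousOn.continuousAt hnhds
  have hpc : ContinuousAt (fun q => (cht (Model n) m).symm (Y q)) (0, β₀) := by
    refine ContinuousAt.comp (g := (cht (Model n) m).symm) ?_ hYc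
    rw [hY0]
    exact continuousAt_extChartAt_symm m
  -- Long enough for the time `T q` and a return time, performed in either order.
  set R₁ : ℝ := max R (‖c‖ + 1 + ∑ j, (‖b j‖ + 1)) with hR₁
  have e1 : ∀ᶠ q in 𝓝 ((0 : ℝ), β₀), ∀ v ∈ Metric.closedBall (0 : Fin s → ℝ) R₁,
      ((q.1, v), (cht (Model n) m).symm (Y q)) ∈ flowDom Ω F W := by
    refine H.eventually_closedBall_mem_flowDom (a := ((0 : ℝ), β₀)) (e := Prod.fst)
      continuousAt_fst hpc h0 ?_ R₁
    change CompleteAt Ω F W 0 ((cht (Model n) m).symm (Y (0, β₀)))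
    rw [hY0, hsymm]
    exact hm
  have e2 : ∀ᶠ q in 𝓝 ((0 : ℝ), β₀), ‖T q‖ < ‖c‖ + 1 := by
    refine hTc.norm.eventually (gt_mem_nhds ?_)
    change ‖T (0, β₀)‖ < _
    rw [hT0]; linarith
  have e3 : ∀ᶠ q in 𝓝 ((0 : ℝ), β₀), ∀ j, ‖t j (g q)‖ < ‖b j‖ + 1 := by
    refine Filter.eventually_all.2 fun j => (hτc j).norm.eventually (gt_mem_nhds ?_)
    change ‖t j (g (0, β₀))‖ < _
    rw [hτ0]; linarith
  have e4 : ∀ᶠ q in 𝓝 ((0 : ℝ), β₀), ∀ j, ((q.1, T q), flowC Ω F W m ((q.1, t j (g q)), Y q)) ∈ N := by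
    refine Filter.eventually_all.2 fun j => ?_
    have hc2 : ContinuousAt (fun q => flowC Ω F W m ((q.1, t j (g q)), Y q)) (0, β₀) := by
      refine ContinuousAt.comp (g := flowC Ω F W m) (f := fun q : ℝ × (Fin s → ℝ) =>
        ((q.1, t j (g q)), Y q)) ?_ ((continuousAt_fst.prodMk (hτc j)).prodMk hYc)
      simp only
      rw [hτ0, hY0]
      exact (H.contDiffAt_flowC (mem_flowCDom_of_period h0 hm (hb j))).continuousAt
    have hc1 : ContinuousAt (fun q : ℝ × (Fin s → ℝ) => ((q.1, T q),
        flowC Ω F W m ((q.1, t j (g q)), Y q))) (0, β₀) :=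
      (continuousAt_fst.prodMk hTc).prodMk hc2
    refine hc1.eventually (p := fun z => z ∈ N) ?_
    simp only
    rw [hτ0, hY0, flowC_of_period (hb j), hT0]
    exact hN
  obtain ⟨O₃, hO₃sub, hO₃o, h0O₃⟩ := mem_nhds_iff.1 (e1.and (e2.and (e3.and e4)))
  refine ⟨O₂ ∩ O₃, Y, fun j q => t j (g q), hO₂o.inter hO₃o, ⟨h0O₂, h0O₃⟩,
    hY.mono fun q hq => hq.1.1, fun j => (hτd j).mono inter_subset_left, hY0, hτ0, ?_⟩
  rintro q ⟨⟨hq1, hq2⟩, hq3⟩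
  obtain ⟨f1, f2, f3, f4⟩ := hO₃sub hq3
  obtain ⟨g1, g2, g3, g4⟩ := hq q hq1
  have hε : q.1 ∈ Ioo (-ε₀) ε₀ := g1.1
  have hYt : Y q ∈ (cht (Model n) m).target := g1.2.1
  set p := (cht (Model n) m).symm (Y q) with hp
  have hpT : flow Ω F W (q.1, T q) p = p := by
    have h1 := congrArg (cht (Model n) m).symm g2
    simp only [flowC] at h1
    rwa [(cht (Model n) m).left_inv g1.2.2.2] at h1
  have hball : ∀ v : Fin s → ℝ, ‖v‖ ≤ R₁ → ((q.1, v), p) ∈ flowDom Ω F W := fun v hv =>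
    f1 v (by simpa using hv)
  refine ⟨hε, hYt, fun v hv => hball v (hv.trans (le_max_left _ _)), fun i => congrFun g3 i,
    fun j => ?_⟩
  obtain ⟨k1, k2⟩ := hqt j (g q) (hq2 j)
  have k1' : flow Ω F W (q.1, t j (g q)) p ∈ (cht (Model n) m).source := k1.2.2.2
  have k1'' : ((q.1, t j (g q)), p) ∈ flowDom Ω F W := k1.2.2.1
  set y' := flowC Ω F W m ((q.1, t j (g q)), Y q) with hy'
  have hy'symm : (cht (Model n) m).symm y' = flow Ω F W (q.1, t j (g q)) p :=
    (cht (Model n) m).left_inv k1'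
  have hsum : ‖t j (g q)‖ + ‖T q‖ ≤ R₁ := by
    have h1 : ‖b j‖ + 1 ≤ ∑ j, (‖b j‖ + 1) :=
      Finset.single_le_sum (f := fun j => ‖b j‖ + 1) (fun j _ => by positivity) (Finset.mem_univ j)
    have h2 : ‖c‖ + 1 + ∑ j, (‖b j‖ + 1) ≤ R₁ := le_max_right _ _
    linarith [f3 j]
  have hcomm := (H.flow_comm_of_ball hε hball hsum).2
  -- The return point lies on the section, has the same value of `F^ε`, and is fixed by the flow of
  -- `T q` because the flows commute. Uniqueness of the solution makes it the base point, so the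
  -- return time is a period.
  have hyY : y' = Y q := by
    refine g4 y' (f4 j) k2 ?_ ?_
    · funext i
      simp only [mapC]
      rw [hy'symm, H.F_flow hε k1'']
      exact congrFun g3 i
    · simp only [flowC]
      rw [hy'symm, hcomm, hpT]
      rfl
  rw [← hy'symm, hyY]

/-- The perturbed tori: base points, periods, and the structure of their orbits. -/
theorem Involutive.exists_torusData [Nonempty (Fin s)] (H : Involutive r Ω ε₀ F W) (h0 : (0 : ℝ) ∈ Ioo (-ε₀) ε₀)
    {m : M} (hm : CompleteAt Ω F W 0 m) {c : Fin s → ℝ} (hc : flow Ω F W (0, c) m = m)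
    (hmult : (mD (Model n) (flow Ω F W (0, c)) m :
      Model n →ₗ[ℝ] Model n).charpoly.rootMultiplicity 1 = 2 * s)
    (b : Module.Basis (Fin s) ℝ (Fin s → ℝ)) (hb : ∀ v, flow Ω F W (0, v) m = m ↔
      ∃ z : Fin s → ℤ, v = ∑ j, (z j : ℝ) • b j) :
    ∃ (O : Set (ℝ × (Fin s → ℝ))) (Y : ℝ × (Fin s → ℝ) → Model n)
      (τ : Fin s → ℝ × (Fin s → ℝ) → Fin s → ℝ),
      TorusData r Ω ε₀ F W m O Y τ ∧ (0, fun i => F i 0 m) ∈ O ∧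
      Y (0, fun i => F i 0 m) = cht (Model n) m m := by
  have hs : m ∈ (cht (Model n) m).source := mem_extChartAt_source m
  have hbj : ∀ j, flow Ω F W (0, b j) m = m := fun j =>
    (hb _).2 ⟨Pi.single j 1, by simp [Pi.single_apply]⟩
  set R : ℝ := 3 * ∑ j, (‖b j‖ + 1) with hR
  obtain ⟨O, Y, τ, hO, h0O, hY, hτ, hY0, hτ0, hq⟩ := H.exists_periodic_family h0 hm hc hmult hbj R
  obtain ⟨l, hl⟩ := exists_leftInverse_clm (H.chart_combL_injective h0 hm.mem hs)
  set y₀ := cht (Model n) m m with hy₀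
  have hsymm : (cht (Model n) m).symm y₀ = m := (cht (Model n) m).left_inv hs
  set β₀ : Fin s → ℝ := fun i => F i 0 m with hβ₀
  have hnhds : O ∈ 𝓝 (0, β₀) := hO.mem_nhds h0O
  have hYc : ContinuousAt Y (0, β₀) := hY.continuousOn.continuousAt hnhds
  have hτc : ∀ j, ContinuousAt (τ j) (0, β₀) := fun j => (hτ j).continuousOn.continuousAt hnhds
  have hpc : ContinuousAt (fun q => (cht (Model n) m).symm (Y q)) (0, β₀) := by
    refine ContinuousAt.comp (g := (cht (Model n) m).symm) ?_ hYc
    rw [hY0]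
    exact continuousAt_extChartAt_symm m
  have e1 : ∀ᶠ q in 𝓝 ((0 : ℝ), β₀), LinearIndependent ℝ (fun j => τ j q) := by
    have hc1 : ContinuousAt (fun q => fun j => τ j q) (0, β₀) := continuousAt_pi.2 hτc
    refine hc1.eventually (p := fun f => LinearIndependent ℝ f) ?_
    refine isOpen_setOfPred_linearIndependent.mem_nhds ?_
    have : (fun j => τ j (0, β₀)) = b := funext hτ0
    change LinearIndependent ℝ (fun j => τ j (0, β₀))
    rw [this]
    exact b.linearIndependent
  have e2 : ∀ᶠ q in 𝓝 ((0 : ℝ), β₀), ∀ j, ‖τ j q‖ < ‖b j‖ + 1 := by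
    refine Filter.eventually_all.2 fun j => (hτc j).norm.eventually (gt_mem_nhds ?_)
    change ‖τ j (0, β₀)‖ < _
    rw [hτ0]; linarith
  -- The bounds on `τ j q` allow the same `R` in `completeAt_of_periods` for all nearby `q`.
  have hcompl : ∀ q ∈ O, LinearIndependent ℝ (fun j => τ j q) → (∀ j, ‖τ j q‖ < ‖b j‖ + 1) →
      CompleteAt Ω F W q.1 ((cht (Model n) m).symm (Y q)) := by
    intro q hqO hli hn
    obtain ⟨g1, g2, g3, g4, g5⟩ := hq q hqO
    set b' := basisOfLinearIndependentOfCardEqFinrank hli (by simp) with hb'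
    have hb'j : ∀ j, b' j = τ j q := fun j => by simp [hb']
    refine H.completeAt_of_periods g1 b' (fun j => by rw [hb'j]; exact g5 j) (R := R) ?_ g3
    refine mul_le_mul_of_nonneg_left (Finset.sum_le_sum fun j _ => ?_) (by norm_num)
    rw [hb'j]; exact (hn j).le
  -- uniform local injectivity of the orbit maps
  obtain ⟨N, hN, hNinj⟩ : ∃ N ∈ 𝓝 (((0 : ℝ), (0 : Fin s → ℝ)), y₀), InjOn
      (fun z : (ℝ × (Fin s → ℝ)) × Model n => ((z.1.1, l (flowC Ω F W m z)), z.2)) N := by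
    have hv0 : flow Ω F W (0, (0 : Fin s → ℝ)) m = m := H.flow_zero h0 hm.mem
    have haD := mem_flowCDom_of_period h0 hm hv0
    refine exists_injOn_of_hasStrictFDerivAt (hasStrictFDerivAt_fst.fst.prodMk
      (l.hasStrictFDerivAt.comp _ ((H.contDiffAt_flowC haD).hasStrictFDerivAt
        H.pred_ne_zero)) |>.prodMk hasStrictFDerivAt_snd) ?_
    rw [injective_iff_map_eq_zero]
    rintro ⟨⟨e, w⟩, u⟩ hu
    simp only [ContinuousLinearMap.prod_apply, Prod.mk_eq_zero, ContinuousLinearMap.comp_apply,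
      ContinuousLinearMap.coe_fst', ContinuousLinearMap.coe_snd'] at hu
    obtain ⟨⟨rfl, h2⟩, rfl⟩ := hu
    have h3 : w = 0 := by
      rw [H.fderiv_flowC haD, hsymm, hv0, map_zero, map_zero, add_zero] at h2
      rwa [show l (chartD (Model n) m m (combL Ω F 0 m w)) = w from hl w] at h2
    rw [h3]; rfl
  -- New periods in a fixed ball are excluded near each `v₀`, and compactness does the rest. If `v₀`
  -- is a period at `ε = 0`, subtracting the same integer combination of the `τ j` leaves a period
  -- near zero, which vanishes by local injectivity; otherwise continuity keeps the endpoint away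
  -- from the base point.
  have e3 : ∀ᶠ q in 𝓝 ((0 : ℝ), β₀), ∀ v ∈ Metric.closedBall (0 : Fin s → ℝ) R,
      q ∈ O ∧ LinearIndependent ℝ (fun j => τ j q) ∧ (∀ j, ‖τ j q‖ < ‖b j‖ + 1) →
      flow Ω F W (q.1, v) ((cht (Model n) m).symm (Y q)) = (cht (Model n) m).symm (Y q) →
      ∃ z : Fin s → ℤ, v = ∑ j, (z j : ℝ) • τ j q := by
    refine (isCompact_closedBall (0 : Fin s → ℝ) R).eventually_forall_of_forall_eventually
      (P := fun q v => q ∈ O ∧ LinearIndependent ℝ (fun j => τ j q) ∧ (∀ j, ‖τ j q‖ < ‖b j‖ + 1) →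
        flow Ω F W (q.1, v) ((cht (Model n) m).symm (Y q)) = (cht (Model n) m).symm (Y q) →
        ∃ z : Fin s → ℤ, v = ∑ j, (z j : ℝ) • τ j q) fun v₀ _ => ?_
    have hpc' : ContinuousAt (fun z : (ℝ × (Fin s → ℝ)) × (Fin s → ℝ) =>
        (cht (Model n) m).symm (Y z.1)) ((0, β₀), v₀) :=
      ContinuousAt.comp (f := fun z : (ℝ × (Fin s → ℝ)) × (Fin s → ℝ) => z.1)
        (g := fun q => (cht (Model n) m).symm (Y q)) hpc continuousAt_fst
    by_cases hv₀ : flow Ω F W (0, v₀) m = m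
    · obtain ⟨z, hz⟩ := (hb v₀).1 hv₀
      have hc1 : ContinuousAt (fun a : (ℝ × (Fin s → ℝ)) × (Fin s → ℝ) =>
          ((a.1.1, a.2 - ∑ j, (z j : ℝ) • τ j a.1), Y a.1)) ((0, β₀), v₀) := by
        refine ContinuousAt.prodMk (ContinuousAt.prodMk (by fun_prop) (ContinuousAt.sub
          continuousAt_snd ?_)) (ContinuousAt.comp (f := fun z : (ℝ × (Fin s → ℝ)) × (Fin s → ℝ) =>
            z.1) hYc continuousAt_fst)
        refine tendsto_finsetSum _ fun j _ => Filter.Tendsto.const_smul ?_ _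
        exact ContinuousAt.comp (f := fun z : (ℝ × (Fin s → ℝ)) × (Fin s → ℝ) => z.1) (hτc j)
          continuousAt_fst
      have hc2 : ContinuousAt (fun a : (ℝ × (Fin s → ℝ)) × (Fin s → ℝ) =>
          ((a.1.1, (0 : Fin s → ℝ)), Y a.1)) ((0, β₀), v₀) :=
        ContinuousAt.prodMk (by fun_prop) (ContinuousAt.comp
          (f := fun z : (ℝ × (Fin s → ℝ)) × (Fin s → ℝ) => z.1) hYc continuousAt_fst)
      have n1 : ∀ᶠ a in 𝓝 (((0 : ℝ), β₀), v₀),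
          ((a.1.1, a.2 - ∑ j, (z j : ℝ) • τ j a.1), Y a.1) ∈ N := by
        refine hc1.eventually (p := fun z => z ∈ N) ?_
        simp only [hτ0]
        rw [← hz, sub_self, hY0]; exact hN
      have n2 : ∀ᶠ a in 𝓝 (((0 : ℝ), β₀), v₀), ((a.1.1, (0 : Fin s → ℝ)), Y a.1) ∈ N := by
        refine hc2.eventually (p := fun z => z ∈ N) ?_
        simp only
        rw [hY0]; exact hN
      filter_upwards [n1, n2] with a h1 h2 h3 h4
      refine ⟨z, ?_⟩
      obtain ⟨g1, g2, g3, g4, g5⟩ := hq a.1 h3.1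
      have hca := hcompl a.1 h3.1 h3.2.1 h3.2.2
      have hper : a.2 - ∑ j, (z j : ℝ) • τ j a.1 ∈ H.periods g1 hca := by
        refine AddSubgroup.sub_mem _ h4 (AddSubgroup.sum_mem _ fun j _ => ?_)
        rw [Int.cast_smul_eq_zsmul]
        exact AddSubgroup.zsmul_mem _ (g5 j) _
      have h5 := hNinj h1 h2 (by
        simp only [flowC]
        rw [(H.mem_periods g1 hca).1 hper, H.flow_zero g1 hca.mem])
      have h6 : a.2 - ∑ j, (z j : ℝ) • τ j a.1 = 0 := congrArg (fun z => z.1.2) h5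
      exact sub_eq_zero.1 h6
    · have hc1 : ContinuousAt (fun a : (ℝ × (Fin s → ℝ)) × (Fin s → ℝ) =>
          flow Ω F W (a.1.1, a.2) ((cht (Model n) m).symm (Y a.1))) ((0, β₀), v₀) := by
        refine ContinuousAt.comp (f := fun a : (ℝ × (Fin s → ℝ)) × (Fin s → ℝ) =>
          ((a.1.1, a.2), (cht (Model n) m).symm (Y a.1)))
          (g := fun z : (ℝ × (Fin s → ℝ)) × M => flow Ω F W z.1 z.2) ?_
          (ContinuousAt.prodMk (by fun_prop) hpc')
        simp only
        rw [hY0, hsymm]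
        exact (H.exists_flow_near (q := ((0, v₀), m)) h0 (hm v₀)).2.1.continuousAt
      have hne := (hc1.prodMk hpc').eventually (p := fun z : M × M => z.1 ≠ z.2)
        ((isOpen_ne_fun continuous_fst continuous_snd).mem_nhds (by
          change flow Ω F W (0, v₀) ((cht (Model n) m).symm (Y (0, β₀))) ≠
            (cht (Model n) m).symm (Y (0, β₀))
          rw [hY0, hsymm]; exact hv₀))
      filter_upwards [hne] with a ha _ ha'
      exact absurd ha' ha
  obtain ⟨O₃, hO₃sub, hO₃o, h0O₃⟩ := mem_nhds_iff.1 (e1.and (e2.and e3))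
  have hall : ∀ q ∈ O ∩ O₃, CompleteAt Ω F W q.1 ((cht (Model n) m).symm (Y q)) := by
    rintro q ⟨hqO, hq3⟩
    obtain ⟨f1, f2, -⟩ := hO₃sub hq3
    exact hcompl q hqO f1 f2
  refine ⟨O ∩ O₃, Y, τ, ⟨hO.inter hO₃o, hY.mono inter_subset_left,
    fun j => (hτ j).mono inter_subset_left, fun q h => (hq q h.1).1, fun q h => (hq q h.1).2.1, hall,
    fun q h => (hq q h.1).2.2.2.1, fun q h => (hO₃sub h.2).1, ?_⟩, ⟨h0O, h0O₃⟩, hY0⟩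
  rintro q ⟨hqO, hq3⟩ v
  obtain ⟨f1, f2, f3⟩ := hO₃sub hq3
  obtain ⟨g1, g2, g3, g4, g5⟩ := hq q hqO
  have hca := hcompl q hqO f1 f2
  refine ⟨fun hv => ?_, ?_⟩
  · set b' := basisOfLinearIndependentOfCardEqFinrank f1 (by simp) with hb'
    have hb'j : ∀ j, b' j = τ j q := fun j => by simp [hb']
    have hvs : v = ∑ j, b'.equivFun v j • τ j q := by
      conv_lhs => rw [← b'.sum_equivFun v]
      simp [hb'j]
    set a := b'.equivFun v with ha
    -- Modulo the known periods, any period can be moved into the fundamental cell, hence into the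
    -- ball treated above.
    have hsplit : v = ∑ j, Int.fract (a j) • τ j q + ∑ j, ((⌊a j⌋ : ℤ) : ℝ) • τ j q := by
      rw [← Finset.sum_add_distrib]
      conv_lhs => rw [hvs]
      refine Finset.sum_congr rfl fun j _ => ?_
      rw [← add_smul, Int.fract_add_floor]
    have hper : ∑ j, Int.fract (a j) • τ j q ∈ H.periods g1 hca := by
      rw [eq_sub_of_add_eq hsplit.symm]
      refine AddSubgroup.sub_mem _ hv (AddSubgroup.sum_mem _ fun j _ => ?_)
      rw [Int.cast_smul_eq_zsmul]
      exact AddSubgroup.zsmul_mem _ (g5 j) _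
    obtain ⟨z, hz⟩ := f3 (∑ j, Int.fract (a j) • τ j q) (by
      rw [mem_closedBall_zero_iff]
      calc ‖∑ j, Int.fract (a j) • τ j q‖ ≤ ∑ j, ‖Int.fract (a j) • τ j q‖ := norm_sum_le _ _
        _ ≤ ∑ j, (‖b j‖ + 1) := by
          refine Finset.sum_le_sum fun j _ => ?_
          rw [norm_smul, Real.norm_eq_abs, abs_of_nonneg (Int.fract_nonneg _)]
          have := mul_le_of_le_one_left (norm_nonneg (τ j q)) (Int.fract_lt_one (a j)).le
          linarith [f2 j]
        _ ≤ R := by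
          have : 0 ≤ ∑ j, (‖b j‖ + 1) := Finset.sum_nonneg fun j _ => by positivity
          rw [hR]; linarith) ⟨hqO, f1, f2⟩ hper
    refine ⟨fun j => z j + ⌊a j⌋, ?_⟩
    rw [hsplit, hz, ← Finset.sum_add_distrib]
    refine Finset.sum_congr rfl fun j _ => ?_
    push_cast
    rw [add_smul]
  · rintro ⟨z, rfl⟩
    refine (H.mem_periods g1 hca).1 (AddSubgroup.sum_mem _ fun j _ => ?_)
    rw [Int.cast_smul_eq_zsmul]
    exact AddSubgroup.zsmul_mem _ (g5 j) _

end Family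


/-! ### A Poincaré lemma with parameters. -/

section Potential

variable {s : ℕ}

/-- The potential, along segments issued from `β₀`, of the family of 1-forms `∑ τᵢ dβᵢ`. -/
def potential (τ : ℝ × (Fin s → ℝ) → Fin s → ℝ) (β₀ : Fin s → ℝ) (q : ℝ × (Fin s → ℝ)) : ℝ :=
  ∫ t in (0 : ℝ)..1, ∑ i, τ (q.1, β₀ + t • (q.2 - β₀)) i * (q.2 i - β₀ i)

lemma contDiffOn_potential_integrand {k : ℕ∞} {τ : ℝ × (Fin s → ℝ) → Fin s → ℝ}
    {β₀ : Fin s → ℝ} {O : Set (ℝ × (Fin s → ℝ))} (hτ : ContDiffOn ℝ k τ O) :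
    ContDiffOn ℝ k (fun z : (ℝ × (Fin s → ℝ)) × ℝ =>
      ∑ i, τ (z.1.1, β₀ + z.2 • (z.1.2 - β₀)) i * (z.1.2 i - β₀ i))
      ((fun z : (ℝ × (Fin s → ℝ)) × ℝ => (z.1.1, β₀ + z.2 • (z.1.2 - β₀))) ⁻¹' O) := by
  have hψ : ContDiff ℝ k (fun z : (ℝ × (Fin s → ℝ)) × ℝ => (z.1.1, β₀ + z.2 • (z.1.2 - β₀))) := by
    fun_prop
  have h1 := hτ.comp hψ.contDiffOn (s := (fun z : (ℝ × (Fin s → ℝ)) × ℝ =>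
    (z.1.1, β₀ + z.2 • (z.1.2 - β₀))) ⁻¹' O) fun z hz => hz
  refine ContDiffOn.sum fun i _ => ContDiffOn.mul (contDiffOn_pi.1 h1 i) ?_
  exact ContDiff.contDiffOn (by fun_prop)

lemma isOpen_potential_domain {β₀ : Fin s → ℝ} {O : Set (ℝ × (Fin s → ℝ))} (hO : IsOpen O) :
    IsOpen ((fun z : (ℝ × (Fin s → ℝ)) × ℝ => (z.1.1, β₀ + z.2 • (z.1.2 - β₀))) ⁻¹' O) :=
  hO.preimage (by fun_prop)

lemma contDiffOn_potential {k : ℕ∞} {τ : ℝ × (Fin s → ℝ) → Fin s → ℝ} {β₀ : Fin s → ℝ}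
    {O U : Set (ℝ × (Fin s → ℝ))} (hO : IsOpen O) (hτ : ContDiffOn ℝ k τ O) (hU : IsOpen U)
    (hUO : ∀ q ∈ U, ∀ t ∈ Icc (0 : ℝ) 1, (q.1, β₀ + t • (q.2 - β₀)) ∈ O) :
    ContDiffOn ℝ k (potential τ β₀) U :=
  contDiffOn_integral_segment (isOpen_potential_domain hO) (contDiffOn_potential_integrand hτ) hU hUO

/-- By the symmetry `hsym`, the derivative of the integrand in the direction `w` is the
`t`-derivative of `t ∑ τᵢ wᵢ` along the segment. The integral is then the boundary term at `t = 1`.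
-/
lemma fderiv_potential {τ : ℝ × (Fin s → ℝ) → Fin s → ℝ} {β₀ : Fin s → ℝ}
    {O : Set (ℝ × (Fin s → ℝ))} (hO : IsOpen O) (hτ : ContDiffOn ℝ 1 τ O)
    (hsym : ∀ q ∈ O, ∀ u w : Fin s → ℝ,
      ∑ i, fderiv ℝ τ q (0, u) i * w i = ∑ i, fderiv ℝ τ q (0, w) i * u i)
    {q : ℝ × (Fin s → ℝ)} (hq : ∀ t ∈ Icc (0 : ℝ) 1, (q.1, β₀ + t • (q.2 - β₀)) ∈ O)
    (w : Fin s → ℝ) : fderiv ℝ (potential τ β₀) q (0, w) = ∑ i, τ q i * w i := by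
  set g : (ℝ × (Fin s → ℝ)) × ℝ → ℝ := fun z =>
    ∑ i, τ (z.1.1, β₀ + z.2 • (z.1.2 - β₀)) i * (z.1.2 i - β₀ i) with hg
  set O' := (fun z : (ℝ × (Fin s → ℝ)) × ℝ => (z.1.1, β₀ + z.2 • (z.1.2 - β₀))) ⁻¹' O with hO'
  have hgd : ContDiffOn ℝ 1 g O' := contDiffOn_potential_integrand (k := 1) hτ
  have hO'o : IsOpen O' := isOpen_potential_domain hO
  have hD := hasFDerivAt_integral_segment hO'o hgd (x₀ := q) hq
  have hcont : ContinuousOn (fun t : ℝ => fderiv ℝ g (q, t)) (Icc 0 1) :=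
    (hgd.continuousOn_fderiv_of_isOpen hO'o le_rfl).comp (by fun_prop) hq
  have hcont' : ContinuousOn (fun t : ℝ => (fderiv ℝ g (q, t)).comp
      (ContinuousLinearMap.inl ℝ (ℝ × (Fin s → ℝ)) ℝ)) (Icc 0 1) :=
    hcont.clm_comp continuousOn_const
  have hτat : ∀ t ∈ Icc (0 : ℝ) 1, HasFDerivAt τ (fderiv ℝ τ (q.1, β₀ + t • (q.2 - β₀)))
      (q.1, β₀ + t • (q.2 - β₀)) := fun t ht =>
    ((hτ.contDiffAt (hO.mem_nhds (hq t ht))).differentiableAt one_ne_zero).hasFDerivAt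
  have hval : ∀ t ∈ Icc (0 : ℝ) 1, fderiv ℝ g (q, t) ((0, w), 0) =
      ∑ i, (fderiv ℝ τ (q.1, β₀ + t • (q.2 - β₀)) (0, t • w) i * (q.2 i - β₀ i) +
        τ (q.1, β₀ + t • (q.2 - β₀)) i * w i) := by
    intro t ht
    have h1 := ((hgd.contDiffAt (x := (q, t)) (hO'o.mem_nhds (hq t ht))).differentiableAt
      one_ne_zero).hasFDerivAt
    have hc : HasDerivAt (fun a : ℝ => ((q.1, q.2 + a • w), t)) ((0, w), 0) 0 := by
      refine HasDerivAt.prodMk (HasDerivAt.prodMk (hasDerivAt_const _ _) ?_) (hasDerivAt_const _ _)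
      simpa using ((hasDerivAt_id (0 : ℝ)).smul_const w).const_add q.2
    have h2 : HasDerivAt (fun a : ℝ => g ((q.1, q.2 + a • w), t))
        (fderiv ℝ g (q, t) ((0, w), 0)) 0 := by
      refine HasFDerivAt.comp_hasDerivAt (f := fun a : ℝ => ((q.1, q.2 + a • w), t))
        (l := g) 0 ?_ hc
      simpa using h1
    have hc3 : HasDerivAt (fun a : ℝ => (q.1, β₀ + t • (q.2 + a • w - β₀))) (0, t • w) 0 := by
      refine HasDerivAt.prodMk (hasDerivAt_const _ _) ?_
      simpa using (((((hasDerivAt_id (0 : ℝ)).smul_const w).const_add q.2).sub_const β₀).const_smul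
        t).const_add β₀
    have h3 : HasDerivAt (fun a : ℝ => τ (q.1, β₀ + t • (q.2 + a • w - β₀)))
        (fderiv ℝ τ (q.1, β₀ + t • (q.2 - β₀)) (0, t • w)) 0 := by
      refine HasFDerivAt.comp_hasDerivAt (f := fun a : ℝ => (q.1, β₀ + t • (q.2 + a • w - β₀)))
        (l := τ) 0 ?_ hc3
      simpa using hτat t ht
    have h4 : HasDerivAt (fun a : ℝ => g ((q.1, q.2 + a • w), t))
        (∑ i, (fderiv ℝ τ (q.1, β₀ + t • (q.2 - β₀)) (0, t • w) i * (q.2 i - β₀ i) +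
          τ (q.1, β₀ + t • (q.2 - β₀)) i * w i)) 0 := by
      refine HasDerivAt.fun_sum fun i _ => ?_
      have h5 : HasDerivAt (fun a : ℝ => q.2 i + a * w i - β₀ i) (w i) 0 := by
        simpa using (((hasDerivAt_id (0 : ℝ)).mul_const (w i)).const_add (q.2 i)).sub_const (β₀ i)
      have h6 := (hasDerivAt_pi.1 h3 i).fun_mul h5
      simpa using h6
    exact h2.unique h4
  have hder : ∀ t ∈ uIcc (0 : ℝ) 1, HasDerivAt
      (fun t : ℝ => t * ∑ i, τ (q.1, β₀ + t • (q.2 - β₀)) i * w i)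
      (fderiv ℝ g (q, t) ((0, w), 0)) t := by
    intro t ht
    rw [uIcc_of_le zero_le_one] at ht
    have hc3 : HasDerivAt (fun a : ℝ => (q.1, β₀ + a • (q.2 - β₀))) (0, q.2 - β₀) t := by
      refine HasDerivAt.prodMk (hasDerivAt_const _ _) ?_
      simpa using ((hasDerivAt_id t).smul_const (q.2 - β₀)).const_add β₀
    have h3 : HasDerivAt (fun a : ℝ => τ (q.1, β₀ + a • (q.2 - β₀)))
        (fderiv ℝ τ (q.1, β₀ + t • (q.2 - β₀)) (0, q.2 - β₀)) t :=
      HasFDerivAt.comp_hasDerivAt (f := fun a : ℝ => (q.1, β₀ + a • (q.2 - β₀)))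
        (l := τ) t (hτat t ht) hc3
    have h4 : HasDerivAt (fun a : ℝ => ∑ i, τ (q.1, β₀ + a • (q.2 - β₀)) i * w i)
        (∑ i, fderiv ℝ τ (q.1, β₀ + t • (q.2 - β₀)) (0, q.2 - β₀) i * w i) t :=
      HasDerivAt.fun_sum fun i _ => (hasDerivAt_pi.1 h3 i).mul_const (w i)
    refine ((hasDerivAt_id t).mul h4).congr_deriv ?_
    rw [hval t ht, Finset.sum_add_distrib]
    have h5 := hsym _ (hq t ht) w (q.2 - β₀)
    have h6 : ((0 : ℝ), t • w) = t • ((0 : ℝ), w) := by simp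
    rw [h6, map_smul]
    simp only [Pi.smul_apply, smul_eq_mul, id, one_mul, mul_assoc]
    rw [← Finset.mul_sum]
    simp only [Pi.sub_apply] at h5
    rw [h5, add_comm]
  have hfd : fderiv ℝ (potential τ β₀) q = ∫ t in (0 : ℝ)..1,
      (fderiv ℝ g (q, t)).comp (ContinuousLinearMap.inl ℝ (ℝ × (Fin s → ℝ)) ℝ) := hD.fderiv
  rw [hfd, ContinuousLinearMap.intervalIntegral_apply
    (hcont'.intervalIntegrable_of_Icc zero_le_one)]
  have hder_int : IntervalIntegrable (fun t => fderiv ℝ g (q, t) ((0, w), 0)) volume 0 1 :=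
    (hcont.clm_apply continuousOn_const).intervalIntegrable_of_Icc zero_le_one
  have := intervalIntegral.integral_eq_sub_of_hasDerivAt hder hder_int
  simp only [one_mul, zero_mul, sub_zero, one_smul, add_sub_cancel] at this
  exact this

end Potential

/-! ### Closedness of the period forms. -/

section Data

variable {n : ℕ} {M : Type*} [TopologicalSpace M] [ChartedSpace (Model n) M]
  {s : ℕ} {r : ℕ∞} {Ω : M → Model n →L[ℝ] Model n →L[ℝ] ℝ} {ε₀ : ℝ} {F : Fin s → ℝ → M → ℝ}
  {W : Set M}

variable {m : M} {O : Set (ℝ × (Fin s → ℝ))} {Y : ℝ × (Fin s → ℝ) → Model n}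
  {τ : Fin s → ℝ × (Fin s → ℝ) → Fin s → ℝ} [T2Space M] [IsManifold (𝓡 (2 * n)) r M]

lemma TorusData.flow_τ (D : TorusData r Ω ε₀ F W m O Y τ) {q : ℝ × (Fin s → ℝ)} (hq : q ∈ O)
    (j : Fin s) : flow Ω F W (q.1, τ j q) ((cht (Model n) m).symm (Y q)) =
      (cht (Model n) m).symm (Y q) :=
  (D.flow_eq_iff q hq _).2 ⟨Pi.single j 1, by simp [Pi.single_apply]⟩

lemma TorusData.mem_flowCDom (D : TorusData r Ω ε₀ F W m O Y τ) {q : ℝ × (Fin s → ℝ)} (hq : q ∈ O)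
    (j : Fin s) : ((q.1, τ j q), Y q) ∈ flowCDom Ω ε₀ F W m := by
  refine ⟨D.mem_Ioo q hq, D.mem_target q hq, D.complete q hq _, ?_⟩
  simp only
  rw [D.flow_τ hq]
  exact (cht (Model n) m).map_target (D.mem_target q hq)

lemma TorusData.hasFDerivAt_Y (H : Involutive r Ω ε₀ F W) (D : TorusData r Ω ε₀ F W m O Y τ)
    {q : ℝ × (Fin s → ℝ)} (hq : q ∈ O) : HasFDerivAt Y (fderiv ℝ Y q) q :=
  ((D.contDiffOn_Y.contDiffAt (D.isOpen.mem_nhds hq)).differentiableAt H.pred_ne_zero).hasFDerivAt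

lemma TorusData.hasFDerivAt_τ (H : Involutive r Ω ε₀ F W) (D : TorusData r Ω ε₀ F W m O Y τ)
    {q : ℝ × (Fin s → ℝ)} (hq : q ∈ O) (j : Fin s) : HasFDerivAt (τ j) (fderiv ℝ (τ j) q) q :=
  (((D.contDiffOn_τ j).contDiffAt (D.isOpen.mem_nhds hq)).differentiableAt
    H.pred_ne_zero).hasFDerivAt

/-- The derivative of the base point along `β`. -/
lemma TorusData.dF_fderiv_Y (H : Involutive r Ω ε₀ F W) (D : TorusData r Ω ε₀ F W m O Y τ)
    {q : ℝ × (Fin s → ℝ)} (hq : q ∈ O) (w : Fin s → ℝ) :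
    dF F q.1 ((cht (Model n) m).symm (Y q))
      (chartSymmD (Model n) m (Y q) (fderiv ℝ Y q (0, w))) = w := by
  rw [← H.fderiv_mapC (q := (q.1, Y q)) (D.mem_Ioo q hq) (D.mem_target q hq)]
  have hopen : IsOpen (Ioo (-ε₀) ε₀ ×ˢ (cht (Model n) m).target) :=
    isOpen_Ioo.prod (isOpen_extChartAt_target m)
  have h1 := (((H.contDiffOn_mapC m).contDiffAt (x := (q.1, Y q)) (hopen.mem_nhds
    ⟨D.mem_Ioo q hq, D.mem_target q hq⟩)).differentiableAt H.ne_zero).hasFDerivAt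
  have h2 := HasFDerivAt.comp (f := fun q : ℝ × (Fin s → ℝ) => (q.1, Y q)) q h1
    (hasFDerivAt_fst.prodMk (D.hasFDerivAt_Y H hq))
  have h3 : HasFDerivAt (fun q : ℝ × (Fin s → ℝ) => mapC F m (q.1, Y q))
      (ContinuousLinearMap.snd ℝ ℝ (Fin s → ℝ)) q := by
    refine hasFDerivAt_snd.congr_of_eventuallyEq ?_
    filter_upwards [D.isOpen.mem_nhds hq] with z hz
    exact funext fun i => D.F_eq z hz i
  have h4 := congrArg (fun A : ℝ × (Fin s → ℝ) →L[ℝ] (Fin s → ℝ) => A (0, w)) (h2.unique h3)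
  exact h4

/-- The 1-forms `∑ᵢ τⱼᵢ dβᵢ` are closed. -/
lemma TorusData.symmetric_τ (H : Involutive r Ω ε₀ F W) (D : TorusData r Ω ε₀ F W m O Y τ)
    {q : ℝ × (Fin s → ℝ)} (hq : q ∈ O) (j : Fin s) (u w : Fin s → ℝ) :
    ∑ i, fderiv ℝ (τ j) q (0, u) i * w i = ∑ i, fderiv ℝ (τ j) q (0, w) i * u i := by
  set p := (cht (Model n) m).symm (Y q) with hp
  set a : (Fin s → ℝ) → Model n := fun u => chartSymmD (Model n) m (Y q) (fderiv ℝ Y q (0, u))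
    with ha
  set x : (Fin s → ℝ) → Model n := fun u => combL Ω F q.1 p (fderiv ℝ (τ j) q (0, u)) with hx
  have hdom := D.mem_flowCDom hq j
  have hper := D.flow_τ hq j
  -- The derivative in `β` of the identity `flow (ε, τⱼ) Y = Y`: the first term comes from the
  -- change of the period, the second from that of the base point.
  have hfix : ∀ u, x u + mD (Model n) (flow Ω F W (q.1, τ j q)) p (a u) = a u := by
    intro u
    have h1 := ((H.contDiffAt_flowC hdom).differentiableAt H.pred_ne_zero).hasFDerivAt
    have h2 := HasFDerivAt.comp (f := fun q : ℝ × (Fin s → ℝ) => ((q.1, τ j q), Y q)) q h1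
      ((hasFDerivAt_fst.prodMk (D.hasFDerivAt_τ H hq j)).prodMk (D.hasFDerivAt_Y H hq))
    have h3 : HasFDerivAt (fun q : ℝ × (Fin s → ℝ) => flowC Ω F W m ((q.1, τ j q), Y q))
        (fderiv ℝ Y q) q := by
      refine (D.hasFDerivAt_Y H hq).congr_of_eventuallyEq ?_
      filter_upwards [D.isOpen.mem_nhds hq] with z hz
      simp only [flowC]
      rw [D.flow_τ hz, (cht (Model n) m).right_inv (D.mem_target z hz)]
    have h4 : fderiv ℝ (flowC Ω F W m) ((q.1, τ j q), Y q)
        ((0, fderiv ℝ (τ j) q (0, u)), fderiv ℝ Y q (0, u)) = fderiv ℝ Y q (0, u) :=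
      congrArg (fun A : ℝ × (Fin s → ℝ) →L[ℝ] Model n => A (0, u)) (h2.unique h3)
    rw [H.fderiv_flowC hdom, hper] at h4
    have h5 := congrArg (chartSymmD (Model n) m (Y q)) h4
    have := H.isManifold_one
    rwa [chartSymmD_chartD (D.mem_target q hq)] at h5
  -- The monodromy sends `a u` to `a u - x u` and preserves `Ω`. In the expansion `Ω(x u, x w)`
  -- vanishes because orbits are isotropic, and the mixed terms are the two sides of the claim.
  have hpres : ∀ u w, Ω p (a u - x u) (a w - x w) = Ω p (a u) (a w) := by
    intro u w
    have h1 := (H.exists_flow_near (q := ((q.1, τ j q), p)) (D.mem_Ioo q hq)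
      (D.complete q hq _)).2.2 (a u) (a w)
    simp only at h1
    rw [hper] at h1
    rw [← h1, sub_eq_of_eq_add' (hfix u).symm, sub_eq_of_eq_add' (hfix w).symm]
  have hxa : ∀ u w, Ω p (x u) (a w) = ∑ i, fderiv ℝ (τ j) q (0, u) i * w i := by
    intro u w
    rw [hx, H.form_combL]
    simp only [ha]
    rw [D.dF_fderiv_Y H hq]
  have hxx : Ω p (x u) (x w) = 0 := by
    simp only [hx]
    rw [H.form_combL, H.dF_combL (D.mem_Ioo q hq) (D.complete q hq).mem]
    simp
  have h1 := hpres u w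
  simp only [map_sub, _root_.sub_apply, hxx] at h1
  rw [form_swap H.symplectic p (a u) (x w), hxa, hxa] at h1
  linarith

end Data


/-! ### Action variables from the period forms. -/

section Actions

variable {s : ℕ}

/-- The linear map with rows `τⱼ q / 2π`. -/
def periodMap (τ : Fin s → ℝ × (Fin s → ℝ) → Fin s → ℝ) (q : ℝ × (Fin s → ℝ)) :
    (Fin s → ℝ) →L[ℝ] (Fin s → ℝ) :=
  ContinuousLinearMap.pi fun j =>
    ∑ i, τ j q i • ((2 * Real.pi)⁻¹ • (ContinuousLinearMap.proj i : (Fin s → ℝ) →L[ℝ] ℝ))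

lemma periodMap_apply (τ : Fin s → ℝ × (Fin s → ℝ) → Fin s → ℝ) (q : ℝ × (Fin s → ℝ))
    (w : Fin s → ℝ) (j : Fin s) :
    periodMap τ q w j = (2 * Real.pi)⁻¹ * ∑ i, τ j q i * w i := by
  simp only [periodMap, ContinuousLinearMap.pi_apply, _root_.sum_apply, _root_.smul_apply,
    smul_eq_mul, ContinuousLinearMap.proj_apply, Finset.mul_sum]
  exact Finset.sum_congr rfl fun i _ => by ring

lemma contDiffOn_periodMap {k : ℕ∞} {τ : Fin s → ℝ × (Fin s → ℝ) → Fin s → ℝ}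
    {O : Set (ℝ × (Fin s → ℝ))} (hτ : ∀ j, ContDiffOn ℝ k (τ j) O) :
    ContDiffOn ℝ k (periodMap τ) O := by
  refine contDiffOn_clm_apply.2 fun w => contDiffOn_pi.2 fun j => ?_
  simp only [periodMap_apply]
  exact contDiffOn_const.mul (ContDiffOn.sum fun i _ =>
    (contDiffOn_pi.1 (hτ j) i).mul contDiffOn_const)

lemma periodMap_injective {τ : Fin s → ℝ × (Fin s → ℝ) → Fin s → ℝ} {q : ℝ × (Fin s → ℝ)}
    (h : LinearIndependent ℝ (fun j => τ j q)) (w : Fin s → ℝ) (hw : periodMap τ q w = 0) :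
    w = 0 := by
  have h1 : ∀ j, ∑ i, τ j q i * w i = 0 := by
    intro j
    have := congrFun hw j
    rw [periodMap_apply, Pi.zero_apply, mul_eq_zero] at this
    exact this.resolve_left (inv_ne_zero (by positivity))
  set A : Matrix (Fin s) (Fin s) ℝ := Matrix.of fun j => τ j q with hA
  have hAu : IsUnit A := Matrix.linearIndependent_rows_iff_isUnit.1 h
  refine Matrix.mulVec_injective_of_isUnit hAu ?_
  rw [Matrix.mulVec_zero]
  funext j
  exact h1 j

/-- Action variables for a family of closed 1-forms. -/
theorem exists_action_chart {k : ℕ∞} (hk : 1 ≤ k) {τ : Fin s → ℝ × (Fin s → ℝ) → Fin s → ℝ}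
    {O : Set (ℝ × (Fin s → ℝ))} (hO : IsOpen O) {β₀ : Fin s → ℝ} (h0 : (0, β₀) ∈ O)
    (hτ : ∀ j, ContDiffOn ℝ k (τ j) O)
    (hsym : ∀ q ∈ O, ∀ j, ∀ u w : Fin s → ℝ,
      ∑ i, fderiv ℝ (τ j) q (0, u) i * w i = ∑ i, fderiv ℝ (τ j) q (0, w) i * u i)
    (hli : ∀ q ∈ O, LinearIndependent ℝ (fun j => τ j q)) :
    ∃ ρ > 0, ∃ (e : OpenPartialHomeomorph (ℝ × (Fin s → ℝ)) (ℝ × (Fin s → ℝ)))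
      (A : ℝ × (Fin s → ℝ) → (Fin s → ℝ) →L[ℝ] (Fin s → ℝ)),
      e.source = Ioo (-ρ) ρ ×ˢ Metric.ball β₀ ρ ∧ e.source ⊆ O ∧ (∀ q, (e q).1 = q.1) ∧
      ContDiffOn ℝ k e.symm e.target ∧ ContDiffOn ℝ k A e.target ∧
      (∀ q ∈ e.target, HasFDerivAt (fun J => (e.symm (q.1, J)).2) (A q) q.2) ∧
      ∀ q ∈ e.target, ∀ w j, ∑ i, τ j (e.symm q) i * A q w i = 2 * Real.pi * w j := by
  have hk1 : (1 : WithTop ℕ∞) ≤ k := by exact_mod_cast hk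
  have hk0 : (k : WithTop ℕ∞) ≠ 0 := (lt_of_lt_of_le zero_lt_one hk1).ne'
  -- In the sup metric of the product a ball around `(0, β₀)` is a box, the shape prescribed for
  -- `e.source`.
  have hbox : ∀ δ : ℝ, Metric.ball ((0 : ℝ), β₀) δ = Ioo (-δ) δ ×ˢ Metric.ball β₀ δ := by
    intro δ
    rw [← ball_prod_same, Real.ball_eq_Ioo]
    simp
  obtain ⟨δ, hδ, hδO⟩ := Metric.isOpen_iff.1 hO _ h0
  rw [hbox] at hδO
  set U : Set (ℝ × (Fin s → ℝ)) := Ioo (-δ) δ ×ˢ Metric.ball β₀ δ with hU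
  have hUo : IsOpen U := isOpen_Ioo.prod Metric.isOpen_ball
  have hseg : ∀ q ∈ U, ∀ t ∈ Icc (0 : ℝ) 1, (q.1, β₀ + t • (q.2 - β₀)) ∈ O := by
    intro q hq t ht
    refine hδO ⟨hq.1, ?_⟩
    exact (convex_ball β₀ δ).add_smul_sub_mem (Metric.mem_ball_self hδ) hq.2 ht
  -- The actions: primitives of `(2π)⁻¹ ∑ᵢ τⱼᵢ dβᵢ`, normalized to vanish at `β₀` for every `ε`.
  set Jf : ℝ × (Fin s → ℝ) → Fin s → ℝ := fun q j => (2 * Real.pi)⁻¹ * potential (τ j) β₀ q with hJf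
  have hJd : ContDiffOn ℝ k Jf U := contDiffOn_pi.2 fun j =>
    contDiffOn_const.mul (contDiffOn_potential hO (hτ j) hUo hseg)
  have hJder : ∀ q ∈ U, ∀ w, fderiv ℝ Jf q (0, w) = periodMap τ q w := by
    intro q hq w
    have hd : ∀ j, DifferentiableAt ℝ (potential (τ j) β₀) q := fun j =>
      ((contDiffOn_potential hO (hτ j) hUo hseg).contDiffAt (hUo.mem_nhds hq)).differentiableAt hk0
    have h1 : HasFDerivAt Jf (ContinuousLinearMap.pi fun j =>
        (2 * Real.pi)⁻¹ • fderiv ℝ (potential (τ j) β₀) q) q :=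
      hasFDerivAt_pi.2 fun j => (hd j).hasFDerivAt.const_mul _
    rw [h1.fderiv]
    funext j
    rw [periodMap_apply, ContinuousLinearMap.pi_apply, _root_.smul_apply, smul_eq_mul,
      fderiv_potential hO ((hτ j).of_le hk1) (fun q hq => hsym q hq j) (hseg q hq)]
  set Φ : ℝ × (Fin s → ℝ) → ℝ × (Fin s → ℝ) := fun q => (q.1, Jf q) with hΦ
  have hΦd : ContDiffOn ℝ k Φ U := contDiff_fst.contDiffOn.prodMk hJd
  have h0U : (0, β₀) ∈ U := ⟨by simp [hδ], Metric.mem_ball_self hδ⟩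
  have hJat : ∀ q ∈ U, HasFDerivAt Jf (fderiv ℝ Jf q) q := fun q hq =>
    ((hJd.contDiffAt (hUo.mem_nhds hq)).differentiableAt hk0).hasFDerivAt
  have hinj : ∀ q ∈ U, ∀ w, periodMap τ q w = 0 → w = 0 := fun q hq w hw =>
    periodMap_injective (hli q (hδO hq)) w hw
  obtain ⟨L, hL⟩ := exists_equiv_of_injective
    (A := (ContinuousLinearMap.fst ℝ ℝ (Fin s → ℝ)).prod (fderiv ℝ Jf (0, β₀))) (by
      rintro ⟨a, w⟩ hu
      simp only [ContinuousLinearMap.prod_apply, Prod.mk_eq_zero,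
        ContinuousLinearMap.coe_fst'] at hu
      obtain ⟨rfl, h2⟩ := hu
      rw [hJder _ h0U] at h2
      rw [hinj _ h0U w h2]; rfl)
  obtain ⟨e₀, he₀, h0s, hsU, hsymm, -⟩ := exists_inverse_on_nhds hk hUo hΦd h0U (f' := L) (by
    rw [hL]; exact hasFDerivAt_fst.prodMk (hJat _ h0U))
  obtain ⟨ρ, hρ, hρs⟩ := Metric.isOpen_iff.1 e₀.open_source _ h0s
  rw [hbox] at hρs
  set Q : Set (ℝ × (Fin s → ℝ)) := Ioo (-ρ) ρ ×ˢ Metric.ball β₀ ρ with hQ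
  have hQo : IsOpen Q := isOpen_Ioo.prod Metric.isOpen_ball
  set e := e₀.restrOpen Q hQo with he
  have hes : e.source = Q := by
    rw [he, OpenPartialHomeomorph.restrOpen_source]
    exact inter_eq_right.2 hρs
  have heΦ : ∀ q, e q = Φ q := he₀
  have het : e.target ⊆ e₀.target := fun q hq => hq.1
  have hesU : e.source ⊆ U := hes.trans_subset (hρs.trans hsU)
  have hsy : ContDiffOn ℝ k e.symm e.target := hsymm.mono het
  have hmem : ∀ q ∈ e.target, e.symm q ∈ U := fun q hq => hesU (e.map_target hq)
  have hPd : ContDiffOn ℝ k (fun q => periodMap τ (e.symm q)) e.target :=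
    (contDiffOn_periodMap hτ).comp hsy fun q hq => hδO (hmem q hq)
  have hPe : ∀ q ∈ e.target, ∃ P : (Fin s → ℝ) ≃L[ℝ] (Fin s → ℝ),
      (P : (Fin s → ℝ) →L[ℝ] (Fin s → ℝ)) = periodMap τ (e.symm q) := fun q hq =>
    exists_equiv_of_injective (hinj _ (hmem q hq))
  have hfst : ∀ q ∈ e.target, (e.symm q).1 = q.1 := fun q hq => by
    conv_rhs => rw [← e.right_inv hq, heΦ]
  -- The derivative of the energies in the actions is written as the inverse of `periodMap`, which
  -- involves no derivative of `e.symm`. It is therefore again of class `C^k`, with no loss.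
  refine ⟨ρ, hρ, e, fun q => ContinuousLinearMap.inverse (periodMap τ (e.symm q)), hes,
    hesU.trans hδO, fun q => by rw [heΦ], hsy, ?_, ?_, ?_⟩
  · intro q hq
    obtain ⟨P, hP⟩ := hPe q hq
    have h1 : ContDiffAt ℝ k ContinuousLinearMap.inverse (periodMap τ (e.symm q)) := by
      rw [← hP]; exact contDiffAt_map_inverse P
    exact ContDiffAt.comp_contDiffWithinAt q h1 (hPd q hq)
  · intro q hq
    obtain ⟨P, hP⟩ := hPe q hq
    simp only
    rw [← hP, ContinuousLinearMap.inverse_equiv]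
    have h1 : HasFDerivAt e.symm (fderiv ℝ e.symm q) q :=
      ((hsy.contDiffAt (e.open_target.mem_nhds hq)).differentiableAt hk0).hasFDerivAt
    have h2 : HasFDerivAt (fun J : Fin s → ℝ => e.symm (q.1, J))
        ((fderiv ℝ e.symm q).comp (ContinuousLinearMap.inr ℝ ℝ (Fin s → ℝ))) q.2 :=
      HasFDerivAt.comp (f := fun J : Fin s → ℝ => (q.1, J)) (g := e.symm) q.2 h1
        (hasFDerivAt_prodMk_right (𝕜 := ℝ) q.1 q.2)
    have hev : ∀ᶠ J in 𝓝 q.2, (q.1, J) ∈ e.target :=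
      (Continuous.prodMk_right q.1).continuousAt.eventually (e.open_target.mem_nhds hq)
    have h3 := h2.snd
    set B := (ContinuousLinearMap.snd ℝ ℝ (Fin s → ℝ)).comp
      ((fderiv ℝ e.symm q).comp (ContinuousLinearMap.inr ℝ ℝ (Fin s → ℝ))) with hB
    have h4 : HasFDerivAt (fun J => (q.1, (e.symm (q.1, J)).2))
        ((0 : (Fin s → ℝ) →L[ℝ] ℝ).prod B) q.2 := (hasFDerivAt_const q.1 q.2).prodMk h3
    have h5 := HasFDerivAt.comp (f := fun J => (q.1, (e.symm (q.1, J)).2)) (g := Jf) q.2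
      (by
        have : (q.1, (e.symm (q.1, q.2)).2) = e.symm q :=
          Prod.ext (hfst q hq).symm rfl
        rw [this]
        exact hJat _ (hmem q hq)) h4
    have h6 : HasFDerivAt (fun J : Fin s → ℝ => Jf (q.1, (e.symm (q.1, J)).2))
        (ContinuousLinearMap.id ℝ (Fin s → ℝ)) q.2 := by
      refine (hasFDerivAt_id q.2).congr_of_eventuallyEq ?_
      filter_upwards [hev] with J hJ
      have h7 : (q.1, (e.symm (q.1, J)).2) = e.symm (q.1, J) :=
        Prod.ext (hfst _ hJ).symm rfl
      rw [h7]
      have h8 := e.right_inv hJ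
      rw [heΦ] at h8
      exact congrArg Prod.snd h8
    have h7 := h5.unique h6
    refine h3.congr_fderiv ?_
    ext1 w
    have h8 := congrArg (fun C : (Fin s → ℝ) →L[ℝ] (Fin s → ℝ) => C w) h7
    simp only [ContinuousLinearMap.comp_apply, ContinuousLinearMap.prod_apply,
      _root_.zero_apply, ContinuousLinearMap.id_apply] at h8
    rw [hJder _ (hmem q hq), ← hP] at h8
    exact (P.symm_apply_eq.2 h8.symm).symm
  · intro q hq w j
    obtain ⟨P, hP⟩ := hPe q hq
    have h1 : periodMap τ (e.symm q) (P.symm w) = w := by rw [← hP]; exact P.apply_symm_apply w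
    have h2 := congrFun h1 j
    rw [periodMap_apply] at h2
    simp only
    rw [← hP, ContinuousLinearMap.inverse_equiv, ← h2]
    have : (2 * Real.pi) ≠ 0 := by positivity
    rw [mul_inv_cancel_left₀ this]
    rfl

end Actions


/-! ### Regularity and invariance of orbits. -/

section Orbits

variable {n : ℕ} {M : Type*} [TopologicalSpace M] [ChartedSpace (Model n) M]
  {s : ℕ} {r : ℕ∞} {Ω : M → Model n →L[ℝ] Model n →L[ℝ] ℝ} {ε₀ : ℝ} {F : Fin s → ℝ → M → ℝ}
  {W : Set M}

variable [T2Space M] [IsManifold (𝓡 (2 * n)) r M]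

/-- The orbit map of a point is of class `C^r`. -/
lemma Involutive.contMDiff_orbit (H : Involutive r Ω ε₀ F W) {ε : ℝ} (hε : ε ∈ Ioo (-ε₀) ε₀)
    {x : M} (hx : CompleteAt Ω F W ε x) :
    ContMDiff 𝓘(ℝ, Fin s → ℝ) 𝓘(ℝ, Model n) r (fun v => flow Ω F W (ε, v) x) := by
  have := H.isManifold_one
  intro v₀
  set x₀ := flow Ω F W (ε, v₀) x with hx₀
  set f : (Fin s → ℝ) → Model n := fun v => cht (Model n) x₀ (flow Ω F W (ε, v) x) with hf
  set U : Set (Fin s → ℝ) := {v | flow Ω F W (ε, v) x ∈ (cht (Model n) x₀).source} with hU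
  have hcont : Continuous (fun v => flow Ω F W (ε, v) x) := continuous_iff_continuousAt.2 fun v =>
    (H.contMDiffAt_flow_vec hε (hx v)).continuousAt
  have hUo : IsOpen U := (isOpen_extChartAt_source x₀).preimage hcont
  have h0U : v₀ ∈ U := mem_extChartAt_source x₀
  have hfd : ContDiffOn ℝ (r - 1 : ℕ∞) f U := fun v hv =>
    (H.hasStrictFDerivAt_flow_cht hε (hx v) hv).1.contDiffWithinAt
  have hft : ∀ v ∈ U, f v ∈ (cht (Model n) x₀).target := fun v hv =>
    (cht (Model n) x₀).map_source hv
  -- Bootstrap: the derivative of the orbit map consists of the `C^{r-1}` fields evaluated along the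
  -- `C^{r-1}` orbit map, so the orbit map is of class `C^r`.
  have hder : ∀ v ∈ U, fderiv ℝ f v = ∑ i, (ContinuousLinearMap.proj i :
      (Fin s → ℝ) →L[ℝ] ℝ).smulRight (fieldInChart (ham Ω (F i ε)) x₀ (f v)) := by
    intro v hv
    rw [(H.hasStrictFDerivAt_flow_cht hε (hx v) hv).2.hasFDerivAt.fderiv]
    ext1 w
    simp only [ContinuousLinearMap.comp_apply, combL, _root_.sum_apply, map_sum,
      ContinuousLinearMap.smulRight_apply, map_smul]
    refine Finset.sum_congr rfl fun i _ => ?_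
    rw [hf, fieldInChart_cht _ hv]
  have hfr : ContDiffOn ℝ r f U := by
    rw [← H.cast_pred, contDiffOn_succ_iff_fderiv_of_isOpen hUo]
    refine ⟨hfd.differentiableOn H.pred_ne_zero, by simp, ?_⟩
    refine ContDiffOn.congr (ContDiffOn.sum fun i _ => ?_) hder
    refine contDiffOn_const.smulRight ?_
    exact (H.contDiffOn_ham i x₀).comp (contDiffOn_const.prodMk hfd) fun v hv => ⟨hε, hft v hv⟩
  have h1 : ContMDiffAt 𝓘(ℝ, Fin s → ℝ) 𝓘(ℝ, Model n) r
      (fun v => (cht (Model n) x₀).symm (f v)) v₀ :=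
    ContMDiffAt.comp v₀ (g := (cht (Model n) x₀).symm) (f := f)
      ((contMDiffOn_extChartAt_symm x₀).contMDiffAt (cht_target_mem_nhds (hft v₀ h0U)))
      (hfr.contDiffAt (hUo.mem_nhds h0U)).contMDiffAt
  refine h1.congr_of_eventuallyEq ?_
  filter_upwards [hUo.mem_nhds h0U] with v hv
  exact ((cht (Model n) x₀).left_inv hv).symm

lemma Involutive.mdifferentiableAt_orbit (H : Involutive r Ω ε₀ F W) {ε : ℝ}
    (hε : ε ∈ Ioo (-ε₀) ε₀) {x : M} (hx : CompleteAt Ω F W ε x) (v : Fin s → ℝ) :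
    MDifferentiableAt 𝓘(ℝ, Fin s → ℝ) 𝓘(ℝ, Model n) (fun v => flow Ω F W (ε, v) x) v :=
  (H.contMDiffAt_flow_vec hε (hx v)).mdifferentiableAt H.pred_ne_zero

lemma Involutive.integralCurveOn_flow (H : Involutive r Ω ε₀ F W) {ε : ℝ}
    (hε : ε ∈ Ioo (-ε₀) ε₀) {x : M} (hx : CompleteAt Ω F W ε x) (w v : Fin s → ℝ) (S : Set ℝ) :
    IntegralCurveOn (fun t => flow Ω F W (ε, w + t • v) x) (combField Ω F (ε, v)) S := by
  intro t _
  have hc : HasDerivWithinAt (fun t : ℝ => w + t • v) v S t := by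
    simpa using (((hasDerivAt_id t).smul_const v).const_add w).hasDerivWithinAt
  have h1 := hasMFDerivWithinAt_comp_curve (f := fun v => flow Ω F W (ε, v) x)
    (c := fun t : ℝ => w + t • v) (H.mdifferentiableAt_orbit hε hx (w + t • v)) hc
  rw [H.vD_flow hε (hx _), combL_apply] at h1
  exact h1

/-- Orbits of complete points are invariant under the flows. -/
lemma Involutive.flowInvariant_orbit (H : Involutive r Ω ε₀ F W) {ε : ℝ}
    (hε : ε ∈ Ioo (-ε₀) ε₀) {x : M} (hx : CompleteAt Ω F W ε x) (i : Fin s) :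
    FlowInvariant (n := n) (hamVF Ω (F i ε)) (range fun v => flow Ω F W (ε, v) x) := by
  have := H.isManifold_one
  rintro γ T hT hγ t₀ ht₀ ⟨w, hw⟩ t ht
  set v : Fin s → ℝ := Pi.single i 1 with hv
  have hX : combField Ω F (ε, v) = ham Ω (F i ε) := funext fun z => combField_single ε i z
  have h1 := H.integralCurveOn_flow hε hx (w - t₀ • v) v T
  have h2 : IntegralCurveOn γ (combField Ω F (ε, v)) T := by rw [hX]; exact hγ
  have h3 := IntegralCurveOn.eqOn_of_ordConnected (H.fieldC1 hε v) hT h2 h1 ht₀ (by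
    simp only [sub_add_cancel]; exact hw.symm) ht
  rw [h3]
  exact ⟨_, rfl⟩

/-- By `form_combL`, the pairing of an orbit direction with any vector depends only on the image of
that vector under `dF`. This computes it for a family of points on which the values of `F^ε` are
known. -/
lemma dF_vD {ε : ℝ} {f : (Fin s → ℝ) → M} {g : (Fin s → ℝ) → Fin s → ℝ} {J : Fin s → ℝ}
    {A : (Fin s → ℝ) →L[ℝ] (Fin s → ℝ)}
    (hf : MDifferentiableAt 𝓘(ℝ, Fin s → ℝ) 𝓘(ℝ, Model n) f J) (hg : HasFDerivAt g A J)
    (hF : ∀ i, MDifferentiableAt 𝓘(ℝ, Model n) 𝓘(ℝ, ℝ) (F i ε) (f J))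
    (heq : ∀ᶠ J' in 𝓝 J, ∀ i, F i ε (f J') = g J' i) (w : Fin s → ℝ) :
    dF F ε (f J) (vD (Model n) f J w) = A w := by
  funext i
  have h1 := (hF i).hasMFDerivAt.comp J hf.hasMFDerivAt
  have h2 : HasFDerivAt (F i ε ∘ f) ((dfun (F i ε) (f J)).comp (vD (Model n) f J)) J :=
    hasMFDerivAt_iff_hasFDerivAt.1 h1
  have h3 : HasFDerivAt (F i ε ∘ f) ((ContinuousLinearMap.proj i : (Fin s → ℝ) →L[ℝ] ℝ).comp A) J := by
    refine (hasFDerivAt_pi'.1 hg i).congr_of_eventuallyEq ?_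
    filter_upwards [heq] with J' hJ'
    exact hJ' i
  exact congrArg (fun B : (Fin s → ℝ) →L[ℝ] ℝ => B w) (h2.unique h3)

end Orbits


/-! ### The family of tori with action-angle coordinates. -/

section Construction

variable {s : ℕ}

/-- The vector with coordinates `φ / 2π` in the basis `τ`. -/
def angleVec (τ : Fin s → Fin s → ℝ) : (Fin s → ℝ) →L[ℝ] (Fin s → ℝ) :=
  ∑ j, ((2 * Real.pi)⁻¹ • (ContinuousLinearMap.proj j : (Fin s → ℝ) →L[ℝ] ℝ)).smulRight (τ j)

lemma angleVec_apply (τ : Fin s → Fin s → ℝ) (φ : Fin s → ℝ) :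
    angleVec τ φ = ∑ j, ((2 * Real.pi)⁻¹ * φ j) • τ j := by
  simp [angleVec]

lemma angleVec_single (τ : Fin s → Fin s → ℝ) (j : Fin s) :
    angleVec τ (Pi.single j 1) = (2 * Real.pi)⁻¹ • τ j := by
  simp [angleVec_apply, Pi.single_apply]

lemma angleVec_surjective [Nonempty (Fin s)] {τ : Fin s → Fin s → ℝ} (h : LinearIndependent ℝ τ)
    (v : Fin s → ℝ) : ∃ φ, angleVec τ φ = v := by
  set b := basisOfLinearIndependentOfCardEqFinrank h (by simp) with hb
  have hbj : ∀ j, b j = τ j := fun j => by simp [hb]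
  refine ⟨fun j => 2 * Real.pi * b.equivFun v j, ?_⟩
  rw [angleVec_apply]
  conv_rhs => rw [← b.sum_equivFun v]
  refine Finset.sum_congr rfl fun j _ => ?_
  rw [inv_mul_cancel_left₀ (by positivity), hbj]

lemma angleVec_sub_eq_iff {τ : Fin s → Fin s → ℝ} (h : LinearIndependent ℝ τ)
    {φ φ' : Fin s → ℝ} {z : Fin s → ℤ} :
    angleVec τ φ' - angleVec τ φ = ∑ j, (z j : ℝ) • τ j ↔
      ∀ j, φ' j = φ j + 2 * Real.pi * z j := by
  have hpi : (2 * Real.pi) ≠ 0 := by positivity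
  rw [← sub_eq_zero, ← map_sub, angleVec_apply, ← Finset.sum_sub_distrib]
  simp only [← sub_smul]
  constructor
  · intro h1 j
    have h2 := Fintype.linearIndependent_iff.1 h _ h1 j
    rw [Pi.sub_apply] at h2
    field_simp at h2
    linarith
  · intro h1
    refine Finset.sum_eq_zero fun j _ => ?_
    rw [Pi.sub_apply, h1 j, add_sub_cancel_left, inv_mul_cancel_left₀ hpi, sub_self, zero_smul]

variable {n : ℕ} {M : Type*} [TopologicalSpace M] [ChartedSpace (Model n) M]
  {r : ℕ∞} {Ω : M → Model n →L[ℝ] Model n →L[ℝ] ℝ} {ε₀ : ℝ} {F : Fin s → ℝ → M → ℝ}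
  {W : Set M} {m : M} {O : Set (ℝ × (Fin s → ℝ))} {Y : ℝ × (Fin s → ℝ) → Model n}
  {τ : Fin s → ℝ × (Fin s → ℝ) → Fin s → ℝ}

/-- The family of tori with action-angle coordinates, `e` being the map
`(ε, β) ↦ (ε, actions)`. -/
def actionAngleFamily (Ω : M → Model n →L[ℝ] Model n →L[ℝ] ℝ) (F : Fin s → ℝ → M → ℝ) (W : Set M)
    (m : M) (Y : ℝ × (Fin s → ℝ) → Model n) (τ : Fin s → ℝ × (Fin s → ℝ) → Fin s → ℝ) (ρ : ℝ)
    (β₀ : Fin s → ℝ) (e : OpenPartialHomeomorph (ℝ × (Fin s → ℝ)) (ℝ × (Fin s → ℝ))) :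
    TorusFamily s M where
  radius := ρ
  base := Metric.ball β₀ ρ
  dom ε := {J | (ε, J) ∈ e.target}
  energy ε J := (e.symm (ε, J)).2
  chart ε J φ := flow Ω F W (ε, angleVec (fun j => τ j (e.symm (ε, J))) φ)
    ((cht (Model n) m).symm (Y (e.symm (ε, J))))

variable [T2Space M] [IsManifold (𝓡 (2 * n)) r M]

lemma TorusData.contMDiffOn_chart (H : Involutive r Ω ε₀ F W) (D : TorusData r Ω ε₀ F W m O Y τ)
    {e : OpenPartialHomeomorph (ℝ × (Fin s → ℝ)) (ℝ × (Fin s → ℝ))} (heO : e.source ⊆ O)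
    (he : ContDiffOn ℝ (r - 1 : ℕ∞) e.symm e.target) (he1 : ∀ q ∈ e.target, (e.symm q).1 = q.1)
    {q : ℝ × (Fin s → ℝ) × (Fin s → ℝ)} (hq : (q.1, q.2.1) ∈ e.target) :
    ContMDiffAt 𝓘(ℝ, ℝ × (Fin s → ℝ) × (Fin s → ℝ)) 𝓘(ℝ, Model n) (r - 1 : ℕ∞)
      (fun q : ℝ × (Fin s → ℝ) × (Fin s → ℝ) =>
        flow Ω F W (q.1, angleVec (fun j => τ j (e.symm (q.1, q.2.1))) q.2.2)
          ((cht (Model n) m).symm (Y (e.symm (q.1, q.2.1))))) q := by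
  have hqO : e.symm (q.1, q.2.1) ∈ O := heO (e.map_target hq)
  have c0 : ContDiffAt ℝ (r - 1 : ℕ∞)
      (fun q : ℝ × (Fin s → ℝ) × (Fin s → ℝ) => e.symm (q.1, q.2.1)) q :=
    ContDiffAt.comp (g := e.symm) (f := fun q : ℝ × (Fin s → ℝ) × (Fin s → ℝ) => (q.1, q.2.1)) q
      (he.contDiffAt (e.open_target.mem_nhds hq))
      (contDiffAt_fst.prodMk (contDiffAt_snd.fst))
  have cY : ContDiffAt ℝ (r - 1 : ℕ∞)
      (fun q : ℝ × (Fin s → ℝ) × (Fin s → ℝ) => Y (e.symm (q.1, q.2.1))) q :=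
    ContDiffAt.comp (g := Y) (f := fun q : ℝ × (Fin s → ℝ) × (Fin s → ℝ) => e.symm (q.1, q.2.1)) q
      (D.contDiffOn_Y.contDiffAt (D.isOpen.mem_nhds hqO)) c0
  have cτ : ∀ j, ContDiffAt ℝ (r - 1 : ℕ∞)
      (fun q : ℝ × (Fin s → ℝ) × (Fin s → ℝ) => τ j (e.symm (q.1, q.2.1))) q := fun j =>
    ContDiffAt.comp (g := τ j)
      (f := fun q : ℝ × (Fin s → ℝ) × (Fin s → ℝ) => e.symm (q.1, q.2.1)) q
      ((D.contDiffOn_τ j).contDiffAt (D.isOpen.mem_nhds hqO)) c0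
  have cv : ContDiffAt ℝ (r - 1 : ℕ∞) (fun q : ℝ × (Fin s → ℝ) × (Fin s → ℝ) =>
      angleVec (fun j => τ j (e.symm (q.1, q.2.1))) q.2.2) q := by
    simp only [angleVec_apply]
    refine ContDiffAt.sum fun j _ => ContDiffAt.fun_smul ?_ (cτ j)
    exact ContDiff.contDiffAt (by fun_prop)
  have hf := H.contMDiffAt_flow_cht_symm (x₀ := m)
    (q := ((q.1, angleVec (fun j => τ j (e.symm (q.1, q.2.1))) q.2.2), Y (e.symm (q.1, q.2.1))))
    (by have := D.mem_Ioo _ hqO; rwa [he1 _ hq] at this) (D.mem_target _ hqO)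
    (by have := D.complete _ hqO; rw [he1 _ hq] at this; exact this _)
  exact ContMDiffAt.comp q (g := fun z : (ℝ × (Fin s → ℝ)) × Model n =>
    flow Ω F W z.1 ((cht (Model n) m).symm z.2))
    (f := fun q : ℝ × (Fin s → ℝ) × (Fin s → ℝ) =>
      ((q.1, angleVec (fun j => τ j (e.symm (q.1, q.2.1))) q.2.2), Y (e.symm (q.1, q.2.1))))
    hf.2 ((contDiffAt_fst.prodMk cv).prodMk cY).contMDiffAt

lemma Involutive.vD_orbit_angleVec (H : Involutive r Ω ε₀ F W) {ε : ℝ} (hε : ε ∈ Ioo (-ε₀) ε₀)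
    {x : M} (hx : CompleteAt Ω F W ε x) (A : (Fin s → ℝ) →L[ℝ] (Fin s → ℝ)) (φ u : Fin s → ℝ) :
    vD (Model n) (fun φ => flow Ω F W (ε, A φ) x) φ u =
      combL Ω F ε (flow Ω F W (ε, A φ) x) (A u) := by
  have h1 := (H.mdifferentiableAt_orbit hε hx (A φ)).hasMFDerivAt.comp φ
    (hasMFDerivAt_iff_hasFDerivAt.2 A.hasFDerivAt)
  have h2 := h1.mfderiv
  have h3 : vD (Model n) (fun φ => flow Ω F W (ε, A φ) x) φ =
      (vD (Model n) (fun v => flow Ω F W (ε, v) x) (A φ)).comp A := h2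
  rw [h3, H.vD_flow hε (hx _)]
  rfl

/-- The direction `∂_φⱼ` is the combination of the fields with coefficients `τⱼ / 2π`, so its
pairing with a vector only sees `dF^ε` of that vector. This is zero on angle directions and given by
`A` on action directions, where the normalization `hAτ` of `A` yields the canonical relation. -/
theorem TorusData.isTorusFamily [Nonempty (Fin s)] (H : Involutive r Ω ε₀ F W)
    (D : TorusData r Ω ε₀ F W m O Y τ) {β₀ : Fin s → ℝ}
    (hY0 : (cht (Model n) m).symm (Y (0, β₀)) = m) {Λ : Set M}
    (hΛ : range (fun v => flow Ω F W (0, v) m) = Λ) {ρ : ℝ} (hρ : 0 < ρ)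
    {e : OpenPartialHomeomorph (ℝ × (Fin s → ℝ)) (ℝ × (Fin s → ℝ))}
    {A : ℝ × (Fin s → ℝ) → (Fin s → ℝ) →L[ℝ] (Fin s → ℝ)}
    (hes : e.source = Ioo (-ρ) ρ ×ˢ Metric.ball β₀ ρ) (heO : e.source ⊆ O)
    (he1 : ∀ q, (e q).1 = q.1) (he : ContDiffOn ℝ (r - 1 : ℕ∞) e.symm e.target)
    (hA : ContDiffOn ℝ (r - 1 : ℕ∞) A e.target)
    (hAd : ∀ q ∈ e.target, HasFDerivAt (fun J => (e.symm (q.1, J)).2) (A q) q.2)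
    (hAτ : ∀ q ∈ e.target, ∀ w j, ∑ i, τ j (e.symm q) i * A q w i = 2 * Real.pi * w j) :
    IsTorusFamily (r - 1) r Ω ε₀ F Λ W β₀ (actionAngleFamily Ω F W m Y τ ρ β₀ e) := by
  have he1' : ∀ q ∈ e.target, (e.symm q).1 = q.1 := fun q hq => by
    rw [← he1 (e.symm q), e.right_inv hq]
  have hO : ∀ {ε J}, (ε, J) ∈ e.target → e.symm (ε, J) ∈ O := fun h => heO (e.map_target h)
  have hpair : ∀ {ε J}, (ε, J) ∈ e.target → (ε, (e.symm (ε, J)).2) = e.symm (ε, J) := fun h =>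
    Prod.ext (he1' _ h).symm rfl
  have hIoo : ∀ {ε J}, (ε, J) ∈ e.target → ε ∈ Ioo (-ε₀) ε₀ := fun h => by
    have := D.mem_Ioo _ (hO h)
    rwa [he1' _ h] at this
  have hcomp : ∀ {ε J}, (ε, J) ∈ e.target →
      CompleteAt Ω F W ε ((cht (Model n) m).symm (Y (e.symm (ε, J)))) := fun h => by
    have := D.complete _ (hO h)
    rwa [he1' _ h] at this
  have hFeq : ∀ {ε J}, (ε, J) ∈ e.target → ∀ v i,
      F i ε (flow Ω F W (ε, v) ((cht (Model n) m).symm (Y (e.symm (ε, J))))) =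
        (e.symm (ε, J)).2 i := by
    intro ε J h v i
    rw [H.F_flow (hIoo h) (hcomp h v)]
    have := D.F_eq _ (hO h) i
    rwa [he1' _ h] at this
  have hdomeq : {q : ℝ × (Fin s → ℝ) | q.1 ∈ Ioo (-ρ) ρ ∧ q.2 ∈ {J | (q.1, J) ∈ e.target}} =
      e.target := by
    ext q
    refine ⟨fun h => h.2, fun h => ⟨?_, h⟩⟩
    have := e.map_target h
    rw [hes] at this
    rw [← he1' q h]
    exact this.1
  have hangle : ∀ {ε J}, (ε, J) ∈ e.target → ∀ φ u,
      vD (Model n) ((actionAngleFamily Ω F W m Y τ ρ β₀ e).chart ε J) φ u =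
        combL Ω F ε ((actionAngleFamily Ω F W m Y τ ρ β₀ e).chart ε J φ)
          (angleVec (fun j => τ j (e.symm (ε, J))) u) := fun h φ u =>
    H.vD_orbit_angleVec (hIoo h) (hcomp h) _ φ u
  have horb : ∀ {ε J}, (ε, J) ∈ e.target →
      range ((actionAngleFamily Ω F W m Y τ ρ β₀ e).chart ε J) =
        range fun v => flow Ω F W (ε, v) ((cht (Model n) m).symm (Y (e.symm (ε, J)))) := by
    intro ε J h
    ext p
    constructor
    · rintro ⟨φ, rfl⟩
      exact ⟨_, rfl⟩
    · rintro ⟨v, rfl⟩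
      obtain ⟨φ, rfl⟩ := angleVec_surjective (D.independent _ (hO h)) v
      exact ⟨φ, rfl⟩
  -- On `N_ε` the value of `F^ε` determines the actions, so a level set in `N_ε` is exactly one
  -- orbit.
  have htorus : ∀ {ε J}, (ε, J) ∈ e.target →
      (actionAngleFamily Ω F W m Y τ ρ β₀ e).torus F ε (e.symm (ε, J)).2 =
        range fun v => flow Ω F W (ε, v) ((cht (Model n) m).symm (Y (e.symm (ε, J)))) := by
    intro ε J h
    rw [← horb h]
    ext p
    constructor
    · rintro ⟨⟨J', hJ', φ, rfl⟩, h2⟩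
      have h3 : (e.symm (ε, J')).2 = (e.symm (ε, J)).2 := by
        funext i
        rw [← h2 i]
        exact (hFeq hJ' _ i).symm
      have h4 : e.symm (ε, J') = e.symm (ε, J) := by rw [← hpair hJ', h3, hpair h]
      have h5 : J' = J := congrArg Prod.snd (e.symm.injOn hJ' h h4)
      rw [h5]
      exact ⟨φ, rfl⟩
    · rintro ⟨φ, rfl⟩
      exact ⟨⟨J, h, φ, rfl⟩, fun i => hFeq h _ i⟩
  have hbase : ∀ {ε β}, ε ∈ Ioo (-ρ) ρ → β ∈ Metric.ball β₀ ρ → ∃ J, (ε, J) ∈ e.target ∧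
      e.symm (ε, J) = (ε, β) := by
    intro ε β hε hβ
    have h1 : (ε, β) ∈ e.source := by rw [hes]; exact ⟨hε, hβ⟩
    have h2 : (ε, (e (ε, β)).2) = e (ε, β) := Prod.ext (he1 (ε, β)).symm rfl
    exact ⟨(e (ε, β)).2, by rw [h2]; exact e.map_source h1, by rw [h2]; exact e.left_inv h1⟩
  have hρ0 : (0 : ℝ) ∈ Ioo (-ρ) ρ := ⟨by linarith, hρ⟩
  refine
    { radius_pos := hρ
      radius_le := ?_
      isOpen_base := Metric.isOpen_ball
      isConnected_base := Metric.isConnected_ball hρ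
      mem_base := Metric.mem_ball_self hρ
      isOpen_dom := ?_
      bijOn_energy := ?_
      contDiffOn_energy := ?_
      contDiffOn_fderiv_energy := ?_
      contMDiffOn_chart := ?_
      contMDiff_angles := ?_
      chart_eq_iff := ?_
      chart_mem := ?_
      F_chart := ?_
      invariant := ?_
      form_angle_angle := ?_
      form_angle_action := ?_
      torus_zero := ?_ }
  · have h1 : ∀ ε ∈ Ioo (-ρ) ρ, ε < ε₀ := by
      intro ε hε
      have : (ε, β₀) ∈ e.source := by rw [hes]; exact ⟨hε, Metric.mem_ball_self hρ⟩
      exact (D.mem_Ioo _ (heO this)).2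
    by_contra hlt
    have hlt' : ε₀ < ρ := not_le.1 hlt
    have h2 := h1 0 hρ0
    exact lt_irrefl _ (h1 ε₀ ⟨by linarith, hlt'⟩)
  · change IsOpen {q : ℝ × (Fin s → ℝ) | q.1 ∈ Ioo (-ρ) ρ ∧ q.2 ∈ {J | (q.1, J) ∈ e.target}}
    rw [hdomeq]
    exact e.open_target
  · intro ε hε
    refine ⟨fun J hJ => ?_, fun J hJ J' hJ' h => ?_, fun β hβ => ?_⟩
    · have := e.map_target hJ
      rw [hes] at this
      exact this.2
    · have h' : (e.symm (ε, J)).2 = (e.symm (ε, J')).2 := h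
      have h4 : e.symm (ε, J) = e.symm (ε, J') := by rw [← hpair hJ, h', hpair hJ']
      exact congrArg Prod.snd (e.symm.injOn hJ hJ' h4)
    · obtain ⟨J, h1, h2⟩ := hbase hε hβ
      exact ⟨J, h1, congrArg Prod.snd h2⟩
  · change ContDiffOn ℝ (r - 1 : ℕ∞) (fun q : ℝ × (Fin s → ℝ) => (e.symm (q.1, q.2)).2)
      {q : ℝ × (Fin s → ℝ) | q.1 ∈ Ioo (-ρ) ρ ∧ q.2 ∈ {J | (q.1, J) ∈ e.target}}
    rw [hdomeq]
    exact contDiff_snd.comp_contDiffOn he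
  · change ContDiffOn ℝ (r - 1 : ℕ∞)
      (fun q : ℝ × (Fin s → ℝ) => fderiv ℝ (fun J => (e.symm (q.1, J)).2) q.2)
      {q : ℝ × (Fin s → ℝ) | q.1 ∈ Ioo (-ρ) ρ ∧ q.2 ∈ {J | (q.1, J) ∈ e.target}}
    rw [hdomeq]
    exact hA.congr fun q hq => (hAd q hq).fderiv
  · intro q hq
    exact (D.contMDiffOn_chart H heO he he1' hq.2).contMDiffWithinAt
  · intro ε _ J hJ
    exact ContMDiff.comp (g := fun v => flow Ω F W (ε, v)
      ((cht (Model n) m).symm (Y (e.symm (ε, J)))))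
      (f := angleVec (fun j => τ j (e.symm (ε, J)))) (H.contMDiff_orbit (hIoo hJ) (hcomp hJ))
      (ContinuousLinearMap.contDiff _).contMDiff
  · intro ε _ J hJ J' hJ' φ φ'
    constructor
    · intro h
      have h3 : (e.symm (ε, J)).2 = (e.symm (ε, J')).2 := by
        funext i
        rw [← hFeq hJ (angleVec (fun j => τ j (e.symm (ε, J))) φ) i,
          ← hFeq hJ' (angleVec (fun j => τ j (e.symm (ε, J'))) φ') i]
        exact congrArg (F i ε) h
      have h4 : e.symm (ε, J) = e.symm (ε, J') := by rw [← hpair hJ, h3, hpair hJ']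
      have h5 : J = J' := congrArg Prod.snd (e.symm.injOn hJ hJ' h4)
      subst h5
      refine ⟨rfl, ?_⟩
      have h6 := (H.mem_periods (hIoo hJ) (hcomp hJ)).1
        ((H.flow_eq_flow_iff (hIoo hJ) (hcomp hJ)).1 h)
      have h7 := D.flow_eq_iff _ (hO hJ)
        (angleVec (fun j => τ j (e.symm (ε, J))) φ' - angleVec (fun j => τ j (e.symm (ε, J))) φ)
      rw [he1' _ hJ] at h7
      obtain ⟨z, hz⟩ := h7.1 h6
      exact ⟨z, (angleVec_sub_eq_iff (D.independent _ (hO hJ))).1 hz⟩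
    · rintro ⟨rfl, z, hz⟩
      refine (H.flow_eq_flow_iff (hIoo hJ) (hcomp hJ)).2 ((H.mem_periods (hIoo hJ) (hcomp hJ)).2 ?_)
      have h7 := D.flow_eq_iff _ (hO hJ)
        (angleVec (fun j => τ j (e.symm (ε, J))) φ' - angleVec (fun j => τ j (e.symm (ε, J))) φ)
      rw [he1' _ hJ] at h7
      exact h7.2 ⟨z, (angleVec_sub_eq_iff (D.independent _ (hO hJ))).2 hz⟩
  · intro ε _ J hJ φ
    exact flow_mem (hcomp hJ _)
  · intro ε _ J hJ φ i
    exact hFeq hJ _ i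
  · intro ε hε β hβ i
    obtain ⟨J, h1, h2⟩ := hbase hε hβ
    have h3 := htorus h1
    have h4 := H.flowInvariant_orbit (hIoo h1) (hcomp h1) i
    rw [← h3, h2] at h4
    exact h4
  · intro ε _ J hJ φ j k
    change Ω ((actionAngleFamily Ω F W m Y τ ρ β₀ e).chart ε J φ)
      (vD (Model n) ((actionAngleFamily Ω F W m Y τ ρ β₀ e).chart ε J) φ (Pi.single j 1))
      (vD (Model n) ((actionAngleFamily Ω F W m Y τ ρ β₀ e).chart ε J) φ (Pi.single k 1)) = 0
    rw [hangle hJ, hangle hJ]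
    have h3 := H.form_combL ε ((actionAngleFamily Ω F W m Y τ ρ β₀ e).chart ε J φ)
      (angleVec (fun j => τ j (e.symm (ε, J))) (Pi.single j 1))
      (combL Ω F ε ((actionAngleFamily Ω F W m Y τ ρ β₀ e).chart ε J φ)
        (angleVec (fun j => τ j (e.symm (ε, J))) (Pi.single k 1)))
    rw [H.dF_combL (x := (actionAngleFamily Ω F W m Y τ ρ β₀ e).chart ε J φ) (hIoo hJ)
      (flow_mem (hcomp hJ _))] at h3
    simpa using h3
  · intro ε _ J hJ φ j k
    change Ω ((actionAngleFamily Ω F W m Y τ ρ β₀ e).chart ε J φ)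
      (vD (Model n) ((actionAngleFamily Ω F W m Y τ ρ β₀ e).chart ε J) φ (Pi.single j 1))
      (vD (Model n) (fun J' => (actionAngleFamily Ω F W m Y τ ρ β₀ e).chart ε J' φ) J
        (Pi.single k 1)) = if j = k then 1 else 0
    rw [hangle hJ]
    have hd : MDifferentiableAt 𝓘(ℝ, Fin s → ℝ) 𝓘(ℝ, Model n)
        (fun J' => (actionAngleFamily Ω F W m Y τ ρ β₀ e).chart ε J' φ) J := by
      have h2 := (D.contMDiffOn_chart H heO he he1' (q := (ε, J, φ)) hJ).mdifferentiableAt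
        H.pred_ne_zero
      exact MDifferentiableAt.comp (f := fun J' : Fin s → ℝ => (ε, J', φ)) J h2
        (DifferentiableAt.mdifferentiableAt (by fun_prop))
    have hev : ∀ᶠ J' in 𝓝 J, (ε, J') ∈ e.target :=
      (Continuous.prodMk_right ε).continuousAt.eventually (e.open_target.mem_nhds hJ)
    have h2 := dF_vD (ε := ε) (F := F) hd (hAd (ε, J) hJ)
      (fun i => H.mdifferentiableAt i (hIoo hJ) _) (by
        filter_upwards [hev] with J' hJ' i
        exact hFeq hJ' _ i) (Pi.single k 1)
    have h3 := H.form_combL ε ((actionAngleFamily Ω F W m Y τ ρ β₀ e).chart ε J φ)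
      (angleVec (fun j => τ j (e.symm (ε, J))) (Pi.single j 1))
      (vD (Model n) (fun J' => (actionAngleFamily Ω F W m Y τ ρ β₀ e).chart ε J' φ) J
        (Pi.single k 1))
    rw [h2, angleVec_single] at h3
    simp only [Pi.smul_apply, smul_eq_mul, mul_assoc] at h3
    rw [← Finset.mul_sum, hAτ _ hJ, inv_mul_cancel_left₀ (by positivity), Pi.single_apply] at h3
    rw [angleVec_single]
    exact h3
  · obtain ⟨J, h1, h2⟩ := hbase hρ0 (Metric.mem_ball_self hρ)
    have h3 := htorus h1
    rw [h2, hY0, hΛ] at h3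
    exact h3

end Construction


/-- Any cluster point of `σ` in `K` is sent to `θ a`, hence is `a`. It lets a curve on a torus be
lifted to angles converging to a chosen value, without covering space theory. -/
lemma tendsto_of_compact_of_unique {X Z : Type*} [TopologicalSpace X] [TopologicalSpace Z]
    [T2Space Z] {α : Type*} {l : Filter α} {θ : X → Z} (hθ : Continuous θ) {K : Set X}
    (hK : IsCompact K) {a : X} (huniq : ∀ a' ∈ K, θ a' = θ a → a' = a) {σ : α → X}
    (hσ : ∀ᶠ t in l, σ t ∈ K) (hlim : Filter.Tendsto (fun t => θ (σ t)) l (𝓝 (θ a))) :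
    Filter.Tendsto σ l (𝓝 a) := by
  refine hK.tendsto_nhds_of_unique_mapClusterPt hσ fun a' ha' hcl => huniq a' ha' ?_
  have h1 : MapClusterPt (θ a') l (θ ∘ σ) := hcl.tendsto_comp hθ.continuousAt
  by_contra hne
  have h2 : (𝓝 (θ a') ⊓ Filter.map (θ ∘ σ) l).NeBot := h1
  have h3 : 𝓝 (θ a') ⊓ Filter.map (θ ∘ σ) l ≤ 𝓝 (θ a') ⊓ 𝓝 (θ a) := inf_le_inf_left _ hlim
  rw [(disjoint_nhds_nhds.2 hne).eq_bot, le_bot_iff] at h3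
  exact h2.ne h3

/-! ### Tangency and frequencies on an arbitrary family of tori. -/

namespace IsTorusFamily

variable {n : ℕ} {M : Type*} [TopologicalSpace M] [ChartedSpace (Model n) M]
  {s : ℕ} {r : ℕ∞} {Ω : M → Model n →L[ℝ] Model n →L[ℝ] ℝ} {ε₀ : ℝ} {F : Fin s → ℝ → M → ℝ}
  {W Λ : Set M} {β₀ : Fin s → ℝ} {T : TorusFamily s M} {ε : ℝ} {J : Fin s → ℝ}

lemma mem_Ioo (hT : IsTorusFamily 1 r Ω ε₀ F Λ W β₀ T) (hε : ε ∈ Ioo (-T.radius) T.radius) :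
    ε ∈ Ioo (-ε₀) ε₀ :=
  ⟨by linarith [hε.1, hT.radius_le], hε.2.trans_le hT.radius_le⟩

lemma range_chart (hT : IsTorusFamily 1 r Ω ε₀ F Λ W β₀ T) (hε : ε ∈ Ioo (-T.radius) T.radius)
    (hJ : J ∈ T.dom ε) : range (T.chart ε J) = T.torus F ε (T.energy ε J) := by
  ext p
  constructor
  · rintro ⟨φ, rfl⟩
    exact ⟨⟨J, hJ, φ, rfl⟩, fun i => hT.F_chart ε hε J hJ φ i⟩
  · rintro ⟨⟨J', hJ', φ, rfl⟩, h2⟩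
    have h3 : T.energy ε J' = T.energy ε J := by
      funext i
      rw [← h2 i]
      exact (hT.F_chart ε hε J' hJ' φ i).symm
    rw [(hT.bijOn_energy ε hε).injOn hJ' hJ h3]
    exact ⟨φ, rfl⟩

lemma eventually_mem_dom (hT : IsTorusFamily 1 r Ω ε₀ F Λ W β₀ T)
    (hε : ε ∈ Ioo (-T.radius) T.radius) (hJ : J ∈ T.dom ε) : ∀ᶠ J' in 𝓝 J, J' ∈ T.dom ε := by
  have h1 : Continuous (fun J' : Fin s → ℝ => (ε, J')) := Continuous.prodMk_right ε
  have h2 := (h1.continuousAt (x := J)).eventually (hT.isOpen_dom.mem_nhds ⟨hε, hJ⟩)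
  filter_upwards [h2] with J' h
  exact h.2

lemma hasFDerivAt_energy (hT : IsTorusFamily 1 r Ω ε₀ F Λ W β₀ T)
    (hε : ε ∈ Ioo (-T.radius) T.radius) (hJ : J ∈ T.dom ε) :
    HasFDerivAt (T.energy ε) (fderiv ℝ (T.energy ε) J) J := by
  have h1 := ((hT.contDiffOn_energy.contDiffAt (x := (ε, J))
    (hT.isOpen_dom.mem_nhds ⟨hε, hJ⟩)).differentiableAt (by simp)).hasFDerivAt
  exact (HasFDerivAt.comp (f := fun J' : Fin s → ℝ => (ε, J')) J h1
    (hasFDerivAt_prodMk_right (𝕜 := ℝ) ε J)).differentiableAt.hasFDerivAt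

lemma mdifferentiableAt_action (hT : IsTorusFamily 1 r Ω ε₀ F Λ W β₀ T)
    (hε : ε ∈ Ioo (-T.radius) T.radius) (hJ : J ∈ T.dom ε) (φ : Fin s → ℝ) :
    MDifferentiableAt 𝓘(ℝ, Fin s → ℝ) 𝓘(ℝ, Model n) (fun J' => T.chart ε J' φ) J := by
  have ho : IsOpen {q : ℝ × (Fin s → ℝ) × (Fin s → ℝ) |
      q.1 ∈ Ioo (-T.radius) T.radius ∧ q.2.1 ∈ T.dom q.1} :=
    hT.isOpen_dom.preimage (f := fun q : ℝ × (Fin s → ℝ) × (Fin s → ℝ) => (q.1, q.2.1))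
      (by fun_prop)
  have h1 := (hT.contMDiffOn_chart.contMDiffAt (x := (ε, J, φ))
    (ho.mem_nhds ⟨hε, hJ⟩)).mdifferentiableAt (by simp)
  exact MDifferentiableAt.comp (f := fun J' : Fin s → ℝ => (ε, J', φ)) J h1
    (DifferentiableAt.mdifferentiableAt (by fun_prop))

variable [T2Space M] [IsManifold (𝓡 (2 * n)) r M]

lemma mdifferentiableAt_angle (hT : IsTorusFamily 1 r Ω ε₀ F Λ W β₀ T)
    (H : Involutive r Ω ε₀ F W) (hε : ε ∈ Ioo (-T.radius) T.radius) (hJ : J ∈ T.dom ε)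
    (φ : Fin s → ℝ) :
    MDifferentiableAt 𝓘(ℝ, Fin s → ℝ) 𝓘(ℝ, Model n) (T.chart ε J) φ :=
  (hT.contMDiff_angles ε hε J hJ φ).mdifferentiableAt H.ne_zero

lemma dF_action (hT : IsTorusFamily 1 r Ω ε₀ F Λ W β₀ T) (H : Involutive r Ω ε₀ F W)
    (hε : ε ∈ Ioo (-T.radius) T.radius) (hJ : J ∈ T.dom ε) (φ w : Fin s → ℝ) :
    dF F ε (T.chart ε J φ) (vD (Model n) (fun J' => T.chart ε J' φ) J w) =
      fderiv ℝ (T.energy ε) J w :=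
  dF_vD (hT.mdifferentiableAt_action hε hJ φ) (hT.hasFDerivAt_energy hε hJ)
    (fun i => H.mdifferentiableAt i (hT.mem_Ioo hε) _) (by
      filter_upwards [hT.eventually_mem_dom hε hJ] with J' hJ' i
      exact hT.F_chart ε hε J' hJ' φ i) w

/-- The pairing of angle and action directions. -/
lemma form_vD (hT : IsTorusFamily 1 r Ω ε₀ F Λ W β₀ T)
    (hε : ε ∈ Ioo (-T.radius) T.radius) (hJ : J ∈ T.dom ε) (φ u : Fin s → ℝ) (k : Fin s) :
    Ω (T.chart ε J φ) (vD (Model n) (T.chart ε J) φ u)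
      (vD (Model n) (fun J' => T.chart ε J' φ) J (Pi.single k 1)) = u k := by
  have h1 : ∀ j, Ω (T.chart ε J φ) (vD (Model n) (T.chart ε J) φ (Pi.single j 1))
      (vD (Model n) (fun J' => T.chart ε J' φ) J (Pi.single k 1)) = if j = k then 1 else 0 :=
    fun j => hT.form_angle_action ε hε J hJ φ j k
  have hu : u = ∑ j, u j • (Pi.single j (1 : ℝ) : Fin s → ℝ) := by
    rw [← pi_eq_sum_univ' u]
  conv_lhs => rw [hu]
  rw [map_sum, map_sum, _root_.sum_apply]
  simp only [map_smul, _root_.smul_apply, smul_eq_mul, h1]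
  simp

lemma vD_chart_injective (hT : IsTorusFamily 1 r Ω ε₀ F Λ W β₀ T)
    (hε : ε ∈ Ioo (-T.radius) T.radius) (hJ : J ∈ T.dom ε) (φ : Fin s → ℝ) :
    Function.Injective (vD (Model n) (T.chart ε J) φ) := by
  rw [injective_iff_map_eq_zero]
  intro u hu
  funext k
  have := hT.form_vD hε hJ φ u k
  rw [hu, map_zero] at this
  exact this.symm

/-- The Hamiltonian fields are tangent to the tori. -/
lemma exists_vD_eq_ham (hT : IsTorusFamily 1 r Ω ε₀ F Λ W β₀ T) (H : Involutive r Ω ε₀ F W)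
    (hε : ε ∈ Ioo (-T.radius) T.radius) (hJ : J ∈ T.dom ε) (φ : Fin s → ℝ) (i : Fin s) :
    ∃ u, vD (Model n) (T.chart ε J) φ u = ham Ω (F i ε) (T.chart ε J φ) := by
  have hM1 := H.isManifold_one
  have hε' := hT.mem_Ioo hε
  set x := T.chart ε J φ with hx
  have hxW : x ∈ W := hT.chart_mem ε hε J hJ φ
  have hxs : x ∈ (cht (Model n) x).source := mem_extChartAt_source x
  set v : Fin s → ℝ := Pi.single i 1 with hv
  have hz := H.flow_zero hε' hxW
  obtain ⟨t₁, ht₁, hγ, hγd⟩ := H.exists_orbit_extension hε' (v := v) (x := x) le_rfl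
    (by rw [zero_smul]; exact zero_mem_flowDom hxW)
  have hX : combField Ω F (ε, v) = ham Ω (F i ε) := funext fun z => combField_single ε i z
  rw [hX] at hγ
  have hmem : ∀ t ∈ Icc 0 t₁, flow Ω F W (ε, t • v) x ∈ range (T.chart ε J) := by
    intro t ht
    rw [hT.range_chart hε hJ]
    refine hT.invariant ε hε (T.energy ε J) ((hT.bijOn_energy ε hε).mapsTo hJ) i _ (Icc 0 t₁)
      ordConnected_Icc hγ 0 (left_mem_Icc.2 ht₁.le) ?_ t ht
    simp only [zero_smul]
    rw [hz, ← hT.range_chart hε hJ]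
    exact ⟨φ, rfl⟩
  -- A cube of side `2π` centred at `φ`: every point of the torus has angles in it, and the point
  -- with angles `φ` has no other representative there, `φ` being interior.
  set K : Set (Fin s → ℝ) := Icc (fun j => φ j - Real.pi) (fun j => φ j + Real.pi) with hK
  have hlift : ∀ t ∈ Icc 0 t₁, ∃ φ' ∈ K, T.chart ε J φ' = flow Ω F W (ε, t • v) x := by
    intro t ht
    obtain ⟨φ₁, hφ₁⟩ := hmem t ht
    have h2 : ∀ j, ∃ z : ℤ, φ₁ j + 2 * Real.pi * z ∈ Icc (φ j - Real.pi) (φ j + Real.pi) := by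
      intro j
      refine ⟨-toIcoDiv Real.two_pi_pos (φ j - Real.pi) (φ₁ j), ?_⟩
      have h3 := sub_toIcoDiv_zsmul_mem_Ico Real.two_pi_pos (φ j - Real.pi) (φ₁ j)
      rw [zsmul_eq_mul] at h3
      push_cast
      constructor
      · linarith [h3.1]
      · linarith [h3.2]
    choose z hz using h2
    refine ⟨fun j => φ₁ j + 2 * Real.pi * z j, ⟨fun j => (hz j).1, fun j => (hz j).2⟩, ?_⟩
    rw [← hφ₁]
    exact ((hT.chart_eq_iff ε hε J hJ J hJ _ _).2 ⟨rfl, z, fun j => rfl⟩).symm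
  choose! σ hσK hσ using hlift
  have huniq : ∀ φ' ∈ K, T.chart ε J φ' = T.chart ε J φ → φ' = φ := by
    intro φ' hφ' he
    obtain ⟨-, z, hz⟩ := (hT.chart_eq_iff ε hε J hJ J hJ _ _).1 he
    funext j
    have h1 := hφ'.1 j
    have h2 := hφ'.2 j
    have h3 := hz j
    simp only at h1 h2
    have hz0 : z j = 0 := by
      have hpi := Real.pi_pos
      have a1 : (-1 : ℝ) < z j := by nlinarith
      have a2 : (z j : ℝ) < 1 := by nlinarith
      have b1 : -1 < z j := by exact_mod_cast a1
      have b2 : z j < 1 := by exact_mod_cast a2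
      omega
    rw [h3, hz0]; simp
  have hstr := (H.hasStrictFDerivAt_flow_cht hε' (v := 0) (x₀ := x) (zero_mem_flowDom hxW)
    (by rw [hz]; exact hxs)).2.hasFDerivAt
  rw [hz] at hstr
  have hline : HasDerivAt (fun t : ℝ => t • v) v 0 := by
    simpa using (hasDerivAt_id (0 : ℝ)).smul_const v
  have hcur : HasDerivAt (fun t : ℝ => cht (Model n) x (flow Ω F W (ε, t • v) x))
      (((chartD (Model n) x x).comp (combL Ω F ε x)) v) 0 := by
    refine HasFDerivAt.comp_hasDerivAt (f := fun t : ℝ => t • v)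
      (l := fun v => cht (Model n) x (flow Ω F W (ε, v) x)) 0 ?_ hline
    rw [zero_smul]; exact hstr
  have hθ : HasFDerivAt (fun φ' => cht (Model n) x (T.chart ε J φ'))
      ((chartD (Model n) x x).comp (vD (Model n) (T.chart ε J) φ)) φ :=
    hasMFDerivAt_iff_hasFDerivAt.1 ((hasMFDerivAt_cht (x₀ := x) hxs).comp φ
      (hT.mdifferentiableAt_angle H hε hJ φ).hasMFDerivAt)
  have hcD : Function.Injective (chartD (Model n) x x) :=
    Function.LeftInverse.injective (g := chartSymmD (Model n) x (cht (Model n) x x))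
      fun u => chartSymmD_chartD' hxs u
  have hσlim : Filter.Tendsto σ (𝓝[Icc 0 t₁ \ {0}] 0) (𝓝 φ) := by
    refine tendsto_of_compact_of_unique (θ := T.chart ε J)
      (hT.contMDiff_angles ε hε J hJ).continuous isCompact_Icc huniq ?_ ?_
    · filter_upwards [self_mem_nhdsWithin] with t ht
      exact hσK t ht.1
    · have hc : Filter.Tendsto (fun t : ℝ => flow Ω F W (ε, t • v) x) (𝓝[Icc 0 t₁ \ {0}] 0)
          (𝓝 x) := by
        have h1 : ContinuousAt (fun v => flow Ω F W (ε, v) x) ((0 : ℝ) • v) := by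
          rw [zero_smul]
          exact (H.contMDiffAt_flow_vec hε' (zero_mem_flowDom hxW)).continuousAt
        have h2 : ContinuousAt (fun t : ℝ => flow Ω F W (ε, t • v) x) 0 :=
          ContinuousAt.comp (f := fun t : ℝ => t • v) (g := fun v => flow Ω F W (ε, v) x) h1
            hline.continuousAt
        have h3 := h2.tendsto
        simp only [zero_smul] at h3
        rw [hz] at h3
        exact h3.mono_left nhdsWithin_le_nhds
      refine hc.congr' ?_
      filter_upwards [self_mem_nhdsWithin] with t ht
      exact (hσ t ht.1).symm
  have hne : (𝓝[Icc 0 t₁ \ {0}] (0 : ℝ)).NeBot := by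
    have h1 : Ioo 0 t₁ ⊆ Icc 0 t₁ \ {0} := fun t ht => ⟨Ioo_subset_Icc_self ht, ht.1.ne'⟩
    exact (left_nhdsWithin_Ioo_neBot ht₁).mono (nhdsWithin_mono _ h1)
  have hr := mem_range_of_curve_factors hθ (Function.Injective.comp (g := chartD (Model n) x x) hcD
    (hT.vD_chart_injective hε hJ φ)) hσlim (hcur.hasDerivWithinAt (s := Icc 0 t₁))
    (by simp only [zero_smul]; rw [hz]) (by
      filter_upwards [self_mem_nhdsWithin] with t ht
      rw [hσ t ht.1])
  obtain ⟨u, hu⟩ := hr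
  refine ⟨u, hcD ?_⟩
  have h4 : combL Ω F ε x v = ham Ω (F i ε) x := by rw [combL_apply, hX]
  rw [← h4]
  exact hu

/-- The frequencies of the flow of the `κ`-th Hamiltonian. -/
def _root_.Nekhoroshev.TorusFamily.freq (T : TorusFamily s M) (κ : Fin s) (q : ℝ × (Fin s → ℝ)) :
    Fin s → ℝ :=
  fun j => fderiv ℝ (T.energy q.1) q.2 (Pi.single j 1) κ

/-- Once the field is known to be tangent, pairing it with `∂_{I_k}` reads off its `k`-th angular
component by the canonical relation; by the definition of the Hamiltonian field, the same pairing is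
`∂F_κ/∂I_k`. -/
lemma vD_freq (hT : IsTorusFamily 1 r Ω ε₀ F Λ W β₀ T) (H : Involutive r Ω ε₀ F W)
    (hε : ε ∈ Ioo (-T.radius) T.radius) (hJ : J ∈ T.dom ε) (φ : Fin s → ℝ) (κ : Fin s) :
    vD (Model n) (T.chart ε J) φ (T.freq κ (ε, J)) = ham Ω (F κ ε) (T.chart ε J φ) := by
  obtain ⟨u, hu⟩ := hT.exists_vD_eq_ham H hε hJ φ κ
  have h1 : u = T.freq κ (ε, J) := by
    funext k
    rw [← hT.form_vD hε hJ φ u k, hu, form_ham H.symplectic, ← dF_apply, hT.dF_action H hε hJ]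
    rfl
  rw [← h1, hu]

/-- The map from actions to energies is nonsingular. -/
lemma fderiv_energy_injective (hT : IsTorusFamily 1 r Ω ε₀ F Λ W β₀ T) (H : Involutive r Ω ε₀ F W)
    (hε : ε ∈ Ioo (-T.radius) T.radius) (hJ : J ∈ T.dom ε) (w : Fin s → ℝ)
    (hw : fderiv ℝ (T.energy ε) J w = 0) : w = 0 := by
  have hε' := hT.mem_Ioo hε
  have hW := hT.chart_mem ε hε J hJ 0
  set A : Matrix (Fin s) (Fin s) ℝ := Matrix.of fun i j => T.freq i (ε, J) j with hA
  -- The rows are the angular velocities of `X₁, …, X_s`. A relation between them would be a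
  -- relation between the fields at a point of the torus.
  have hAu : IsUnit A := by
    rw [← Matrix.linearIndependent_rows_iff_isUnit, Fintype.linearIndependent_iff]
    intro c hc
    have h1 : combL Ω F ε (T.chart ε J 0) c = 0 := by
      rw [combL_apply, combField]
      have h2 : ∀ i, ham Ω (F i ε) (T.chart ε J 0) =
          vD (Model n) (T.chart ε J) 0 (A.row i) := fun i => (hT.vD_freq H hε hJ 0 i).symm
      simp only [h2, ← map_smul, ← map_sum]
      rw [hc, map_zero]
    exact congrFun (H.combL_injective hε' hW (h1.trans (map_zero _).symm))
  refine Matrix.mulVec_injective_of_isUnit hAu ?_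
  rw [Matrix.mulVec_zero, ← hw]
  funext i
  have hwe : w = ∑ j, w j • (Pi.single j (1 : ℝ) : Fin s → ℝ) := by
    rw [← pi_eq_sum_univ' w]
  conv_rhs => rw [hwe]
  rw [map_sum, Finset.sum_apply]
  simp only [map_smul, Pi.smul_apply, smul_eq_mul, Matrix.mulVec, dotProduct]
  refine Finset.sum_congr rfl fun j _ => ?_
  rw [mul_comm]
  rfl

lemma isQuasiperiodicOn (hT : IsTorusFamily 1 r Ω ε₀ F Λ W β₀ T) (H : Involutive r Ω ε₀ F W)
    (hε : ε ∈ Ioo (-T.radius) T.radius) (hJ : J ∈ T.dom ε) (κ : Fin s)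
    (hω : LinearIndependent ℚ (T.freq κ (ε, J))) :
    IsQuasiperiodicOn (n := n) r s (hamVF Ω (F κ ε)) (T.torus F ε (T.energy ε J)) := by
  refine ⟨T.freq κ (ε, J), T.chart ε J, hω, hT.contMDiff_angles ε hε J hJ,
    hT.vD_chart_injective hε hJ, fun φ φ' => ?_, hT.range_chart hε hJ, fun φ => ?_⟩
  · rw [hT.chart_eq_iff ε hε J hJ J hJ]
    simp
  · rw [isMIntegralCurve_iff_isMIntegralCurveOn]
    intro t _
    have hc : HasDerivWithinAt (fun t : ℝ => φ + t • T.freq κ (ε, J)) (T.freq κ (ε, J)) univ t := by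
      simpa using ((hasDerivAt_id t).smul_const (T.freq κ (ε, J))).const_add φ
    have h1 := hasMFDerivWithinAt_comp_curve (f := T.chart ε J)
      (c := fun t : ℝ => φ + t • T.freq κ (ε, J)) (hT.mdifferentiableAt_angle H hε hJ _) hc
    rw [hT.vD_freq H hε hJ] at h1
    exact h1

end IsTorusFamily


/-- A rational relation confines `ω` to one of countably many proper subspaces. -/
lemma volume_not_linearIndependent_rat (s : ℕ) :
    (volume : Measure (Fin s → ℝ)) {ω | ¬ LinearIndependent ℚ ω} = 0 := by
  have hsub : {ω : Fin s → ℝ | ¬ LinearIndependent ℚ ω} ⊆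
      ⋃ c ∈ {c : Fin s → ℚ | c ≠ 0}, ((LinearMap.ker (∑ i, (c i : ℝ) •
        (LinearMap.proj i : (Fin s → ℝ) →ₗ[ℝ] ℝ)) : Submodule ℝ (Fin s → ℝ)) :
          Set (Fin s → ℝ)) := by
    intro ω hω
    rw [mem_ofPred_eq, Fintype.linearIndependent_iff] at hω
    push Not at hω
    obtain ⟨c, hc, i, hi⟩ := hω
    refine mem_biUnion (x := c) (fun h => hi (by rw [h]; rfl)) ?_
    rw [SetLike.mem_coe, LinearMap.mem_ker]
    simpa [Rat.smul_def] using hc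
  refine measure_mono_null hsub ((measure_biUnion_null_iff (to_countable _)).2 fun c hc => ?_)
  refine Measure.addHaar_submodule _ _ fun htop => hc ?_
  funext i
  have h1 : (Pi.single i 1 : Fin s → ℝ) ∈ (⊤ : Submodule ℝ (Fin s → ℝ)) := trivial
  rw [← htop, LinearMap.mem_ker] at h1
  simpa [Pi.single_apply] using h1

/-! ### Quasiperiodicity on almost every torus. -/

namespace IsTorusFamily

variable {n : ℕ} {M : Type*} [TopologicalSpace M] [ChartedSpace (Model n) M]
  {s : ℕ} {r : ℕ∞} {Ω : M → Model n →L[ℝ] Model n →L[ℝ] ℝ} {ε₀ : ℝ} {F : Fin s → ℝ → M → ℝ}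
  {W Λ : Set M} {β₀ : Fin s → ℝ} {T : TorusFamily s M} {ε : ℝ} {J : Fin s → ℝ}

lemma contDiffOn_freq (hT : IsTorusFamily 1 r Ω ε₀ F Λ W β₀ T) (κ : Fin s) :
    ContDiffOn ℝ (1 : ℕ∞) (T.freq κ) {q | q.1 ∈ Ioo (-T.radius) T.radius ∧ q.2 ∈ T.dom q.1} :=
  contDiffOn_pi.2 fun j =>
    contDiffOn_pi.1 (hT.contDiffOn_fderiv_energy.clm_apply (contDiffOn_const (c := Pi.single j 1))) κ

/-- The Hessian is the derivative of the frequency map. -/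
lemma hessian_apply (hT : IsTorusFamily 1 r Ω ε₀ F Λ W β₀ T) (κ : Fin s) (hJ : J ∈ T.dom 0)
    (j k : Fin s) : T.hessian κ J j k = fderiv ℝ (T.freq κ) (0, J) (0, Pi.single j 1) k := by
  have h0 : (0 : ℝ) ∈ Ioo (-T.radius) T.radius := ⟨by linarith [hT.radius_pos], hT.radius_pos⟩
  have h1 := (((hT.contDiffOn_freq κ).contDiffAt (x := (0, J))
    (hT.isOpen_dom.mem_nhds ⟨h0, hJ⟩)).differentiableAt (by simp)).hasFDerivAt
  have h2 := HasFDerivAt.comp (f := fun J' : Fin s → ℝ => ((0 : ℝ), J')) J h1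
    (hasFDerivAt_prodMk_right (𝕜 := ℝ) 0 J)
  have h3 : HasFDerivAt (fun J' => fderiv ℝ (fun J'' => T.energy 0 J'' κ) J' (Pi.single k 1))
      ((ContinuousLinearMap.proj k : (Fin s → ℝ) →L[ℝ] ℝ).comp
        ((fderiv ℝ (T.freq κ) (0, J)).comp (ContinuousLinearMap.inr ℝ ℝ (Fin s → ℝ)))) J := by
    refine (hasFDerivAt_pi'.1 h2 k).congr_of_eventuallyEq ?_
    filter_upwards [hT.eventually_mem_dom h0 hJ] with J' hJ'
    have h4 := hasFDerivAt_pi'.1 (hT.hasFDerivAt_energy h0 hJ') κ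
    rw [h4.fderiv]
    rfl
  rw [TorusFamily.hessian, Matrix.of_apply, h3.fderiv]
  rfl

variable [T2Space M] [IsManifold (𝓡 (2 * n)) r M]

/-- The frequency map and the energy map are both local diffeomorphisms in the actions, for all
small `ε` on a common neighbourhood. The exceptional `β` form the image of a null set of frequencies
under the `C^1` map energy ∘ frequency⁻¹. -/
theorem ae_quasiperiodic (hT : IsTorusFamily 1 r Ω ε₀ F Λ W β₀ T) (H : Involutive r Ω ε₀ F W)
    (κ : Fin s) (hJ : J ∈ T.dom 0) (hJβ : T.energy 0 J = β₀) (hdet : (T.hessian κ J).det ≠ 0) :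
    ∃ ε₁ > 0, ε₁ ≤ T.radius ∧ ∀ ε ∈ Ioo (-ε₁) ε₁,
      ∃ B₀ : Set (Fin s → ℝ), IsOpen B₀ ∧ β₀ ∈ B₀ ∧ B₀ ⊆ T.base ∧
        ∀ᵐ β ∂(volume : Measure (Fin s → ℝ)), β ∈ B₀ →
          IsQuasiperiodicOn (n := n) r s (hamVF Ω (F κ ε)) (T.torus F ε β) := by
  have h0 : (0 : ℝ) ∈ Ioo (-T.radius) T.radius := ⟨by linarith [hT.radius_pos], hT.radius_pos⟩
  set 𝒟 : Set (ℝ × (Fin s → ℝ)) := {q | q.1 ∈ Ioo (-T.radius) T.radius ∧ q.2 ∈ T.dom q.1} with h𝒟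
  have h𝒟o : IsOpen 𝒟 := hT.isOpen_dom
  have hq0 : (0, J) ∈ 𝒟 := ⟨h0, hJ⟩
  -- With `ε` added as an identity component, invertibility in the actions at `ε = 0` gives a local
  -- inverse valid for all nearby `ε` at once.
  have hder : ∀ {f : ℝ × (Fin s → ℝ) → Fin s → ℝ}, ContDiffOn ℝ (1 : ℕ∞) f 𝒟 →
      (∀ w, fderiv ℝ f (0, J) (0, w) = 0 → w = 0) →
      ∃ L : (ℝ × (Fin s → ℝ)) ≃L[ℝ] (ℝ × (Fin s → ℝ)), HasFDerivAt (fun q => (q.1, f q))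
        (L : (ℝ × (Fin s → ℝ)) →L[ℝ] (ℝ × (Fin s → ℝ))) (0, J) := by
    intro f hf hinj
    have hd := ((hf.contDiffAt (h𝒟o.mem_nhds hq0)).differentiableAt (by simp)).hasFDerivAt
    obtain ⟨L, hL⟩ := exists_equiv_of_injective
      (A := (ContinuousLinearMap.fst ℝ ℝ (Fin s → ℝ)).prod (fderiv ℝ f (0, J))) (by
        rintro ⟨a, w⟩ hu
        simp only [ContinuousLinearMap.prod_apply, Prod.mk_eq_zero,
          ContinuousLinearMap.coe_fst'] at hu
        obtain ⟨rfl, h2⟩ := hu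
        rw [hinj w h2]; rfl)
    exact ⟨L, by rw [hL]; exact hasFDerivAt_fst.prodMk hd⟩
  have hEd : ContDiffOn ℝ (1 : ℕ∞) (fun q : ℝ × (Fin s → ℝ) => T.energy q.1 q.2) 𝒟 :=
    hT.contDiffOn_energy
  obtain ⟨L₂, hL₂⟩ := hder (hT.contDiffOn_freq κ) (by
    intro w hw
    refine Matrix.eq_zero_of_vecMul_eq_zero hdet ?_
    rw [← hw]
    funext k
    have hwe : ((0 : ℝ), w) = ∑ j, w j • ((0 : ℝ), (Pi.single j (1 : ℝ) : Fin s → ℝ)) := by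
      have h1 : (ContinuousLinearMap.inr ℝ ℝ (Fin s → ℝ)) w = ContinuousLinearMap.inr ℝ ℝ (Fin s → ℝ)
          (∑ j, w j • (Pi.single j (1 : ℝ) : Fin s → ℝ)) := by rw [← pi_eq_sum_univ' w]
      simp only [map_sum, map_smul] at h1
      exact h1
    rw [hwe, map_sum, Finset.sum_apply]
    simp only [map_smul, Pi.smul_apply, smul_eq_mul, Matrix.vecMul, dotProduct]
    exact Finset.sum_congr rfl fun j _ => by rw [hT.hessian_apply κ hJ])
  obtain ⟨L₁, hL₁⟩ := hder hEd (by
    intro w hw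
    refine hT.fderiv_energy_injective H h0 hJ w ?_
    have h1 := ((hEd.contDiffAt (h𝒟o.mem_nhds hq0)).differentiableAt (by simp)).hasFDerivAt
    have h2 := HasFDerivAt.comp (f := fun J' : Fin s → ℝ => ((0 : ℝ), J')) J h1
      (hasFDerivAt_prodMk_right (𝕜 := ℝ) 0 J)
    have h3 : fderiv ℝ (T.energy 0) J = _ := h2.fderiv
    rw [h3]
    exact hw)
  obtain ⟨e₂, he₂, h0e₂, he₂𝒟, he₂s, -⟩ := exists_inverse_on_nhds le_rfl h𝒟o
    (contDiff_fst.contDiffOn.prodMk (hT.contDiffOn_freq κ)) hq0 hL₂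
  -- The energy chart is taken inside the source of the frequency chart, so every `β` it reaches
  -- comes from actions that are recovered from their frequencies.
  obtain ⟨e₁, he₁, h0e₁, he₁s, -, -⟩ := exists_inverse_on_nhds le_rfl e₂.open_source
    ((contDiff_fst.contDiffOn.prodMk hEd).mono he₂𝒟) h0e₂ hL₁
  have hβt : (0, β₀) ∈ e₁.target := by
    have := e₁.map_source h0e₁
    rw [he₁] at this
    rwa [hJβ] at this
  have hopen : IsOpen {a : ℝ | (a, β₀) ∈ e₁.target} :=
    e₁.open_target.preimage (Continuous.prodMk_left β₀)
  obtain ⟨δ, hδ, hδs⟩ := Metric.isOpen_iff.1 hopen 0 hβt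
  refine ⟨min δ T.radius, lt_min hδ hT.radius_pos, min_le_right _ _, fun ε hε => ?_⟩
  have hεδ : (ε, β₀) ∈ e₁.target := by
    refine hδs ?_
    rw [Metric.mem_ball, Real.dist_eq, sub_zero, abs_lt]
    exact ⟨by linarith [hε.1, min_le_left δ T.radius], hε.2.trans_le (min_le_left _ _)⟩
  have hεr : ε ∈ Ioo (-T.radius) T.radius :=
    ⟨by linarith [hε.1, min_le_right δ T.radius], hε.2.trans_le (min_le_right _ _)⟩
  have hpt : ∀ β, (ε, β) ∈ e₁.target → ∃ J', (ε, J') ∈ e₂.source ∧ T.energy ε J' = β := by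
    intro β hβ
    have h1 := e₁.right_inv hβ
    have h2 := e₁.map_target hβ
    rw [he₁] at h1
    have h3 : (e₁.symm (ε, β)).1 = ε := congrArg Prod.fst h1
    have h4 : T.energy (e₁.symm (ε, β)).1 (e₁.symm (ε, β)).2 = β := congrArg Prod.snd h1
    refine ⟨(e₁.symm (ε, β)).2, ?_, by rw [← h3]; rw [h3]; rw [h3] at h4; exact h4⟩
    have h5 : (ε, (e₁.symm (ε, β)).2) = e₁.symm (ε, β) := Prod.ext h3.symm rfl
    rw [h5]
    exact he₁s h2
  refine ⟨{β | (ε, β) ∈ e₁.target}, e₁.open_target.preimage (Continuous.prodMk_right ε), hεδ, ?_, ?_⟩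
  · intro β hβ
    obtain ⟨J', hJ', rfl⟩ := hpt β hβ
    exact (hT.bijOn_energy ε hεr).mapsTo (he₂𝒟 hJ').2
  · set N : Set (Fin s → ℝ) := {ω | (ε, ω) ∈ e₂.target} ∩ {ω | ¬ LinearIndependent ℚ ω} with hN
    -- From frequencies to energies at fixed `ε`. The map is differentiable on `N` between spaces of
    -- equal dimension, so it sends the null set `N` to a null set.
    set g : (Fin s → ℝ) → Fin s → ℝ := fun ω =>
      T.energy (e₂.symm (ε, ω)).1 (e₂.symm (ε, ω)).2 with hg
    have hgd : DifferentiableOn ℝ g N := by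
      have h1 : ContDiffOn ℝ (1 : ℕ∞) (fun ω : Fin s → ℝ => e₂.symm (ε, ω)) N :=
        he₂s.comp (contDiff_prodMk_right ε).contDiffOn fun ω hω => hω.1
      have h2 : ContDiffOn ℝ (1 : ℕ∞) g N :=
        hEd.comp h1 fun ω hω => he₂𝒟 (e₂.map_target hω.1)
      exact h2.differentiableOn (by simp)
    have hN0 : (volume : Measure (Fin s → ℝ)) N = 0 :=
      measure_mono_null inter_subset_right (volume_not_linearIndependent_rat s)
    have hgN := addHaar_image_eq_zero_of_differentiableOn_of_addHaar_eq_zero volume hgd hN0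
    have hae := measure_eq_zero_iff_ae_notMem.1 hgN
    filter_upwards [hae] with β hβ hβt
    obtain ⟨J', hJ', rfl⟩ := hpt β hβt
    refine hT.isQuasiperiodicOn H hεr (he₂𝒟 hJ').2 κ ?_
    by_contra hli
    have h1 : e₂ (ε, J') = (ε, T.freq κ (ε, J')) := he₂ _
    have h2 := e₂.map_source hJ'
    have h3 := e₂.left_inv hJ'
    rw [h1] at h2 h3
    refine hβ ⟨T.freq κ (ε, J'), ⟨h2, hli⟩, ?_⟩
    simp only [hg]
    rw [h3]

end IsTorusFamily

end Nekhoroshev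

end

theorem corollary1p4 {n s : ℕ} {r : ℕ∞} (hr : 2 ≤ r)
    {M : Type*} [TopologicalSpace M] [T2Space M] [ChartedSpace (Nekhoroshev.Model n) M]
    [IsManifold (𝓡 (2 * n)) r M]
    {L : Type*} [TopologicalSpace L] [ChartedSpace (EuclideanSpace ℝ (Fin s)) L]
    [IsManifold (𝓡 s) r L] [CompactSpace L] [ConnectedSpace L]
    (Ω : (x : M) → TangentSpace (𝓡 (2 * n)) x →L[ℝ] TangentSpace (𝓡 (2 * n)) x →L[ℝ] ℝ)
    (ε₀ : ℝ) (F : Fin s → ℝ → M → ℝ) (ι : L → M) (W : Set M)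
    (H : Nekhoroshev.Hypotheses r Ω ε₀ F ι W) (κ : Fin s) :
    ∃ β₀ : Fin s → ℝ, (∀ x i, F i 0 (ι x) = β₀ i) ∧
      (∃ T : Nekhoroshev.TorusFamily s M,
        Nekhoroshev.IsTorusFamily (r - 1) r Ω ε₀ F (range ι) W β₀ T) ∧
      ∀ T : Nekhoroshev.TorusFamily s M,
        Nekhoroshev.IsTorusFamily 1 r Ω ε₀ F (range ι) W β₀ T →
        ∀ m ∈ range ι, ∀ J ∈ T.dom 0, ∀ φ, T.chart 0 J φ = m → (T.hessian κ J).det ≠ 0 →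
          ∃ ε₁ > 0, ε₁ ≤ T.radius ∧ ∀ ε ∈ Ioo (-ε₁) ε₁,
            ∃ B₀ : Set (Fin s → ℝ), IsOpen B₀ ∧ β₀ ∈ B₀ ∧ B₀ ⊆ T.base ∧
              ∀ᵐ β ∂(volume : Measure (Fin s → ℝ)), β ∈ B₀ →
                Nekhoroshev.IsQuasiperiodicOn r s
                  (Nekhoroshev.hamVF Ω (F κ ε)) (T.torus F ε β) := by
  have hI := H.involutive hr
  -- The index `κ` is what excludes `s = 0`.
  have : Nonempty (Fin s) := ⟨κ⟩
  -- The multiplicity is known at one point of `Λ`. That point serves as the centre of the whole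
  -- construction, and transitivity recovers the rest of `Λ` from its orbit.
  obtain ⟨x, c, hc, hmult⟩ := H.exists_floquet hr
  obtain ⟨b, hb⟩ := H.exists_period_basis hr x
  obtain ⟨hm, hmem⟩ := H.completeAt hr (mem_range_self (f := ι) x)
  refine ⟨fun i => F i 0 (ι x), fun y i => H.F_const hr x y i, ?_, ?_⟩
  · obtain ⟨O, Y, τ, D, h0O, hY0⟩ := hI.exists_torusData H.zero_mem hm hc hmult b hb
    obtain ⟨ρ, hρ, e, A, hes, heO, he1, he, hA, hAd, hAτ⟩ := Nekhoroshev.exists_action_chart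
      hI.one_le_pred D.isOpen h0O D.contDiffOn_τ (fun q hq j => D.symmetric_τ hI hq j)
      D.independent
    refine ⟨_, D.isTorusFamily hI (by
      rw [hY0]; exact (Nekhoroshev.cht (Nekhoroshev.Model n) (ι x)).left_inv
        (mem_extChartAt_source (ι x))) ?_ hρ hes heO he1 he hA hAd hAτ⟩
    ext p
    constructor
    · rintro ⟨v, rfl⟩
      exact hmem v
    · rintro ⟨y, rfl⟩
      obtain ⟨v, hv⟩ := H.transitive hr x y
      exact ⟨v, hv.symm⟩
  · rintro T hT m ⟨y, rfl⟩ J hJ φ hφ hdet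
    refine hT.ae_quasiperiodic hI κ hJ ?_ hdet
    have h0 : (0 : ℝ) ∈ Ioo (-T.radius) T.radius := ⟨by linarith [hT.radius_pos], hT.radius_pos⟩
    funext i
    rw [← hT.F_chart 0 h0 J hJ φ i, hφ]
    exact H.F_const hr x y i
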